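/- Let $(S,g)$ be a non-empty compact Sasakian manifold of dimension $2m+1$: the cone $C(S)=S\times\mathbb R_{>0}$ with the metric $dr^2+r^2g$ is Kähler for a complex structure $J$ with $\mathcal L_{r\partial_r}J=0$. Let $\xi=J(r\partial_r)|_{r=1}$ be the Reeb field, $\eta=g(\xi,\cdot)$ the contact form, and $D=\ker\eta$. A form $\alpha$ is basic if $i_\xi\alpha=0$ and $\mathcal L_\xi\alpha=0$; two closed basic forms have the same basic class $[\cdot]_B$ if they differ by $d\beta$ with $\beta$ basic. In foliation charts $(x,z^1,\dots,z^m)$ (with $\xi=\partial_x$ and $z$ transversely holomorphic) basic forms have $\partial_B,\bar\partial_B$; put $d^c_B=\frac{\sqrt{-1}}2(\bar\partial_B-\partial_B)$. For a basic function $\varphi$ let $\eta_\varphi=\eta+d^c_B\varphi$, so that $d\eta_\varphi=d\eta+\sqrt{-1}\partial_B\bar\partial_B\varphi$, and let $$\Omega=\{\varphi\in C^\infty(S,\mathbb R)\;:\;\varphi\text{ is basic and } d\eta_\varphi(X,JX)>0\text{ for all }0\neq X\in D\}.$$ For $\varphi\in\Omega$ write $d\eta_\varphi=\sqrt{-1}\sum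 g_{i\bar j}\,dz^i\wedge d\bar z^j$ (the Kähler form of a transverse Kähler metric). Its transverse Ricci form is $\mathrm{Ric}^T(d\eta_\varphi)=-\sqrt{-1}\,\partial_B\bar\partial_B\log\det(g_{i\bar j})=\sqrt{-1}\sum R_{i\bar j}\,dz^i\wedge d\bar z^j$ and its transverse scalar curvature is $s^T(d\eta_\varphi)=\sum g^{\bar j i}R_{i\bar j}$. Orient $S$ by $(d\eta)^m\wedge\eta$ and let $V=\int_S(d\eta)^m\wedge\eta$. Assume $[\mathrm{Ric}^T(d\eta)]_B=(2m+2)[d\eta]_B$. For $\varphi,\varphi'\in\Omega$ and a piecewise smooth path $\{\varphi_t\}_{a\le t\le b}$ in $\Omega$ with $\varphi_a=\varphi$, $\varphi_b=\varphi'$, put $$L(\varphi,\varphi')=\frac1V\int_a^b\Big(\int_S\dot\varphi_t\,(d\eta_{\varphi_t})^m\wedge\eta_{\varphi_t}\Big)dt,$$ $$M(\varphi,\varphi')=-\frac1V\int_a^b\Big\{\int_S\dot\varphi_t\,\big(s^T(d\eta_{\varphi_t})-m(2m+2)\big)(d\eta_{\varphi_t})^m\wedge\eta_{\varphi_t}\Big\}dt.$$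 Then such paths exist for all $\varphi,\varphi'\in\Omega$, the integrals over $[a,b]$ exist, and $L$ and $M$ do not depend on the choice of the path, so they are well-defined functions on $\Omega\times\Omega$. Both satisfy the 1-cocycle condition: for $F=L,M$ and all $\varphi,\varphi',\varphi''\in\Omega$, $$F(\varphi,\varphi')+F(\varphi',\varphi)=0,\qquad F(\varphi,\varphi')+F(\varphi',\varphi'')+F(\varphi'',\varphi)=0.$$ Moreover $\Omega$ is stable under adding constants, and for all $\varphi,\varphi'\in\Omega$ and $C_1,C_2\in\mathbb R$ $$L(\varphi,\varphi'+C_2)=L(\varphi,\varphi')+C_2,\qquad M(\varphi+C_1,\varphi'+C_2)=M(\varphi,\varphi').$$ -/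

import Mathlib

open Set Filter Topology MeasureTheory Manifold Bundle
open scoped ContDiff

noncomputable section

namespace Sasaki

/-! ### Exterior derivatives of 1-forms and 2-forms on a manifold without boundary

Forms are fields of continuous linear (bilinear) maps on the tangent spaces. They are pulled back to
the model vector space by the inverse of the preferred chart, differentiated there, and the result is
pulled back to the manifold. The normalization is
`dα (X, Y) = X (α Y) - Y (α X) - α [X, Y]`, the one of Mathlib's `extDeriv`. -/

section ExteriorDerivative

variable {E H M : Type*} [NormedAddCommGroup E] [NormedSpace ℝ E] [TopologicalSpace H]
  (I : ModelWithCorners ℝ E H) [TopologicalSpace M] [ChartedSpace H M]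

/-- The derivative at `y` of the inverse of the chart at `x`. -/
def chartSymmDeriv (x : M) (y : E) : E →L[ℝ] TangentSpace I ((extChartAt I x).symm y) :=
  mfderiv 𝓘(ℝ, E) I (extChartAt I x).symm y

/-- The derivative at `x` of the chart at `x`. -/
def chartDeriv (x : M) : TangentSpace I x →L[ℝ] E :=
  mfderiv I 𝓘(ℝ, E) (extChartAt I x) x

/-- The 1-form `α` read in the chart at `x`, as a 1-form on the model vector space. -/
def pullbackOne (α : ∀ q : M, TangentSpace I q →L[ℝ] ℝ) (x : M) (y : E) : E →L[ℝ] ℝ :=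
  (α ((extChartAt I x).symm y)).comp (chartSymmDeriv I x y)

/-- The 2-form `α` read in the chart at `x`, as a 2-form on the model vector space. -/
def pullbackTwo (α : ∀ q : M, TangentSpace I q →L[ℝ] TangentSpace I q →L[ℝ] ℝ) (x : M) (y : E) :
    E →L[ℝ] E →L[ℝ] ℝ :=
  ContinuousLinearMap.bilinearComp (E := E) (F := E) (α ((extChartAt I x).symm y))
    (chartSymmDeriv I x y) (chartSymmDeriv I x y)

/-- The bilinear map `(v, w) ↦ D v w - D w v`. -/
def skew (D : E →L[ℝ] E →L[ℝ] ℝ) : E →L[ℝ] E →L[ℝ] ℝ := D - D.flip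

/-- The exterior derivative `dα (v, w) = (D_v α) w - (D_w α) v` of a 1-form. -/
def dOne (α : ∀ q : M, TangentSpace I q →L[ℝ] ℝ) (x : M) :
    TangentSpace I x →L[ℝ] TangentSpace I x →L[ℝ] ℝ :=
  ContinuousLinearMap.bilinearComp (E' := E) (F' := E)
    (skew (fderiv ℝ (pullbackOne I α x) (extChartAt I x x))) (chartDeriv I x) (chartDeriv I x)

set_option synthInstance.maxHeartbeats 200000 in
/-- The exterior derivative
`dα (u, v, w) = (D_u α) (v, w) + (D_v α) (w, u) + (D_w α) (u, v)` of a 2-form. -/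
def dTwo (α : ∀ q : M, TangentSpace I q →L[ℝ] TangentSpace I q →L[ℝ] ℝ) (x : M)
    (u v w : TangentSpace I x) : ℝ :=
  let D : E →L[ℝ] E →L[ℝ] E →L[ℝ] ℝ := fderiv ℝ (pullbackTwo I α x) (extChartAt I x x)
  let T : TangentSpace I x →L[ℝ] E := chartDeriv I x
  D (T u) (T v) (T w) + D (T v) (T w) (T u) + D (T w) (T u) (T v)

end ExteriorDerivative

/-! ### Sasakian manifolds -/

/-- The model space of a manifold of dimension `2m+1`. -/
abbrev Model (m : ℕ) : Type := EuclideanSpace ℝ (Fin (2 * m + 1))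

/-- The tangent space of the `(2m+1)`-dimensional manifold `S` at `p`. -/
abbrev Tan (m : ℕ) {S : Type*} [TopologicalSpace S] [ChartedSpace (Model m) S] (p : S) : Type :=
  TangentSpace (𝓡 (2 * m + 1)) p

/-- The model with corners of `S × ℝ`. -/
abbrev coneModel (m : ℕ) : ModelWithCorners ℝ (Model m × ℝ) (ModelProd (Model m) ℝ) :=
  (𝓡 (2 * m + 1)).prod 𝓘(ℝ, ℝ)

section Structure

variable {m : ℕ} {S : Type*} [TopologicalSpace S] [ChartedSpace (Model m) S]

/-- The cone metric `dr² + r² g` at the point `(p, r)`; a tangent vector of `S × ℝ` at `(p, r)` is a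
pair `(v, a)`, standing for `v + a ∂/∂r`. -/
def coneMetric (g : ∀ p : S, Tan m p →L[ℝ] Tan m p →L[ℝ] ℝ) (p : S) (r : ℝ) :
    (Tan m p × ℝ) →L[ℝ] (Tan m p × ℝ) →L[ℝ] ℝ :=
  (ContinuousLinearMap.mul ℝ ℝ).bilinearComp
      (ContinuousLinearMap.snd ℝ (Model m) ℝ) (ContinuousLinearMap.snd ℝ (Model m) ℝ)
    + r ^ 2 • ContinuousLinearMap.bilinearComp (E := Model m) (F := Model m) (g p)
      (ContinuousLinearMap.fst ℝ (Model m) ℝ) (ContinuousLinearMap.fst ℝ (Model m) ℝ)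

/-- The fundamental 2-form `(X, Y) ↦ ḡ (J X, Y)` of the cone metric `ḡ = dr² + r² g`. -/
def coneForm (g : ∀ p : S, Tan m p →L[ℝ] Tan m p →L[ℝ] ℝ)
    (J : ∀ (p : S) (_ : ℝ), (Tan m p × ℝ) →L[ℝ] (Tan m p × ℝ)) (c : S × ℝ) :
    TangentSpace (coneModel m) c →L[ℝ] TangentSpace (coneModel m) c →L[ℝ] ℝ :=
  (coneMetric g c.1 c.2).comp (J c.1 c.2)

/-- The derivative of a map from `S × ℝ` to `ℂᵐ⁺¹`. -/
def coneDeriv (ψ : S × ℝ → (Fin (m + 1) → ℂ)) (c : S × ℝ) :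
    (Tan m c.1 × ℝ) →L[ℝ] (Fin (m + 1) → ℂ) :=
  mfderiv (coneModel m) 𝓘(ℝ, Fin (m + 1) → ℂ) ψ c

end Structure

/-- A Sasakian structure on the manifold `S` of dimension `2m+1`: a Riemannian metric `g` on `S` and a
complex structure `J` on the cone `C(S) = S × ℝ_{>0}`, such that `(C(S), dr² + r² g, J)` is Kähler and
the Lie derivative of `J` along `r ∂/∂r` vanishes. The cone is the open subset `r > 0` of `S × ℝ`;
the values of `J` outside of it play no role. -/
structure SasakianStructure (m : ℕ) (S : Type*) [TopologicalSpace S] [ChartedSpace (Model m) S]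
    [IsManifold (𝓡 (2 * m + 1)) ∞ S] where
  /-- the Riemannian metric of `S` -/
  g : ContMDiffRiemannianMetric (𝓡 (2 * m + 1)) ∞ (Model m)
    (fun p : S => TangentSpace (𝓡 (2 * m + 1)) p)
  /-- the complex structure of the cone -/
  J : ∀ (p : S) (_ : ℝ), (Tan m p × ℝ) →L[ℝ] (Tan m p × ℝ)
  /-- `J` comes from an atlas of local holomorphic coordinates -/
  holomorphic_coordinates : ∀ (p : S) (r : ℝ), 0 < r →
    ∃ (W : Set (S × ℝ)) (ψ : S × ℝ → (Fin (m + 1) → ℂ)), IsOpen W ∧ (p, r) ∈ W ∧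
      (∀ c ∈ W, 0 < c.2) ∧
      ContMDiffOn (coneModel m) 𝓘(ℝ, Fin (m + 1) → ℂ) ∞ ψ W ∧
      ∀ c ∈ W, Function.Bijective (coneDeriv ψ c) ∧
        ∀ v : Tan m c.1 × ℝ,
          coneDeriv ψ c (J c.1 c.2 v) = Complex.I • coneDeriv ψ c v
  /-- the cone metric is Hermitian -/
  hermitian : ∀ (p : S) (r : ℝ), 0 < r → ∀ v w : Tan m p × ℝ,
    coneMetric g.inner p r (J p r v) (J p r w) = coneMetric g.inner p r v w
  /-- the fundamental form of the cone metric is closed -/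
  closed : ∀ (p : S) (r : ℝ), 0 < r → ∀ u v w : TangentSpace (coneModel m) ((p, r) : S × ℝ),
    dTwo (coneModel m) (coneForm g.inner J) (p, r) u v w = 0
  /-- `J` is invariant under the flow `(p, r) ↦ (p, c r)`, `c > 0`, of `r ∂/∂r`, that is, its Lie
  derivative along `r ∂/∂r` vanishes -/
  homothety_invariant : ∀ (p : S) (r c : ℝ), 0 < r → 0 < c → ∀ v : Tan m p × ℝ,
    J p (c * r) (v.1, c * v.2) = ((J p r v).1, c * (J p r v).2)

section Sasakian

variable {m : ℕ} {S : Type*} [TopologicalSpace S] [ChartedSpace (Model m) S]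
  [IsManifold (𝓡 (2 * m + 1)) ∞ S] (𝒮 : SasakianStructure m S)

/-- The Reeb field `ξ = J (r ∂/∂r)` on `S = {r = 1}` (it is tangent to `S`). -/
def reeb (p : S) : Tan m p := (𝒮.J p 1 (0, 1)).1

/-- The contact form `η (Y) = g (ξ, Y)`. -/
def contact (p : S) : Tan m p →L[ℝ] ℝ := 𝒮.g.inner p (reeb 𝒮 p)

/-- The transverse complex structure: the endomorphism `Φ` of `TS` with `Φ ξ = 0` and `Φ = J` on
`D = ker η`. It is the `TS`-component of `J` along `S = {r = 1}`: for `X ∈ D` one has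
`J X = Φ X ∈ D`, while `J ξ = - r ∂/∂r`. -/
def transverseJ (p : S) : Tan m p →L[ℝ] Tan m p :=
  ((ContinuousLinearMap.fst ℝ (Tan m p) ℝ).comp (𝒮.J p 1)).comp
    (ContinuousLinearMap.inl ℝ (Tan m p) ℝ)

/-! ### Basic functions and basic 1-forms, `d_B^c`, the space of potentials -/

/-- The differential of a real function. -/
def diff (u : S → ℝ) (p : S) : Tan m p →L[ℝ] ℝ := mfderiv (𝓡 (2 * m + 1)) 𝓘(ℝ, ℝ) u p

/-- Smooth basic functions. -/
def IsBasicFunction (φ : S → ℝ) : Prop :=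
  ContMDiff (𝓡 (2 * m + 1)) 𝓘(ℝ, ℝ) ∞ φ ∧
    ∀ p, diff φ p (reeb 𝒮 p) = 0

/-- Smooth basic 1-forms: `i_ξ β = 0` and `L_ξ β = 0`. By Cartan's formula the second condition is
`i_ξ dβ = 0`, given the first one. -/
def IsBasicOneForm (β : ∀ p : S, Tan m p →L[ℝ] ℝ) : Prop :=
  ContMDiff (𝓡 (2 * m + 1)) ((𝓡 (2 * m + 1)).prod 𝓘(ℝ, Model m →L[ℝ] ℝ)) ∞
      (fun p => TotalSpace.mk' (Model m →L[ℝ] ℝ)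
        (E := fun p : S => TangentSpace (𝓡 (2 * m + 1)) p →L[ℝ] ℝ) p (β p)) ∧
    (∀ p, β p (reeb 𝒮 p) = 0) ∧
    ∀ p, ∀ v : Tan m p, dOne (𝓡 (2 * m + 1)) β p (reeb 𝒮 p) v = 0

/-- `[α]_B = [α']_B` in the second basic cohomology. -/
def BasicCohomologous (α α' : ∀ p : S, Tan m p →L[ℝ] Tan m p →L[ℝ] ℝ) : Prop :=
  ∃ β : ∀ p : S, Tan m p →L[ℝ] ℝ, IsBasicOneForm 𝒮 β ∧
    ∀ p, α p - α' p = dOne (𝓡 (2 * m + 1)) β p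

/-- `d_B^c u = (√-1 / 2) (∂̄_B u - ∂_B u) = - (1 / 2) du ∘ Φ` for a basic function `u`, since
`∂_B u = (du - √-1 du ∘ Φ) / 2` and `∂̄_B u = (du + √-1 du ∘ Φ) / 2`. -/
def dcB (u : S → ℝ) (p : S) : Tan m p →L[ℝ] ℝ :=
  (-(1 / 2) : ℝ) • (diff u p).comp (transverseJ 𝒮 p)

/-- `√-1 ∂_B ∂̄_B u = d_B d_B^c u` for a (local) basic function `u`. -/
def ddcB (u : S → ℝ) (p : S) : Tan m p →L[ℝ] Tan m p →L[ℝ] ℝ :=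
  dOne (𝓡 (2 * m + 1)) (dcB 𝒮 u) p

/-- `η_φ = η + d_B^c φ`. -/
def contactOf (φ : S → ℝ) (p : S) : Tan m p →L[ℝ] ℝ := contact 𝒮 p + dcB 𝒮 φ p

/-- `dη`. -/
def kahlerForm (p : S) : Tan m p →L[ℝ] Tan m p →L[ℝ] ℝ := dOne (𝓡 (2 * m + 1)) (contact 𝒮) p

/-- `dη_φ`. -/
def kahlerFormOf (φ : S → ℝ) (p : S) : Tan m p →L[ℝ] Tan m p →L[ℝ] ℝ :=
  dOne (𝓡 (2 * m + 1)) (contactOf 𝒮 φ) p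

/-- The space `Ω` of potentials: smooth basic functions `φ` for which the transverse form `dη_φ` is
positive definite, that is `dη_φ (X, J X) > 0` for all nonzero `X ∈ D = ker η`. -/
def potentials : Set (S → ℝ) :=
  {φ | IsBasicFunction 𝒮 φ ∧
    ∀ (p : S) (X : Tan m p), contact 𝒮 p X = 0 → X ≠ 0 →
      0 < kahlerFormOf 𝒮 φ p X (transverseJ 𝒮 p X)}

/-! ### Foliation charts, transverse Ricci form and transverse scalar curvature -/

/-- The derivative of a map from `S` to `ℝ × ℂᵐ`. -/
def foliationDeriv (χ : S → ℝ × (Fin m → ℂ)) (p : S) : Tan m p →L[ℝ] ℝ × (Fin m → ℂ) :=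
  mfderiv (𝓡 (2 * m + 1)) 𝓘(ℝ, ℝ × (Fin m → ℂ)) χ p

/-- A foliation chart `(x, z¹, …, zᵐ)`: a smooth chart of `S` with values in `ℝ × ℂᵐ`, such that
`ξ = ∂/∂x` and `z` is transversely holomorphic. -/
structure FoliationChart where
  /-- the chart -/
  chart : OpenPartialHomeomorph S (ℝ × (Fin m → ℂ))
  smooth : ContMDiffOn (𝓡 (2 * m + 1)) 𝓘(ℝ, ℝ × (Fin m → ℂ)) ∞ chart chart.source
  smooth_symm : ContMDiffOn 𝓘(ℝ, ℝ × (Fin m → ℂ)) (𝓡 (2 * m + 1)) ∞ chart.symm chart.target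
  reeb_eq : ∀ p ∈ chart.source, foliationDeriv chart p (reeb 𝒮 p) = (1, 0)
  transversely_holomorphic : ∀ p ∈ chart.source, ∀ v : Tan m p,
    (foliationDeriv chart p (transverseJ 𝒮 p v)).2 = Complex.I • (foliationDeriv chart p v).2

variable {𝒮}

/-- The tangent vector at `p` whose components in the foliation chart `χ` are `(0, w)`. -/
def FoliationChart.lift (χ : FoliationChart 𝒮) (p : S) (w : Fin m → ℂ) : Tan m p :=
  (foliationDeriv χ.chart p).inverse (0, w)

/-- The coefficients `a_{i j̄}` at `p` of a real transverse (1,1)-form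
`α = √-1 ∑ a_{i j̄} dzⁱ ∧ dz̄ʲ` in the foliation chart `χ`, that is
`a_{i j̄} = -√-1 α (∂/∂zⁱ, ∂/∂z̄ʲ) = (α (∂/∂xⁱ, ∂/∂yʲ) - √-1 α (∂/∂xⁱ, ∂/∂xʲ)) / 2`
where `zⁱ = xⁱ + √-1 yⁱ`. -/
def FoliationChart.coeff (χ : FoliationChart 𝒮)
    (α : ∀ p : S, Tan m p →L[ℝ] Tan m p →L[ℝ] ℝ) (p : S) : Matrix (Fin m) (Fin m) ℂ :=
  Matrix.of fun i j =>
    (1 / 2 : ℂ) *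
      ((α p (χ.lift p (Pi.single i 1)) (χ.lift p (Pi.single j Complex.I)) : ℂ)
        - Complex.I * (α p (χ.lift p (Pi.single i 1)) (χ.lift p (Pi.single j 1)) : ℂ))

/-- `log det (g_{i j̄})` in the foliation chart `χ`, for the transverse Kähler metric whose Kähler form
is `α = √-1 ∑ g_{i j̄} dzⁱ ∧ dz̄ʲ`. -/
def FoliationChart.logDet (χ : FoliationChart 𝒮)
    (α : ∀ p : S, Tan m p →L[ℝ] Tan m p →L[ℝ] ℝ) (p : S) : ℝ :=
  Real.log (χ.coeff α p).det.re

/-- The transverse Ricci form `- √-1 ∂_B ∂̄_B log det (g_{i j̄})` in the foliation chart `χ`. -/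
def FoliationChart.ricci (χ : FoliationChart 𝒮)
    (α : ∀ p : S, Tan m p →L[ℝ] Tan m p →L[ℝ] ℝ) (p : S) : Tan m p →L[ℝ] Tan m p →L[ℝ] ℝ :=
  -ddcB 𝒮 (χ.logDet α) p

/-- The transverse scalar curvature `∑ g^{j̄ i} R_{i j̄}` in the foliation chart `χ`, where
`√-1 ∑ R_{i j̄} dzⁱ ∧ dz̄ʲ` is the transverse Ricci form. -/
def FoliationChart.scal (χ : FoliationChart 𝒮)
    (α : ∀ p : S, Tan m p →L[ℝ] Tan m p →L[ℝ] ℝ) (p : S) : ℝ :=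
  ((χ.coeff α p)⁻¹ * χ.coeff (χ.ricci α) p).trace.re

variable (𝒮)

open Classical in
/-- The transverse Ricci form `Ric^T(α)` of the transverse Kähler metric with Kähler form `α`. It is
computed in an arbitrary foliation chart around `p`; foliation charts exist around each point of a
Sasakian manifold, and the result does not depend on the chart. -/
def transverseRicci (α : ∀ p : S, Tan m p →L[ℝ] Tan m p →L[ℝ] ℝ) (p : S) :
    Tan m p →L[ℝ] Tan m p →L[ℝ] ℝ :=
  if h : ∃ χ : FoliationChart 𝒮, p ∈ χ.chart.source then h.choose.ricci α p else 0

open Classical in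
/-- The transverse scalar curvature `s^T(α)` of the transverse Kähler metric with Kähler form `α`,
computed in an arbitrary foliation chart around `p`. -/
def transverseScal (α : ∀ p : S, Tan m p →L[ℝ] Tan m p →L[ℝ] ℝ) (p : S) : ℝ :=
  if h : ∃ χ : FoliationChart 𝒮, p ∈ χ.chart.source then h.choose.scal α p else 0

end Sasakian

/-! ### Integration of top forms -/

/-- The top form `αᵐ ∧ θ` of a 2-form `α` and a 1-form `θ` on a vector space `V` of dimension `2m+1`:
`(αᵐ ∧ θ) (v₀, …, v₂ₘ) =
  2⁻ᵐ ∑_σ sgn σ α (v_{σ 0}, v_{σ 1}) ⋯ α (v_{σ (2m-2)}, v_{σ (2m-1)}) θ (v_{σ (2m)})`. -/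
def powWedge {V : Type*} (m : ℕ) (α : V → V → ℝ) (θ : V → ℝ) (v : Fin (2 * m + 1) → V) : ℝ :=
  (1 / 2 ^ m : ℝ) * ∑ σ : Equiv.Perm (Fin (2 * m + 1)), ((Equiv.Perm.sign σ : ℤ) : ℝ) *
    (∏ i : Fin m, α (v (σ ⟨2 * i, by omega⟩)) (v (σ ⟨2 * i + 1, by omega⟩))) *
      θ (v (σ (Fin.last (2 * m))))

section Integration

variable {m : ℕ} {S : Type*} [TopologicalSpace S] [ChartedSpace (Model m) S]

/-- The value of the top form `Θ` on the coordinate frame of the chart at `x`, at the point with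
coordinates `y`: the density of `Θ` in that chart. -/
def chartDensity (Θ : ∀ p : S, (Fin (2 * m + 1) → Tan m p) → ℝ) (x : S) (y : Model m) : ℝ :=
  Θ ((extChartAt (𝓡 (2 * m + 1)) x).symm y)
    fun i => chartSymmDeriv (𝓡 (2 * m + 1)) x y (EuclideanSpace.single i 1)

variable [IsManifold (𝓡 (2 * m + 1)) ∞ S] [CompactSpace S] [T2Space S]

variable (m S) in
/-- A smooth partition of unity subordinate to the preferred charts of `S`. -/
def chartPartition : SmoothPartitionOfUnity S (𝓡 (2 * m + 1)) S univ :=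
  (SmoothPartitionOfUnity.exists_isSubordinate_chartAt_source (𝓡 (2 * m + 1)) S).choose

/-- The integral `∫_S Θ` of a top form over the compact manifold `S`, oriented by the nowhere vanishing
top form `Θ₀`: `Θ` is cut up by a partition of unity subordinate to the charts, and each piece is
integrated in its chart, with the sign `±1` according to whether the chart is positively oriented. -/
def integralTop (Θ₀ Θ : ∀ p : S, (Fin (2 * m + 1) → Tan m p) → ℝ) : ℝ :=
  ∑ᶠ x : S, ∫ y in (extChartAt (𝓡 (2 * m + 1)) x).target,
    chartPartition m S x ((extChartAt (𝓡 (2 * m + 1)) x).symm y) *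
      SignType.sign (chartDensity Θ₀ x y) * chartDensity Θ x y

/-! ### Paths of potentials and the functionals -/

variable (𝒮 : SasakianStructure m S)

/-- `∫_S f (dη_φ)ᵐ ∧ η_φ`, where `S` is oriented by `(dη)ᵐ ∧ η`. -/
def integralOf (φ f : S → ℝ) : ℝ :=
  integralTop (fun p => powWedge m (fun v w => kahlerForm 𝒮 p v w) (contact 𝒮 p))
    fun p v => f p * powWedge m (fun v w => kahlerFormOf 𝒮 φ p v w) (contactOf 𝒮 φ p) v

/-- The volume `V = ∫_S (dη)ᵐ ∧ η`. -/
def contactVolume : ℝ :=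
  integralTop (fun p => powWedge m (fun v w => kahlerForm 𝒮 p v w) (contact 𝒮 p))
    fun p => powWedge m (fun v w => kahlerForm 𝒮 p v w) (contact 𝒮 p)

/-- A piecewise smooth path `{φ_t | a ≤ t ≤ b}` in `Ω` from `φ` to `φ'`: there are
`a = τ 0 < τ 1 < ⋯ < τ n = b` such that `(t, p) ↦ φ_t (p)` is smooth on each of the sets
`[τ i, τ (i + 1)] × S`. -/
structure PotentialPath (φ φ' : S → ℝ) where
  a : ℝ
  b : ℝ
  /-- the family `φ_t` -/
  path : ℝ → S → ℝ
  mem : ∀ t ∈ Icc a b, path t ∈ potentials 𝒮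
  left : path a = φ
  right : path b = φ'
  piecewise_smooth : ∃ (n : ℕ) (τ : ℕ → ℝ), τ 0 = a ∧ τ n = b ∧ (∀ i < n, τ i < τ (i + 1)) ∧
    ∀ i < n, ContMDiffOn (𝓘(ℝ, ℝ).prod (𝓡 (2 * m + 1))) 𝓘(ℝ, ℝ) ∞
      (fun c : ℝ × S => path c.1 c.2) (Icc (τ i) (τ (i + 1)) ×ˢ univ)

variable {𝒮} {φ φ' : S → ℝ}

/-- The velocity `dφ_t/dt` (it is defined except at the finitely many break points). -/
def PotentialPath.velocity (γ : PotentialPath 𝒮 φ φ') (t : ℝ) (p : S) : ℝ :=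
  deriv (fun s => γ.path s p) t

/-- `∫_S (dφ_t/dt) (dη_{φ_t})ᵐ ∧ η_{φ_t}`. -/
def PotentialPath.integrandL (γ : PotentialPath 𝒮 φ φ') (t : ℝ) : ℝ :=
  integralOf 𝒮 (γ.path t) (γ.velocity t)

/-- `∫_S (dφ_t/dt) (s^T(dη_{φ_t}) - m (2m+2)) (dη_{φ_t})ᵐ ∧ η_{φ_t}`. -/
def PotentialPath.integrandM (γ : PotentialPath 𝒮 φ φ') (t : ℝ) : ℝ :=
  integralOf 𝒮 (γ.path t) fun p =>
    γ.velocity t p * (transverseScal 𝒮 (kahlerFormOf 𝒮 (γ.path t)) p - m * (2 * m + 2))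

/-- The functional `L` evaluated along a path. -/
def PotentialPath.valueL (γ : PotentialPath 𝒮 φ φ') : ℝ :=
  1 / contactVolume 𝒮 * ∫ t in γ.a..γ.b, γ.integrandL t

/-- The functional `M` evaluated along a path. -/
def PotentialPath.valueM (γ : PotentialPath 𝒮 φ φ') : ℝ :=
  -(1 / contactVolume 𝒮) * ∫ t in γ.a..γ.b, γ.integrandM t

end Integration

end Sasaki

end

/-! Both path integrals are integrals of exact 1-forms on Ω, and the proof writes down primitives.
Once L and M are differences of a function on Ω, path independence is the fundamental theorem of
calculus and the cocycle conditions are telescoping.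

All top forms are compared with (dη)ᵐ ∧ η. `volRatio` is the quotient by it of κᵐ ∧ η (for the
horizontal invariant part of κ), a polynomial of degree at most m along affine lines; `mixedRatio`
is its derivative, the quotient of m Aᵐ⁻¹ ∧ κ ∧ η. The analytic core is
`integral_mixedRatio_eq_zero`: ∫ m (dα)ᵐ⁻¹ ∧ dτ ∧ η = 0 if dα is of transverse type (1,1) and τ is
horizontal. It makes v ↦ m (dα)ᵐ⁻¹ ∧ dd^c v ∧ η symmetric (`integral_mul_mixedRatio_comm`).

For L the primitive is E(φ) = ∫₀¹ ds ∫ φ P(s), with P(s) = (dη + s dd^c φ)ᵐ ∧ η. Along a path,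
symmetry moves dd^c from the velocity to φ, leaving the velocity times P + s P' = (s P)', which
integrates in s to P(1) (`energy_isPrimitiveOn`). Since P is a polynomial in s, ∫₀¹ ds is replaced
by a finite quadrature at the nodes 0, …, m.

For M write Ric^T(dη) = c dη + dβ with c = 2m+2, and let D be the density of (dη_φ)ᵐ ∧ η. Then
Ric^T(dη_φ) = c dη_φ + dβ - dd^c f with f = log D + c φ. Hence (s^T - m c)(dη_φ)ᵐ ∧ η is m (dη_φ)ᵐ⁻¹
∧ (dβ - dd^c f) ∧ η. The dβ-term comes from the derivative at s = 0 of the energy based at η + s β.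
The other term comes from minus the entropy ∫ f D, up to a surplus which c E cancels
(`kEnergy_isPrimitiveOn`). Adding C to φ adds C V to E and c C V to the entropy, and changes nothing
in the β-part, so L shifts by C and M is unchanged.

Three geometric facts support this. Foliation charts exist (`exists_foliationChart`): homothety
invariance makes r∂_r a holomorphic field on the cone, its flow in complex time straightens it to
∂/∂ζ, and on r = 1 the function Im ζ is a coordinate along ξ = J(r∂_r). Next, dη = 2 g(Φ·, ·)
(`kahlerForm_apply`), so dη is positive of type (1,1). Finally, in a foliation chart the top form is
the determinant of a Hermitian matrix (`powWedge_eq_det`), whose cofactors are divergence free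
because the form is closed. -/

noncomputable section

namespace Sasaki

/-! ### Top forms as determinants -/

/-- The model space of foliation charts. -/
abbrev CF (m : ℕ) : Type := ℝ × (Fin m → ℂ)

section PowWedge

variable {V : Type*} [AddCommGroup V] [Module ℝ V]

/-- The multilinear map whose antisymmetrization is `2ᵐ αᵐ ∧ θ`. -/
def powWedgeMultilinear (m : ℕ) (α : V →ₗ[ℝ] V →ₗ[ℝ] ℝ) (θ : V →ₗ[ℝ] ℝ) :
    MultilinearMap ℝ (fun _ : Fin (2 * m + 1) => V) ℝ :=
  MultilinearMap.mk' (fun v => (∏ i : Fin m, α (v ⟨2 * i, by omega⟩) (v ⟨2 * i + 1, by omega⟩)) *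
      θ (v (Fin.last (2 * m))))
    (by
      intro v j x y
      -- A slot belongs either to θ or to exactly one of the factors α(·, ·); all other factors
      -- ignore the update.
      by_cases hj : j = Fin.last (2 * m)
      · subst hj
        have h1 : ∀ (i : Fin m) (z : V), Function.update v (Fin.last (2 * m)) z ⟨2 * i, by omega⟩
            = v ⟨2 * i, by omega⟩ := fun i z => Function.update_of_ne (by
              intro h; have := congrArg Fin.val h; simp at this; omega) _ _
        have h2 : ∀ (i : Fin m) (z : V), Function.update v (Fin.last (2 * m)) z ⟨2 * i + 1, by omega⟩
            = v ⟨2 * i + 1, by omega⟩ := fun i z => Function.update_of_ne (by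
              intro h; have := congrArg Fin.val h; simp at this; omega) _ _
        simp only [h1, h2, Function.update_self, map_add, mul_add]
      · have hj' : j.val < 2 * m := by
          have := j.isLt
          have h3 : j.val ≠ 2 * m := fun h => hj (Fin.ext h)
          omega
        have hl : ∀ z, Function.update v j z (Fin.last (2 * m)) = v (Fin.last (2 * m)) :=
          fun z => Function.update_of_ne (fun h => hj h.symm) _ _
        -- The factor containing slot j: j is 2 i₀ or 2 i₀ + 1 according to its parity.
        let i₀ : Fin m := ⟨j.val / 2, by omega⟩
        have h1 : ∀ i ∈ Finset.univ.erase i₀, ∀ z : V, Function.update v j z ⟨2 * i, by omega⟩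
            = v ⟨2 * i, by omega⟩ := fun i hi z => Function.update_of_ne (by
              intro h; apply Finset.ne_of_mem_erase hi
              apply Fin.ext; have := congrArg Fin.val h; simp only [i₀] at *; omega) _ _
        have h2 : ∀ i ∈ Finset.univ.erase i₀, ∀ z : V, Function.update v j z ⟨2 * i + 1, by omega⟩
            = v ⟨2 * i + 1, by omega⟩ := fun i hi z => Function.update_of_ne (by
              intro h; apply Finset.ne_of_mem_erase hi
              apply Fin.ext; have := congrArg Fin.val h; simp only [i₀] at *; omega) _ _
        have h3 : ∀ z : V, ∏ i ∈ Finset.univ.erase i₀,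
            α (Function.update v j z ⟨2 * i, by omega⟩) (Function.update v j z ⟨2 * i + 1, by omega⟩)
            = ∏ i ∈ Finset.univ.erase i₀, α (v ⟨2 * i, by omega⟩) (v ⟨2 * i + 1, by omega⟩) :=
          fun z => Finset.prod_congr rfl fun i hi => by rw [h1 i hi, h2 i hi]
        simp only [hl, ← Finset.mul_prod_erase Finset.univ _ (Finset.mem_univ i₀), h3]
        rcases Nat.even_or_odd' j.val with ⟨k, hk | hk⟩
        · have e1 : (⟨2 * i₀, by omega⟩ : Fin (2 * m + 1)) = j := Fin.ext (by simp only [i₀]; omega)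
          have e2 : (⟨2 * i₀ + 1, by omega⟩ : Fin (2 * m + 1)) ≠ j := fun h => by
            have := congrArg Fin.val h; simp only [i₀] at this; omega
          simp only [e1, Function.update_self, Function.update_of_ne e2, map_add,
            LinearMap.add_apply, add_mul]
        · have e1 : (⟨2 * i₀ + 1, by omega⟩ : Fin (2 * m + 1)) = j :=
            Fin.ext (by simp only [i₀]; omega)
          have e2 : (⟨2 * i₀, by omega⟩ : Fin (2 * m + 1)) ≠ j := fun h => by
            have := congrArg Fin.val h; simp only [i₀] at this; omega
          simp only [e1, Function.update_self, Function.update_of_ne e2, map_add, add_mul])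
    (by
      intro v j c x
      by_cases hj : j = Fin.last (2 * m)
      · subst hj
        have h1 : ∀ (i : Fin m) (z : V), Function.update v (Fin.last (2 * m)) z ⟨2 * i, by omega⟩
            = v ⟨2 * i, by omega⟩ := fun i z => Function.update_of_ne (by
              intro h; have := congrArg Fin.val h; simp at this; omega) _ _
        have h2 : ∀ (i : Fin m) (z : V), Function.update v (Fin.last (2 * m)) z ⟨2 * i + 1, by omega⟩
            = v ⟨2 * i + 1, by omega⟩ := fun i z => Function.update_of_ne (by
              intro h; have := congrArg Fin.val h; simp at this; omega) _ _
        simp only [h1, h2, Function.update_self, map_smul, smul_eq_mul]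
        ring
      · have hj' : j.val < 2 * m := by
          have := j.isLt
          have h3 : j.val ≠ 2 * m := fun h => hj (Fin.ext h)
          omega
        have hl : ∀ z, Function.update v j z (Fin.last (2 * m)) = v (Fin.last (2 * m)) :=
          fun z => Function.update_of_ne (fun h => hj h.symm) _ _
        let i₀ : Fin m := ⟨j.val / 2, by omega⟩
        have h1 : ∀ i ∈ Finset.univ.erase i₀, ∀ z : V, Function.update v j z ⟨2 * i, by omega⟩
            = v ⟨2 * i, by omega⟩ := fun i hi z => Function.update_of_ne (by
              intro h; apply Finset.ne_of_mem_erase hi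
              apply Fin.ext; have := congrArg Fin.val h; simp only [i₀] at *; omega) _ _
        have h2 : ∀ i ∈ Finset.univ.erase i₀, ∀ z : V, Function.update v j z ⟨2 * i + 1, by omega⟩
            = v ⟨2 * i + 1, by omega⟩ := fun i hi z => Function.update_of_ne (by
              intro h; apply Finset.ne_of_mem_erase hi
              apply Fin.ext; have := congrArg Fin.val h; simp only [i₀] at *; omega) _ _
        have h3 : ∀ z : V, ∏ i ∈ Finset.univ.erase i₀,
            α (Function.update v j z ⟨2 * i, by omega⟩) (Function.update v j z ⟨2 * i + 1, by omega⟩)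
            = ∏ i ∈ Finset.univ.erase i₀, α (v ⟨2 * i, by omega⟩) (v ⟨2 * i + 1, by omega⟩) :=
          fun z => Finset.prod_congr rfl fun i hi => by rw [h1 i hi, h2 i hi]
        simp only [hl, ← Finset.mul_prod_erase Finset.univ _ (Finset.mem_univ i₀), h3]
        rcases Nat.even_or_odd' j.val with ⟨k, hk | hk⟩
        · have e1 : (⟨2 * i₀, by omega⟩ : Fin (2 * m + 1)) = j := Fin.ext (by simp only [i₀]; omega)
          have e2 : (⟨2 * i₀ + 1, by omega⟩ : Fin (2 * m + 1)) ≠ j := fun h => by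
            have := congrArg Fin.val h; simp only [i₀] at this; omega
          simp only [e1, Function.update_self, Function.update_of_ne e2, map_smul,
            LinearMap.smul_apply, smul_eq_mul]
          ring
        · have e1 : (⟨2 * i₀ + 1, by omega⟩ : Fin (2 * m + 1)) = j :=
            Fin.ext (by simp only [i₀]; omega)
          have e2 : (⟨2 * i₀, by omega⟩ : Fin (2 * m + 1)) ≠ j := fun h => by
            have := congrArg Fin.val h; simp only [i₀] at this; omega
          simp only [e1, Function.update_self, Function.update_of_ne e2, map_smul, smul_eq_mul]
          ring)

/-- The alternating map `αᵐ ∧ θ`. -/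
def powWedgeAlternating (m : ℕ) (α : V →ₗ[ℝ] V →ₗ[ℝ] ℝ) (θ : V →ₗ[ℝ] ℝ) :
    V [⋀^Fin (2 * m + 1)]→ₗ[ℝ] ℝ :=
  (1 / 2 ^ m : ℝ) • MultilinearMap.alternatization (powWedgeMultilinear m α θ)

theorem powWedgeAlternating_apply (m : ℕ) (α : V →ₗ[ℝ] V →ₗ[ℝ] ℝ) (θ : V →ₗ[ℝ] ℝ)
    (v : Fin (2 * m + 1) → V) :
    powWedgeAlternating m α θ v = powWedge m (fun x y => α x y) θ v := by
  simp only [powWedgeAlternating, powWedge, AlternatingMap.smul_apply,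
    MultilinearMap.alternatization_apply, smul_eq_mul]
  congr 1
  refine Finset.sum_congr rfl fun σ _ => ?_
  simp only [powWedgeMultilinear, MultilinearMap.domDomCongr_apply, MultilinearMap.mk'_apply,
    Units.smul_def, zsmul_eq_mul]
  ring

/-- A top degree alternating map is multiplied by the determinant under a change of frame. -/
theorem powWedge_comp (m : ℕ) (hV : Module.finrank ℝ V = 2 * m + 1) [FiniteDimensional ℝ V]
    (α : V →ₗ[ℝ] V →ₗ[ℝ] ℝ) (θ : V →ₗ[ℝ] ℝ) (L : V →ₗ[ℝ] V) (v : Fin (2 * m + 1) → V) :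
    powWedge m (fun x y => α x y) θ (fun i => L (v i))
      = LinearMap.det L * powWedge m (fun x y => α x y) θ v := by
  rw [← powWedgeAlternating_apply, ← powWedgeAlternating_apply]
  let b := Module.finBasisOfFinrankEq ℝ V hV
  -- Alternating maps of top degree form a line, spanned by the determinant of any basis.
  rw [AlternatingMap.eq_smul_basis_det b (powWedgeAlternating m α θ)]
  simp only [AlternatingMap.smul_apply, smul_eq_mul]
  have := Module.Basis.det_comp b L v
  rw [show (fun i => L (v i)) = L ∘ v from rfl, this]
  ring

end PowWedge

section Frame

variable (m : ℕ)

/-- The indices `0, …, 2m` grouped in `m` pairs and the last one. -/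
def pairIndex : (Fin m × Bool) ⊕ Unit ≃ Fin (2 * m + 1) where
  toFun a := match a with
    | Sum.inl (i, b) => ⟨2 * i + (if b then 1 else 0), by split <;> omega⟩
    | Sum.inr _ => Fin.last (2 * m)
  invFun a := if h : a.val < 2 * m then Sum.inl (⟨a.val / 2, by omega⟩, decide (a.val % 2 = 1))
    else Sum.inr ()
  left_inv := by
    rintro (⟨i, b⟩ | ⟨⟩)
    · cases b
      · have : 2 * i.val < 2 * m := by omega
        simp [this]
      · have : 2 * i.val + 1 < 2 * m := by omega
        simp [this]
        exact Fin.ext (by simp; omega)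
    · simp
  right_inv := by
    intro a
    by_cases h : a.val < 2 * m
    · simp only [h, dite_true]
      apply Fin.ext
      by_cases h2 : a.val % 2 = 1 <;> simp [h2] <;> omega
    · simp only [h, dite_false]
      apply Fin.ext
      simp
      omega

/-- The frame `∂/∂x¹, ∂/∂y¹, …, ∂/∂xᵐ, ∂/∂yᵐ, ∂/∂x` indexed by pairs. -/
def pairFrame : (Fin m × Bool) ⊕ Unit → CF m
  | Sum.inl (i, b) => (0, Pi.single i (if b then Complex.I else 1))
  | Sum.inr _ => (1, 0)

/-- The frame `∂/∂x¹, ∂/∂y¹, …, ∂/∂xᵐ, ∂/∂yᵐ, ∂/∂x`. -/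
def stdFrame (a : Fin (2 * m + 1)) : CF m := pairFrame m ((pairIndex m).symm a)

variable {m}

/-- Conjugating by the regrouping of indices preserves signs and replaces neighbouring slots 2i,
2i+1 by honest pairs, so that permutations respecting the pairs can be recognized. -/
theorem powWedge_stdFrame (B : CF m → CF m → ℝ) (θ : CF m → ℝ) :
    powWedge m B θ (stdFrame m) = (1 / 2 ^ m : ℝ) *
      ∑ σ : Equiv.Perm ((Fin m × Bool) ⊕ Unit), ((Equiv.Perm.sign σ : ℤ) : ℝ) *
      (∏ i : Fin m, B (pairFrame m (σ (Sum.inl (i, false)))) (pairFrame m (σ (Sum.inl (i, true))))) *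
      θ (pairFrame m (σ (Sum.inr ()))) := by
  rw [powWedge]
  congr 1
  refine (Fintype.sum_equiv (Equiv.permCongr (pairIndex m)) _ _ fun σ => ?_).symm
  rw [Equiv.Perm.sign_permCongr]
  have h0 : ∀ i : Fin m, (pairIndex m).symm ⟨2 * i, by omega⟩ = Sum.inl (i, false) := fun i => by
    rw [Equiv.symm_apply_eq]; simp [pairIndex]
  have h1 : ∀ i : Fin m, (pairIndex m).symm ⟨2 * i + 1, by omega⟩ = Sum.inl (i, true) := fun i => by
    rw [Equiv.symm_apply_eq]; simp [pairIndex]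
  have h2 : (pairIndex m).symm (Fin.last (2 * m)) = Sum.inr () := by
    rw [Equiv.symm_apply_eq]; simp [pairIndex]
  simp only [stdFrame, Equiv.permCongr_apply, Equiv.symm_apply_apply, h0, h1, h2]

/-- A permutation that maps pairs to pairs. -/
theorem exists_pair_permutation (σ : Equiv.Perm ((Fin m × Bool) ⊕ Unit))
    (h : ∀ i, ∃ k, ∀ b, ∃ c, σ (Sum.inl (i, b)) = Sum.inl (k, c)) :
    ∃ (τ : Equiv.Perm (Fin m)) (u : Fin m → Equiv.Perm Bool),
      σ = Equiv.sumCongr (Equiv.prodCongrLeft (fun _ : Bool => τ) * Equiv.prodCongrRight u) 1 := by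
  choose τ u hu using h
  have hui : ∀ i, Function.Injective (u i) := fun i b c hbc => by
    have : σ (Sum.inl (i, b)) = σ (Sum.inl (i, c)) := by rw [hu, hu, hbc]
    simpa using σ.injective this
  have hus : ∀ i, Function.Surjective (u i) := fun i => Finite.injective_iff_surjective.1 (hui i)
  have hτ : Function.Injective τ := fun i j hij => by
    obtain ⟨b, hb⟩ := hus i (u j false)
    have : σ (Sum.inl (i, b)) = σ (Sum.inl (j, false)) := by rw [hu, hu, hb, hij]
    have := σ.injective this
    simp at this
    exact this.1
  have hτb : Function.Bijective τ := ⟨hτ, Finite.injective_iff_surjective.1 hτ⟩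
  refine ⟨Equiv.ofBijective τ hτb, fun i => Equiv.ofBijective (u i) ⟨hui i, hus i⟩, ?_⟩
  have key : ∀ i b, σ (Sum.inl (i, b)) = Sum.inl (τ i, u i b) := hu
  ext x
  rcases x with ⟨i, b⟩ | ⟨⟩
  · rw [key]; rfl
  -- Pairs go to pairs, so only the last index is left to be sent to the last index.
  · obtain ⟨y, hy⟩ : ∃ y, σ y = Sum.inr () := σ.surjective _
    rcases y with ⟨i, b⟩ | ⟨⟩
    · rw [key] at hy; simp at hy
    · rw [hy]; rfl

/-- A permutation τ of the pairs acts once on the first and once on the second members, so its sign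
enters squared; only the flips inside the pairs count. -/
theorem sign_pair_permutation (τ : Equiv.Perm (Fin m)) (u : Fin m → Equiv.Perm Bool) :
    Equiv.Perm.sign (Equiv.sumCongr (Equiv.prodCongrLeft (fun _ : Bool => τ) *
      Equiv.prodCongrRight u) (1 : Equiv.Perm Unit)) = ∏ i, Equiv.Perm.sign (u i) := by
  erw [Equiv.Perm.sign_sumCongr]
  rw [map_mul, Equiv.Perm.sign_prodCongrLeft, Equiv.Perm.sign_prodCongrRight]
  simp

/-- The real bilinear form `(v, w) ↦ - 2 Im (vᵀ H w̄)`. -/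
def hermForm (H : Matrix (Fin m) (Fin m) ℂ) (v w : Fin m → ℂ) : ℝ :=
  -2 * (∑ i, ∑ j, v i * H i j * star (w j)).im

/-- The matrix `a_{i j̄} = (b (eᵢ, √-1 eⱼ) - √-1 b (eᵢ, eⱼ)) / 2` of a real bilinear form on `ℂᵐ`. -/
def formMatrix (b : (Fin m → ℂ) → (Fin m → ℂ) → ℝ) : Matrix (Fin m) (Fin m) ℂ :=
  Matrix.of fun i j => (1 / 2 : ℂ) * ((b (Pi.single i 1) (Pi.single j Complex.I) : ℂ)
    - Complex.I * (b (Pi.single i 1) (Pi.single j 1) : ℂ))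

theorem hermForm_diagonal_single (d : Fin m → ℝ) (i j : Fin m) (a b : ℂ) :
    hermForm (Matrix.diagonal fun k => (d k : ℂ)) (Pi.single i a) (Pi.single j b)
      = if i = j then -2 * d i * (a * star b).im else 0 := by
  rw [hermForm]
  rw [Finset.sum_eq_single i, Finset.sum_eq_single j]
  · by_cases h : i = j
    · subst h
      simp
      ring
    · simp [h]
  · intro k _ hk
    simp [Pi.single_eq_of_ne hk]
  · simp
  · intro k _ hk
    simp [Pi.single_eq_of_ne hk]
  · simp

/-- The pullback of a form to `ℝ × ℂᵐ`. -/
def sndForm (b : (Fin m → ℂ) → (Fin m → ℂ) → ℝ) (X Y : CF m) : ℝ := b X.2 Y.2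

/-- For a diagonal form different coordinate lines are orthogonal and the leaf direction is in the
kernel. Hence only permutations mapping pairs to pairs contribute to the top form. -/
theorem sndForm_diagonal_pairFrame (d : Fin m → ℝ) (x y : (Fin m × Bool) ⊕ Unit)
    (h : sndForm (hermForm (Matrix.diagonal fun k => (d k : ℂ))) (pairFrame m x) (pairFrame m y)
      ≠ 0) : ∃ i b c, x = Sum.inl (i, b) ∧ y = Sum.inl (i, c) := by
  rcases x with ⟨i, b⟩ | ⟨⟩
  · rcases y with ⟨j, c⟩ | ⟨⟩
    · simp only [sndForm, pairFrame, hermForm_diagonal_single] at h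
      by_cases hij : i = j
      · exact ⟨i, b, c, rfl, by rw [hij]⟩
      · simp [hij] at h
    · simp [sndForm, pairFrame, hermForm] at h
  · simp [sndForm, pairFrame, hermForm] at h

/-- Each surviving permutation uses every coordinate line exactly once, hence every diagonal entry
exactly once. -/
theorem powWedge_diagonal (d : Fin m → ℝ) :
    powWedge m (sndForm (hermForm (Matrix.diagonal fun k => (d k : ℂ)))) Prod.fst (stdFrame m)
      = (∏ i, d i) *
        powWedge m (sndForm (hermForm (1 : Matrix (Fin m) (Fin m) ℂ))) Prod.fst (stdFrame m) := by
  rw [powWedge_stdFrame, powWedge_stdFrame, mul_left_comm, Finset.mul_sum (a := ∏ i, d i)]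
  congr 1
  refine Finset.sum_congr rfl fun σ _ => ?_
  have h1 : (1 : Matrix (Fin m) (Fin m) ℂ) = Matrix.diagonal fun _ => ((1 : ℝ) : ℂ) := by simp
  rw [h1]
  by_cases hσ : ∀ i, ∃ k, ∀ b, ∃ c, σ (Sum.inl (i, b)) = Sum.inl (k, c)
  · obtain ⟨τ, u, rfl⟩ := exists_pair_permutation σ hσ
    have : ∏ i, d i = ∏ i, d (τ i) := (Equiv.prod_comp τ d).symm
    have h2 : ∀ i : Fin m, ∀ b, (Equiv.sumCongr (Equiv.prodCongrLeft (fun _ : Bool => τ) *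
      Equiv.prodCongrRight u) (1 : Equiv.Perm Unit)) (Sum.inl (i, b)) = Sum.inl (τ i, u i b) :=
      fun i b => rfl
    simp only [h2, sndForm, pairFrame, hermForm_diagonal_single, if_true, this]
    rw [Finset.prod_congr rfl fun i _ => show _ = d (τ i) * (-2 * 1 *
      ((if (u i) false = true then Complex.I else 1) *
        star (if (u i) true = true then Complex.I else 1)).im) by ring,
      Finset.prod_mul_distrib]
    ring
  · push Not at hσ
    obtain ⟨i, hi⟩ := hσ
    have key : ∀ d' : Fin m → ℝ, ∏ i : Fin m,
        sndForm (hermForm (Matrix.diagonal fun k => (d' k : ℂ)))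
          (pairFrame m (σ (Sum.inl (i, false)))) (pairFrame m (σ (Sum.inl (i, true)))) = 0 := by
      intro d'
      apply Finset.prod_eq_zero (Finset.mem_univ i)
      by_contra hne
      obtain ⟨k, b, c, hb, hc⟩ := sndForm_diagonal_pairFrame d' _ _ hne
      obtain ⟨b', hb'⟩ := hi k
      cases b'
      · exact hb' b hb
      · exact hb' c hc
    rw [key d, key]
    simp

/-- The value of the standard top form on the standard frame. -/
def frameConst (m : ℕ) : ℝ :=
  powWedge m (sndForm (hermForm (1 : Matrix (Fin m) (Fin m) ℂ))) Prod.fst (stdFrame m)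

/-- Only the sign of this constant matters. Every surviving term equals 2ᵐ: flipping a pair changes
both the sign of the permutation and the sign of the corresponding factor. -/
theorem frameConst_pos (m : ℕ) : 0 < frameConst m := by
  rw [frameConst, powWedge_stdFrame]
  have h1 : (1 : Matrix (Fin m) (Fin m) ℂ) = Matrix.diagonal fun _ => ((1 : ℝ) : ℂ) := by simp
  have hval : ∀ (τ : Equiv.Perm (Fin m)) (u : Fin m → Equiv.Perm Bool),
      ((Equiv.Perm.sign (Equiv.sumCongr (Equiv.prodCongrLeft (fun _ : Bool => τ) *
        Equiv.prodCongrRight u) (1 : Equiv.Perm Unit)) : ℤ) : ℝ) *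
      (∏ i : Fin m, sndForm (hermForm (1 : Matrix (Fin m) (Fin m) ℂ))
        (pairFrame m ((Equiv.sumCongr (Equiv.prodCongrLeft (fun _ : Bool => τ) *
        Equiv.prodCongrRight u) (1 : Equiv.Perm Unit)) (Sum.inl (i, false))))
        (pairFrame m ((Equiv.sumCongr (Equiv.prodCongrLeft (fun _ : Bool => τ) *
        Equiv.prodCongrRight u) (1 : Equiv.Perm Unit)) (Sum.inl (i, true))))) *
      (pairFrame m ((Equiv.sumCongr (Equiv.prodCongrLeft (fun _ : Bool => τ) *
        Equiv.prodCongrRight u) (1 : Equiv.Perm Unit)) (Sum.inr ()))).1 = 2 ^ m := by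
    intro τ u
    have h2 : ∀ i : Fin m, ∀ b, (Equiv.sumCongr (Equiv.prodCongrLeft (fun _ : Bool => τ) *
      Equiv.prodCongrRight u) (1 : Equiv.Perm Unit)) (Sum.inl (i, b)) = Sum.inl (τ i, u i b) :=
      fun i b => rfl
    have h3 : (Equiv.sumCongr (Equiv.prodCongrLeft (fun _ : Bool => τ) *
      Equiv.prodCongrRight u) (1 : Equiv.Perm Unit)) (Sum.inr ()) = Sum.inr () := rfl
    rw [sign_pair_permutation, h3, h1]
    simp only [h2, sndForm, pairFrame, hermForm_diagonal_single, if_true, mul_one]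
    push_cast
    rw [← Finset.prod_mul_distrib]
    rw [Finset.prod_congr rfl (g := fun _ => (2 : ℝ))]
    · simp
    · intro i _
      generalize u i = e
      revert e
      intro e
      have : e = 1 ∨ e = Equiv.swap false true := by revert e; decide
      rcases this with rfl | rfl
      · simp
      · have : Equiv.Perm.sign (Equiv.swap false true) = -1 := Equiv.Perm.sign_swap (by simp)
        simp [this]
  have hnn : ∀ σ : Equiv.Perm ((Fin m × Bool) ⊕ Unit), 0 ≤ ((Equiv.Perm.sign σ : ℤ) : ℝ) *
      (∏ i : Fin m, sndForm (hermForm (1 : Matrix (Fin m) (Fin m) ℂ))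
        (pairFrame m (σ (Sum.inl (i, false)))) (pairFrame m (σ (Sum.inl (i, true))))) *
      (pairFrame m (σ (Sum.inr ()))).1 := by
    intro σ
    by_cases hσ : ∀ i, ∃ k, ∀ b, ∃ c, σ (Sum.inl (i, b)) = Sum.inl (k, c)
    · obtain ⟨τ, u, rfl⟩ := exists_pair_permutation σ hσ
      rw [hval]; positivity
    · push Not at hσ
      obtain ⟨i, hi⟩ := hσ
      have : ∏ i : Fin m,
        sndForm (hermForm (1 : Matrix (Fin m) (Fin m) ℂ))
          (pairFrame m (σ (Sum.inl (i, false)))) (pairFrame m (σ (Sum.inl (i, true)))) = 0 := by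
        apply Finset.prod_eq_zero (Finset.mem_univ i)
        by_contra hne
        rw [h1] at hne
        obtain ⟨k, b, c, hb, hc⟩ := sndForm_diagonal_pairFrame _ _ _ hne
        obtain ⟨b', hb'⟩ := hi k
        cases b'
        · exact hb' b hb
        · exact hb' c hc
      rw [this]; simp
  apply mul_pos (by positivity)
  apply Finset.sum_pos' (fun σ _ => hnn σ)
  refine ⟨_, Finset.mem_univ (Equiv.sumCongr (Equiv.prodCongrLeft (fun _ : Bool => (1 : Equiv.Perm (Fin m))) *
        Equiv.prodCongrRight (fun _ => 1)) (1 : Equiv.Perm Unit)), ?_⟩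
  rw [hval]; positivity

theorem hermForm_eq (H : Matrix (Fin m) (Fin m) ℂ) (v w : Fin m → ℂ) :
    hermForm H v w = -2 * (v ⬝ᵥ H.mulVec (star w)).im := by
  simp only [hermForm, dotProduct, Matrix.mulVec, Finset.mul_sum, mul_assoc, Pi.star_apply]

theorem hermForm_conj (U H : Matrix (Fin m) (Fin m) ℂ) (v w : Fin m → ℂ) :
    hermForm (U * H * U.conjTranspose) v w = hermForm H (Matrix.vecMul v U) (Matrix.vecMul w U) := by
  rw [hermForm_eq, hermForm_eq, Matrix.star_vecMul, ← Matrix.mulVec_mulVec, ← Matrix.mulVec_mulVec,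
    Matrix.dotProduct_mulVec]

theorem hermForm_add_left (H : Matrix (Fin m) (Fin m) ℂ) (u v w : Fin m → ℂ) :
    hermForm H (u + v) w = hermForm H u w + hermForm H v w := by
  simp only [hermForm_eq, add_dotProduct, Complex.add_im]; ring

theorem hermForm_smul_left (H : Matrix (Fin m) (Fin m) ℂ) (c : ℝ) (v w : Fin m → ℂ) :
    hermForm H (c • v) w = c * hermForm H v w := by
  simp only [hermForm_eq, smul_dotProduct, Complex.smul_im, smul_eq_mul]; ring

theorem hermForm_add_right (H : Matrix (Fin m) (Fin m) ℂ) (u v w : Fin m → ℂ) :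
    hermForm H u (v + w) = hermForm H u v + hermForm H u w := by
  simp only [hermForm_eq, star_add, Matrix.mulVec_add, dotProduct_add, Complex.add_im]; ring

theorem hermForm_smul_right (H : Matrix (Fin m) (Fin m) ℂ) (c : ℝ) (v w : Fin m → ℂ) :
    hermForm H v (c • w) = c * hermForm H v w := by
  simp only [hermForm_eq, star_smul, Matrix.mulVec_smul, dotProduct_smul, star_trivial,
    Complex.smul_im, smul_eq_mul]; ring

/-- The form `sndForm (hermForm H)` as a bilinear map. -/
def hermBilin (H : Matrix (Fin m) (Fin m) ℂ) : CF m →ₗ[ℝ] CF m →ₗ[ℝ] ℝ :=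
  LinearMap.mk₂ ℝ (sndForm (hermForm H)) (fun _ _ _ => hermForm_add_left _ _ _ _)
    (fun _ _ _ => hermForm_smul_left _ _ _ _) (fun _ _ _ => hermForm_add_right _ _ _ _)
    (fun _ _ _ => hermForm_smul_right _ _ _ _)

theorem finrank_CF (m : ℕ) : Module.finrank ℝ (CF m) = 2 * m + 1 := by
  rw [Module.finrank_prod, Module.finrank_self, Module.finrank_pi_fintype]
  simp [Complex.finrank_real_complex]
  ring

/-- A unitary change of the transverse coordinates reduces to the diagonal case, where the product
of the eigenvalues appears. -/
theorem powWedge_hermForm (H : Matrix (Fin m) (Fin m) ℂ) (hH : H.IsHermitian) :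
    powWedge m (sndForm (hermForm H)) Prod.fst (stdFrame m) = H.det.re * frameConst m := by
  set U : Matrix (Fin m) (Fin m) ℂ := hH.eigenvectorUnitary.1 with hU
  have hUU : U * U.conjTranspose = 1 := by
    have := Matrix.mem_unitaryGroup_iff.1 hH.eigenvectorUnitary.2
    rwa [Matrix.star_eq_conjTranspose] at this
  have hspec : H = U * Matrix.diagonal (fun k => (hH.eigenvalues k : ℂ)) * U.conjTranspose := by
    conv_lhs => rw [hH.spectral_theorem]
    rw [Unitary.conjStarAlgAut_apply]
    rfl
  let L : CF m →ₗ[ℝ] CF m :=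
    LinearMap.prodMap LinearMap.id ((Matrix.vecMulLinear U).restrictScalars ℝ)
  have hpull : ∀ K : Matrix (Fin m) (Fin m) ℂ,
      powWedge m (sndForm (hermForm (U * K * U.conjTranspose))) Prod.fst (stdFrame m)
        = LinearMap.det L * powWedge m (sndForm (hermForm K)) Prod.fst (stdFrame m) := by
    intro K
    have h1 := powWedge_comp m (finrank_CF m) (hermBilin K) (LinearMap.fst ℝ ℝ (Fin m → ℂ)) L
      (stdFrame m)
    have h2 : (fun x y => hermBilin K x y) = sndForm (hermForm K) := rfl
    rw [h2] at h1
    have h3 : (⇑(LinearMap.fst ℝ ℝ (Fin m → ℂ))) = Prod.fst := rfl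
    rw [h3] at h1
    rw [← h1]
    have h4 : sndForm (hermForm (U * K * U.conjTranspose))
        = fun x y => sndForm (hermForm K) (L x) (L y) := by
      funext x y
      exact hermForm_conj U K x.2 y.2
    rw [h4]
    rfl
  -- The real determinant of the unitary change of frame need not be computed: it fixes the form of
  -- the identity matrix, whose top form is nonzero.
  have hdet : LinearMap.det L = 1 := by
    have h1 := hpull 1
    rw [mul_one, hUU] at h1
    have h2 := (frameConst_pos m).ne'
    rw [frameConst] at h2
    exact (mul_right_cancel₀ h2 (by rw [one_mul]; exact h1)).symm
  have hd : H.det.re = ∏ i, hH.eigenvalues i := by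
    rw [hH.det_eq_prod_eigenvalues]
    have : (∏ i, ((hH.eigenvalues i : ℝ) : ℂ)) = ((∏ i, hH.eigenvalues i : ℝ) : ℂ) := by push_cast; rfl
    exact (congrArg Complex.re this).trans (Complex.ofReal_re _)
  conv_lhs => rw [hspec]
  rw [hpull, hdet, one_mul, powWedge_diagonal, hd, frameConst]

/-- A `√-1`-invariant real bilinear form is determined by its matrix. -/
theorem hermForm_formMatrix (b : (Fin m → ℂ) →ₗ[ℝ] (Fin m → ℂ) →ₗ[ℝ] ℝ)
    (hI : ∀ v w, b (Complex.I • v) (Complex.I • w) = b v w)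
    (v w : Fin m → ℂ) : hermForm (formMatrix fun x y => b x y) v w = b v w := by
  have hI' : ∀ v w, b (Complex.I • v) w = -b v (Complex.I • w) := fun v w => by
    rw [← hI v, smul_smul, Complex.I_mul_I, neg_one_smul, map_neg, neg_neg]
  have hsum : ∀ v : Fin m → ℂ, v = ∑ i, ((v i).re • (Pi.single i 1 : Fin m → ℂ) +
      (v i).im • (Pi.single i Complex.I : Fin m → ℂ)) := by
    intro v
    ext k
    rw [Finset.sum_apply, Finset.sum_eq_single k]
    · simp [Complex.re_add_im]
    · intro i _ hi; simp [Pi.single_eq_of_ne hi.symm]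
    · simp
  have hs : ∀ i, Pi.single i Complex.I = Complex.I • (Pi.single i 1 : Fin m → ℂ) := fun i => by
    rw [← Pi.single_smul, smul_eq_mul, mul_one]
  have hb : b v w = ∑ i, ∑ j, (((v i).re * (w j).re + (v i).im * (w j).im) *
        b (Pi.single i 1) (Pi.single j 1) +
      ((v i).re * (w j).im - (v i).im * (w j).re) * b (Pi.single i 1) (Pi.single j Complex.I)) := by
    conv_lhs => rw [hsum v, hsum w]
    rw [LinearMap.map_sum₂]
    refine Finset.sum_congr rfl fun i _ => ?_
    rw [map_sum]
    refine Finset.sum_congr rfl fun j _ => ?_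
    simp only [map_add, map_smul, LinearMap.add_apply, LinearMap.smul_apply, smul_eq_mul]
    simp only [hs, hI, hI']
    ring
  rw [hb, hermForm, Complex.im_sum, Finset.mul_sum]
  refine Finset.sum_congr rfl fun i _ => ?_
  rw [Complex.im_sum, Finset.mul_sum]
  refine Finset.sum_congr rfl fun j _ => ?_
  simp [formMatrix]
  ring

/-- Invariance and antisymmetry make b(·, √-1 ·) symmetric, which handles the real parts of the
entries; b itself is antisymmetric and gives the imaginary parts. -/
theorem formMatrix_isHermitian (b : (Fin m → ℂ) →ₗ[ℝ] (Fin m → ℂ) →ₗ[ℝ] ℝ)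
    (halt : ∀ v w, b v w = -b w v) (hI : ∀ v w, b (Complex.I • v) (Complex.I • w) = b v w) :
    (formMatrix fun x y => b x y).IsHermitian := by
  have hI' : ∀ v w, b (Complex.I • v) w = -b v (Complex.I • w) := fun v w => by
    rw [← hI v, smul_smul, Complex.I_mul_I, neg_one_smul, map_neg, neg_neg]
  have hs : ∀ i, Pi.single i Complex.I = Complex.I • (Pi.single i 1 : Fin m → ℂ) := fun i => by
    rw [← Pi.single_smul, smul_eq_mul, mul_one]
  ext i j
  have h1 : b (Pi.single i 1) (Pi.single j Complex.I) = b (Pi.single j 1) (Pi.single i Complex.I) := by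
    rw [hs, hs, halt, hI', neg_neg]
  have h2 : b (Pi.single i 1) (Pi.single j 1) = -b (Pi.single j 1) (Pi.single i 1) := halt _ _
  simp only [formMatrix, Matrix.conjTranspose_apply, Matrix.of_apply, h1, h2]
  apply Complex.ext <;> simp

/-- The top form `bᵐ ∧ θ` on the standard frame is the determinant of the matrix of `b`. -/
theorem powWedge_eq_det (B : CF m →ₗ[ℝ] CF m →ₗ[ℝ] ℝ) (θ : CF m →ₗ[ℝ] ℝ)
    (halt : ∀ v w, B v w = -B w v) (h0 : ∀ v, B (1, 0) v = 0) (hθ : θ (1, 0) = 1)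
    (hI : ∀ v w : Fin m → ℂ, B (0, Complex.I • v) (0, Complex.I • w) = B (0, v) (0, w)) :
    powWedge m (fun x y => B x y) θ (stdFrame m)
      = (formMatrix fun v w => B (0, v) (0, w)).det.re * frameConst m := by
  let b : (Fin m → ℂ) →ₗ[ℝ] (Fin m → ℂ) →ₗ[ℝ] ℝ :=
    B.compl₁₂ (LinearMap.inr ℝ ℝ (Fin m → ℂ)) (LinearMap.inr ℝ ℝ (Fin m → ℂ))
  have hbdef : ∀ v w, b v w = B (0, v) (0, w) := fun v w => rfl
  have hB : (fun x y => B x y) = sndForm (hermForm (formMatrix fun v w => B (0, v) (0, w))) := by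
    funext x y
    have h := hermForm_formMatrix b (fun v w => hI v w) x.2 y.2
    have e : ∀ x : CF m, x = x.1 • ((1, 0) : CF m) + (0, x.2) := fun x => by ext <;> simp
    rw [sndForm]
    refine Eq.trans ?_ h.symm
    rw [hbdef]
    conv_lhs => rw [e x, e y]
    simp only [map_add, map_smul, LinearMap.add_apply, LinearMap.smul_apply, h0]
    rw [halt _ (1, 0), h0]
    simp
  have hherm : (formMatrix fun v w => B (0, v) (0, w)).IsHermitian :=
    formMatrix_isHermitian b (fun v w => halt _ _) fun v w => hI v w
  rw [hB, ← powWedge_hermForm _ hherm, powWedge_stdFrame, powWedge_stdFrame]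
  congr 1
  refine Finset.sum_congr rfl fun σ _ => ?_
  -- Unless the leaf vector is fed into θ, it is fed into B, which annihilates it. So θ matters only
  -- through its value 1 on that vector.
  by_cases hσ : σ (Sum.inr ()) = Sum.inr ()
  · rw [hσ]
    simp [pairFrame, hθ]
  · rw [Finset.prod_eq_zero_iff.2]
    · simp
    · obtain ⟨⟨i, b⟩ | ⟨⟩, hx⟩ := σ.surjective (Sum.inr ())
      · refine ⟨i, Finset.mem_univ _, ?_⟩
        cases b
        · rw [hx]; simp [sndForm, pairFrame, hermForm]
        · rw [hx]; simp [sndForm, pairFrame, hermForm]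
      · exact absurd hx hσ

end Frame

end Sasaki

end

noncomputable section

namespace Sasaki

/-! ### Superposition operators and holomorphic flow boxes -/

section Superposition

universe u

variable {K : Type*} [TopologicalSpace K] {E F : Type u} [NormedAddCommGroup E]
  [NormedAddCommGroup F]

/-- The superposition operator `γ ↦ f ∘ γ`. -/
def superpose (f : E → F) (hf : Continuous f) (γ : C(K, E)) : C(K, F) := ContinuousMap.comp ⟨f, hf⟩ γ

theorem continuous_superpose (f : E → F) (hf : Continuous f) :
    Continuous (superpose (K := K) f hf) := ContinuousMap.continuous_postcomp ⟨f, hf⟩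

variable [CompactSpace K] [NormedSpace ℝ E] [NormedSpace ℝ F]

/-- Pointwise application of a bilinear map. -/
def pointwiseBilin {G : Type*} [NormedAddCommGroup G] [NormedSpace ℝ G] (B : G →L[ℝ] E →L[ℝ] F) :
    C(K, G) →L[ℝ] C(K, E) →L[ℝ] C(K, F) :=
  LinearMap.mkContinuous₂ (LinearMap.mk₂ ℝ
    (fun (A : C(K, G)) (δ : C(K, E)) => (⟨fun t => B (A t) (δ t), by fun_prop⟩ : C(K, F)))
    (fun _ _ _ => by ext; simp) (fun _ _ _ => by ext; simp) (fun _ _ _ => by ext; simp)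
    (fun _ _ _ => by ext; simp)) ‖B‖ (fun A δ => by
      refine (ContinuousMap.norm_le _ (by positivity)).2 fun t => ?_
      refine (B.le_opNorm₂ _ _).trans ?_
      gcongr
      · exact A.norm_coe_le_norm t
      · exact δ.norm_coe_le_norm t)

/-- Pointwise application of linear maps. -/
abbrev pointwiseApply : C(K, E →L[ℝ] F) →L[ℝ] C(K, E) →L[ℝ] C(K, F) :=
  pointwiseBilin (ContinuousLinearMap.id ℝ (E →L[ℝ] F))

/-- Continuity of the superposition operator of f' bounds the variation of f' near the image of γ
uniformly in t; the mean value inequality on each segment then gives a uniform remainder estimate.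
-/
theorem hasFDerivAt_superpose (f : E → F) (hf : ContDiff ℝ 1 f) (γ : C(K, E)) :
    HasFDerivAt (superpose (K := K) f hf.continuous)
      (pointwiseApply (superpose (fderiv ℝ f) (hf.continuous_fderiv one_ne_zero) γ)) γ := by
  rw [hasFDerivAt_iff_isLittleO_nhds_zero, Asymptotics.isLittleO_iff]
  intro ε hε
  have hcont := (continuous_superpose (K := K) (fderiv ℝ f)
    (hf.continuous_fderiv one_ne_zero)).continuousAt (x := γ)
  obtain ⟨r, hr, hball⟩ := Metric.continuousAt_iff.1 hcont ε hε
  filter_upwards [Metric.ball_mem_nhds (0 : C(K, E)) hr] with δ hδ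
  rw [mem_ball_zero_iff] at hδ
  refine (ContinuousMap.norm_le _ (by positivity)).2 fun t => ?_
  -- A point of the segment is the value at t of the path γ + θ δ, which is still within r of γ.
  have key : ∀ s ∈ segment ℝ (γ t) (γ t + δ t), ‖fderiv ℝ f s - fderiv ℝ f (γ t)‖ ≤ ε := by
    intro s hs
    rw [segment_eq_image'] at hs
    obtain ⟨θ, hθ, rfl⟩ := hs
    have h1 : dist (γ + θ • δ) γ < r := by
      rw [dist_eq_norm, add_sub_cancel_left, norm_smul, Real.norm_eq_abs, abs_of_nonneg hθ.1]
      exact lt_of_le_of_lt (mul_le_of_le_one_left (norm_nonneg _) hθ.2) hδ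
    have h2 := hball h1
    have h3 := (ContinuousMap.dist_lt_iff hε).1 h2 t
    rw [dist_eq_norm] at h3
    simpa [superpose] using h3.le
  have := Convex.norm_image_sub_le_of_norm_fderiv_le' (𝕜 := ℝ) (f := f) (φ := fderiv ℝ f (γ t))
    (s := segment ℝ (γ t) (γ t + δ t)) (x := γ t) (y := γ t + δ t) (C := ε)
    (fun s _ => (hf.differentiable one_ne_zero) s) key (convex_segment _ _)
    (left_mem_segment _ _ _) (right_mem_segment _ _ _)
  rw [add_sub_cancel_left] at this
  exact this.trans (mul_le_mul_of_nonneg_left (δ.norm_coe_le_norm t) hε.le)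

/-- The derivative is the superposition operator of f' followed by a bounded bilinear pairing, so
one induction step replaces F by `E →L[ℝ] F`. This is why F is quantified inside and shares the
universe of E. -/
theorem contDiff_superpose_nat (n : ℕ) : ∀ {F : Type u} [NormedAddCommGroup F] [NormedSpace ℝ F]
    (f : E → F) (hf : ContDiff ℝ n f), ContDiff ℝ n (superpose (K := K) f hf.continuous) := by
  induction n with
  | zero => intro F _ _ f hf; exact contDiff_zero.2 (continuous_superpose _ _)
  | succ n ih =>
    intro F _ _ f hf
    have hf1 : ContDiff ℝ 1 f := hf.of_le (by norm_cast; omega)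
    have hd : ContDiff ℝ n (fderiv ℝ f) := hf.fderiv_right (by norm_cast)
    push_cast
    rw [contDiff_succ_iff_hasFDerivAt]
    exact ⟨_, pointwiseApply.contDiff.comp (ih (fderiv ℝ f) hd), hasFDerivAt_superpose f hf1⟩

theorem contDiff_superpose (f : E → F) (hf : ContDiff ℝ ∞ f) :
    ContDiff ℝ ∞ (superpose (K := K) f hf.continuous) :=
  contDiff_infty.2 fun n => contDiff_superpose_nat n f (contDiff_infty.1 hf n)

end Superposition

/-! ### The flow of a holomorphic vector field in complex time -/

section FlowBox

variable {n : ℕ}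

/-- The integral `τ ↦ ∫₀^τ γ` of a path. -/
def pathIntegral : C(Icc (0 : ℝ) 1, Fin n → ℂ) →L[ℝ] C(Icc (0 : ℝ) 1, Fin n → ℂ) :=
  LinearMap.mkContinuous
    { toFun := fun γ => ⟨fun τ => ∫ s in (0 : ℝ)..τ, IccExtend zero_le_one γ s, by
        have h : Continuous (IccExtend zero_le_one γ) := γ.continuous.Icc_extend'
        exact (intervalIntegral.continuous_primitive (fun a b => h.intervalIntegrable a b) 0).comp
          continuous_subtype_val⟩
      map_add' := fun γ δ => by
        ext1 τ
        have h : ∀ γ : C(Icc (0 : ℝ) 1, Fin n → ℂ), Continuous (IccExtend zero_le_one γ) :=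
          fun γ => γ.continuous.Icc_extend'
        have := intervalIntegral.integral_add (μ := volume) ((h γ).intervalIntegrable 0 τ)
          ((h δ).intervalIntegrable 0 τ)
        exact this
      map_smul' := fun c γ => by
        ext1 τ
        exact intervalIntegral.integral_smul c _ } 1 (fun γ => by
      rw [one_mul]
      refine (ContinuousMap.norm_le _ (by positivity)).2 fun t => ?_
      have := intervalIntegral.norm_integral_le_of_norm_le_const (a := (0 : ℝ)) (b := t) (C := ‖γ‖)
        (f := IccExtend zero_le_one γ) (fun s _ => γ.norm_coe_le_norm _)
      refine this.trans (mul_le_of_le_one_right (norm_nonneg _) ?_)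
      rw [sub_zero, abs_of_nonneg t.2.1]
      exact t.2.2)

theorem pathIntegral_apply (γ : C(Icc (0 : ℝ) 1, Fin n → ℂ)) (τ : Icc (0 : ℝ) 1) :
    pathIntegral γ τ = ∫ s in (0 : ℝ)..τ, IccExtend zero_le_one γ s := rfl

theorem pathIntegral_I_smul (γ : C(Icc (0 : ℝ) 1, Fin n → ℂ)) :
    pathIntegral (Complex.I • γ) = Complex.I • pathIntegral γ := by
  ext1 τ
  rw [pathIntegral_apply, ContinuousMap.smul_apply, pathIntegral_apply,
    ← intervalIntegral.integral_smul]
  rfl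

/-- Substitution s ↦ σ s. It shows that slowing down a solution with parameter ζ by the factor σ
gives a solution with parameter σ ζ. -/
theorem pathIntegral_scale (γ : C(Icc (0 : ℝ) 1, Fin n → ℂ)) (σ τ : Icc (0 : ℝ) 1)
    (γ' : C(Icc (0 : ℝ) 1, Fin n → ℂ)) (h : ∀ τ, γ' τ = γ (σ * τ)) :
    pathIntegral γ (σ * τ) = (σ : ℝ) • pathIntegral γ' τ := by
  rw [pathIntegral_apply, pathIntegral_apply]
  have h2 : ∫ s in (0 : ℝ)..τ, IccExtend zero_le_one γ' s
      = ∫ s in (0 : ℝ)..τ, IccExtend zero_le_one γ (σ * s) := by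
    refine intervalIntegral.integral_congr fun s hs => ?_
    rw [uIcc_of_le τ.2.1] at hs
    have hs' : s ∈ Icc (0 : ℝ) 1 := ⟨hs.1, hs.2.trans τ.2.2⟩
    have hs'' : (σ : ℝ) * s ∈ Icc (0 : ℝ) 1 := (σ * ⟨s, hs'⟩ : Icc (0 : ℝ) 1).2
    rw [IccExtend_of_mem _ _ hs', IccExtend_of_mem _ _ hs'', h]
    rfl
  rw [h2, intervalIntegral.smul_integral_comp_mul_left]
  simp

/-- Constant paths. -/
def constPath : (Fin n → ℂ) →L[ℝ] C(Icc (0 : ℝ) 1, Fin n → ℂ) :=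
  LinearMap.mkContinuous
    { toFun := fun w => ContinuousMap.const _ w
      map_add' := fun _ _ => rfl
      map_smul' := fun _ _ => rfl } 1 (fun w => by
      rw [one_mul]
      exact (ContinuousMap.norm_le _ (by positivity)).2 fun t => le_rfl)

@[simp] theorem constPath_apply (w : Fin n → ℂ) (t : Icc (0 : ℝ) 1) : constPath w t = w := rfl

variable {m : ℕ} (Z : (Fin n → ℂ) → (Fin n → ℂ)) (hZ : ContDiff ℝ ∞ Z) (w₀ : Fin n → ℂ)
  (l : (Fin m → ℂ) →L[ℂ] (Fin n → ℂ))

/-- The map whose zeros are the solutions of `γ' = ζ Z(γ)`, `γ(0) = w₀ + l y`, together with the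
parameters `(ζ, y)`. -/
def flowMap (x : (ℂ × (Fin m → ℂ)) × C(Icc (0 : ℝ) 1, Fin n → ℂ)) :
    (ℂ × (Fin m → ℂ)) × C(Icc (0 : ℝ) 1, Fin n → ℂ) :=
  (x.1, x.2 - constPath (w₀ + l x.1.2) - x.1.1 • pathIntegral (superpose Z hZ.continuous x.2))

theorem contDiff_flowMap : ContDiff ℝ ∞ (flowMap Z hZ w₀ l) := by
  have h1 : ContDiff ℝ ∞ fun x : (ℂ × (Fin m → ℂ)) × C(Icc (0 : ℝ) 1, Fin n → ℂ) =>
      pathIntegral (superpose Z hZ.continuous x.2) :=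
    pathIntegral.contDiff.comp ((contDiff_superpose Z hZ).comp contDiff_snd)
  have h2 : ContDiff ℝ ∞ fun x : (ℂ × (Fin m → ℂ)) × C(Icc (0 : ℝ) 1, Fin n → ℂ) =>
      constPath (w₀ + l x.1.2) :=
    constPath.contDiff.comp (contDiff_const.add
      ((l.restrictScalars ℝ).contDiff.comp (contDiff_snd.comp contDiff_fst)))
  have h3 : ContDiff ℝ ∞ fun x : (ℂ × (Fin m → ℂ)) × C(Icc (0 : ℝ) 1, Fin n → ℂ) => x.1.1 :=
    contDiff_fst.comp contDiff_fst
  exact contDiff_fst.prodMk ((contDiff_snd.sub h2).sub (h3.smul h1))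

theorem fderiv_flowMap (x v : (ℂ × (Fin m → ℂ)) × C(Icc (0 : ℝ) 1, Fin n → ℂ)) :
    fderiv ℝ (flowMap Z hZ w₀ l) x v = (v.1, v.2 - constPath (l v.1.2)
      - (x.1.1 • pathIntegral (pointwiseApply (superpose (fderiv ℝ Z)
          (hZ.continuous_fderiv (by simp)) x.2) v.2)
        + v.1.1 • pathIntegral (superpose Z hZ.continuous x.2))) := by
  have h1 : HasFDerivAt (fun x : (ℂ × (Fin m → ℂ)) × C(Icc (0 : ℝ) 1, Fin n → ℂ) =>
      pathIntegral (superpose Z hZ.continuous x.2)) _ x :=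
    pathIntegral.hasFDerivAt.comp x ((hasFDerivAt_superpose Z (hZ.of_le (by simp)) x.2).comp x
      hasFDerivAt_snd)
  have h2 : HasFDerivAt (fun x : (ℂ × (Fin m → ℂ)) × C(Icc (0 : ℝ) 1, Fin n → ℂ) =>
      constPath (w₀ + l x.1.2)) _ x :=
    constPath.hasFDerivAt.comp x (((l.restrictScalars ℝ).hasFDerivAt.comp x
      (hasFDerivAt_snd.comp x hasFDerivAt_fst)).const_add w₀)
  have h3 : HasFDerivAt (fun x : (ℂ × (Fin m → ℂ)) × C(Icc (0 : ℝ) 1, Fin n → ℂ) => x.1.1)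
      ((ContinuousLinearMap.fst ℝ ℂ (Fin m → ℂ)).comp (ContinuousLinearMap.fst ℝ _ _)) x :=
    ((ContinuousLinearMap.fst ℝ ℂ (Fin m → ℂ)).comp (ContinuousLinearMap.fst ℝ (ℂ × (Fin m → ℂ))
      C(Icc (0 : ℝ) 1, Fin n → ℂ))).hasFDerivAt
  have h : HasFDerivAt (flowMap Z hZ w₀ l) _ x :=
    hasFDerivAt_fst.prodMk ((hasFDerivAt_snd.sub h2).sub (h3.smul h1))
  rw [h.fderiv]
  rfl

/-- The differential is complex linear only at paths which stay where Z is holomorphic; elsewhere Z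
is merely a smooth field. -/
theorem fderiv_flowMap_I_smul {x : (ℂ × (Fin m → ℂ)) × C(Icc (0 : ℝ) 1, Fin n → ℂ)}
    (hx : ∀ t v, fderiv ℝ Z (x.2 t) (Complex.I • v) = Complex.I • fderiv ℝ Z (x.2 t) v)
    (v : (ℂ × (Fin m → ℂ)) × C(Icc (0 : ℝ) 1, Fin n → ℂ)) :
    fderiv ℝ (flowMap Z hZ w₀ l) x (Complex.I • v)
      = Complex.I • fderiv ℝ (flowMap Z hZ w₀ l) x v := by
  rw [fderiv_flowMap, fderiv_flowMap]
  have h1 : pointwiseApply (superpose (fderiv ℝ Z) (hZ.continuous_fderiv (by simp)) x.2)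
      (Complex.I • v.2) = Complex.I • pointwiseApply (superpose (fderiv ℝ Z)
        (hZ.continuous_fderiv (by simp)) x.2) v.2 := by
    ext1 t
    exact hx t (v.2 t)
  have h2 : constPath (Complex.I • l v.1.2) = Complex.I • constPath (l v.1.2) := rfl
  simp only [Prod.smul_fst, Prod.smul_snd, map_smul, h1, pathIntegral_I_smul, h2, Prod.smul_mk,
    smul_sub, smul_add, smul_smul, mul_comm, smul_eq_mul]

/-- The derivative of `flowMap` at the constant path is invertible. -/
theorem fderiv_flowMap_zero : ∃ A : ((ℂ × (Fin m → ℂ)) × C(Icc (0 : ℝ) 1, Fin n → ℂ)) ≃L[ℝ]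
    ((ℂ × (Fin m → ℂ)) × C(Icc (0 : ℝ) 1, Fin n → ℂ)),
    (A : _ →L[ℝ] _) = fderiv ℝ (flowMap Z hZ w₀ l) (0, constPath w₀) := by
  set k := pathIntegral (superpose Z hZ.continuous (constPath w₀)) with hk
  let B : (ℂ × (Fin m → ℂ)) →L[ℝ] C(Icc (0 : ℝ) 1, Fin n → ℂ) :=
    (constPath.comp (l.restrictScalars ℝ)).comp (ContinuousLinearMap.snd ℝ ℂ (Fin m → ℂ)) +
      ((ContinuousLinearMap.fst ℝ ℂ (Fin m → ℂ)).smulRight k)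
  have hB : ∀ v, B v = constPath (l v.2) + v.1 • k := fun v => rfl
  -- At ζ = 0 the term containing the derivative of Z is multiplied by zero, and the differential is
  -- a shear, inverted by changing the sign of B.
  have hD : ∀ v, fderiv ℝ (flowMap Z hZ w₀ l) (0, constPath w₀) v = (v.1, v.2 - B v.1) := fun v => by
    rw [fderiv_flowMap, hB]
    have h0 : ∀ g : C(Icc (0 : ℝ) 1, Fin n → ℂ), (0 : ℂ) • g = 0 := fun g => by
      ext1 t; exact zero_smul ℂ (g t)
    simp only [← hk, Prod.fst_zero, sub_sub]
    rw [h0, zero_add]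
  refine ⟨ContinuousLinearEquiv.equivOfInverse (fderiv ℝ (flowMap Z hZ w₀ l) (0, constPath w₀))
    ((ContinuousLinearMap.fst ℝ _ _).prod (ContinuousLinearMap.snd ℝ _ _ +
      B.comp (ContinuousLinearMap.fst ℝ _ _))) (fun v => ?_) (fun v => ?_), ?_⟩
  · rw [hD]; simp
  · rw [hD]; simp
  · exact ContinuousLinearMap.ext fun v => rfl

/-- The flow `H (ζ, y)` in complex time `ζ` of a vector field which is holomorphic near `w₀`,
started at `w₀ + l y`. -/
theorem exists_complex_flow {Z : (Fin n → ℂ) → (Fin n → ℂ)} (hZ : ContDiff ℝ ∞ Z) (w₀ : Fin n → ℂ)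
    (l : (Fin m → ℂ) →L[ℂ] (Fin n → ℂ)) {ρ : ℝ} (hρ : 0 < ρ)
    (hol : ∀ w ∈ Metric.ball w₀ ρ, ∀ v, fderiv ℝ Z w (Complex.I • v) = Complex.I • fderiv ℝ Z w v) :
    ∃ (H : ℂ × (Fin m → ℂ) → (Fin n → ℂ)) (V : Set (ℂ × (Fin m → ℂ))), IsOpen V ∧ 0 ∈ V ∧
      ContDiffOn ℝ ∞ H V ∧ (∀ y, (0, y) ∈ V → H (0, y) = w₀ + l y) ∧
      ∀ p ∈ V, H p ∈ Metric.ball w₀ ρ ∧ fderiv ℝ H p (1, 0) = Z (H p) ∧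
        ∀ v, fderiv ℝ H p (Complex.I • v) = Complex.I • fderiv ℝ H p v := by
  set T := flowMap Z hZ w₀ l with hT
  have hTc : ContDiff ℝ ∞ T := contDiff_flowMap Z hZ w₀ l
  obtain ⟨A, hA⟩ := fderiv_flowMap_zero Z hZ w₀ l
  set x₀ : (ℂ × (Fin m → ℂ)) × C(Icc (0 : ℝ) 1, Fin n → ℂ) := (0, constPath w₀) with hx₀
  have hTd : ∀ x, HasFDerivAt T (fderiv ℝ T x) x := fun x =>
    (hTc.differentiable (by simp) x).hasFDerivAt
  let e := (hTc.contDiffAt (x := x₀)).toOpenPartialHomeomorph T (by rw [hA]; exact hTd x₀)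
    (by simp)
  have he : ∀ x, e x = T x := fun x => rfl
  have hx₀s : x₀ ∈ e.source := ContDiffAt.mem_toOpenPartialHomeomorph_source _ _ _
  have hTx₀ : T x₀ = (0, 0) := by
    simp only [hT, flowMap, hx₀, Prod.fst_zero, Prod.snd_zero, map_zero, add_zero, sub_self]
    have h0 : ∀ g : C(Icc (0 : ℝ) 1, Fin n → ℂ), (0 : ℂ) • g = 0 := fun g => by
      ext1 t; exact zero_smul ℂ (g t)
    rw [h0, sub_zero]
  -- Three open conditions: the differential of T is invertible, the path stays in the ball of
  -- holomorphy, and the local inverse of T applies.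
  let 𝒰 : Set ((ℂ × (Fin m → ℂ)) × C(Icc (0 : ℝ) 1, Fin n → ℂ)) :=
    {x | fderiv ℝ T x ∈ range (fun A : ((ℂ × (Fin m → ℂ)) × C(Icc (0 : ℝ) 1, Fin n → ℂ)) ≃L[ℝ]
      ((ℂ × (Fin m → ℂ)) × C(Icc (0 : ℝ) 1, Fin n → ℂ)) => (A : _ →L[ℝ] _))} ∩
      {x | x.2 ∈ Metric.ball (constPath w₀) ρ} ∩ e.source
  have h𝒰 : IsOpen 𝒰 := ((ContinuousLinearEquiv.isOpen.preimage
    (hTc.continuous_fderiv (by simp))).inter (Metric.isOpen_ball.preimage continuous_snd)).inter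
      e.open_source
  have hx₀𝒰 : x₀ ∈ 𝒰 := ⟨⟨⟨A, hA⟩, Metric.mem_ball_self hρ⟩, hx₀s⟩
  obtain ⟨ε, hε, hball⟩ := Metric.isOpen_iff.1 h𝒰 x₀ hx₀𝒰
  -- The solution path with parameters p, from the inverse function theorem in the Banach space of
  -- continuous paths; it depends smoothly on p.
  let Γ : ℂ × (Fin m → ℂ) → C(Icc (0 : ℝ) 1, Fin n → ℂ) := fun p => (e.symm (p, 0)).2
  let j : ℂ × (Fin m → ℂ) → (ℂ × (Fin m → ℂ)) × C(Icc (0 : ℝ) 1, Fin n → ℂ) := fun p => (p, 0)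
  have hj : Continuous j := by fun_prop
  have hj0 : j 0 = e x₀ := by rw [he, hTx₀]
  let W : Set (ℂ × (Fin m → ℂ)) := j ⁻¹' (e.target ∩ e.symm ⁻¹' (Metric.ball x₀ ε))
  have hW : IsOpen W := (e.symm.isOpen_inter_preimage Metric.isOpen_ball).preimage hj
  have h0W : (0 : ℂ × (Fin m → ℂ)) ∈ W := by
    refine ⟨?_, ?_⟩
    · rw [hj0]; exact e.map_source hx₀s
    · rw [mem_preimage, hj0, e.left_inv hx₀s]; exact Metric.mem_ball_self hε
  have hfst : ∀ p ∈ W, e.symm (j p) = (p, Γ p) := fun p hp => by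
    have h1 : T (e.symm (j p)) = j p := e.right_inv hp.1
    have h2 : (e.symm (j p)).1 = p := congrArg Prod.fst h1
    exact Prod.ext h2 rfl
  have hsol : ∀ p ∈ W, Γ p = constPath (w₀ + l p.2)
      + p.1 • pathIntegral (superpose Z hZ.continuous (Γ p)) := fun p hp => by
    have h1 : T (e.symm (j p)) = j p := e.right_inv hp.1
    rw [hfst p hp] at h1
    have h2 := congrArg Prod.snd h1
    simp only [hT, flowMap, j] at h2
    rw [sub_sub, sub_eq_zero] at h2
    exact h2
  have huniq : ∀ p γ, (p, γ) ∈ Metric.ball x₀ ε → γ = constPath (w₀ + l p.2)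
      + p.1 • pathIntegral (superpose Z hZ.continuous γ) → γ = Γ p := fun p γ hpγ h => by
    have h1 : T (p, γ) = j p := by
      simp only [hT, flowMap, j]
      refine Prod.ext rfl ?_
      rw [sub_sub, sub_eq_zero]
      exact h
    have h2 : e.symm (e (p, γ)) = (p, γ) := e.left_inv (hball hpγ).2
    rw [he, h1] at h2
    exact (congrArg Prod.snd h2).symm
  have hΓd : ∀ p ∈ W, ContDiffAt ℝ ∞ Γ p := fun p hp => by
    have h1 : e.symm (j p) ∈ 𝒰 := hball hp.2
    obtain ⟨A', hA'⟩ := h1.1.1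
    have h2 : HasFDerivAt e (A' : _ →L[ℝ] _) (e.symm (j p)) := by
      rw [show (A' : ((ℂ × (Fin m → ℂ)) × C(Icc (0 : ℝ) 1, Fin n → ℂ)) →L[ℝ]
        ((ℂ × (Fin m → ℂ)) × C(Icc (0 : ℝ) 1, Fin n → ℂ))) = fderiv ℝ T (e.symm (j p)) from hA']
      exact hTd _
    have h3 : ContDiffAt ℝ ∞ e.symm (j p) := e.contDiffAt_symm hp.1 h2 hTc.contDiffAt
    exact contDiffAt_snd.comp p (h3.comp p (by fun_prop))
  -- Differentiating T (p, Γ p) = (p, 0) characterizes the derivative of Γ by a linear equation with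
  -- invertible complex linear operator; both sides solve the same instance of it.
  have hΓI : ∀ p ∈ W, ∀ v, fderiv ℝ Γ p (Complex.I • v) = Complex.I • fderiv ℝ Γ p v := by
    intro p hp v
    have h1 : (p, Γ p) ∈ 𝒰 := by rw [← hfst p hp]; exact hball hp.2
    obtain ⟨A', hA'⟩ := h1.1.1
    have h2 : HasFDerivAt (fun p => (p, Γ p)) ((ContinuousLinearMap.id ℝ _).prod (fderiv ℝ Γ p)) p :=
      (hasFDerivAt_id p).prodMk ((hΓd p hp).differentiableAt (by simp)).hasFDerivAt
    have h3 : HasFDerivAt j (ContinuousLinearMap.inl ℝ _ _) p :=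
      (ContinuousLinearMap.inl ℝ (ℂ × (Fin m → ℂ)) C(Icc (0 : ℝ) 1, Fin n → ℂ)).hasFDerivAt
    have h4 : (fun p => T (p, Γ p)) =ᶠ[𝓝 p] j := by
      filter_upwards [hW.mem_nhds hp] with q hq
      rw [← hfst q hq]; exact e.right_inv hq.1
    have h5 : HasFDerivAt (T ∘ fun p => (p, Γ p)) _ p :=
      HasFDerivAt.comp (g := T) p (hTd (p, Γ p)) h2
    have h6 := h5.unique (h3.congr_of_eventuallyEq h4)
    have h7 : ∀ u, fderiv ℝ T (p, Γ p) (u, fderiv ℝ Γ p u) = (u, 0) := fun u =>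
      congrArg (fun L => L u) h6
    have h8 := fderiv_flowMap_I_smul Z hZ w₀ l (x := (p, Γ p)) (fun t u => hol _ (by
      have h9 : Γ p ∈ Metric.ball (constPath w₀) ρ := h1.1.2
      rw [Metric.mem_ball] at h9 ⊢
      exact lt_of_le_of_lt (ContinuousMap.dist_apply_le_dist (f := Γ p) (g := constPath w₀) t) h9) u) (v, fderiv ℝ Γ p v)
    rw [← hT, h7] at h8
    have h9 : fderiv ℝ T (p, Γ p) (Complex.I • v, fderiv ℝ Γ p (Complex.I • v))
        = fderiv ℝ T (p, Γ p) (Complex.I • (v, fderiv ℝ Γ p v)) := by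
      rw [h7, h8, Prod.smul_mk]
      exact Prod.ext rfl (by ext1 t; exact (smul_zero Complex.I).symm)
    rw [show fderiv ℝ T (p, Γ p) = (A' : _ →L[ℝ] _) from hA'.symm] at h9
    exact congrArg Prod.snd (A'.injective h9)
  obtain ⟨δ, hδ, hδW⟩ := Metric.isOpen_iff.1 hW 0 h0W
  let ev : C(Icc (0 : ℝ) 1, Fin n → ℂ) →L[ℝ] (Fin n → ℂ) :=
    ContinuousMap.evalCLM ℝ (1 : Icc (0 : ℝ) 1)
  let H : ℂ × (Fin m → ℂ) → (Fin n → ℂ) := fun p => Γ p 1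
  have hHΓ : H = ev ∘ Γ := rfl
  have hHd : ∀ p ∈ W, HasFDerivAt H (ev.comp (fderiv ℝ Γ p)) p := fun p hp =>
    ev.hasFDerivAt.comp p ((hΓd p hp).differentiableAt (by simp)).hasFDerivAt
  have hHc : ∀ p ∈ W, ContDiffAt ℝ ∞ H p := fun p hp => ev.contDiff.contDiffAt.comp p (hΓd p hp)
  have hHI : ∀ p ∈ W, ∀ v, fderiv ℝ H p (Complex.I • v) = Complex.I • fderiv ℝ H p v := by
    intro p hp v
    rw [(hHd p hp).fderiv, ContinuousLinearMap.comp_apply, hΓI p hp]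
    rfl
  -- rescaling of time
  have hscale : ∀ p ∈ Metric.ball (0 : ℂ × (Fin m → ℂ)) δ, ∀ σ : Icc (0 : ℝ) 1,
      Γ p σ = H ((σ : ℝ) • p.1, p.2) := by
    intro p hp σ
    have hpW := hδW hp
    let γ : C(Icc (0 : ℝ) 1, Fin n → ℂ) := ⟨fun τ => Γ p (σ * τ), by fun_prop⟩
    -- The slowed path solves the equation with parameter σ ζ and stays in the neighbourhood where
    -- solutions are unique.
    have hγ : γ = Γ ((σ : ℝ) • p.1, p.2) := by
      apply huniq
      · have h1 : (p, Γ p) ∈ Metric.ball x₀ ε := by rw [← hfst p hpW]; exact hpW.2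
        rw [mem_ball_iff_norm, hx₀, Prod.mk_sub_mk, Prod.norm_mk] at h1 ⊢
        rw [max_lt_iff] at h1 ⊢
        refine ⟨lt_of_le_of_lt ?_ h1.1, lt_of_le_of_lt ?_ h1.2⟩
        · rw [sub_zero, sub_zero, Prod.norm_def, Prod.norm_def]
          refine max_le_max ?_ le_rfl
          rw [norm_smul, Real.norm_eq_abs, abs_of_nonneg σ.2.1]
          exact mul_le_of_le_one_left (norm_nonneg _) σ.2.2
        · refine (ContinuousMap.norm_le _ (norm_nonneg _)).2 fun τ => ?_
          exact (Γ p - constPath w₀).norm_coe_le_norm (σ * τ)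
      · ext1 τ
        have h1 := congrArg (fun γ : C(Icc (0 : ℝ) 1, Fin n → ℂ) => γ (σ * τ)) (hsol p hpW)
        have h2 := pathIntegral_scale (superpose Z hZ.continuous (Γ p)) σ τ
          (superpose Z hZ.continuous γ) (fun τ => rfl)
        simp only [ContinuousMap.add_apply, ContinuousMap.smul_apply, constPath_apply] at h1 ⊢
        rw [h2] at h1
        refine h1.trans ?_
        rw [smul_assoc, smul_comm]
    have := congrArg (fun γ : C(Icc (0 : ℝ) 1, Fin n → ℂ) => γ 1) hγ
    simpa [γ, H] using this
  have hflow : ∀ p ∈ Metric.ball (0 : ℂ × (Fin m → ℂ)) (δ / 2), p.1 ≠ 0 →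
      fderiv ℝ H p (1, 0) = Z (H p) := by
    intro p hp hp1
    rw [mem_ball_zero_iff] at hp
    have hpW : p ∈ W := hδW (by rw [mem_ball_zero_iff]; linarith)
    -- With doubled parameter the point is reached at the interior time 1/2, where the solution path
    -- has a two-sided derivative. This is why the final ball has radius δ / 2.
    set q : ℂ × (Fin m → ℂ) := ((2 : ℝ) • p.1, p.2) with hq
    have hqδ : q ∈ Metric.ball (0 : ℂ × (Fin m → ℂ)) δ := by
      rw [mem_ball_zero_iff, hq, Prod.norm_mk, max_lt_iff, norm_smul, Real.norm_ofNat]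
      have h1 := norm_fst_le p
      have h2 := norm_snd_le p
      constructor <;> linarith
    have hqW := hδW hqδ
    have hmem : ∀ᶠ σ in 𝓝 (1 / 2 : ℝ), σ ∈ Icc (0 : ℝ) 1 := Icc_mem_nhds (by norm_num) (by norm_num)
    have hhalf : ((1 / 2 : ℝ) • q.1, q.2) = p := by
      rw [hq]
      simp only [smul_smul]
      norm_num
    -- the path solves the equation
    have hcont : Continuous (IccExtend zero_le_one (superpose Z hZ.continuous (Γ q))) :=
      (superpose Z hZ.continuous (Γ q)).continuous.Icc_extend'
    have h1 : HasDerivAt (fun σ : ℝ => (w₀ + l q.2) + q.1 • ∫ s in (0 : ℝ)..σ,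
        IccExtend zero_le_one (superpose Z hZ.continuous (Γ q)) s) (q.1 • Z (H p)) (1 / 2) := by
      have h2 := intervalIntegral.integral_hasDerivAt_right (hcont.intervalIntegrable 0 (1 / 2))
        (hcont.stronglyMeasurableAtFilter _ _) hcont.continuousAt
      rw [IccExtend_of_mem _ _ (by norm_num : (1 / 2 : ℝ) ∈ Icc (0 : ℝ) 1)] at h2
      have h3 : superpose Z hZ.continuous (Γ q) ⟨1 / 2, by norm_num⟩ = Z (H p) := by
        have := hscale q hqδ ⟨1 / 2, by norm_num⟩
        rw [hhalf] at this
        rw [← this]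
        rfl
      rw [h3] at h2
      exact (h2.const_smul q.1).const_add _
    have h4 : (fun σ : ℝ => H (σ • q.1, q.2)) =ᶠ[𝓝 (1 / 2)] fun σ : ℝ => (w₀ + l q.2) +
        q.1 • ∫ s in (0 : ℝ)..σ, IccExtend zero_le_one (superpose Z hZ.continuous (Γ q)) s := by
      filter_upwards [hmem] with σ hσ
      rw [← hscale q hqδ ⟨σ, hσ⟩]
      exact congrArg (fun γ : C(Icc (0 : ℝ) 1, Fin n → ℂ) => γ ⟨σ, hσ⟩) (hsol q hqW)
    have h5 : HasDerivAt (fun σ : ℝ => H (σ • q.1, q.2)) (fderiv ℝ H p (q.1, 0)) (1 / 2) := by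
      have h6 : HasFDerivAt H (fderiv ℝ H p) ((1 / 2 : ℝ) • q.1, q.2) := by
        rw [hhalf]; exact (hHd p hpW).differentiableAt.hasFDerivAt
      have h7 : HasDerivAt (fun σ : ℝ => (σ • q.1, q.2)) (q.1, (0 : Fin m → ℂ)) (1 / 2) := by
        have h8 : HasDerivAt (fun σ : ℝ => σ • q.1) ((1 : ℝ) • q.1) (1 / 2) :=
          (hasDerivAt_id (1 / 2 : ℝ)).smul_const q.1
        rw [one_smul] at h8
        exact h8.prodMk (hasDerivAt_const _ _)
      exact h6.comp_hasDerivAt _ h7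
    have h9 := h5.unique (h1.congr_of_eventuallyEq h4)
    have hlin : ∀ c : ℂ, fderiv ℝ H p (c, 0) = c • fderiv ℝ H p (1, 0) := fun c => by
      have e1 : ((c, 0) : ℂ × (Fin m → ℂ)) = c.re • ((1, 0) : ℂ × (Fin m → ℂ))
          + c.im • (Complex.I • ((1, 0) : ℂ × (Fin m → ℂ))) := by
        ext <;> simp [Complex.re_add_im]
      rw [e1, map_add, map_smul, map_smul, hHI p hpW]
      conv_rhs => rw [← Complex.re_add_im c, add_smul, mul_smul]
      rfl
    rw [hlin] at h9
    have hq1 : q.1 ≠ 0 := by rw [hq]; simpa using hp1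
    exact smul_right_injective _ hq1 h9
  have hsub : Metric.ball (0 : ℂ × (Fin m → ℂ)) (δ / 2) ⊆ W := fun p hp =>
    hδW (Metric.ball_subset_ball (by linarith) hp)
  refine ⟨H, Metric.ball 0 (δ / 2), Metric.isOpen_ball, Metric.mem_ball_self (by positivity),
    fun p hp => (hHc p (hsub hp)).contDiffWithinAt, fun y hy => ?_, fun p hp => ⟨?_, ?_,
      hHI p (hsub hp)⟩⟩
  · have h1 := congrArg (fun γ : C(Icc (0 : ℝ) 1, Fin n → ℂ) => γ 1) (hsol _ (hsub hy))
    refine h1.trans ?_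
    simp only [ContinuousMap.add_apply, ContinuousMap.smul_apply, constPath_apply, zero_smul,
      add_zero]
  · have h1 : e.symm (j p) ∈ 𝒰 := hball (hsub hp).2
    have h2 := h1.1.2
    rw [hfst p (hsub hp), mem_ofPred_eq, Metric.mem_ball] at h2
    exact lt_of_le_of_lt (ContinuousMap.dist_apply_le_dist (f := Γ p) (g := constPath w₀) 1) h2
  · by_cases hp1 : p.1 = 0
    -- The factor ζ cannot be cancelled at ζ = 0; there the flow equation follows by continuity
    -- along the ζ-slice.
    · let c : ℂ → ℂ × (Fin m → ℂ) := fun ζ => (ζ, p.2)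
      have hc0 : c 0 = p := Prod.ext hp1.symm rfl
      have hcc : Continuous c := by fun_prop
      have hH1 : ContinuousAt (fun ζ => fderiv ℝ H (c ζ) (1, 0)) 0 := by
        have h1 : ContinuousAt (fderiv ℝ H) (c 0) := by
          rw [hc0]
          exact (((hHc p (hsub hp)).fderiv_right (m := 0) (by simp))).continuousAt
        exact (h1.comp hcc.continuousAt).clm_apply continuousAt_const
      have hH2 : ContinuousAt (fun ζ => Z (H (c ζ))) 0 := by
        have h1 : ContinuousAt H (c 0) := by rw [hc0]; exact (hHc p (hsub hp)).continuousAt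
        exact hZ.continuous.continuousAt.comp (h1.comp hcc.continuousAt)
      have h3 : (fun ζ => fderiv ℝ H (c ζ) (1, 0)) =ᶠ[𝓝[≠] 0] fun ζ => Z (H (c ζ)) := by
        have h4 : ∀ᶠ ζ in 𝓝[≠] (0 : ℂ), c ζ ∈ Metric.ball (0 : ℂ × (Fin m → ℂ)) (δ / 2) :=
          mem_nhdsWithin_of_mem_nhds (hcc.continuousAt.preimage_mem_nhds
            (Metric.isOpen_ball.mem_nhds (by rw [hc0]; exact hp)))
        filter_upwards [h4, self_mem_nhdsWithin] with ζ h5 h6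
        exact hflow _ h5 h6
      have h7 := tendsto_nhds_unique ((hH1.tendsto.mono_left nhdsWithin_le_nhds).congr' h3)
        (hH2.tendsto.mono_left (nhdsWithin_le_nhds (s := {0}ᶜ)))
      rwa [hc0] at h7
    · exact hflow p hp hp1

end FlowBox

end Sasaki

end

/-! ### Straightening a holomorphic vector field -/

noncomputable section

namespace Sasaki

/-- A smooth vector field can be extended from a neighbourhood of a point. -/
theorem exists_contDiff_eventuallyEq {E F : Type*} [NormedAddCommGroup E] [NormedSpace ℝ E]
    [FiniteDimensional ℝ E] [NormedAddCommGroup F] [NormedSpace ℝ F] {Z : E → F} {N : Set E}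
    (hN : IsOpen N) {w₀ : E} (hw₀ : w₀ ∈ N) (hZ : ContDiffOn ℝ ∞ Z N) :
    ∃ Z' : E → F, ContDiff ℝ ∞ Z' ∧ Z' =ᶠ[𝓝 w₀] Z := by
  obtain ⟨r, hr, hrN⟩ := Metric.isOpen_iff.1 hN w₀ hw₀
  let f : ContDiffBump w₀ := ⟨r / 4, r / 2, by positivity, by linarith⟩
  refine ⟨fun w => f w • Z w, contDiff_iff_contDiffAt.2 fun w => ?_, ?_⟩
  · by_cases hw : w ∈ N
    · exact f.contDiff.contDiffAt.smul (hZ.contDiffAt (hN.mem_nhds hw))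
    · have h1 : w ∈ (Metric.closedBall w₀ (r / 2))ᶜ := fun h => hw (hrN
        (Metric.closedBall_subset_ball (by linarith) h))
      refine (contDiffAt_const (c := (0 : F))).congr_of_eventuallyEq ?_
      filter_upwards [Metric.isClosed_closedBall.isOpen_compl.mem_nhds h1] with x hx
      rw [f.zero_of_le_dist, zero_smul]
      rw [mem_compl_iff, Metric.mem_closedBall, not_le] at hx
      exact hx.le
  · filter_upwards [f.eventuallyEq_one] with w hw
    rw [hw]
    simp

/-- A holomorphic vector field is a coordinate field in suitable holomorphic coordinates. -/
theorem exists_holomorphic_flow_box {m : ℕ} {Z : (Fin (m + 1) → ℂ) → (Fin (m + 1) → ℂ)}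
    {N : Set (Fin (m + 1) → ℂ)} (hN : IsOpen N) {w₀ : Fin (m + 1) → ℂ} (hw₀ : w₀ ∈ N)
    (hZ : ContDiffOn ℝ ∞ Z N) (hZ₀ : Z w₀ ≠ 0)
    (hol : ∀ w ∈ N, ∀ v, fderiv ℝ Z w (Complex.I • v) = Complex.I • fderiv ℝ Z w v) :
    ∃ (U : Set (Fin (m + 1) → ℂ)) (G : (Fin (m + 1) → ℂ) → ℂ × (Fin m → ℂ)), IsOpen U ∧ w₀ ∈ U ∧
      ContDiffOn ℝ ∞ G U ∧ ∀ w ∈ U, fderiv ℝ G w (Z w) = (1, 0) ∧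
        Function.Injective (fderiv ℝ G w) ∧
        ∀ v, fderiv ℝ G w (Complex.I • v) = Complex.I • fderiv ℝ G w v := by
  -- Superposition operators need a field defined on the whole space; the extension is holomorphic
  -- only in a ball where it agrees with Z.
  obtain ⟨Z', hZ', hZZ'⟩ := exists_contDiff_eventuallyEq hN hw₀ hZ
  obtain ⟨ρ, hρ, hball⟩ := Metric.eventually_nhds_iff_ball.1
    (hZZ'.eventually_nhds.and (hN.mem_nhds hw₀))
  have hol' : ∀ w ∈ Metric.ball w₀ ρ, ∀ v,
      fderiv ℝ Z' w (Complex.I • v) = Complex.I • fderiv ℝ Z' w v := fun w hw v => by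
    rw [Filter.EventuallyEq.fderiv_eq (hball w hw).1]
    exact hol w (hball w hw).2 v
  have hZZ : ∀ w ∈ Metric.ball w₀ ρ, Z' w = Z w := fun w hw => (hball w hw).1.self_of_nhds
  -- a complement of the vector field at the base point
  obtain ⟨C, hC⟩ := (Submodule.span ℂ {Z w₀}).exists_isCompl
  have hfin : Module.finrank ℂ C = m := by
    have h1 := Submodule.finrank_add_eq_of_isCompl hC
    rw [finrank_span_singleton hZ₀] at h1
    simp at h1
    omega
  let lC : (Fin m → ℂ) ≃ₗ[ℂ] C := LinearEquiv.ofFinrankEq _ _ (by rw [hfin]; simp)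
  let l : (Fin m → ℂ) →L[ℂ] (Fin (m + 1) → ℂ) :=
    LinearMap.toContinuousLinearMap (C.subtype ∘ₗ lC.toLinearMap)
  have hl : ∀ y, l y = (lC y : Fin (m + 1) → ℂ) := fun y => rfl
  obtain ⟨H, V, hV, h0V, hH, hHl, hHV⟩ := exists_complex_flow hZ' w₀ l hρ hol'
  have hHd : ∀ p ∈ V, HasFDerivAt H (fderiv ℝ H p) p := fun p hp =>
    ((hH.contDiffAt (hV.mem_nhds hp)).differentiableAt (by simp)).hasFDerivAt
  have hH0 : H 0 = w₀ := by 
    have := hHl 0 h0V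
    rw [map_zero, add_zero] at this
    exact this
  have hlin : ∀ p ∈ V, ∀ c : ℂ, fderiv ℝ H p (c, 0) = c • Z' (H p) := fun p hp c => by
    have e1 : ((c, 0) : ℂ × (Fin m → ℂ)) = c.re • ((1, 0) : ℂ × (Fin m → ℂ))
        + c.im • (Complex.I • ((1, 0) : ℂ × (Fin m → ℂ))) := by
      ext <;> simp [Complex.re_add_im]
    rw [e1, map_add, map_smul, map_smul, (hHV p hp).2.2, (hHV p hp).2.1]
    conv_rhs => rw [← Complex.re_add_im c, add_smul, mul_smul]
    rfl
  have hDy : ∀ y, fderiv ℝ H 0 (0, y) = l y := by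
    intro y
    have h1 : HasDerivAt (fun t : ℝ => H (0, t • y)) (fderiv ℝ H 0 (0, y)) 0 := by
      have h2 : HasDerivAt (fun t : ℝ => ((0 : ℂ), t • y)) ((0 : ℂ), y) 0 := by
        have h3 : HasDerivAt (fun t : ℝ => t • y) ((1 : ℝ) • y) 0 :=
          (hasDerivAt_id (0 : ℝ)).smul_const y
        rw [one_smul] at h3
        exact (hasDerivAt_const _ _).prodMk h3
      have h4 : HasFDerivAt H (fderiv ℝ H 0) ((0 : ℂ), (0 : ℝ) • y) := by
        rw [zero_smul]; exact hHd 0 h0V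
      exact h4.comp_hasDerivAt _ h2
    have h5 : HasDerivAt (fun t : ℝ => w₀ + t • l y) (l y) 0 := by
      have h3 : HasDerivAt (fun t : ℝ => t • l y) ((1 : ℝ) • l y) 0 :=
        (hasDerivAt_id (0 : ℝ)).smul_const (l y)
      rw [one_smul] at h3
      exact h3.const_add _
    have h6 : (fun t : ℝ => H (0, t • y)) =ᶠ[𝓝 0] fun t : ℝ => w₀ + t • l y := by
      have hc : ContinuousAt (fun t : ℝ => ((0 : ℂ), t • y)) 0 := by fun_prop
      have h7 : ∀ᶠ t : ℝ in 𝓝 0, ((0 : ℂ), t • y) ∈ V :=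
        hc.preimage_mem_nhds (hV.mem_nhds (by rw [zero_smul]; exact h0V))
      filter_upwards [h7] with t ht
      rw [hHl _ ht]
      congr 1
      exact (l.restrictScalars ℝ).map_smul t y
    exact h1.unique (h5.congr_of_eventuallyEq h6)
  -- The derivative at 0 is (c, y) ↦ c Z(w₀) + l y, and the two summands lie in complementary
  -- subspaces.
  have hinj : Function.Injective (fderiv ℝ H 0) := by
    rw [injective_iff_map_eq_zero]
    rintro ⟨c, y⟩ hcy
    have h1 : ((c, y) : ℂ × (Fin m → ℂ)) = (c, 0) + (0, y) := by simp
    rw [h1, map_add, hlin 0 h0V, hDy, hH0, hZZ w₀ (Metric.mem_ball_self hρ), hl] at hcy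
    have h2 : c • Z w₀ = -(lC y : Fin (m + 1) → ℂ) := eq_neg_of_add_eq_zero_left hcy
    have h3 : c • Z w₀ = 0 := by
      have h4 : c • Z w₀ ∈ Submodule.span ℂ {Z w₀} :=
        Submodule.smul_mem _ _ (Submodule.mem_span_singleton_self _)
      have h5 : c • Z w₀ ∈ C := by rw [h2]; exact C.neg_mem (lC y).2
      exact (Submodule.disjoint_def.1 hC.disjoint) _ h4 h5
    have h4 : c = 0 := (smul_eq_zero.1 h3).resolve_right hZ₀
    have h5 : lC y = 0 := by
      apply Subtype.ext
      rw [h3] at h2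
      simpa using h2.symm
    have h6 : y = 0 := by simpa using h5
    rw [h4, h6]; rfl
  have hfr : Module.finrank ℝ (ℂ × (Fin m → ℂ)) = Module.finrank ℝ (Fin (m + 1) → ℂ) := by
    rw [Module.finrank_prod, Module.finrank_pi_fintype, Module.finrank_pi_fintype]
    simp [Complex.finrank_real_complex]
    ring
  let A₀ : (ℂ × (Fin m → ℂ)) ≃L[ℝ] (Fin (m + 1) → ℂ) :=
    (LinearEquiv.ofInjectiveOfFinrankEq (fderiv ℝ H 0 : _ →ₗ[ℝ] _) hinj
      hfr).toContinuousLinearEquiv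
  have hA₀ : (A₀ : _ →L[ℝ] _) = fderiv ℝ H 0 := by ext1 <;> rfl
  let e := (hH.contDiffAt (hV.mem_nhds h0V)).toOpenPartialHomeomorph H
    (by rw [hA₀]; exact hHd 0 h0V) (by simp)
  have he : ∀ p, e p = H p := fun p => rfl
  have h0s : (0 : ℂ × (Fin m → ℂ)) ∈ e.source :=
    ContDiffAt.mem_toOpenPartialHomeomorph_source _ _ _
  let R : Set ((ℂ × (Fin m → ℂ)) →L[ℝ] (Fin (m + 1) → ℂ)) :=
    range fun A : (ℂ × (Fin m → ℂ)) ≃L[ℝ] (Fin (m + 1) → ℂ) => (A : _ →L[ℝ] _)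
  let Q : Set (ℂ × (Fin m → ℂ)) := V ∩ fderiv ℝ H ⁻¹' R
  have hQ : IsOpen Q := by
    have h1 : ContinuousOn (fderiv ℝ H) V := hH.continuousOn_fderiv_of_isOpen hV (by simp)
    exact h1.isOpen_inter_preimage hV ContinuousLinearEquiv.isOpen
  have h0Q : (0 : ℂ × (Fin m → ℂ)) ∈ Q := ⟨h0V, A₀, hA₀⟩
  -- The coordinates are the local inverse of the flow map H. As the differential of H is complex
  -- linear and sends ∂/∂ζ to Z, the inverse is complex linear and sends Z to ∂/∂ζ.
  refine ⟨e.target ∩ e.symm ⁻¹' Q, e.symm, e.symm.isOpen_inter_preimage hQ, ⟨?_, ?_⟩, ?_, ?_⟩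
  · rw [← hH0, ← he]; exact e.map_source h0s
  · rw [mem_preimage, ← hH0, ← he, e.left_inv h0s]; exact h0Q
  · rintro w ⟨hw, hwQ⟩
    obtain ⟨A, hA⟩ := hwQ.2
    have h1 : HasFDerivAt e (A : _ →L[ℝ] _) (e.symm w) := by
      rw [show (A : (ℂ × (Fin m → ℂ)) →L[ℝ] (Fin (m + 1) → ℂ)) = fderiv ℝ H (e.symm w) from hA]
      exact hHd _ hwQ.1
    exact (e.contDiffAt_symm hw h1 (hH.contDiffAt (hV.mem_nhds hwQ.1))).contDiffWithinAt
  · rintro w ⟨hw, hwQ⟩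
    obtain ⟨A, hA⟩ := hwQ.2
    change (A : (ℂ × (Fin m → ℂ)) →L[ℝ] (Fin (m + 1) → ℂ)) = fderiv ℝ H (e.symm w) at hA
    have h1 : HasFDerivAt e (A : _ →L[ℝ] _) (e.symm w) := by
      rw [hA]; exact hHd _ hwQ.1
    have h2 : fderiv ℝ e.symm w = (A.symm : _ →L[ℝ] _) := (e.hasFDerivAt_symm hw h1).fderiv
    have h3 : H (e.symm w) = w := e.right_inv hw
    have h4 := hHV _ hwQ.1
    rw [h3] at h4
    refine ⟨?_, ?_, fun v => ?_⟩
    · rw [h2, ← hZZ w h4.1, ← h4.2.1, ← hA]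
      exact A.symm_apply_apply _
    · rw [h2]; exact A.symm.injective
    · rw [h2]
      apply A.injective
      have h5 := h4.2.2 (A.symm v)
      rw [← hA] at h5
      refine (A.apply_symm_apply _).trans ?_
      refine Eq.trans ?_ h5.symm
      congr 1
      exact (A.apply_symm_apply v).symm

end Sasaki

end

noncomputable section

namespace Sasaki

/-! ### Families of functions depending on a real parameter -/

section Slices

variable {E F : Type*} [NormedAddCommGroup E] [NormedSpace ℝ E] [NormedAddCommGroup F]
  [NormedSpace ℝ F]

theorem hasFDerivAt_slice {f : ℝ × E → F} {t : ℝ} {y : E} {f' : ℝ × E →L[ℝ] F}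
    (hf : HasFDerivAt f f' (t, y)) :
    HasFDerivAt (fun y' => f (t, y')) (f'.comp (ContinuousLinearMap.inr ℝ ℝ E)) y :=
  hf.comp y (hasFDerivAt_prodMk_right t y)

theorem hasDerivAt_slice {f : ℝ × E → F} {t : ℝ} {y : E} {f' : ℝ × E →L[ℝ] F}
    (hf : HasFDerivAt f f' (t, y)) : HasDerivAt (fun s => f (s, y)) (f' (1, 0)) t :=
  hf.comp_hasDerivAt t ((hasDerivAt_id t).prodMk (hasDerivAt_const t y))

/-- Differentiation in the parameter commutes with differentiation in space. -/
theorem hasDerivAt_fderiv_slice {f : ℝ × E → F} {t : ℝ} {y : E} (hf : ContDiffAt ℝ 2 f (t, y)) :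
    HasDerivAt (fun s => fderiv ℝ (fun y' => f (s, y')) y)
      (fderiv ℝ (fun y' => deriv (fun s => f (s, y')) t) y) t := by
  have hd : ∀ᶠ z in 𝓝 (t, y), HasFDerivAt f (fderiv ℝ f z) z := by
    filter_upwards [hf.eventually (by simp)] with z hz
    exact (hz.differentiableAt (by simp)).hasFDerivAt
  have h2 : HasFDerivAt (fderiv ℝ f) (fderiv ℝ (fderiv ℝ f) (t, y)) (t, y) :=
    ((hf.fderiv_right (m := 1) (by norm_num)).differentiableAt (by simp)).hasFDerivAt
  have hsymm : IsSymmSndFDerivAt ℝ f (t, y) := hf.isSymmSndFDerivAt (by simp)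
  have h3 : (fun s => fderiv ℝ (fun y' => f (s, y')) y) =ᶠ[𝓝 t]
      fun s => (fderiv ℝ f (s, y)).comp (ContinuousLinearMap.inr ℝ ℝ E) := by
    have hc : ContinuousAt (fun s : ℝ => (s, y)) t := by fun_prop
    filter_upwards [hc.eventually hd] with s hs
    exact (hasFDerivAt_slice hs).fderiv
  have h4 : (fun y' => deriv (fun s => f (s, y')) t) =ᶠ[𝓝 y] fun y' => fderiv ℝ f (t, y') (1, 0) := by
    have hc : ContinuousAt (fun y' : E => (t, y')) y := by fun_prop
    filter_upwards [hc.eventually hd] with y' hy'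
    exact (hasDerivAt_slice hy').deriv
  have h5 : HasDerivAt (fun s => (fderiv ℝ f (s, y)).comp (ContinuousLinearMap.inr ℝ ℝ E))
      ((fderiv ℝ (fderiv ℝ f) (t, y) (1, 0)).comp (ContinuousLinearMap.inr ℝ ℝ E)) t :=
    (((ContinuousLinearMap.compL ℝ E (ℝ × E) F).flip
      (ContinuousLinearMap.inr ℝ ℝ E)).hasFDerivAt.comp_hasDerivAt t (hasDerivAt_slice h2))
  have h6 : HasFDerivAt (fun y' => fderiv ℝ f (t, y') (1, 0))
      ((ContinuousLinearMap.apply ℝ F ((1 : ℝ), (0 : E))).comp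
        ((fderiv ℝ (fderiv ℝ f) (t, y)).comp (ContinuousLinearMap.inr ℝ ℝ E))) y :=
    (ContinuousLinearMap.apply ℝ F ((1 : ℝ), (0 : E))).hasFDerivAt.comp y (hasFDerivAt_slice h2)
  rw [(h6.congr_of_eventuallyEq h4).fderiv]
  refine (h5.congr_of_eventuallyEq h3).congr_deriv ?_
  ext v
  exact hsymm (1, 0) (0, v)

variable {J : Set ℝ} {U : Set E}

/-- The parameter set may be a closed interval, so the joint derivative is taken within J × U; the
spatial slice is open, so its derivative is unrestricted even at an end point of J. -/
theorem fderiv_slice_eq {f : ℝ × E → F} (hU : IsOpen U) (hf : ContDiffOn ℝ ∞ f (J ×ˢ U))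
    {z : ℝ × E} (hz : z ∈ J ×ˢ U) :
    fderiv ℝ (fun y => f (z.1, y)) z.2
      = (fderivWithin ℝ f (J ×ˢ U) z).comp (ContinuousLinearMap.inr ℝ ℝ E) := by
  have h1 : HasFDerivWithinAt f (fderivWithin ℝ f (J ×ˢ U) z) (J ×ˢ U) (z.1, z.2) :=
    (hf.differentiableOn (by simp) z hz).hasFDerivWithinAt
  have h2 := h1.comp (t := J ×ˢ U) (s := U) z.2
    ((hasFDerivAt_prodMk_right z.1 z.2).hasFDerivWithinAt) (fun y hy => ⟨hz.1, hy⟩)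
  exact (h2.hasFDerivAt (hU.mem_nhds hz.2)).fderiv

theorem derivWithin_slice_eq {f : ℝ × E → F} (hJ : UniqueDiffOn ℝ J)
    (hf : ContDiffOn ℝ ∞ f (J ×ˢ U)) {z : ℝ × E} (hz : z ∈ J ×ˢ U) :
    derivWithin (fun s => f (s, z.2)) J z.1 = fderivWithin ℝ f (J ×ˢ U) z (1, 0) := by
  have h1 : HasFDerivWithinAt f (fderivWithin ℝ f (J ×ˢ U) z) (J ×ˢ U) (z.1, z.2) :=
    (hf.differentiableOn (by simp) z hz).hasFDerivWithinAt
  have h2 : HasDerivWithinAt (fun s : ℝ => (s, z.2)) (1, 0) J z.1 :=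
    ((hasDerivAt_id z.1).prodMk (hasDerivAt_const z.1 z.2)).hasDerivWithinAt
  have h4 : MapsTo (fun s : ℝ => (s, z.2)) J (J ×ˢ U) := fun s hs => ⟨hs, hz.2⟩
  have h3 := h1.comp_hasDerivWithinAt z.1 h2 h4
  exact h3.derivWithin (hJ z.1 hz.1)

theorem contDiffOn_fderiv_slice {f : ℝ × E → F} (hJ : UniqueDiffOn ℝ J) (hU : IsOpen U)
    (hf : ContDiffOn ℝ ∞ f (J ×ˢ U)) :
    ContDiffOn ℝ ∞ (fun z : ℝ × E => fderiv ℝ (fun y => f (z.1, y)) z.2) (J ×ˢ U) := by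
  have h1 : ContDiffOn ℝ ∞ (fderivWithin ℝ f (J ×ˢ U)) (J ×ˢ U) :=
    hf.fderivWithin (hJ.prod hU.uniqueDiffOn) (by simp)
  refine ContDiffOn.congr ?_ fun z hz => fderiv_slice_eq hU hf hz
  exact h1.clm_comp contDiffOn_const

theorem contDiffOn_derivWithin_slice {f : ℝ × E → F} (hJ : UniqueDiffOn ℝ J) (hU : IsOpen U)
    (hf : ContDiffOn ℝ ∞ f (J ×ˢ U)) :
    ContDiffOn ℝ ∞ (fun z : ℝ × E => derivWithin (fun s => f (s, z.2)) J z.1) (J ×ˢ U) := by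
  have h1 : ContDiffOn ℝ ∞ (fderivWithin ℝ f (J ×ˢ U)) (J ×ˢ U) :=
    hf.fderivWithin (hJ.prod hU.uniqueDiffOn) (by simp)
  refine ContDiffOn.congr ?_ fun z hz => derivWithin_slice_eq hJ hf hz
  exact h1.clm_apply contDiffOn_const

end Slices

end Sasaki

end

noncomputable section

namespace Sasaki

/-! ### Pointwise identities on a Sasakian manifold -/

section Pointwise

variable {m : ℕ} {S : Type*} [TopologicalSpace S] [ChartedSpace (Model m) S]
  [IsManifold (𝓡 (2 * m + 1)) ∞ S] (𝒮 : SasakianStructure m S)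

/-- In holomorphic coordinates J is multiplication by √-1, and their differential is injective. -/
theorem J_J (p : S) {r : ℝ} (hr : 0 < r) (v : Tan m p × ℝ) : 𝒮.J p r (𝒮.J p r v) = -v := by
  obtain ⟨W, ψ, hW, hp, -, -, h⟩ := 𝒮.holomorphic_coordinates p r hr
  have h1 := h _ hp
  apply h1.1.1
  rw [h1.2, h1.2, smul_smul, Complex.I_mul_I, neg_one_smul]
  exact (map_neg (coneDeriv ψ (p, r)) v).symm

theorem coneMetric_apply (p : S) (r : ℝ) (v w : Tan m p × ℝ) :
    coneMetric 𝒮.g.inner p r v w = v.2 * w.2 + r ^ 2 * 𝒮.g.inner p v.1 w.1 := rfl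

theorem coneMetric_symm (p : S) (r : ℝ) (v w : Tan m p × ℝ) :
    coneMetric 𝒮.g.inner p r v w = coneMetric 𝒮.g.inner p r w v := by
  rw [coneMetric_apply, coneMetric_apply, 𝒮.g.symm, mul_comm v.2]

theorem coneMetric_J_left (p : S) {r : ℝ} (hr : 0 < r) (v w : Tan m p × ℝ) :
    coneMetric 𝒮.g.inner p r (𝒮.J p r v) w = -coneMetric 𝒮.g.inner p r v (𝒮.J p r w) := by
  have h := 𝒮.hermitian p r hr v (𝒮.J p r w)
  rw [J_J 𝒮 p hr] at h
  rw [← h, map_neg, neg_neg]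

/-- J is skew for the cone metric, so J ∂_r is orthogonal to ∂_r and has no radial component. -/
theorem J_radial (p : S) : 𝒮.J p 1 (0, 1) = (reeb 𝒮 p, 0) := by
  refine Prod.ext rfl ?_
  have h := coneMetric_J_left 𝒮 p one_pos (0, 1) (0, 1)
  rw [coneMetric_symm 𝒮 p 1 (0, 1)] at h
  rw [coneMetric_apply] at h
  have h0 : 𝒮.g.inner p (𝒮.J p 1 (0, 1)).1 (0 : Tan m p) = 0 := map_zero _
  simp only [h0] at h
  simp only [mul_one, mul_zero, add_zero] at h
  change (𝒮.J p 1 (0, 1)).2 = 0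
  linarith

theorem J_snd (p : S) (v : Tan m p × ℝ) : (𝒮.J p 1 v).2 = -contact 𝒮 p v.1 := by
  have h := coneMetric_J_left 𝒮 p one_pos (0, 1) v
  rw [J_radial, coneMetric_apply, coneMetric_apply] at h
  have h0 : 𝒮.g.inner p (0 : Tan m p) = 0 := map_zero _
  simp only [h0] at h
  simp only [zero_mul, one_pow, one_mul, zero_add, _root_.zero_apply, add_zero] at h
  have h1 : contact 𝒮 p v.1 = 𝒮.g.inner p (reeb 𝒮 p) v.1 := rfl
  rw [h1, h, neg_neg]

/-- On r = 1 the complex structure of the cone is encoded by Φ, ξ and η. All identities between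
these three are the components of J² = -1. -/
theorem J_apply (p : S) (v : Tan m p × ℝ) :
    𝒮.J p 1 v = (transverseJ 𝒮 p v.1 + v.2 • reeb 𝒮 p, -contact 𝒮 p v.1) := by
  refine Prod.ext ?_ (J_snd 𝒮 p v)
  have h : v = (v.1, (0 : ℝ)) + v.2 • ((0 : Tan m p), (1 : ℝ)) := by
    refine Prod.ext ?_ ?_
    · simp
    · simp
  conv_lhs => rw [h]
  rw [map_add, map_smul, J_radial]
  rfl

/-- Homothety invariance transports the formula from r = 1 and makes the dependence on r explicit.
-/
theorem J_scaled (p : S) {r : ℝ} (hr : 0 < r) (v : Tan m p × ℝ) :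
    𝒮.J p r v = (transverseJ 𝒮 p v.1 + (v.2 / r) • reeb 𝒮 p, -(r * contact 𝒮 p v.1)) := by
  have h := 𝒮.homothety_invariant p 1 r one_pos hr (v.1, v.2 / r)
  rw [mul_one, mul_div_cancel₀ _ hr.ne', J_apply] at h
  rw [show v = (v.1, v.2) from rfl, h, mul_neg]

theorem J_reeb (p : S) : 𝒮.J p 1 (reeb 𝒮 p, 0) = (0, -1) := by
  rw [← J_radial, J_J 𝒮 p one_pos]
  exact Prod.ext neg_zero rfl

theorem contact_reeb (p : S) : contact 𝒮 p (reeb 𝒮 p) = 1 := by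
  have h := congrArg Prod.snd (J_reeb 𝒮 p)
  rw [J_apply] at h
  exact neg_injective h

theorem transverseJ_reeb (p : S) : transverseJ 𝒮 p (reeb 𝒮 p) = 0 := congrArg Prod.fst (J_reeb 𝒮 p)

theorem contact_transverseJ (p : S) (v : Tan m p) : contact 𝒮 p (transverseJ 𝒮 p v) = 0 := by
  have h := J_J 𝒮 p one_pos (v, 0)
  rw [J_apply 𝒮 p (v, 0)] at h
  have h2 := congrArg Prod.snd h
  rw [J_snd] at h2
  simpa using h2

theorem transverseJ_transverseJ (p : S) (v : Tan m p) :
    transverseJ 𝒮 p (transverseJ 𝒮 p v) = -v + contact 𝒮 p v • reeb 𝒮 p := by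
  have h := J_J 𝒮 p one_pos (v, 0)
  rw [J_apply 𝒮 p (v, 0), J_apply] at h
  have h2 := congrArg Prod.fst h
  simp only [zero_smul, add_zero, Prod.fst_neg] at h2
  rw [neg_smul] at h2
  rw [← h2, add_assoc, neg_add_cancel, add_zero]

theorem g_transverseJ_left (p : S) (v w : Tan m p) :
    𝒮.g.inner p (transverseJ 𝒮 p v) w = -𝒮.g.inner p v (transverseJ 𝒮 p w) := by
  have h := coneMetric_J_left 𝒮 p one_pos (v, 0) (w, 0)
  rw [coneMetric_apply, coneMetric_apply] at h
  simp at h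
  exact h

end Pointwise

end Sasaki

end

noncomputable section

namespace Sasaki

/-! ### Existence of foliation charts -/

section ConeCoordinates

variable {m : ℕ} {S : Type*} [TopologicalSpace S] [ChartedSpace (Model m) S]
  [IsManifold (𝓡 (2 * m + 1)) ∞ S]

/-- The derivative of the chart at `p`. -/
def chartD (p q : S) : Model m →L[ℝ] Model m :=
  mfderiv (𝓡 (2 * m + 1)) (𝓡 (2 * m + 1)) (chartAt (Model m) p) q

/-- The derivative of the inverse of the chart at `p`. -/
def chartSymmD (p : S) (y : Model m) : Model m →L[ℝ] Model m :=
  mfderiv (𝓡 (2 * m + 1)) (𝓡 (2 * m + 1)) (chartAt (Model m) p).symm y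

theorem chartSymmD_chartD (p : S) {q : S} (hq : q ∈ (chartAt (Model m) p).source) (v : Model m) :
    chartSymmD p (chartAt (Model m) p q) (chartD p q v) = v := by
  have h := (mdifferentiable_chart (I := 𝓡 (2 * m + 1)) p).symm_comp_deriv hq
  exact congrArg (fun L : Model m →L[ℝ] Model m => L v) h

theorem chartD_chartSymmD (p : S) {y : Model m} (hy : y ∈ (chartAt (Model m) p).target)
    (v : Model m) :
    chartD p ((chartAt (Model m) p).symm y) (chartSymmD p y v) = v := by
  have h := (mdifferentiable_chart (I := 𝓡 (2 * m + 1)) p).comp_symm_deriv hy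
  exact congrArg (fun L : Model m →L[ℝ] Model m => L v) h

/-- The inverse of the product chart of `S × ℝ`. -/
def coneIncl (p : S) (z : Model m × ℝ) : S × ℝ := ((chartAt (Model m) p).symm z.1, z.2)

theorem contMDiffOn_coneIncl (p : S) : ContMDiffOn 𝓘(ℝ, Model m × ℝ) (coneModel m) ∞
    (coneIncl p) ((chartAt (Model m) p).target ×ˢ univ) := by
  refine ContMDiffOn.prodMk ?_ contDiff_snd.contMDiff.contMDiffOn
  exact (contMDiffOn_chart_symm (I := 𝓡 (2 * m + 1)) (x := p)).comp
    contDiff_fst.contMDiff.contMDiffOn (fun z hz => hz.1)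

theorem hasMFDerivAt_coneIncl (p : S) {z : Model m × ℝ} (hz : z.1 ∈ (chartAt (Model m) p).target) :
    HasMFDerivAt 𝓘(ℝ, Model m × ℝ) (coneModel m) (coneIncl p) z
      (((chartSymmD p z.1).comp (ContinuousLinearMap.fst ℝ (Model m) ℝ)).prod
        (ContinuousLinearMap.snd ℝ (Model m) ℝ)) := by
  refine HasMFDerivAt.prodMk (I := 𝓘(ℝ, Model m × ℝ)) (I' := 𝓡 (2 * m + 1)) (I'' := 𝓘(ℝ, ℝ))
    (f := fun z : Model m × ℝ => (chartAt (Model m) p).symm z.1) (g := fun z => z.2) ?_ ?_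
  · have h1 : MDifferentiableAt (𝓡 (2 * m + 1)) (𝓡 (2 * m + 1)) (chartAt (Model m) p).symm z.1 :=
      (mdifferentiable_chart (I := 𝓡 (2 * m + 1)) p).mdifferentiableAt_symm hz
    exact h1.hasMFDerivAt.comp z (hasFDerivAt_fst (𝕜 := ℝ) (p := z)).hasMFDerivAt
  · exact (hasFDerivAt_snd (𝕜 := ℝ) (p := z)).hasMFDerivAt

variable (𝒮 : SasakianStructure m S)

/-- Holomorphic coordinates of the cone, read in the product charts. -/
theorem exists_cone_coordinates (p : S) : ∃ (D : Set (Model m × ℝ))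
    (P : Model m × ℝ → (Fin (m + 1) → ℂ)), IsOpen D ∧ (chartAt (Model m) p p, 1) ∈ D ∧
      ContDiffOn ℝ ∞ P D ∧ ∀ z ∈ D, z.1 ∈ (chartAt (Model m) p).target ∧ 0 < z.2 ∧
        Function.Injective (fderiv ℝ P z) ∧
        ∀ v : Model m × ℝ,
          fderiv ℝ P z (chartD p ((chartAt (Model m) p).symm z.1)
              (𝒮.J ((chartAt (Model m) p).symm z.1) z.2 (chartSymmD p z.1 v.1, v.2)).1,
            (𝒮.J ((chartAt (Model m) p).symm z.1) z.2 (chartSymmD p z.1 v.1, v.2)).2)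
            = Complex.I • fderiv ℝ P z v := by
  obtain ⟨W, ψ, hW, hp, hWpos, hψ, hψW⟩ := 𝒮.holomorphic_coordinates p 1 one_pos
  set e := chartAt (Model m) p with he
  have hc := contMDiffOn_coneIncl (m := m) p
  have hP : ContMDiffOn 𝓘(ℝ, Model m × ℝ) 𝓘(ℝ, Fin (m + 1) → ℂ) ∞ (ψ ∘ coneIncl p)
      ((e.target ×ˢ univ) ∩ coneIncl p ⁻¹' W) := hψ.comp' hc
  refine ⟨(e.target ×ˢ univ) ∩ coneIncl p ⁻¹' W, ψ ∘ coneIncl p,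
    hc.continuousOn.isOpen_inter_preimage (e.open_target.prod isOpen_univ) hW, ⟨⟨?_, trivial⟩, ?_⟩,
    contMDiffOn_iff_contDiffOn.1 hP, ?_⟩
  · exact mem_chart_target _ _
  · rw [mem_preimage, coneIncl, e.left_inv (mem_chart_source _ _)]; exact hp
  · rintro z ⟨⟨hz, -⟩, hzW⟩
    have hd : ∀ v : Model m × ℝ, fderiv ℝ (ψ ∘ coneIncl p) z v
        = coneDeriv ψ (coneIncl p z) (chartSymmD p z.1 v.1, v.2) := by
      have h1 := hasMFDerivAt_coneIncl p hz
      have h2 : MDifferentiableAt (coneModel m) 𝓘(ℝ, Fin (m + 1) → ℂ) ψ (coneIncl p z) :=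
        ((hψ _ hzW).contMDiffAt (hW.mem_nhds hzW)).mdifferentiableAt (by simp)
      have h3 : HasFDerivAt (ψ ∘ coneIncl p)
          (ContinuousLinearMap.comp
            (show Model m × ℝ →L[ℝ] (Fin (m + 1) → ℂ) from coneDeriv ψ (coneIncl p z))
            (((chartSymmD p z.1).comp (ContinuousLinearMap.fst ℝ (Model m) ℝ)).prod
            (ContinuousLinearMap.snd ℝ (Model m) ℝ))) z :=
        (h2.hasMFDerivAt.comp z h1).hasFDerivAt
      intro v
      rw [h3.fderiv]
      rfl
    refine ⟨hz, hWpos _ hzW, fun v w hvw => ?_, fun v => ?_⟩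
    · rw [hd, hd] at hvw
      have h1 := (hψW _ hzW).1.1 hvw
      have h2 := congrArg Prod.fst h1
      have h3 := congrArg Prod.snd h1
      refine Prod.ext ?_ h3
      have h4 := congrArg (chartD p (e.symm z.1)) h2
      rwa [chartD_chartSymmD p hz, chartD_chartSymmD p hz] at h4
    · rw [hd, hd, ← (hψW _ hzW).2]
      congr 1
      refine Prod.ext ?_ rfl
      have h5 := chartSymmD_chartD p (e.map_target hz)
      rw [e.right_inv hz] at h5
      exact h5 _

/-- Functions `G` on the cone which are holomorphic and for which `r ∂/∂r` is a coordinate field. -/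
theorem exists_radial_coordinates (p : S) : ∃ (D : Set (Model m × ℝ))
    (G : Model m × ℝ → ℂ × (Fin m → ℂ)), IsOpen D ∧ (chartAt (Model m) p p, 1) ∈ D ∧
      ContDiffOn ℝ ∞ G D ∧ ∀ z ∈ D, z.1 ∈ (chartAt (Model m) p).target ∧
        Function.Injective (fderiv ℝ G z) ∧ fderiv ℝ G z (0, z.2) = (1, 0) ∧
        ∀ v : Model m × ℝ,
          fderiv ℝ G z (chartD p ((chartAt (Model m) p).symm z.1)
              (𝒮.J ((chartAt (Model m) p).symm z.1) z.2 (chartSymmD p z.1 v.1, v.2)).1,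
            (𝒮.J ((chartAt (Model m) p).symm z.1) z.2 (chartSymmD p z.1 v.1, v.2)).2)
            = Complex.I • fderiv ℝ G z v := by
  obtain ⟨D, P, hD, hpD, hP, hPD⟩ := exists_cone_coordinates 𝒮 p
  set e := chartAt (Model m) p with he
  set z₀ : Model m × ℝ := (e p, 1) with hz₀
  have hPd : ∀ z ∈ D, HasFDerivAt P (fderiv ℝ P z) z := fun z hz =>
    ((hP.contDiffAt (hD.mem_nhds hz)).differentiableAt (by simp)).hasFDerivAt
  have hfr : Module.finrank ℝ (Model m × ℝ) = Module.finrank ℝ (Fin (m + 1) → ℂ) := by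
    rw [Module.finrank_prod, Module.finrank_pi_fintype]
    simp [Complex.finrank_real_complex]
    ring
  have hA : ∀ z ∈ D, ∃ A : (Model m × ℝ) ≃L[ℝ] (Fin (m + 1) → ℂ), (A : _ →L[ℝ] _) = fderiv ℝ P z :=
    fun z hz => ⟨(LinearEquiv.ofInjectiveOfFinrankEq (fderiv ℝ P z : _ →ₗ[ℝ] _) (hPD z hz).2.2.1
      hfr).toContinuousLinearEquiv, by ext1 <;> rfl⟩
  obtain ⟨A₀, hA₀⟩ := hA z₀ hpD
  let κ := (hP.contDiffAt (hD.mem_nhds hpD)).toOpenPartialHomeomorph P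
    (by rw [hA₀]; exact hPd z₀ hpD) (by simp)
  have hκ : ∀ z, κ z = P z := fun z => rfl
  have hz₀s : z₀ ∈ κ.source := ContDiffAt.mem_toOpenPartialHomeomorph_source _ _ _
  let N : Set (Fin (m + 1) → ℂ) := κ.target ∩ κ.symm ⁻¹' D
  have hN : IsOpen N := κ.symm.isOpen_inter_preimage hD
  have hmemN : ∀ z ∈ κ.source ∩ D, P z ∈ N := fun z hz => ⟨κ.map_source hz.1, by
    rw [mem_preimage, ← hκ, κ.left_inv hz.1]; exact hz.2⟩
  have hk : ∀ w ∈ N, ContDiffAt ℝ ∞ κ.symm w := by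
    rintro w ⟨hw, hwD⟩
    obtain ⟨A, hA⟩ := hA _ hwD
    have h1 : HasFDerivAt κ (A : _ →L[ℝ] _) (κ.symm w) := by rw [hA]; exact hPd _ hwD
    exact κ.contDiffAt_symm hw h1 (hP.contDiffAt (hD.mem_nhds hwD))
  have hPk : ∀ w ∈ N, P (κ.symm w) = w := fun w hw => κ.right_inv hw.1
  -- the radial field
  let Z : (Fin (m + 1) → ℂ) → (Fin (m + 1) → ℂ) := fun w =>
    fderiv ℝ P (κ.symm w) (0, (κ.symm w).2)
  have hZ : ContDiffOn ℝ ∞ Z N := by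
    intro w hw
    have h1 : ContDiffAt ℝ ∞ (fderiv ℝ P) (κ.symm w) :=
      (hP.contDiffAt (hD.mem_nhds hw.2)).fderiv_right (by simp)
    have h2 : ContDiffAt ℝ ∞ (fun w => ((0 : Model m), (κ.symm w).2)) w :=
      contDiffAt_const.prodMk (contDiffAt_snd.comp w (hk w hw))
    exact ((h1.comp w (hk w hw)).clm_apply h2).contDiffWithinAt
  -- scalings are holomorphic
  have hscale : ∀ (y : Model m) (r c : ℝ), 0 < c → (y, r) ∈ D → (y, c * r) ∈ D →
      ∀ u u' : Model m × ℝ, fderiv ℝ P (y, r) u' = Complex.I • fderiv ℝ P (y, r) u →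
      fderiv ℝ P (y, c * r) (u'.1, c * u'.2) = Complex.I • fderiv ℝ P (y, c * r) (u.1, c * u.2) := by
    intro y r c hc hr hcr u u' h
    rw [← (hPD _ hr).2.2.2] at h
    have h1 := (hPD _ hr).2.2.1 h
    rw [← (hPD _ hcr).2.2.2 (u.1, c * u.2), h1]
    have h2 := 𝒮.homothety_invariant (e.symm y) r c (hPD _ hr).2.1 hc (chartSymmD p y u.1, u.2)
    dsimp only at h2 ⊢
    rw [h2]
  -- Z is the derivative at c = 1 of the scalings r ↦ c r read in the holomorphic coordinates. Each
  -- scaling has a complex linear differential, and differentiation in c commutes with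
  -- differentiation in w.
  have hol : ∀ w ∈ N, ∀ v, fderiv ℝ Z w (Complex.I • v) = Complex.I • fderiv ℝ Z w v := by
    intro w hw v
    let q : ℝ × (Fin (m + 1) → ℂ) → (Fin (m + 1) → ℂ) := fun x =>
      P ((κ.symm x.2).1, x.1 * (κ.symm x.2).2)
    let s : ℝ × (Fin (m + 1) → ℂ) → Model m × ℝ := fun x =>
      ((κ.symm x.2).1, x.1 * (κ.symm x.2).2)
    have hs1 : ∀ w, s (1, w) = κ.symm w := fun w => by simp [s]
    have hs : ∀ (c : ℝ), ∀ w ∈ N, ContDiffAt ℝ ∞ s (c, w) := fun c w hw => by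
      have h1 : ContDiffAt ℝ ∞ (fun x : ℝ × (Fin (m + 1) → ℂ) => κ.symm x.2) (c, w) :=
        (hk w hw).comp (c, w) contDiffAt_snd
      exact (contDiffAt_fst.comp _ h1).prodMk (contDiffAt_fst.mul (contDiffAt_snd.comp _ h1))
    have hqs : ∀ c, ∀ w ∈ N, s (c, w) ∈ D → ContDiffAt ℝ ∞ q (c, w) := fun c w hw hD' =>
      (hP.contDiffAt (hD.mem_nhds hD')).comp (c, w) (hs c w hw)
    have hD1 : ∀ w ∈ N, s (1, w) ∈ D := fun w hw => by rw [hs1]; exact hw.2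
    have hslice := hasDerivAt_fderiv_slice ((hqs 1 w hw (hD1 w hw)).of_le (m := 2)
      (WithTop.coe_le_coe.2 le_top))
    have hderiv : (fun w' => deriv (fun c => q (c, w')) 1) =ᶠ[𝓝 w] Z := by
      filter_upwards [hN.mem_nhds hw] with w' hw'
      have h1 : HasDerivAt (fun c : ℝ => ((κ.symm w').1, c * (κ.symm w').2))
          ((0 : Model m), (κ.symm w').2) 1 := by
        have h2 : HasDerivAt (fun c : ℝ => c * (κ.symm w').2) (1 * (κ.symm w').2) 1 :=
          (hasDerivAt_id (1 : ℝ)).mul_const _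
        rw [one_mul] at h2
        exact (hasDerivAt_const _ _).prodMk h2
      have h3 : HasFDerivAt P (fderiv ℝ P (κ.symm w'))
          ((κ.symm w').1, (1 : ℝ) * (κ.symm w').2) := by
        rw [one_mul]; exact hPd _ hw'.2
      exact (HasFDerivAt.comp_hasDerivAt
        (f := fun c : ℝ => ((κ.symm w').1, c * (κ.symm w').2)) (1 : ℝ) h3 h1).deriv
    rw [hderiv.fderiv_eq] at hslice
    have hcx : ∀ᶠ c in 𝓝 (1 : ℝ), fderiv ℝ (fun w' => q (c, w')) w (Complex.I • v)
        = Complex.I • fderiv ℝ (fun w' => q (c, w')) w v := by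
      have h1 : ContinuousAt (fun c : ℝ => s (c, w)) 1 := by
        simp only [s]; fun_prop
      filter_upwards [h1.preimage_mem_nhds (hD.mem_nhds (hD1 w hw)), Ioi_mem_nhds one_pos]
        with c hc hc0
      have hkd : HasFDerivAt κ.symm (fderiv ℝ κ.symm w) w :=
        ((hk w hw).differentiableAt (by simp)).hasFDerivAt
      have h2 : ∀ u, fderiv ℝ (fun w' => q (c, w')) w u
          = fderiv ℝ P (s (c, w)) ((fderiv ℝ κ.symm w u).1, c * (fderiv ℝ κ.symm w u).2) := by
        intro u
        have h3 : HasFDerivAt (fun w' => s (c, w')) _ w := (hkd.fst).prodMk (hkd.snd.const_mul c)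
        have h4 : HasFDerivAt (fun w' => q (c, w')) _ w := (hPd _ hc).comp w h3
        rw [h4.fderiv]
        rfl
      rw [h2, h2]
      apply hscale _ _ _ hc0 (by exact hw.2) hc
      have h5 : ∀ u, fderiv ℝ P (κ.symm w) (fderiv ℝ κ.symm w u) = u := by
        intro u
        have h6 : HasFDerivAt (P ∘ κ.symm) _ w := (hPd _ hw.2).comp w hkd
        have h7 : (P ∘ κ.symm) =ᶠ[𝓝 w] id := by
          filter_upwards [hN.mem_nhds hw] with w' hw'
          exact hPk w' hw'
        have h8 := h6.unique ((hasFDerivAt_id w).congr_of_eventuallyEq h7)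
        exact congrArg (fun L => L u) h8
      have h9 : ((κ.symm w).1, (κ.symm w).2) = κ.symm w := rfl
      rw [h9, h5, h5]
    have h1 : HasDerivAt (fun c => fderiv ℝ (fun w' => q (c, w')) w (Complex.I • v))
        (fderiv ℝ Z w (Complex.I • v)) 1 :=
      by simpa using hslice.clm_apply (hasDerivAt_const 1 (Complex.I • v))
    have h2 : HasDerivAt (fun c => fderiv ℝ (fun w' => q (c, w')) w v) (fderiv ℝ Z w v) 1 :=
      by simpa using hslice.clm_apply (hasDerivAt_const 1 v)
    exact h1.unique ((h2.const_smul Complex.I).congr_of_eventuallyEq hcx)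
  have hZ₀ : Z (P z₀) ≠ 0 := by
    intro h
    have h1 : κ.symm (P z₀) = z₀ := κ.left_inv hz₀s
    simp only [Z, h1] at h
    have h2 := (hPD z₀ hpD).2.2.1 (h.trans (map_zero _).symm)
    simpa [hz₀] using congrArg Prod.snd h2
  obtain ⟨U, F, hU, hU₀, hF, hFU⟩ := exists_holomorphic_flow_box hN (hmemN z₀ ⟨hz₀s, hpD⟩) hZ hZ₀ hol
  have hPc : ContinuousOn P (κ.source ∩ D) := hP.continuousOn.mono inter_subset_right
  refine ⟨κ.source ∩ D ∩ P ⁻¹' U, F ∘ P,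
    hPc.isOpen_inter_preimage (κ.open_source.inter hD) hU, ⟨⟨hz₀s, hpD⟩, hU₀⟩,
    hF.comp (hP.mono (inter_subset_left.trans inter_subset_right)) (fun z hz => hz.2), ?_⟩
  rintro z ⟨⟨hzs, hzD⟩, hzU⟩
  have hd : fderiv ℝ (F ∘ P) z = (fderiv ℝ F (P z)).comp (fderiv ℝ P z) :=
    ((((hF.contDiffAt (hU.mem_nhds hzU)).differentiableAt (by simp)).hasFDerivAt).comp z
      (hPd z hzD)).fderiv
  have hFz := hFU _ hzU
  have hkz : κ.symm (P z) = z := κ.left_inv hzs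
  refine ⟨(hPD z hzD).1, ?_, ?_, fun v => ?_⟩
  · rw [hd]; exact hFz.2.1.comp (hPD z hzD).2.2.1
  · rw [hd, ← hFz.1]
    simp only [Z, hkz]
    rfl
  · rw [hd, ContinuousLinearMap.comp_apply, (hPD z hzD).2.2.2 v, hFz.2.2]
    rfl

/-- Foliation charts exist around each point. -/
theorem exists_foliationChart (p : S) : ∃ χ : FoliationChart 𝒮, p ∈ χ.chart.source := by
  obtain ⟨D, G, hD, hpD, hG, hGD⟩ := exists_radial_coordinates 𝒮 p
  set e := chartAt (Model m) p with he
  let D₁ : Set (Model m) := (fun y => (y, (1 : ℝ))) ⁻¹' D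
  have hD₁ : IsOpen D₁ := hD.preimage (by fun_prop)
  -- Since r∂_r = ∂/∂ζ, the Reeb field J(r∂_r) corresponds to √-1 ∂/∂ζ. So Im ζ increases at unit
  -- speed along ξ, and Re ζ is the direction transverse to S to be dropped.
  let T : ℂ × (Fin m → ℂ) →L[ℝ] CF m := Complex.imCLM.prodMap (ContinuousLinearMap.id ℝ (Fin m → ℂ))
  let X : Model m → CF m := fun y => T (G (y, 1))
  have hX : ContDiffOn ℝ ∞ X D₁ := T.contDiff.comp_contDiffOn (hG.comp
    (contDiff_id.prodMk contDiff_const).contDiffOn (fun y hy => hy))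
  have hXd : ∀ y ∈ D₁, HasFDerivAt X ((T.comp (fderiv ℝ G (y, 1))).comp
      (ContinuousLinearMap.inl ℝ (Model m) ℝ)) y := fun y hy => by
    have h1 : HasFDerivAt G (fderiv ℝ G (y, 1)) (y, 1) :=
      ((hG.contDiffAt (hD.mem_nhds hy)).differentiableAt (by simp)).hasFDerivAt
    have h2 : HasFDerivAt (fun y' : Model m => (y', (1 : ℝ)))
        (ContinuousLinearMap.inl ℝ (Model m) ℝ) y := hasFDerivAt_prodMk_left y 1
    have h3 : HasFDerivAt (T ∘ G) (T.comp (fderiv ℝ G (y, 1))) (y, 1) :=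
      T.hasFDerivAt.comp (y, (1 : ℝ)) h1
    exact HasFDerivAt.comp (g := T ∘ G) (f := fun y' : Model m => (y', (1 : ℝ))) y h3 h2
  have hXf : ∀ y ∈ D₁, ∀ v, fderiv ℝ X y v = T (fderiv ℝ G (y, 1) (v, 0)) := fun y hy v => by
    rw [(hXd y hy).fderiv]; rfl
  -- A tangent vector killed by dX has image a real multiple of ∂/∂ζ under dG, hence is a multiple
  -- of r∂_r; being tangent to S it vanishes.
  have hXi : ∀ y ∈ D₁, Function.Injective (fderiv ℝ X y) := by
    intro y hy
    rw [injective_iff_map_eq_zero]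
    intro v hv
    rw [hXf y hy] at hv
    have h1 : (fderiv ℝ G (y, 1) (v, 0)).1.im = 0 := congrArg Prod.fst hv
    have h2 : (fderiv ℝ G (y, 1) (v, 0)).2 = 0 := congrArg Prod.snd hv
    have h3 : fderiv ℝ G (y, 1) (v, 0)
        = fderiv ℝ G (y, 1) ((fderiv ℝ G (y, 1) (v, 0)).1.re • (0, 1)) := by
      rw [map_smul, (hGD _ hy).2.2.1]
      refine Prod.ext ?_ ?_
      · apply Complex.ext <;> simp [h1]
      · simp [h2]
    have h4 := congrArg Prod.fst ((hGD _ hy).2.1 h3)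
    simpa using h4
  have hA : ∀ y ∈ D₁, ∃ A : Model m ≃L[ℝ] CF m, (A : _ →L[ℝ] _) = fderiv ℝ X y :=
    fun y hy => ⟨(LinearEquiv.ofInjectiveOfFinrankEq (fderiv ℝ X y : _ →ₗ[ℝ] _) (hXi y hy)
      (by rw [finrank_CF]; simp)).toContinuousLinearEquiv, by ext1; rfl⟩
  obtain ⟨A₀, hA₀⟩ := hA (e p) hpD
  let x := (hX.contDiffAt (hD₁.mem_nhds hpD)).toOpenPartialHomeomorph X
    (by rw [hA₀]; exact ((hX.contDiffAt (hD₁.mem_nhds hpD)).differentiableAt (by simp)).hasFDerivAt)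
    (by simp)
  have hps : e p ∈ x.source := ContDiffAt.mem_toOpenPartialHomeomorph_source _ _ _
  let x' := x.restrOpen D₁ hD₁
  have hx's : x'.source = x.source ∩ D₁ := x.restrOpen_source D₁ hD₁
  have hx' : ∀ y, x' y = X y := fun y => rfl
  have hxsymm : ContDiffOn ℝ ∞ x'.symm x'.target := by
    intro w hw
    have h1 : x'.symm w ∈ D₁ := by
      have := x'.map_target hw
      rw [hx's] at this
      exact this.2
    obtain ⟨A, hA⟩ := hA _ h1
    have h2 : HasFDerivAt x' (A : _ →L[ℝ] _) (x'.symm w) := by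
      rw [hA]
      exact ((hX.contDiffAt (hD₁.mem_nhds h1)).differentiableAt (by simp)).hasFDerivAt
    exact (x'.contDiffAt_symm hw h2 (hX.contDiffAt (hD₁.mem_nhds h1))).contDiffWithinAt
  have hsrc : ∀ q ∈ (e.trans x').source, q ∈ e.source ∧ e q ∈ D₁ := fun q hq => by
    rw [OpenPartialHomeomorph.trans_source, hx's] at hq
    exact ⟨hq.1, hq.2.2⟩
  have hder : ∀ q ∈ (e.trans x').source, ∀ v : Tan m q,
      foliationDeriv (e.trans x') q v = fderiv ℝ X (e q) (chartD p q v) := by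
    intro q hq v
    have h1 : MDifferentiableAt (𝓡 (2 * m + 1)) (𝓡 (2 * m + 1)) e q :=
      (mdifferentiable_chart (I := 𝓡 (2 * m + 1)) p).mdifferentiableAt (hsrc q hq).1
    have h2 : HasFDerivAt X (fderiv ℝ X (e q)) (e q) :=
      ((hX.contDiffAt (hD₁.mem_nhds (hsrc q hq).2)).differentiableAt (by simp)).hasFDerivAt
    have h3 : HasMFDerivAt (𝓡 (2 * m + 1)) 𝓘(ℝ, CF m) (X ∘ e) q _ :=
      h2.hasMFDerivAt.comp q h1.hasMFDerivAt
    have h4 : foliationDeriv (e.trans x') q = mfderiv (𝓡 (2 * m + 1)) 𝓘(ℝ, CF m) (X ∘ e) q := rfl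
    rw [h4, h3.mfderiv]
    rfl
  have hcx : ∀ q ∈ (e.trans x').source, ∀ v : Tan m q × ℝ,
      fderiv ℝ G (e q, 1) (chartD p q (𝒮.J q 1 v).1, (𝒮.J q 1 v).2)
        = Complex.I • fderiv ℝ G (e q, 1) (chartD p q v.1, v.2) := by
    intro q hq v
    have h1 := (hGD _ (hsrc q hq).2).2.2.2 (chartD p q v.1, v.2)
    have h2 : e.symm (e q) = q := e.left_inv (hsrc q hq).1
    have h3 := chartSymmD_chartD p (hsrc q hq).1 v.1
    dsimp only at h1
    rw [h2, h3] at h1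
    exact h1
  refine ⟨{ chart := e.trans x', smooth := ?_, smooth_symm := ?_, reeb_eq := ?_,
            transversely_holomorphic := ?_ }, ?_⟩
  · have h1 : ContMDiffOn (𝓡 (2 * m + 1)) (𝓡 (2 * m + 1)) ∞ e e.source := contMDiffOn_chart
    exact (hX.contMDiffOn.comp' h1).mono fun q hq => hsrc q hq
  · have h1 : ContMDiffOn (𝓡 (2 * m + 1)) (𝓡 (2 * m + 1)) ∞ e.symm e.target :=
      contMDiffOn_chart_symm
    refine (h1.comp' hxsymm.contMDiffOn).mono fun w hw => ?_
    rw [OpenPartialHomeomorph.trans_target] at hw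
    exact hw
  · intro q hq
    rw [hder q hq, hXf _ (hsrc q hq).2]
    have h1 := hcx q hq (0, 1)
    rw [J_radial] at h1
    have h0 : chartD p q (0 : Model m) = 0 := map_zero _
    have h2 : fderiv ℝ G (e q, 1) (chartD p q (reeb 𝒮 q), 0)
        = Complex.I • fderiv ℝ G (e q, 1) (chartD p q (0 : Model m), 1) := h1
    rw [h2, h0, (hGD _ (hsrc q hq).2).2.2.1]
    simp [T]
  · intro q hq v
    rw [hder q hq, hder q hq, hXf _ (hsrc q hq).2, hXf _ (hsrc q hq).2]
    have h1 := hcx q hq (v, 0)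
    rw [J_apply] at h1
    simp only [zero_smul, add_zero] at h1
    -- Φ v differs from J v by a radial vector, whose image is a real multiple of ∂/∂ζ and does not
    -- affect z.
    have h2 : ((chartD p q (transverseJ 𝒮 q v), 0) : Model m × ℝ)
        = (chartD p q (transverseJ 𝒮 q v), -contact 𝒮 q v) + contact 𝒮 q v • (0, 1) := by
      simp
    rw [h2, map_add, map_smul, (hGD _ (hsrc q hq).2).2.2.1, h1]
    simp [T]
  · rw [OpenPartialHomeomorph.trans_source, hx's]
    exact ⟨mem_chart_source _ _, hps, hpD⟩

end ConeCoordinates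

end Sasaki

end

noncomputable section

namespace Sasaki

/-! ### Calculus in foliation charts -/

section ChartCalculus

variable {m : ℕ} {S : Type*} [TopologicalSpace S] [ChartedSpace (Model m) S]
  [IsManifold (𝓡 (2 * m + 1)) ∞ S] {𝒮 : SasakianStructure m S}

namespace FoliationChart

variable (χ : FoliationChart 𝒮)

/-- The derivative of a foliation chart. -/
def der (p : S) : Tan m p →L[ℝ] CF m := foliationDeriv χ.chart p

/-- The inverse of the derivative of a foliation chart. -/
def inv (p : S) : CF m →L[ℝ] Tan m p := (χ.der p).inverse

theorem mdifferentiable_chart : χ.chart.MDifferentiable (𝓡 (2 * m + 1)) 𝓘(ℝ, CF m) :=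
  ⟨χ.smooth.mdifferentiableOn (by simp), χ.smooth_symm.mdifferentiableOn (by simp)⟩

/-- The derivative of a foliation chart, as an equivalence. -/
def derEquiv {p : S} (hp : p ∈ χ.chart.source) : Tan m p ≃L[ℝ] CF m :=
  χ.mdifferentiable_chart.mfderiv hp

theorem inv_eq {p : S} (hp : p ∈ χ.chart.source) :
    χ.inv p = ((χ.derEquiv hp).symm : CF m →L[ℝ] Tan m p) :=
  ContinuousLinearMap.inverse_equiv (χ.derEquiv hp)

theorem inv_der {p : S} (hp : p ∈ χ.chart.source) (v : Tan m p) : χ.inv p (χ.der p v) = v := by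
  rw [χ.inv_eq hp]
  exact (χ.derEquiv hp).symm_apply_apply v

theorem der_inv {p : S} (hp : p ∈ χ.chart.source) (w : CF m) : χ.der p (χ.inv p w) = w := by
  rw [χ.inv_eq hp]
  exact (χ.derEquiv hp).apply_symm_apply w

theorem mfderiv_symm {y : CF m} (hy : y ∈ χ.chart.target) :
    mfderiv 𝓘(ℝ, CF m) (𝓡 (2 * m + 1)) χ.chart.symm y = χ.inv (χ.chart.symm y) := by
  ext1 w
  have h : χ.der (χ.chart.symm y) (mfderiv 𝓘(ℝ, CF m) (𝓡 (2 * m + 1)) χ.chart.symm y w) = w :=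
    congrArg (fun L : CF m →L[ℝ] CF m => L w) (χ.mdifferentiable_chart.comp_symm_deriv hy)
  have h1 := χ.inv_der (χ.chart.map_target hy)
    (mfderiv 𝓘(ℝ, CF m) (𝓡 (2 * m + 1)) χ.chart.symm y w)
  rw [h] at h1
  exact h1.symm

theorem exists_symm_eq {p : S} (hp : p ∈ χ.chart.source) :
    ∃ y ∈ χ.chart.target, χ.chart.symm y = p :=
  ⟨χ.chart p, χ.chart.map_source hp, χ.chart.left_inv hp⟩

theorem der_reeb {p : S} (hp : p ∈ χ.chart.source) : χ.der p (reeb 𝒮 p) = (1, 0) := χ.reeb_eq p hp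

theorem inv_one_zero {p : S} (hp : p ∈ χ.chart.source) : χ.inv p (1, 0) = reeb 𝒮 p := by
  rw [← χ.der_reeb hp, χ.inv_der hp]

/-- A 1-form read in a foliation chart. -/
def pull1 (α : ∀ p : S, Tan m p →L[ℝ] ℝ) (y : CF m) : CF m →L[ℝ] ℝ :=
  (α (χ.chart.symm y)).comp (χ.inv (χ.chart.symm y))

theorem pull1_apply (α : ∀ p : S, Tan m p →L[ℝ] ℝ) (y v : CF m) :
    χ.pull1 α y v = α (χ.chart.symm y) (χ.inv (χ.chart.symm y) v) := rfl

theorem pull1_contact_one_zero {y : CF m} (hy : y ∈ χ.chart.target) :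
    χ.pull1 (contact 𝒮) y (1, 0) = 1 := by
  rw [pull1_apply, χ.inv_one_zero (χ.chart.map_target hy), contact_reeb]

/-- The transverse complex structure in a foliation chart. -/
theorem transverseJ_inv {y : CF m} (hy : y ∈ χ.chart.target) (v : CF m) :
    transverseJ 𝒮 (χ.chart.symm y) (χ.inv (χ.chart.symm y) v)
      = χ.inv (χ.chart.symm y)
        (-χ.pull1 (contact 𝒮) y (0, Complex.I • v.2), Complex.I • v.2) := by
  have hps : χ.chart.symm y ∈ χ.chart.source := χ.chart.map_target hy
  set w := χ.der (χ.chart.symm y)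
    (transverseJ 𝒮 (χ.chart.symm y) (χ.inv (χ.chart.symm y) v)) with hw
  have h1 : χ.inv (χ.chart.symm y) w
      = transverseJ 𝒮 (χ.chart.symm y) (χ.inv (χ.chart.symm y) v) := by
    rw [hw, χ.inv_der hps]
  have h2 : w.2 = Complex.I • v.2 := by
    have h3 := χ.transversely_holomorphic _ hps (χ.inv (χ.chart.symm y) v)
    have h4 : foliationDeriv χ.chart _ (χ.inv (χ.chart.symm y) v) = v := χ.der_inv hps v
    rw [h4] at h3
    exact h3
  -- Transverse holomorphy determines the z-component of Φ; the leaf component is then forced by η ∘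
  -- Φ = 0.
  have h3 : χ.pull1 (contact 𝒮) y w = 0 := by
    rw [pull1_apply, h1, contact_transverseJ]
  have h4 : w = w.1 • (1, 0) + (0, Complex.I • v.2) := by
    refine Prod.ext ?_ ?_ <;> simp [h2]
  rw [h4, map_add, map_smul, χ.pull1_contact_one_zero hy] at h3
  have h5 : w.1 = -χ.pull1 (contact 𝒮) y (0, Complex.I • v.2) := by
    simp only [smul_eq_mul, mul_one] at h3
    linarith
  rw [← h1]
  congr 1
  exact Prod.ext h5 h2

/-- Coordinate fields are the images of constant fields under the tangent map of the inverse chart.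
-/
theorem contMDiffOn_inv (w : CF m) :
    ContMDiffOn 𝓘(ℝ, CF m) (𝓡 (2 * m + 1)).tangent ∞
      (fun y => TotalSpace.mk' (Model m) (E := fun p : S => TangentSpace (𝓡 (2 * m + 1)) p)
        (χ.chart.symm y) (χ.inv (χ.chart.symm y) w)) χ.chart.target := by
  have h1 := χ.smooth_symm.contMDiffOn_tangentMapWithin (m := ∞) (by simp)
    χ.chart.open_target.uniqueMDiffOn
  have h2 : ContMDiff 𝓘(ℝ, CF m) 𝓘(ℝ, CF m).tangent ∞
      (fun y => TotalSpace.mk' (CF m) (E := fun y : CF m => TangentSpace 𝓘(ℝ, CF m) y) y w) := by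
    intro y
    refine (contMDiffAt_section (IB := 𝓘(ℝ, CF m)) (F := CF m)
      (E := fun y : CF m => TangentSpace 𝓘(ℝ, CF m) y) (s := fun _ => w) y).2 ?_
    simpa using contMDiffAt_const
  have h3 := h1.comp h2.contMDiffOn (s := χ.chart.target) (fun y hy => hy)
  refine h3.congr fun y hy => ?_
  simp only [Function.comp, tangentMapWithin]
  rw [mfderivWithin_of_isOpen χ.chart.open_target hy, χ.mfderiv_symm hy]
  rfl

/-- This unwinds the bundle smoothness of g. Smoothness of η follows by taking one argument to be
∂/∂x = ξ, and smoothness of Φ from its expression by η and multiplication by √-1. -/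
theorem contDiffOn_metric (v w : CF m) :
    ContDiffOn ℝ ∞ (fun y => 𝒮.g.inner (χ.chart.symm y) (χ.inv (χ.chart.symm y) v)
      (χ.inv (χ.chart.symm y) w)) χ.chart.target := by
  rw [← contMDiffOn_iff_contDiffOn]
  have h : ContMDiffOn 𝓘(ℝ, CF m) ((𝓡 (2 * m + 1)).prod 𝓘(ℝ)) ∞
      (fun y ↦ TotalSpace.mk' ℝ (E := Bundle.Trivial S ℝ) (χ.chart.symm y)
        (𝒮.g.inner (χ.chart.symm y) (χ.inv (χ.chart.symm y) v)
          (χ.inv (χ.chart.symm y) w))) χ.chart.target := by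
    apply ContMDiffOn.clm_bundle_apply₂ (F₁ := Model m) (F₂ := Model m)
    · exact 𝒮.g.contMDiff.comp_contMDiffOn χ.smooth_symm
    · exact χ.contMDiffOn_inv v
    · exact χ.contMDiffOn_inv w
  intro y hy
  have := h y hy
  simp only [contMDiffWithinAt_totalSpace] at this
  exact this.2

theorem contDiffOn_pull1_of_apply {α : ∀ p : S, Tan m p →L[ℝ] ℝ}
    (h : ∀ v, ContDiffOn ℝ ∞ (fun y => χ.pull1 α y v) χ.chart.target) :
    ContDiffOn ℝ ∞ (χ.pull1 α) χ.chart.target := contDiffOn_clm_apply.2 h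

theorem contDiffOn_pull1_contact : ContDiffOn ℝ ∞ (χ.pull1 (contact 𝒮)) χ.chart.target := by
  refine χ.contDiffOn_pull1_of_apply fun v => (χ.contDiffOn_metric (1, 0) v).congr fun y hy => ?_
  rw [χ.inv_one_zero (χ.chart.map_target hy)]; rfl

theorem contDiffOn_pull1 {α : ∀ p : S, Tan m p →L[ℝ] ℝ}
    (h : ContMDiff (𝓡 (2 * m + 1)) ((𝓡 (2 * m + 1)).prod 𝓘(ℝ, Model m →L[ℝ] ℝ)) ∞
      (fun p => TotalSpace.mk' (Model m →L[ℝ] ℝ)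
        (E := fun p : S => TangentSpace (𝓡 (2 * m + 1)) p →L[ℝ] ℝ) p (α p))) :
    ContDiffOn ℝ ∞ (χ.pull1 α) χ.chart.target := by
  refine χ.contDiffOn_pull1_of_apply fun v => ?_
  rw [← contMDiffOn_iff_contDiffOn]
  have h : ContMDiffOn 𝓘(ℝ, CF m) ((𝓡 (2 * m + 1)).prod 𝓘(ℝ)) ∞
      (fun y ↦ TotalSpace.mk' ℝ (E := Bundle.Trivial S ℝ) (χ.chart.symm y)
        (α (χ.chart.symm y) (χ.inv (χ.chart.symm y) v))) χ.chart.target := by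
    apply ContMDiffOn.clm_bundle_apply (F₁ := Model m)
    · exact h.comp_contMDiffOn χ.smooth_symm
    · exact χ.contMDiffOn_inv v
  intro y hy
  have := h y hy
  simp only [contMDiffWithinAt_totalSpace] at this
  exact this.2

/-! #### The exterior derivative of a 1-form -/

/-- The change of coordinates from a preferred chart to a foliation chart. -/
def transition (p : S) (y : Model m) : CF m := χ.chart ((extChartAt (𝓡 (2 * m + 1)) p).symm y)

theorem contDiffOn_transition (p : S) : ContDiffOn ℝ ∞ (χ.transition p)
    ((chartAt (Model m) p).target ∩ (chartAt (Model m) p).symm ⁻¹' χ.chart.source) :=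
  contMDiffOn_iff_contDiffOn.1
    (χ.smooth.comp' (contMDiffOn_chart_symm (I := 𝓡 (2 * m + 1)) (x := p)))

theorem isOpen_transition_domain (p : S) : IsOpen
    ((chartAt (Model m) p).target ∩ (chartAt (Model m) p).symm ⁻¹' χ.chart.source) :=
  (chartAt (Model m) p).symm.isOpen_inter_preimage χ.chart.open_source

theorem chartSymmDeriv_eq (p : S) {y : Model m}
    (hy : y ∈ (chartAt (Model m) p).target ∩ (chartAt (Model m) p).symm ⁻¹' χ.chart.source) :
    chartSymmDeriv (𝓡 (2 * m + 1)) p y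
      = (χ.inv ((extChartAt (𝓡 (2 * m + 1)) p).symm y)).comp (fderiv ℝ (χ.transition p) y) := by
  ext1 v
  set q := (extChartAt (𝓡 (2 * m + 1)) p).symm y with hq
  have h1 : MDifferentiableAt (𝓡 (2 * m + 1)) (𝓡 (2 * m + 1)) (chartAt (Model m) p).symm y :=
    (_root_.mdifferentiable_chart (I := 𝓡 (2 * m + 1)) p).mdifferentiableAt_symm hy.1
  have h2 : MDifferentiableAt (𝓡 (2 * m + 1)) 𝓘(ℝ, CF m) χ.chart q :=
    χ.mdifferentiable_chart.mdifferentiableAt hy.2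
  have h3 : HasMFDerivAt (𝓡 (2 * m + 1)) 𝓘(ℝ, CF m) (χ.transition p) y
      ((mfderiv (𝓡 (2 * m + 1)) 𝓘(ℝ, CF m) χ.chart q).comp
        (mfderiv (𝓡 (2 * m + 1)) (𝓡 (2 * m + 1)) (chartAt (Model m) p).symm y)) :=
    h2.hasMFDerivAt.comp y h1.hasMFDerivAt
  have h4 : fderiv ℝ (χ.transition p) y v = χ.der q (chartSymmDeriv (𝓡 (2 * m + 1)) p y v) := by
    rw [← mfderiv_eq_fderiv]
    exact congrArg (fun L : Model m →L[ℝ] CF m => L v) h3.mfderiv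
  rw [ContinuousLinearMap.comp_apply, h4]
  exact (χ.inv_der (p := q) hy.2 _).symm

/-- The exterior derivative of a 1-form can be computed in a foliation chart. -/
theorem dOne_eq {α : ∀ p : S, Tan m p →L[ℝ] ℝ} {p : S} (hp : p ∈ χ.chart.source)
    (h : DifferentiableAt ℝ (χ.pull1 α) (χ.chart p)) (v w : Tan m p) :
    dOne (𝓡 (2 * m + 1)) α p v w
      = skew (fderiv ℝ (χ.pull1 α) (χ.chart p)) (χ.der p v) (χ.der p w) := by
  set e := chartAt (Model m) p with he
  set T := χ.transition p with hT
  have hmem : e p ∈ e.target ∩ e.symm ⁻¹' χ.chart.source :=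
    ⟨mem_chart_target _ _, by
      rw [mem_preimage, e.left_inv (mem_chart_source _ _)]; exact hp⟩
  have hTp : T (e p) = χ.chart p := by
    have : e.symm (e p) = p := e.left_inv (mem_chart_source _ _)
    exact congrArg χ.chart this
  have hTd : ContDiffAt ℝ ∞ T (e p) :=
    (χ.contDiffOn_transition p).contDiffAt ((χ.isOpen_transition_domain p).mem_nhds hmem)
  have hT2 : DifferentiableAt ℝ (fderiv ℝ T) (e p) :=
    (hTd.fderiv_right (m := 1) (by norm_cast)).differentiableAt (by simp)
  -- The change of coordinates contributes its second derivative to the derivative of the pulled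
  -- back form; this term is symmetric and disappears under antisymmetrization.
  have hsymm : ∀ a b, fderiv ℝ (fderiv ℝ T) (e p) a b = fderiv ℝ (fderiv ℝ T) (e p) b a :=
    fun a b => (hTd.isSymmSndFDerivAt (by simp; norm_cast)) a b
  have hev : pullbackOne (𝓡 (2 * m + 1)) α p =ᶠ[𝓝 (e p)]
      fun y => (χ.pull1 α (T y)).comp (fderiv ℝ T y) := by
    filter_upwards [(χ.isOpen_transition_domain p).mem_nhds hmem] with y hy
    have h2 : χ.chart.symm (T y) = (extChartAt (𝓡 (2 * m + 1)) p).symm y := χ.chart.left_inv hy.2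
    rw [pullbackOne, χ.chartSymmDeriv_eq p hy, pull1, h2]
    rfl
  have hd : HasFDerivAt (fun y => χ.pull1 α (T y))
      ((fderiv ℝ (χ.pull1 α) (χ.chart p)).comp (fderiv ℝ T (e p))) (e p) := by
    rw [← hTp] at h ⊢
    exact h.hasFDerivAt.comp (e p) (hTd.differentiableAt (by simp)).hasFDerivAt
  have hD : ∀ a b, fderiv ℝ (pullbackOne (𝓡 (2 * m + 1)) α p) (e p) a b
      = fderiv ℝ (χ.pull1 α) (χ.chart p) (fderiv ℝ T (e p) a) (fderiv ℝ T (e p) b)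
        + χ.pull1 α (χ.chart p) (fderiv ℝ (fderiv ℝ T) (e p) a b) := fun a b => by
    rw [hev.fderiv_eq, HasFDerivAt.fderiv (HasFDerivAt.clm_comp hd hT2.hasFDerivAt)]
    simp only [_root_.add_apply, ContinuousLinearMap.comp_apply,
      ContinuousLinearMap.compL_apply, ContinuousLinearMap.flip_apply, hTp]
    ring
  have hch : ∀ v : Tan m p, fderiv ℝ T (e p) (chartDeriv (𝓡 (2 * m + 1)) p v) = χ.der p v := by
    intro v
    have h1 : chartSymmDeriv (𝓡 (2 * m + 1)) p (e p) (chartDeriv (𝓡 (2 * m + 1)) p v)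
        = χ.inv ((extChartAt (𝓡 (2 * m + 1)) p).symm (e p))
          (fderiv ℝ T (e p) (chartDeriv (𝓡 (2 * m + 1)) p v)) :=
      congrArg (fun L : Model m →L[ℝ] Tan m ((extChartAt (𝓡 (2 * m + 1)) p).symm (e p)) =>
        L (chartDeriv (𝓡 (2 * m + 1)) p v)) (χ.chartSymmDeriv_eq p hmem)
    have h2 : chartSymmDeriv (𝓡 (2 * m + 1)) p (e p) (chartDeriv (𝓡 (2 * m + 1)) p v) = v :=
      chartSymmD_chartD p (mem_chart_source _ _) v
    -- The chart returns the base point only up to a propositional equality, along which the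
    -- identity of tangent vectors has to be carried.
    have h3 : ∀ q : S, q = p → ∀ x, χ.inv q x = (show Model m from v) → x = χ.der p v := by
      rintro q rfl x hx
      rw [← χ.der_inv hp x]
      exact congrArg (χ.der q) hx
    exact h3 _ (e.left_inv (mem_chart_source _ _)) _ (h1.symm.trans h2)
  change skew (fderiv ℝ (pullbackOne (𝓡 (2 * m + 1)) α p) (e p))
    (chartDeriv (𝓡 (2 * m + 1)) p v) (chartDeriv (𝓡 (2 * m + 1)) p w) = _
  simp only [skew, _root_.sub_apply, ContinuousLinearMap.flip_apply]
  rw [hD, hD, hsymm, hch, hch]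
  ring

theorem dOne_inv {α : ∀ p : S, Tan m p →L[ℝ] ℝ} {y : CF m} (hy : y ∈ χ.chart.target)
    (h : DifferentiableAt ℝ (χ.pull1 α) y) (v w : CF m) :
    dOne (𝓡 (2 * m + 1)) α (χ.chart.symm y) (χ.inv (χ.chart.symm y) v) (χ.inv (χ.chart.symm y) w)
      = skew (fderiv ℝ (χ.pull1 α) y) v w := by
  have hy' := χ.chart.right_inv hy
  have hs := χ.chart.map_target hy
  rw [χ.dOne_eq hs (by rwa [hy']), hy', χ.der_inv hs, χ.der_inv hs]

end FoliationChart

end ChartCalculus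

end Sasaki

end

/-! ### The identity dη = 2 g(Φ·, ·) -/

noncomputable section

namespace Sasaki

theorem hasFDerivAt_apply_const {E F G : Type*} [NormedAddCommGroup E] [NormedSpace ℝ E]
    [NormedAddCommGroup F] [NormedSpace ℝ F] [NormedAddCommGroup G] [NormedSpace ℝ G]
    {K : E → G →L[ℝ] F} {c : E} (h : DifferentiableAt ℝ K c) (x : G) :
    HasFDerivAt (fun z => K z x) ((fderiv ℝ K c).flip x) c := by
  simpa using h.hasFDerivAt.clm_apply (hasFDerivAt_const x c)

theorem hasDerivAt_line_apply {E G : Type*} [NormedAddCommGroup E] [NormedSpace ℝ E]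
    [NormedAddCommGroup G] [NormedSpace ℝ G] {K : E → G →L[ℝ] G →L[ℝ] ℝ} {c : E}
    (h : DifferentiableAt ℝ K c) (u : E) (x y : G) :
    HasDerivAt (fun t : ℝ => K (c + t • u) x y) (fderiv ℝ K c u x y) 0 := by
  have h1 := hasFDerivAt_apply_const h x
  have h2 := hasFDerivAt_apply_const h1.differentiableAt y
  rw [h1.fderiv] at h2
  exact h2.hasLineDerivAt u

section KahlerForm

variable {m : ℕ} {S : Type*} [TopologicalSpace S] [ChartedSpace (Model m) S]
  [IsManifold (𝓡 (2 * m + 1)) ∞ S] (𝒮 : SasakianStructure m S)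

theorem chartDeriv_cone (p : S) (v : Model m) (a : ℝ) :
    chartDeriv (coneModel m) ((p, 1) : S × ℝ) (v, a) = (chartD p p v, a) := by
  have h1 : MDifferentiableAt (𝓡 (2 * m + 1)) (𝓡 (2 * m + 1)) (chartAt (Model m) p) p :=
    (mdifferentiable_chart (I := 𝓡 (2 * m + 1)) p).mdifferentiableAt (mem_chart_source _ _)
  have h2 : HasMFDerivAt (coneModel m) 𝓘(ℝ, Model m × ℝ)
      (fun c : S × ℝ => (chartAt (Model m) p c.1, c.2)) (p, 1)
      (((chartD p p).comp (ContinuousLinearMap.fst ℝ (Model m) ℝ)).prod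
        (ContinuousLinearMap.snd ℝ (Model m) ℝ)) := by
    rw [modelWithCornersSelf_prod, ← chartedSpaceSelf_prod]
    exact HasMFDerivAt.prodMk (h1.hasMFDerivAt.comp ((p, 1) : S × ℝ) (hasMFDerivAt_fst (p, (1 : ℝ))))
      (hasMFDerivAt_snd (p, (1 : ℝ)))
  exact congrArg (fun L : Model m × ℝ →L[ℝ] Model m × ℝ => L (v, a)) h2.mfderiv

theorem chartSymmDeriv_cone (p : S) {z : Model m × ℝ} (hz : z.1 ∈ (chartAt (Model m) p).target)
    (v : Model m) (a : ℝ) :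
    chartSymmDeriv (coneModel m) ((p, 1) : S × ℝ) z (v, a)
      = (chartSymmDeriv (𝓡 (2 * m + 1)) p z.1 v, a) :=
  congrArg (fun L : Model m × ℝ →L[ℝ] Model m × ℝ => L (v, a)) (hasMFDerivAt_coneIncl p hz).mfderiv

/-- The 2-form `g (Φ ·, ·)` in a preferred chart. -/
def pullbackForm (p : S) (v w y : Model m) : ℝ :=
  𝒮.g.inner ((extChartAt (𝓡 (2 * m + 1)) p).symm y)
    (transverseJ 𝒮 ((extChartAt (𝓡 (2 * m + 1)) p).symm y) (chartSymmDeriv (𝓡 (2 * m + 1)) p y v))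
    (chartSymmDeriv (𝓡 (2 * m + 1)) p y w)

/-- The fundamental form of the cone is r dr ∧ η + r² g(Φ·, ·). With the powers of r explicit its
radial derivative can be read off. -/
theorem pullbackTwo_coneForm (p : S) {z : Model m × ℝ}
    (hz : z.1 ∈ (chartAt (Model m) p).target) (hr : 0 < z.2) (v w : Model m) (a b : ℝ) :
    pullbackTwo (coneModel m) (coneForm 𝒮.g.inner 𝒮.J) (p, 1) z (v, a) (w, b)
      = -(z.2 * pullbackOne (𝓡 (2 * m + 1)) (contact 𝒮) p z.1 v * b)
        + z.2 * a * pullbackOne (𝓡 (2 * m + 1)) (contact 𝒮) p z.1 w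
        + z.2 ^ 2 * pullbackForm 𝒮 p v w z.1 := by
  have h1 : pullbackTwo (coneModel m) (coneForm 𝒮.g.inner 𝒮.J) (p, 1) z (v, a) (w, b)
      = coneForm 𝒮.g.inner 𝒮.J ((extChartAt (coneModel m) ((p, 1) : S × ℝ)).symm z)
        (chartSymmDeriv (coneModel m) ((p, 1) : S × ℝ) z (v, a))
        (chartSymmDeriv (coneModel m) ((p, 1) : S × ℝ) z (w, b)) := rfl
  rw [h1, chartSymmDeriv_cone p hz, chartSymmDeriv_cone p hz]
  set q := (extChartAt (𝓡 (2 * m + 1)) p).symm z.1 with hq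
  set V : Tan m q := chartSymmDeriv (𝓡 (2 * m + 1)) p z.1 v with hV
  set W : Tan m q := chartSymmDeriv (𝓡 (2 * m + 1)) p z.1 w with hW
  have h2 : coneForm 𝒮.g.inner 𝒮.J ((extChartAt (coneModel m) ((p, 1) : S × ℝ)).symm z)
        (V, a) (W, b) = coneMetric 𝒮.g.inner q z.2 (𝒮.J q z.2 (V, a)) (W, b) := rfl
  refine h2.trans ?_
  rw [J_scaled 𝒮 q hr, coneMetric_apply]
  have h3 : pullbackOne (𝓡 (2 * m + 1)) (contact 𝒮) p z.1 v = contact 𝒮 q V := rfl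
  have h4 : pullbackOne (𝓡 (2 * m + 1)) (contact 𝒮) p z.1 w = contact 𝒮 q W := rfl
  have h5 : pullbackForm 𝒮 p v w z.1 = 𝒮.g.inner q (transverseJ 𝒮 q V) W := rfl
  have h6 : 𝒮.g.inner q (transverseJ 𝒮 q V + (a / z.2) • reeb 𝒮 q) W
      = 𝒮.g.inner q (transverseJ 𝒮 q V) W + (a / z.2) * contact 𝒮 q W := by
    rw [map_add, map_smul]; rfl
  dsimp only
  rw [h3, h4, h5, h6]
  field_simp
  ring

variable {𝒮} in
theorem FoliationChart.contDiffOn_pullbackOne (χ : FoliationChart 𝒮)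
    {α : ∀ p : S, Tan m p →L[ℝ] ℝ} (h : ContDiffOn ℝ ∞ (χ.pull1 α) χ.chart.target) (p : S) :
    ContDiffOn ℝ ∞ (pullbackOne (𝓡 (2 * m + 1)) α p)
      ((chartAt (Model m) p).target ∩ (chartAt (Model m) p).symm ⁻¹' χ.chart.source) := by
  have hT := χ.contDiffOn_transition p
  have hO := χ.isOpen_transition_domain p
  have h1 : ContDiffOn ℝ ∞ (fun y => (χ.pull1 α (χ.transition p y)).comp
      (fderiv ℝ (χ.transition p) y))
      ((chartAt (Model m) p).target ∩ (chartAt (Model m) p).symm ⁻¹' χ.chart.source) :=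
    (h.comp hT fun y hy => χ.chart.map_source hy.2).clm_comp
      (hT.fderiv_of_isOpen hO (by simp))
  refine h1.congr fun y hy => ?_
  have h2 : χ.chart.symm (χ.transition p y) = (extChartAt (𝓡 (2 * m + 1)) p).symm y :=
    χ.chart.left_inv hy.2
  rw [pullbackOne, χ.chartSymmDeriv_eq p hy, FoliationChart.pull1, h2]
  rfl

-- Nothing is assumed about the regularity of J as a tensor field; Φ is smooth because the foliation
-- chart expresses it through η.
variable {𝒮} in
theorem FoliationChart.contDiffOn_pullbackForm (χ : FoliationChart 𝒮) (p : S) (v w : Model m) :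
    ContDiffOn ℝ ∞ (pullbackForm 𝒮 p v w)
      ((chartAt (Model m) p).target ∩ (chartAt (Model m) p).symm ⁻¹' χ.chart.source) := by
  have hT := χ.contDiffOn_transition p
  have hO := χ.isOpen_transition_domain p
  have hmaps : MapsTo (χ.transition p)
      ((chartAt (Model m) p).target ∩ (chartAt (Model m) p).symm ⁻¹' χ.chart.source)
      χ.chart.target := fun y hy => χ.chart.map_source hy.2
  have hη := χ.contDiffOn_pull1_contact.comp hT hmaps
  have hDT := hT.fderiv_of_isOpen (m := ∞) hO (by simp)
  let G : CF m → CF m →L[ℝ] CF m →L[ℝ] ℝ := fun y => ContinuousLinearMap.bilinearComp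
    (E := Model m) (F := Model m) (E' := CF m) (F' := CF m) (𝒮.g.inner (χ.chart.symm y))
    (χ.inv (χ.chart.symm y)) (χ.inv (χ.chart.symm y))
  have hG : ContDiffOn ℝ ∞ G χ.chart.target :=
    contDiffOn_clm_apply.2 fun v => contDiffOn_clm_apply.2 fun w => χ.contDiffOn_metric v w
  have hGT := hG.comp hT hmaps
  have hv := hDT.clm_apply (contDiffOn_const (c := v))
  have hw := hDT.clm_apply (contDiffOn_const (c := w))
  have hI : ContDiffOn ℝ ∞ (fun y => Complex.I • (fderiv ℝ (χ.transition p) y v).2)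
      ((chartAt (Model m) p).target ∩ (chartAt (Model m) p).symm ⁻¹' χ.chart.source) :=
    hv.snd.const_smul Complex.I
  have h0 := (hη.clm_apply (contDiffOn_const.prodMk hI (f := fun _ => (0 : ℝ)))).neg.prodMk hI
  refine ((hGT.clm_apply h0).clm_apply hw).congr fun y hy => ?_
  have h2 : χ.chart.symm (χ.transition p y) = (extChartAt (𝓡 (2 * m + 1)) p).symm y :=
    χ.chart.left_inv hy.2
  have h3 : ∀ v, 𝒮.g.inner (χ.chart.symm (χ.transition p y))
      (transverseJ 𝒮 (χ.chart.symm (χ.transition p y)) (χ.inv (χ.chart.symm (χ.transition p y))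
        (fderiv ℝ (χ.transition p) y v)))
      (χ.inv (χ.chart.symm (χ.transition p y)) (fderiv ℝ (χ.transition p) y w))
      = pullbackForm 𝒮 p v w y := by
    intro v
    rw [pullbackForm, χ.chartSymmDeriv_eq p hy, h2]
    rfl
  rw [← h3, χ.transverseJ_inv (hmaps hy)]
  rfl

-- With ω = g(Φ·, ·), contracting d(r dr ∧ η + r² ω) = 0 with ∂_r at r = 1 gives 2 ω - dη = 0. The
-- three terms of the exterior derivative on (∂_r, v, w) are computed as derivatives along lines.
set_option synthInstance.maxHeartbeats 200000 in
theorem kahlerForm_apply (p : S) (v w : Tan m p) :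
    kahlerForm 𝒮 p v w = 2 * 𝒮.g.inner p (transverseJ 𝒮 p v) w := by
  obtain ⟨χ, hp⟩ := exists_foliationChart 𝒮 p
  set e := chartAt (Model m) p with he
  set N := e.target ∩ e.symm ⁻¹' χ.chart.source with hN
  have hNo : IsOpen N := χ.isOpen_transition_domain p
  have hmem : e p ∈ N := ⟨mem_chart_target _ _, by
    rw [mem_preimage, e.left_inv (mem_chart_source _ _)]; exact hp⟩
  have hη : ContDiffOn ℝ ∞ (pullbackOne (𝓡 (2 * m + 1)) (contact 𝒮) p) N :=
    χ.contDiffOn_pullbackOne χ.contDiffOn_pull1_contact p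
  have hω : ∀ v w, ContDiffOn ℝ ∞ (pullbackForm 𝒮 p v w) N := χ.contDiffOn_pullbackForm p
  set η := pullbackOne (𝓡 (2 * m + 1)) (contact 𝒮) p with hηdef
  let N' : Set (Model m × ℝ) := N ×ˢ Ioi 0
  have hN'o : IsOpen N' := hNo.prod isOpen_Ioi
  let c : Model m × ℝ := (e p, 1)
  have hc : c ∈ N' := ⟨hmem, show (0 : ℝ) < 1 from one_pos⟩
  set K := pullbackTwo (coneModel m) (coneForm 𝒮.g.inner 𝒮.J) ((p, 1) : S × ℝ) with hK
  have hKs : ∀ x y : Model m × ℝ, ContDiffOn ℝ ∞ (fun z => K z x y) N' := by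
    rintro ⟨x, a⟩ ⟨y, b⟩
    have h1 : ContDiffOn ℝ ∞ (fun z : Model m × ℝ => η z.1) N' :=
      hη.comp contDiffOn_fst fun z hz => hz.1
    have h2 : ContDiffOn ℝ ∞ (fun z : Model m × ℝ => pullbackForm 𝒮 p x y z.1) N' :=
      (hω x y).comp contDiffOn_fst fun z hz => hz.1
    have h3 : ContDiffOn ℝ ∞ (fun z : Model m × ℝ => z.2) N' := contDiffOn_snd
    refine (((((h3.mul (h1.clm_apply (contDiffOn_const (c := x)))).mul
      (contDiffOn_const (c := b))).neg.add ((h3.mul (contDiffOn_const (c := a))).mul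
        (h1.clm_apply (contDiffOn_const (c := y))))).add ((h3.pow 2).mul h2))).congr
      fun z hz => ?_
    exact pullbackTwo_coneForm 𝒮 p hz.1.1 hz.2 x y a b
  have hKd : DifferentiableAt ℝ K c :=
    ((contDiffOn_clm_apply.2 fun x => contDiffOn_clm_apply.2 fun y => hKs x y).contDiffAt
      (hN'o.mem_nhds hc)).differentiableAt (by simp)
  have hline : ∀ u x y : Model m × ℝ,
      HasDerivAt (fun t : ℝ => K (c + t • u) x y) (fderiv ℝ K c u x y) 0 := by
    exact fun u x y => hasDerivAt_line_apply hKd u x y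
  have hηline : ∀ u x : Model m,
      HasDerivAt (fun t : ℝ => η (e p + t • u) x) (fderiv ℝ η (e p) u x) 0 := by
    intro u x
    have h3 : HasDerivAt (fun t : ℝ => η (e p + t • u)) (fderiv ℝ η (e p) u) 0 :=
      ((hη.contDiffAt (hNo.mem_nhds hmem)).differentiableAt (by simp)).hasFDerivAt.hasLineDerivAt u
    have h4 := h3.clm_apply (hasDerivAt_const 0 x)
    simpa using h4
  have hnear : ∀ u : Model m × ℝ, ∀ᶠ t : ℝ in 𝓝 0, c + t • u ∈ N' := by
    intro u
    have h1 : ContinuousAt (fun t : ℝ => c + t • u) 0 := by fun_prop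
    exact h1.eventually_mem (by simpa using hN'o.mem_nhds hc)
  -- The factor 2 is the derivative of r² at r = 1.
  have e1 : ∀ x y : Model m, fderiv ℝ K c (0, 1) (x, 0) (y, 0) = 2 * pullbackForm 𝒮 p x y (e p) := by
    intro x y
    refine (hline (0, 1) (x, 0) (y, 0)).unique ?_
    have h1 : HasDerivAt (fun t : ℝ => (1 + t) ^ 2 * pullbackForm 𝒮 p x y (e p))
        (2 * pullbackForm 𝒮 p x y (e p)) 0 := by
      have := (((hasDerivAt_id (0 : ℝ)).const_add 1).pow 2).mul_const (pullbackForm 𝒮 p x y (e p))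
      simpa using this
    refine h1.congr_of_eventuallyEq ?_
    filter_upwards [hnear (0, 1)] with t ht
    have h2 := pullbackTwo_coneForm 𝒮 p ht.1.1 ht.2 x y 0 0
    simpa [c] using h2
  have e2 : ∀ x y : Model m, fderiv ℝ K c (x, 0) (y, 0) (0, 1) = -fderiv ℝ η (e p) x y := by
    intro x y
    refine (hline (x, 0) (y, 0) (0, 1)).unique ?_
    refine (hηline x y).neg.congr_of_eventuallyEq ?_
    filter_upwards [hnear (x, 0)] with t ht
    have h2 := pullbackTwo_coneForm 𝒮 p ht.1.1 ht.2 y 0 0 1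
    have h3 : pullbackForm 𝒮 p y 0 (c + t • (x, (0 : ℝ))).1 = 0 := by
      simp only [pullbackForm, map_zero]
    rw [h3] at h2
    simpa [c] using h2
  have e3 : ∀ x y : Model m, fderiv ℝ K c (y, 0) (0, 1) (x, 0) = fderiv ℝ η (e p) y x := by
    intro x y
    refine (hline (y, 0) (0, 1) (x, 0)).unique ?_
    refine (hηline y x).congr_of_eventuallyEq ?_
    filter_upwards [hnear (y, 0)] with t ht
    have h2 := pullbackTwo_coneForm 𝒮 p ht.1.1 ht.2 0 x 1 0
    have h3 : pullbackForm 𝒮 p 0 x (c + t • (y, (0 : ℝ))).1 = 0 := by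
      simp only [pullbackForm, map_zero, _root_.zero_apply]
    rw [h3] at h2
    simpa [c] using h2
  let T : Model m × ℝ →L[ℝ] Model m × ℝ := chartDeriv (coneModel m) ((p, 1) : S × ℝ)
  have hT : ∀ (x : Model m) (a : ℝ), T (x, a) = (chartD p p x, a) := chartDeriv_cone p
  have hT0 : chartD p p (0 : Model m) = 0 := map_zero _
  have hcl : ∀ x y : Model m, fderiv ℝ K c (T (0, 1)) (T (x, 0)) (T (y, 0))
      + fderiv ℝ K c (T (x, 0)) (T (y, 0)) (T (0, 1))
      + fderiv ℝ K c (T (y, 0)) (T (0, 1)) (T (x, 0)) = 0 := fun x y =>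
    𝒮.closed p 1 one_pos ((0 : Model m), (1 : ℝ)) (x, (0 : ℝ)) (y, (0 : ℝ))
  have hcl' : ∀ x y : Model m, 2 * pullbackForm 𝒮 p (chartD p p x) (chartD p p y) (e p)
      + -fderiv ℝ η (e p) (chartD p p x) (chartD p p y)
      + fderiv ℝ η (e p) (chartD p p y) (chartD p p x) = 0 := by
    intro x y
    have h1 := hcl x y
    rw [hT, hT, hT, hT0, e1, e2, e3] at h1
    exact h1
  have h5 : kahlerForm 𝒮 p v w = fderiv ℝ η (e p) (chartD p p v) (chartD p p w)
      - fderiv ℝ η (e p) (chartD p p w) (chartD p p v) := rfl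
  have h6 : pullbackForm 𝒮 p (chartD p p v) (chartD p p w) (e p)
      = 𝒮.g.inner p (transverseJ 𝒮 p v) w := by
    have h7 : ∀ x : Tan m p, chartSymmDeriv (𝓡 (2 * m + 1)) p (e p) (chartD p p x)
      = (show Model m from x) := fun x => chartSymmD_chartD p (mem_chart_source _ _) x
    -- Transport along the propositional equality between p and its image under the chart and its
    -- inverse.
    have h8 : ∀ q : S, q = p → ∀ (V W : Tan m q) (V' W' : Tan m p),
        (show Model m from V) = V' → (show Model m from W) = W' →
        𝒮.g.inner q (transverseJ 𝒮 q V) W = 𝒮.g.inner p (transverseJ 𝒮 p V') W' := by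
      rintro q rfl V W V' W' h h'
      have h : V = V' := h
      have h' : W = W' := h'
      rw [h, h']
    exact h8 _ (e.left_inv (mem_chart_source _ _)) _ _ v w (h7 v) (h7 w)
  have h9 := hcl' v w
  rw [h6] at h9
  rw [h5]
  linarith

/-- The 2-form `dη` is invariant under the transverse complex structure. -/
theorem kahlerForm_transverseJ (p : S) (v w : Tan m p) :
    kahlerForm 𝒮 p (transverseJ 𝒮 p v) (transverseJ 𝒮 p w) = kahlerForm 𝒮 p v w := by
  have h1 : 𝒮.g.inner p (transverseJ 𝒮 p v) (reeb 𝒮 p) = 0 :=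
    (𝒮.g.symm p _ _).trans (contact_transverseJ 𝒮 p v)
  rw [kahlerForm_apply, kahlerForm_apply, g_transverseJ_left, transverseJ_transverseJ,
    map_add, map_neg, map_smul, h1]
  simp

/-- The value is 2 g(Φ v, Φ v), and Φ is injective on D because Φ² = -1 there. -/
theorem kahlerForm_pos (p : S) {v : Tan m p} (hv : contact 𝒮 p v = 0) (h0 : v ≠ 0) :
    0 < kahlerForm 𝒮 p v (transverseJ 𝒮 p v) := by
  rw [kahlerForm_apply]
  refine mul_pos two_pos (𝒮.g.pos p _ fun h => h0 ?_)
  have h1 := transverseJ_transverseJ 𝒮 p v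
  rw [h, map_zero, hv, zero_smul, add_zero] at h1
  exact neg_eq_zero.1 h1.symm

end KahlerForm

end Sasaki

end

/-! ### Basic functions and transverse (1,1)-forms in foliation charts -/

noncomputable section

namespace Sasaki

section BasicForms

variable {m : ℕ} {S : Type*} [TopologicalSpace S] [ChartedSpace (Model m) S]
  [IsManifold (𝓡 (2 * m + 1)) ∞ S] {𝒮 : SasakianStructure m S}

/-- Multiplication by `√-1` on the transverse part of `ℝ × ℂᵐ`. -/
def stdJ (m : ℕ) : CF m →L[ℝ] CF m :=
  (ContinuousLinearMap.inr ℝ ℝ (Fin m → ℂ)).comp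
    ((Complex.I • ContinuousLinearMap.id ℝ (Fin m → ℂ)).comp
      (ContinuousLinearMap.snd ℝ ℝ (Fin m → ℂ)))

theorem stdJ_apply (v : CF m) : stdJ m v = (0, Complex.I • v.2) := rfl

theorem stdJ_stdJ (v : CF m) : stdJ m (stdJ m v) = -(0, v.2) := by
  simp [stdJ_apply, smul_smul]

theorem stdJ_one_zero : stdJ m (1, 0) = 0 := by simp [stdJ_apply]

/-- The derivative along a direction in which a function is locally constant vanishes in that
direction. -/
theorem fderiv_fderiv_eq_zero_of_eqOn {E F : Type*} [NormedAddCommGroup E] [NormedSpace ℝ E]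
    [NormedAddCommGroup F] [NormedSpace ℝ F] {f : E → F} {U : Set E} (hU : IsOpen U)
    (hf : ContDiffOn ℝ ∞ f U) {e : E} (h : ∀ y ∈ U, fderiv ℝ f y e = 0) {y : E} (hy : y ∈ U) :
    fderiv ℝ (fderiv ℝ f) y e = 0 := by
  have hfy : ContDiffAt ℝ ∞ f y := hf.contDiffAt (hU.mem_nhds hy)
  have hd : DifferentiableAt ℝ (fderiv ℝ f) y :=
    (hfy.fderiv_right (m := 1) (by norm_cast)).differentiableAt (by simp)
  have hs : IsSymmSndFDerivAt ℝ f y := hfy.isSymmSndFDerivAt (by simp; norm_cast)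
  have h1 : HasFDerivAt (fun z => fderiv ℝ f z e) ((fderiv ℝ (fderiv ℝ f) y).flip e) y := by
    simpa using hd.hasFDerivAt.clm_apply (hasFDerivAt_const e y)
  have h2 : HasFDerivAt (fun z => fderiv ℝ f z e) (0 : E →L[ℝ] F) y :=
    (hasFDerivAt_const (0 : F) y).congr_of_eventuallyEq
      (by filter_upwards [hU.mem_nhds hy] with z hz using h z hz)
  have h3 := h1.unique h2
  ext v
  rw [hs e v]
  exact congrArg (fun L : E →L[ℝ] F => L v) h3

namespace FoliationChart

variable (χ : FoliationChart 𝒮)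

/-- A function in a foliation chart. -/
def pull0 (u : S → ℝ) (y : CF m) : ℝ := u (χ.chart.symm y)

/-- A function is smooth and basic on the domain of a foliation chart. -/
structure IsBasicOn (u : S → ℝ) : Prop where
  smooth : ContDiffOn ℝ ∞ (χ.pull0 u) χ.chart.target
  basic : ∀ y ∈ χ.chart.target, fderiv ℝ (χ.pull0 u) y (1, 0) = 0

theorem contDiffOn_pull0 {u : S → ℝ} (hu : ContMDiff (𝓡 (2 * m + 1)) 𝓘(ℝ, ℝ) ∞ u) :
    ContDiffOn ℝ ∞ (χ.pull0 u) χ.chart.target :=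
  contMDiffOn_iff_contDiffOn.1 (hu.comp_contMDiffOn χ.smooth_symm)

theorem diff_inv {u : S → ℝ} {y : CF m} (hy : y ∈ χ.chart.target)
    (hu : DifferentiableAt ℝ (χ.pull0 u) y) (v : CF m) :
    diff u (χ.chart.symm y) (χ.inv (χ.chart.symm y) v) = fderiv ℝ (χ.pull0 u) y v := by
  have hs := χ.chart.map_target hy
  have hy' := χ.chart.right_inv hy
  have h1 : u =ᶠ[𝓝 (χ.chart.symm y)] (χ.pull0 u) ∘ χ.chart := by
    filter_upwards [χ.chart.open_source.mem_nhds hs] with q hq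
    simp only [Function.comp, pull0, χ.chart.left_inv hq]
  have h2 : HasMFDerivAt (𝓡 (2 * m + 1)) 𝓘(ℝ, CF m) χ.chart (χ.chart.symm y)
      (χ.der (χ.chart.symm y)) :=
    (χ.mdifferentiable_chart.mdifferentiableAt hs).hasMFDerivAt
  have h3 : HasFDerivAt (χ.pull0 u) (fderiv ℝ (χ.pull0 u) y) (χ.chart (χ.chart.symm y)) := by
    rw [hy']; exact hu.hasFDerivAt
  have h4 : HasMFDerivAt (𝓡 (2 * m + 1)) 𝓘(ℝ, ℝ) ((χ.pull0 u) ∘ χ.chart) (χ.chart.symm y)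
      ((fderiv ℝ (χ.pull0 u) y).comp (χ.der (χ.chart.symm y))) :=
    h3.hasMFDerivAt.comp _ h2
  have h5 : diff u (χ.chart.symm y)
      = (fderiv ℝ (χ.pull0 u) y).comp (χ.der (χ.chart.symm y)) := by
    rw [diff, h1.mfderiv_eq]
    exact h4.mfderiv
  rw [h5, ContinuousLinearMap.comp_apply, χ.der_inv hs]

theorem pull1_diff {u : S → ℝ} (hu : ContDiffOn ℝ ∞ (χ.pull0 u) χ.chart.target) {y : CF m}
    (hy : y ∈ χ.chart.target) : χ.pull1 (diff u) y = fderiv ℝ (χ.pull0 u) y := by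
  refine ContinuousLinearMap.ext fun v => ?_
  exact χ.diff_inv hy ((hu.contDiffAt (χ.chart.open_target.mem_nhds hy)).differentiableAt
    (by simp)) v

theorem isBasicOn_of_isBasicFunction {u : S → ℝ} (hu : IsBasicFunction 𝒮 u) : χ.IsBasicOn u := by
  have h1 := χ.contDiffOn_pull0 hu.1
  refine ⟨h1, fun y hy => ?_⟩
  rw [← χ.pull1_diff h1 hy, pull1_apply, χ.inv_one_zero (χ.chart.map_target hy), hu.2]

variable {χ}

/-- The leaf component of Φ, which involves η, is invisible to a basic function. Hence d^c has
constant coefficients in a foliation chart. -/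
theorem IsBasicOn.pull1_dcB {u : S → ℝ} (hu : χ.IsBasicOn u) {y : CF m}
    (hy : y ∈ χ.chart.target) :
    χ.pull1 (dcB 𝒮 u) y = (-(1 / 2) : ℝ) • (fderiv ℝ (χ.pull0 u) y).comp (stdJ m) := by
  refine ContinuousLinearMap.ext fun v => ?_
  have hd : DifferentiableAt ℝ (χ.pull0 u) y :=
    (hu.smooth.contDiffAt (χ.chart.open_target.mem_nhds hy)).differentiableAt (by simp)
  have h1 : χ.pull1 (dcB 𝒮 u) y v = (-(1 / 2) : ℝ) • diff u (χ.chart.symm y)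
    (transverseJ 𝒮 (χ.chart.symm y) (χ.inv (χ.chart.symm y) v)) := rfl
  rw [h1, χ.transverseJ_inv hy, χ.diff_inv hy hd]
  have h2 : ((-χ.pull1 (contact 𝒮) y (0, Complex.I • v.2), Complex.I • v.2) : CF m)
      = -χ.pull1 (contact 𝒮) y (0, Complex.I • v.2) • (1, 0) + stdJ m v := by
    refine Prod.ext ?_ ?_ <;> simp [stdJ_apply]
  rw [h2, map_add, map_smul, hu.basic y hy, smul_zero, zero_add]
  rfl

theorem IsBasicOn.fderiv_pull1_dcB {u : S → ℝ} (hu : χ.IsBasicOn u) {y : CF m}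
    (hy : y ∈ χ.chart.target) (v w : CF m) :
    fderiv ℝ (χ.pull1 (dcB 𝒮 u)) y v w
      = -(1 / 2) * fderiv ℝ (fderiv ℝ (χ.pull0 u)) y v (stdJ m w) := by
  have hd : DifferentiableAt ℝ (fderiv ℝ (χ.pull0 u)) y :=
    ((hu.smooth.contDiffAt (χ.chart.open_target.mem_nhds hy)).fderiv_right (m := 1)
      (by norm_cast)).differentiableAt (by simp)
  have h1 : χ.pull1 (dcB 𝒮 u) =ᶠ[𝓝 y]
      fun y => (-(1 / 2) : ℝ) • (fderiv ℝ (χ.pull0 u) y).comp (stdJ m) := by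
    filter_upwards [χ.chart.open_target.mem_nhds hy] with z hz using hu.pull1_dcB hz
  have h2 := (hd.hasFDerivAt.clm_comp (hasFDerivAt_const (stdJ m) y)).const_smul (-(1 / 2) : ℝ)
  rw [(h2.congr_of_eventuallyEq h1).fderiv]
  simp

theorem IsBasicOn.contDiffOn_pull1_dcB {u : S → ℝ} (hu : χ.IsBasicOn u) :
    ContDiffOn ℝ ∞ (χ.pull1 (dcB 𝒮 u)) χ.chart.target := by
  have h1 := hu.smooth.fderiv_of_isOpen (m := ∞) χ.chart.open_target (by simp)
  exact ((h1.clm_comp contDiffOn_const).const_smul (-(1 / 2) : ℝ)).congr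
    fun y hy => hu.pull1_dcB hy

variable (χ)

/-- A 1-form which is smooth on the domain of a foliation chart, whose coefficients do not depend on
the leaf coordinate, and whose exterior derivative is a transverse (1,1)-form. -/
structure IsTypeOneOneOn (α : ∀ p : S, Tan m p →L[ℝ] ℝ) : Prop where
  smooth : ContDiffOn ℝ ∞ (χ.pull1 α) χ.chart.target
  fderiv_left : ∀ y ∈ χ.chart.target, fderiv ℝ (χ.pull1 α) y (1, 0) = 0
  fderiv_right : ∀ y ∈ χ.chart.target, ∀ v, fderiv ℝ (χ.pull1 α) y v (1, 0) = 0
  skew_stdJ : ∀ y ∈ χ.chart.target, ∀ v w,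
    skew (fderiv ℝ (χ.pull1 α) y) (stdJ m v) (stdJ m w) = skew (fderiv ℝ (χ.pull1 α) y) v w

variable {χ}

theorem skew_apply (D : CF m →L[ℝ] CF m →L[ℝ] ℝ) (v w : CF m) : skew D v w = D v w - D w v := rfl

theorem IsTypeOneOneOn.differentiableAt {α : ∀ p : S, Tan m p →L[ℝ] ℝ} (h : χ.IsTypeOneOneOn α)
    {y : CF m} (hy : y ∈ χ.chart.target) : DifferentiableAt ℝ (χ.pull1 α) y :=
  (h.smooth.contDiffAt (χ.chart.open_target.mem_nhds hy)).differentiableAt (by simp)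

/-- The form dd^c u is built from the Hessian of u, which has no leaf component; its invariance is
the symmetry of the Hessian together with the square of `stdJ` being -1 on the transverse part. -/
theorem IsBasicOn.isTypeOneOneOn {u : S → ℝ} (hu : χ.IsBasicOn u) :
    χ.IsTypeOneOneOn (dcB 𝒮 u) := by
  have hz : ∀ y ∈ χ.chart.target, fderiv ℝ (fderiv ℝ (χ.pull0 u)) y (1, 0) = 0 := fun y hy =>
    fderiv_fderiv_eq_zero_of_eqOn χ.chart.open_target hu.smooth hu.basic hy
  have hs : ∀ y ∈ χ.chart.target, IsSymmSndFDerivAt ℝ (χ.pull0 u) y := fun y hy =>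
    (hu.smooth.contDiffAt (χ.chart.open_target.mem_nhds hy)).isSymmSndFDerivAt
      (by simp; norm_cast)
  refine ⟨hu.contDiffOn_pull1_dcB, fun y hy => ?_, fun y hy v => ?_, fun y hy v w => ?_⟩
  · refine ContinuousLinearMap.ext fun w => ?_
    rw [hu.fderiv_pull1_dcB hy, hz y hy]
    simp
  · rw [hu.fderiv_pull1_dcB hy, stdJ_one_zero, map_zero, mul_zero]
  · have h1 : ∀ v : CF m, v = v.1 • (1, 0) + (0, v.2) := fun v => by
      refine Prod.ext ?_ ?_ <;> simp
    have h2 : ∀ a b : CF m, fderiv ℝ (fderiv ℝ (χ.pull0 u)) y a (0, b.2)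
        = fderiv ℝ (fderiv ℝ (χ.pull0 u)) y a b := fun a b => by
      conv_rhs => rw [h1 b, map_add, map_smul, hs y hy a (1, 0), hz y hy]
      simp
    rw [skew_apply, skew_apply, hu.fderiv_pull1_dcB hy, hu.fderiv_pull1_dcB hy,
      hu.fderiv_pull1_dcB hy, hu.fderiv_pull1_dcB hy, stdJ_stdJ, stdJ_stdJ, map_neg, map_neg,
      h2, h2, hs y hy (stdJ m v) w, hs y hy (stdJ m w) v]
    ring

/-- As Φ ξ = 0, invariance of dα forces i_ξ dα = 0; with α(ξ) constant this says that the
coefficients of α do not depend on the leaf coordinate. It serves for η (constant 1) and for the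
primitive β of the Ricci difference (constant 0). -/
theorem isTypeOneOneOn_of_dOne {α : ∀ p : S, Tan m p →L[ℝ] ℝ}
    (hs : ContDiffOn ℝ ∞ (χ.pull1 α) χ.chart.target) (c : ℝ) (hc : ∀ p, α p (reeb 𝒮 p) = c)
    (h : ∀ p v w, dOne (𝓡 (2 * m + 1)) α p (transverseJ 𝒮 p v) (transverseJ 𝒮 p w)
      = dOne (𝓡 (2 * m + 1)) α p v w) : χ.IsTypeOneOneOn α := by
  have hd : ∀ y ∈ χ.chart.target, DifferentiableAt ℝ (χ.pull1 α) y := fun y hy =>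
    (hs.contDiffAt (χ.chart.open_target.mem_nhds hy)).differentiableAt (by simp)
  have hr : ∀ y ∈ χ.chart.target, ∀ v, fderiv ℝ (χ.pull1 α) y v (1, 0) = 0 := by
    intro y hy v
    have h1 := hasFDerivAt_apply_const (hd y hy) (1, 0)
    have h2 : HasFDerivAt (fun z => χ.pull1 α z (1, 0)) (0 : CF m →L[ℝ] ℝ) y := by
      refine (hasFDerivAt_const c y).congr_of_eventuallyEq ?_
      filter_upwards [χ.chart.open_target.mem_nhds hy] with z hz
      rw [pull1_apply, χ.inv_one_zero (χ.chart.map_target hz), hc]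
    exact congrArg (fun L : CF m →L[ℝ] ℝ => L v) (h1.unique h2)
  have hskew : ∀ y ∈ χ.chart.target, ∀ v w,
      skew (fderiv ℝ (χ.pull1 α) y) (-χ.pull1 (contact 𝒮) y (stdJ m v), Complex.I • v.2)
        (-χ.pull1 (contact 𝒮) y (stdJ m w), Complex.I • w.2)
      = skew (fderiv ℝ (χ.pull1 α) y) v w := by
    intro y hy v w
    have h1 := h (χ.chart.symm y) (χ.inv (χ.chart.symm y) v) (χ.inv (χ.chart.symm y) w)
    rw [χ.transverseJ_inv hy, χ.transverseJ_inv hy, χ.dOne_inv hy (hd y hy),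
      χ.dOne_inv hy (hd y hy)] at h1
    exact h1
  have hl : ∀ y ∈ χ.chart.target, fderiv ℝ (χ.pull1 α) y (1, 0) = 0 := by
    intro y hy
    refine ContinuousLinearMap.ext fun w => ?_
    have h1 := hskew y hy (1, 0) w
    have h0 : ((-χ.pull1 (contact 𝒮) y (stdJ m (1, 0)), Complex.I • ((1, 0) : CF m).2) : CF m)
        = 0 := by rw [stdJ_one_zero]; simp
    rw [h0, map_zero, skew_apply, hr y hy, sub_zero] at h1
    exact h1.symm
  refine ⟨hs, hl, hr, fun y hy v w => ?_⟩
  rw [← hskew y hy v w]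
  have h1 : ∀ (c : ℝ) (v : CF m), ((-c, Complex.I • v.2) : CF m) = -c • (1, 0) + stdJ m v := by
    intro c v
    refine Prod.ext ?_ ?_ <;> simp [stdJ_apply]
  rw [h1, h1, skew_apply, skew_apply]
  simp only [map_add, map_smul, hl y hy, hr y hy, _root_.add_apply, smul_zero, zero_add]

theorem isTypeOneOneOn_contact : χ.IsTypeOneOneOn (contact 𝒮) :=
  isTypeOneOneOn_of_dOne χ.contDiffOn_pull1_contact 1 (contact_reeb 𝒮)
    (kahlerForm_transverseJ 𝒮)

theorem IsTypeOneOneOn.add {α β : ∀ p : S, Tan m p →L[ℝ] ℝ} (hα : χ.IsTypeOneOneOn α)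
    (hβ : χ.IsTypeOneOneOn β) : χ.IsTypeOneOneOn (fun p => α p + β p) := by
  have h1 : χ.pull1 (fun p => α p + β p) = χ.pull1 α + χ.pull1 β := rfl
  have h2 : ∀ y ∈ χ.chart.target, fderiv ℝ (χ.pull1 (fun p => α p + β p)) y
      = fderiv ℝ (χ.pull1 α) y + fderiv ℝ (χ.pull1 β) y := fun y hy => by
    rw [h1, fderiv_add (hα.differentiableAt hy) (hβ.differentiableAt hy)]
  refine ⟨hα.smooth.add hβ.smooth, fun y hy => ?_, fun y hy v => ?_, fun y hy v w => ?_⟩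
  · rw [h2 y hy, _root_.add_apply, hα.fderiv_left y hy, hβ.fderiv_left y hy, add_zero]
  · rw [h2 y hy, _root_.add_apply, _root_.add_apply, hα.fderiv_right y hy, hβ.fderiv_right y hy,
      add_zero]
  · have h3 := hα.skew_stdJ y hy v w
    have h4 := hβ.skew_stdJ y hy v w
    rw [skew_apply, skew_apply] at h3 h4 ⊢
    simp only [h2 y hy, _root_.add_apply]
    linarith

theorem IsTypeOneOneOn.const_smul {α : ∀ p : S, Tan m p →L[ℝ] ℝ} (hα : χ.IsTypeOneOneOn α)
    (c : ℝ) : χ.IsTypeOneOneOn (fun p => c • α p) := by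
  have h1 : χ.pull1 (fun p => c • α p) = c • χ.pull1 α := rfl
  have h2 : ∀ y ∈ χ.chart.target, fderiv ℝ (χ.pull1 (fun p => c • α p)) y
      = c • fderiv ℝ (χ.pull1 α) y := fun y hy => by
    rw [h1, fderiv_const_smul (hα.differentiableAt hy)]
  refine ⟨hα.smooth.const_smul c, fun y hy => ?_, fun y hy v => ?_, fun y hy v w => ?_⟩
  · rw [h2 y hy, _root_.smul_apply, hα.fderiv_left y hy, smul_zero]
  · rw [h2 y hy, _root_.smul_apply, _root_.smul_apply, hα.fderiv_right y hy, smul_zero]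
  · have h3 := hα.skew_stdJ y hy v w
    rw [skew_apply, skew_apply] at h3 ⊢
    simp only [h2 y hy, _root_.smul_apply, smul_eq_mul]
    linear_combination c * h3

end FoliationChart

/-- Global 1-forms which are of type (1,1) in all foliation charts. -/
def IsTypeOneOne (𝒮 : SasakianStructure m S) (α : ∀ p : S, Tan m p →L[ℝ] ℝ) : Prop :=
  ∀ χ : FoliationChart 𝒮, χ.IsTypeOneOneOn α

/-- A 2-tensor which is invariant under the transverse complex structure. -/
def IsInvariantAt (𝒮 : SasakianStructure m S) (p : S) (κ : Tan m p →L[ℝ] Tan m p →L[ℝ] ℝ) : Prop :=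
  ∀ v w, κ (transverseJ 𝒮 p v) (transverseJ 𝒮 p w) = κ v w

theorem FoliationChart.IsTypeOneOneOn.isInvariantAt {χ : FoliationChart 𝒮}
    {α : ∀ p : S, Tan m p →L[ℝ] ℝ}
    (h : χ.IsTypeOneOneOn α) {p : S} (hp : p ∈ χ.chart.source) :
    IsInvariantAt 𝒮 p (dOne (𝓡 (2 * m + 1)) α p) := by
  obtain ⟨y, hy, rfl⟩ := χ.exists_symm_eq hp
  intro v w
  rw [← χ.inv_der hp v, ← χ.inv_der hp w, χ.transverseJ_inv hy, χ.transverseJ_inv hy,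
    χ.dOne_inv hy (h.differentiableAt hy), χ.dOne_inv hy (h.differentiableAt hy)]
  refine Eq.trans ?_ (h.skew_stdJ y hy _ _)
  have h1 : ∀ (c : ℝ) (v : CF m), ((-c, Complex.I • v.2) : CF m) = -c • (1, 0) + stdJ m v := by
    intro c v
    refine Prod.ext ?_ ?_ <;> simp [stdJ_apply]
  rw [h1, h1, FoliationChart.skew_apply, FoliationChart.skew_apply]
  simp only [map_add, map_smul, h.fderiv_left y hy, h.fderiv_right y hy, _root_.add_apply,
    _root_.zero_apply, smul_zero, zero_add, add_zero]

theorem IsTypeOneOne.isInvariantAt {α : ∀ p : S, Tan m p →L[ℝ] ℝ} (h : IsTypeOneOne 𝒮 α) (p : S) :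
    IsInvariantAt 𝒮 p (dOne (𝓡 (2 * m + 1)) α p) := by
  obtain ⟨χ, hp⟩ := exists_foliationChart 𝒮 p
  exact (h χ).isInvariantAt hp

theorem dOne_add {α β : ∀ p : S, Tan m p →L[ℝ] ℝ} {χ : FoliationChart 𝒮} {p : S}
    (hp : p ∈ χ.chart.source) (hα : DifferentiableAt ℝ (χ.pull1 α) (χ.chart p))
    (hβ : DifferentiableAt ℝ (χ.pull1 β) (χ.chart p)) :
    dOne (𝓡 (2 * m + 1)) (fun p => α p + β p) p
      = dOne (𝓡 (2 * m + 1)) α p + dOne (𝓡 (2 * m + 1)) β p := by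
  have h1 : χ.pull1 (fun p => α p + β p) = χ.pull1 α + χ.pull1 β := rfl
  ext v w
  rw [χ.dOne_eq hp (by rw [h1]; exact hα.add hβ), h1, fderiv_add hα hβ]
  rw [_root_.add_apply, _root_.add_apply, χ.dOne_eq hp hα, χ.dOne_eq hp hβ]
  simp only [FoliationChart.skew_apply, _root_.add_apply]
  ring

theorem dOne_const_smul {α : ∀ p : S, Tan m p →L[ℝ] ℝ} {χ : FoliationChart 𝒮} {p : S}
    (hp : p ∈ χ.chart.source) (hα : DifferentiableAt ℝ (χ.pull1 α) (χ.chart p)) (c : ℝ) :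
    dOne (𝓡 (2 * m + 1)) (fun p => c • α p) p = c • dOne (𝓡 (2 * m + 1)) α p := by
  have h1 : χ.pull1 (fun p => c • α p) = c • χ.pull1 α := rfl
  ext v w
  rw [χ.dOne_eq hp (by rw [h1]; exact hα.const_smul c), h1, fderiv_const_smul hα]
  rw [_root_.smul_apply, _root_.smul_apply, χ.dOne_eq hp hα]
  simp only [FoliationChart.skew_apply, _root_.smul_apply, smul_eq_mul]
  ring

theorem dOne_alternating {α : ∀ p : S, Tan m p →L[ℝ] ℝ} (p : S) (v w : Tan m p) :
    dOne (𝓡 (2 * m + 1)) α p v w = -dOne (𝓡 (2 * m + 1)) α p w v := by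
  have h : ∀ v w : Tan m p, dOne (𝓡 (2 * m + 1)) α p v w
    = fderiv ℝ (pullbackOne (𝓡 (2 * m + 1)) α p) (extChartAt (𝓡 (2 * m + 1)) p p)
        (chartDeriv (𝓡 (2 * m + 1)) p v) (chartDeriv (𝓡 (2 * m + 1)) p w)
      - fderiv ℝ (pullbackOne (𝓡 (2 * m + 1)) α p) (extChartAt (𝓡 (2 * m + 1)) p p)
        (chartDeriv (𝓡 (2 * m + 1)) p w) (chartDeriv (𝓡 (2 * m + 1)) p v) := fun _ _ => rfl
  rw [h, h, neg_sub]

theorem IsTypeOneOne.dOne_add {α β : ∀ p : S, Tan m p →L[ℝ] ℝ} (hα : IsTypeOneOne 𝒮 α)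
    (hβ : IsTypeOneOne 𝒮 β) (p : S) :
    dOne (𝓡 (2 * m + 1)) (fun p => α p + β p) p
      = dOne (𝓡 (2 * m + 1)) α p + dOne (𝓡 (2 * m + 1)) β p := by
  obtain ⟨χ, hp⟩ := exists_foliationChart 𝒮 p
  exact Sasaki.dOne_add hp ((hα χ).differentiableAt (χ.chart.map_source hp))
    ((hβ χ).differentiableAt (χ.chart.map_source hp))

theorem IsTypeOneOne.dOne_const_smul {α : ∀ p : S, Tan m p →L[ℝ] ℝ} (hα : IsTypeOneOne 𝒮 α)
    (c : ℝ) (p : S) :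
    dOne (𝓡 (2 * m + 1)) (fun p => c • α p) p = c • dOne (𝓡 (2 * m + 1)) α p := by
  obtain ⟨χ, hp⟩ := exists_foliationChart 𝒮 p
  exact Sasaki.dOne_const_smul hp ((hα χ).differentiableAt (χ.chart.map_source hp)) c

theorem isTypeOneOne_contact : IsTypeOneOne 𝒮 (contact 𝒮) := fun _ =>
  FoliationChart.isTypeOneOneOn_contact

theorem IsBasicFunction.isTypeOneOne {u : S → ℝ} (hu : IsBasicFunction 𝒮 u) :
    IsTypeOneOne 𝒮 (dcB 𝒮 u) := fun χ => (χ.isBasicOn_of_isBasicFunction hu).isTypeOneOneOn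

theorem IsTypeOneOne.add {α β : ∀ p : S, Tan m p →L[ℝ] ℝ} (hα : IsTypeOneOne 𝒮 α)
    (hβ : IsTypeOneOne 𝒮 β) : IsTypeOneOne 𝒮 (fun p => α p + β p) := fun χ => (hα χ).add (hβ χ)

theorem IsTypeOneOne.const_smul {α : ∀ p : S, Tan m p →L[ℝ] ℝ} (hα : IsTypeOneOne 𝒮 α) (c : ℝ) :
    IsTypeOneOne 𝒮 (fun p => c • α p) := fun χ => (hα χ).const_smul c

theorem kahlerFormOf_eq {φ : S → ℝ} (hφ : IsBasicFunction 𝒮 φ) (p : S) :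
    kahlerFormOf 𝒮 φ p = kahlerForm 𝒮 p + ddcB 𝒮 φ p :=
  isTypeOneOne_contact.dOne_add hφ.isTypeOneOne p

end BasicForms

end Sasaki

end

noncomputable section

namespace Sasaki

/-! ### Derivatives of determinants -/

section Determinant

variable {m : ℕ}

/-- The determinant as a continuous real multilinear map in the rows. -/
def detRow (m : ℕ) : ContinuousMultilinearMap ℝ (fun _ : Fin m => Fin m → ℂ) ℂ where
  toMultilinearMap := (Matrix.detRowAlternating (R := ℂ)
    (n := Fin m)).toMultilinearMap.restrictScalars ℝ
  cont := by
    change Continuous fun M : Matrix (Fin m) (Fin m) ℂ => M.det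
    exact continuous_id.matrix_det

variable {E : Type*} [NormedAddCommGroup E] [NormedSpace ℝ E]

theorem hasFDerivAt_det {M : E → Matrix (Fin m) (Fin m) ℂ} {y : E}
    (hM : ∀ i j, DifferentiableAt ℝ (fun z => M z i j) y) :
    ∃ L : E →L[ℝ] ℂ, HasFDerivAt (fun z => (M z).det) L y ∧
      ∀ v, L v = ∑ i, ((M y).updateRow i fun j => fderiv ℝ (fun z => M z i j) y v).det := by
  have h : ∀ i, HasFDerivAt (fun z => M z i)
      (ContinuousLinearMap.pi fun j => fderiv ℝ (fun z => M z i j) y) y := fun i =>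
    hasFDerivAt_pi.2 fun j => (hM i j).hasFDerivAt
  refine ⟨_, HasFDerivAt.multilinear_comp (f := detRow m) h, fun v => ?_⟩
  rw [_root_.sum_apply]
  refine Finset.sum_congr rfl fun i _ => ?_
  rfl

theorem fderiv_det {M : E → Matrix (Fin m) (Fin m) ℂ} {y : E}
    (hM : ∀ i j, DifferentiableAt ℝ (fun z => M z i j) y) (v : E) :
    fderiv ℝ (fun z => (M z).det) y v
      = ∑ i, ((M y).updateRow i fun j => fderiv ℝ (fun z => M z i j) y v).det := by
  obtain ⟨L, h1, h2⟩ := hasFDerivAt_det hM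
  rw [h1.fderiv, h2]

theorem contDiffOn_det {M : E → Matrix (Fin m) (Fin m) ℂ} {U : Set E}
    (hM : ∀ i j, ContDiffOn ℝ ∞ (fun z => M z i j) U) :
    ContDiffOn ℝ ∞ (fun z => (M z).det) U := by
  have h : ContDiffOn ℝ ∞ (fun z i => M z i) U := contDiffOn_pi.2 fun i => contDiffOn_pi.2 (hM i)
  exact (detRow m).contDiff.comp_contDiffOn h

/-- Cofactor expansion along each replaced row. The left side is the derivative of the determinant,
the right side is the form in which a divergence can be recognized. -/
theorem trace_adjugate_mul (H N : Matrix (Fin m) (Fin m) ℂ) :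
    (H.adjugate * N).trace = ∑ i, (H.updateRow i (N i)).det := by
  have h : ∀ i, (H.updateRow i (N i)).det = ∑ j, H.adjugate j i * N i j := fun i => by
    rw [← Matrix.cramer_transpose_apply, Matrix.cramer_eq_adjugate_mulVec,
      ← Matrix.adjugate_transpose]
    simp [Matrix.mulVec, dotProduct]
  simp only [h, Matrix.trace, Matrix.diag, Matrix.mul_apply]
  exact Finset.sum_comm

theorem det_updateRow_updateRow_comm (H : Matrix (Fin m) (Fin m) ℂ) (b x : Fin m → ℂ) {i k : Fin m}
    (h : i ≠ k) :
    ((H.updateRow i b).updateRow k x).det = -((H.updateRow k b).updateRow i x).det := by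
  have h1 : (H.updateRow k b).updateRow i x
      = ((H.updateRow i b).updateRow k x).submatrix (Equiv.swap i k) id := by
    ext r c
    rw [Matrix.submatrix_apply, id]
    by_cases hi : r = i
    · subst hi
      simp [Matrix.updateRow_apply]
    · by_cases hk : r = k
      · subst hk
        simp [Matrix.updateRow_apply, hi, h]
      · rw [Equiv.swap_apply_of_ne_of_ne hi hk]
        simp [Matrix.updateRow_apply, hi, hk]
  rw [h1, Matrix.det_permute, Equiv.Perm.sign_swap h]
  simp

/-- The terms (i, k) and (k, i) differ by an exchange of two rows, because X is symmetric, so they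
cancel. -/
theorem sum_det_updateRow_updateRow_eq_zero (H : Matrix (Fin m) (Fin m) ℂ) (b : Fin m → ℂ)
    (X : Fin m → Fin m → Fin m → ℂ) (hX : ∀ i k, X i k = X k i) :
    ∑ i, ∑ k, (if i = k then 0 else ((H.updateRow i b).updateRow k (X i k)).det) = 0 := by
  set G : Fin m → Fin m → ℂ := fun i k =>
    if i = k then 0 else ((H.updateRow i b).updateRow k (X i k)).det with hG
  have h1 : ∀ i k, G i k = -G k i := fun i k => by
    by_cases h : i = k
    · simp [hG, h]
    · simp only [hG, h, Ne.symm h, if_false, hX k i]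
      exact det_updateRow_updateRow_comm H b _ h
  have h2 : ∑ i, ∑ k, G i k = -∑ i, ∑ k, G i k := by
    calc ∑ i, ∑ k, G i k = ∑ i, ∑ k, -G k i := by
          exact Finset.sum_congr rfl fun i _ => Finset.sum_congr rfl fun k _ => h1 i k
      _ = -∑ i, ∑ k, G k i := by simp only [Finset.sum_neg_distrib]
      _ = -∑ i, ∑ k, G i k := by rw [Finset.sum_comm]
  exact self_eq_neg.1 h2

/-- The adjugate of a Hermitian matrix is Hermitian, so N and its conjugate transpose contribute
conjugate traces. -/
theorem trace_adjugate_mul_add_conjTranspose {H : Matrix (Fin m) (Fin m) ℂ} (hH : H.IsHermitian)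
    (N : Matrix (Fin m) (Fin m) ℂ) :
    (H.adjugate * (N + N.conjTranspose)).trace.re = 2 * (H.adjugate * N).trace.re := by
  have h1 : H.adjugate.conjTranspose = H.adjugate := by
    rw [Matrix.adjugate_conjTranspose, hH.eq]
  have h2 : (H.adjugate * N.conjTranspose).trace = star (H.adjugate * N).trace := by
    rw [← Matrix.trace_conjTranspose, Matrix.conjTranspose_mul, h1, Matrix.trace_mul_comm]
  rw [mul_add, Matrix.trace_add, h2, Complex.add_re]
  simp
  ring

end Determinant

/-! ### Integration by parts in a foliation chart -/

section Local

variable {m : ℕ}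

/-- The horizontal lift `(-a (0, v), v)` of `v`. -/
def horLift (a : CF m →L[ℝ] ℝ) (v : Fin m → ℂ) : CF m := (-a (0, v), v)

theorem horLift_eq (a : CF m →L[ℝ] ℝ) (v : Fin m → ℂ) :
    horLift a v = -a (0, v) • (1, 0) + (0, v) := by
  refine Prod.ext ?_ ?_ <;> simp [horLift]

/-- The derivative along the horizontal lift of `∂/∂zⁱ`. -/
def dz (a : CF m → CF m →L[ℝ] ℝ) (i : Fin m) (F : CF m → ℂ) (y : CF m) : ℂ :=
  (1 / 2 : ℂ) * (fderiv ℝ F y (horLift (a y) (Pi.single i 1))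
    - Complex.I * fderiv ℝ F y (horLift (a y) (Pi.single i Complex.I)))

theorem dz_det (a : CF m → CF m →L[ℝ] ℝ) (i : Fin m) {M : CF m → Matrix (Fin m) (Fin m) ℂ}
    {y : CF m} (hM : ∀ i j, DifferentiableAt ℝ (fun z => M z i j) y) :
    dz a i (fun z => (M z).det) y
      = ∑ k, ((M y).updateRow k fun j => dz a i (fun z => M z k j) y).det := by
  rw [dz, fderiv_det hM, fderiv_det hM, Finset.mul_sum (a := Complex.I), ← Finset.sum_sub_distrib,
    Finset.mul_sum]
  refine Finset.sum_congr rfl fun k _ => ?_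
  rw [← Matrix.det_updateRow_smul, sub_eq_add_neg, ← neg_one_mul, ← Matrix.det_updateRow_smul,
    ← Matrix.det_updateRow_add, ← Matrix.det_updateRow_smul]
  congr 2
  ext j
  simp [dz]
  ring

/-- For a matrix of functions whose derivatives are symmetric, the divergence of the cofactors
vanishes. -/
theorem sum_det_updateRow_dz (a : CF m → CF m →L[ℝ] ℝ) {H : CF m → Matrix (Fin m) (Fin m) ℂ}
    {b : CF m → Fin m → ℂ} {y : CF m} (hH : ∀ i j, DifferentiableAt ℝ (fun z => H z i j) y)
    (hb : ∀ j, DifferentiableAt ℝ (fun z => b z j) y)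
    (hsymm : ∀ i k j, dz a i (fun z => H z k j) y = dz a k (fun z => H z i j) y) :
    ∑ i, ((H y).updateRow i fun j => dz a i (fun z => b z j) y).det
      = ∑ i, dz a i (fun z => ((H z).updateRow i (b z)).det) y := by
  -- Leibniz rule: the derivative falls either on the inserted row b or on another row k. The terms
  -- of the second kind cancel by the symmetry of the derivatives of H.
  have h1 : ∀ i, dz a i (fun z => ((H z).updateRow i (b z)).det) y
      = ((H y).updateRow i fun j => dz a i (fun z => b z j) y).det
        + ∑ k, (if i = k then 0 else (((H y).updateRow i (b y)).updateRow k
          fun j => dz a i (fun z => H z k j) y).det) := by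
    intro i
    rw [dz_det a i (M := fun z => (H z).updateRow i (b z)) (fun r j => by
      by_cases hr : r = i
      · subst hr
        simpa using hb j
      · simpa [Matrix.updateRow_ne hr] using hH r j)]
    have h2 : ∀ k, (((H y).updateRow i (b y)).updateRow k
        fun j => dz a i (fun z => ((H z).updateRow i (b z)) k j) y).det
        = (if k = i then ((H y).updateRow i fun j => dz a i (fun z => b z j) y).det else 0)
          + (if i = k then 0 else (((H y).updateRow i (b y)).updateRow k
            fun j => dz a i (fun z => H z k j) y).det) := by
      intro k
      by_cases hk : k = i
      · subst hk
        simp [Matrix.updateRow_idem]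
      · simp [hk, Ne.symm hk, Matrix.updateRow_ne hk]
    simp only [h2]
    rw [Finset.sum_add_distrib, Finset.sum_ite_eq' Finset.univ i]
    simp
  simp only [h1, Finset.sum_add_distrib]
  rw [sum_det_updateRow_updateRow_eq_zero (H y) (b y)
    (fun i k j => dz a i (fun z => H z k j) y) (fun i k => funext fun j => hsymm i k j), add_zero]

/-- The antisymmetrized second derivative of a closed real (1,1)-form. -/
theorem closed_one_one_aux {V : Type*} [AddCommGroup V] [Module ℂ V] (A : V → V → V → ℝ)
    (halt : ∀ u v w, A u v w = -A u w v) (hneg : ∀ u v w, A u v (-w) = -A u v w)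
    (hcyc : ∀ u v w, A u v w + A v w u + A w u v = 0)
    (hI : ∀ u v w, A u (Complex.I • v) (Complex.I • w) = A u v w) (i k j : V) :
    A i k j + A (Complex.I • i) k (Complex.I • j)
      = A k i j + A (Complex.I • k) i (Complex.I • j) := by
  have hI' : ∀ u v w, A u v (Complex.I • w) = -A u (Complex.I • v) w := fun u v w => by
    rw [← hI u v (Complex.I • w), smul_smul, Complex.I_mul_I, neg_one_smul, hneg]
  rw [hI' (Complex.I • i) k j, hI' (Complex.I • k) i j]
  have h1 := hcyc i k j
  have h2 := hcyc (Complex.I • i) (Complex.I • k) j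
  have h3 := hI j i k
  have h4 := halt k j i
  have h5 := halt (Complex.I • k) j (Complex.I • i)
  linarith

theorem single_I (i : Fin m) : (Pi.single i Complex.I : Fin m → ℂ)
    = Complex.I • (Pi.single i 1 : Fin m → ℂ) := by
  rw [← Pi.single_smul, smul_eq_mul, mul_one]

/-- The coefficient matrix of the exterior derivative of a 1-form on `ℝ × ℂᵐ`. -/
def extMatrix (α : CF m → CF m →L[ℝ] ℝ) (y : CF m) : Matrix (Fin m) (Fin m) ℂ :=
  formMatrix fun v w => skew (fderiv ℝ α y) (0, v) (0, w)

variable {U : Set (CF m)} {a α : CF m → CF m →L[ℝ] ℝ}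

theorem contDiffOn_skew (hU : IsOpen U) (hα : ContDiffOn ℝ ∞ α U) (v w : CF m) :
    ContDiffOn ℝ ∞ (fun y => skew (fderiv ℝ α y) v w) U := by
  have h := hα.fderiv_of_isOpen (m := ∞) hU (by simp)
  exact ((h.clm_apply contDiffOn_const).clm_apply contDiffOn_const).sub
    ((h.clm_apply contDiffOn_const).clm_apply contDiffOn_const)

theorem contDiffOn_extMatrix (hU : IsOpen U) (hα : ContDiffOn ℝ ∞ α U) (i j : Fin m) :
    ContDiffOn ℝ ∞ (fun y => extMatrix α y i j) U := by
  have h : ∀ v w : CF m, ContDiffOn ℝ ∞ (fun y => ((skew (fderiv ℝ α y) v w : ℝ) : ℂ)) U :=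
    fun v w => Complex.ofRealCLM.contDiff.comp_contDiffOn (contDiffOn_skew hU hα v w)
  exact contDiffOn_const.mul ((h _ _).sub (contDiffOn_const.mul (h _ _)))

theorem fderiv_skew (hU : IsOpen U) (hα : ContDiffOn ℝ ∞ α U) {y : CF m} (hy : y ∈ U)
    (u v w : CF m) :
    fderiv ℝ (fun z => skew (fderiv ℝ α z) v w) y u
      = fderiv ℝ (fderiv ℝ α) y u v w - fderiv ℝ (fderiv ℝ α) y u w v := by
  have hd : DifferentiableAt ℝ (fderiv ℝ α) y :=
    ((hα.contDiffAt (hU.mem_nhds hy)).fderiv_right (m := 1) (by norm_cast)).differentiableAt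
      (by simp)
  have h : ∀ v w, HasFDerivAt (fun z => fderiv ℝ α z v w)
      (((fderiv ℝ (fderiv ℝ α) y).flip v).flip w) y := fun v w => by
    have h1 := hasFDerivAt_apply_const hd v
    have h2 := hasFDerivAt_apply_const h1.differentiableAt w
    rwa [h1.fderiv] at h2
  exact congrArg (fun L : CF m →L[ℝ] ℝ => L u) ((h v w).sub (h w v)).fderiv

/-- This is the (2,1)-part of d(dα) = 0. Horizontal lifts may be used in place of coordinate fields
because the coefficients do not depend on the leaf coordinate. -/
theorem dz_extMatrix_symm (hU : IsOpen U) (hα : ContDiffOn ℝ ∞ α U)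
    (hl : ∀ y ∈ U, fderiv ℝ α y (1, 0) = 0)
    (hinv : ∀ y ∈ U, ∀ v w, skew (fderiv ℝ α y) (stdJ m v) (stdJ m w) = skew (fderiv ℝ α y) v w)
    {y : CF m} (hy : y ∈ U) (i k j : Fin m) :
    dz a i (fun z => extMatrix α z k j) y = dz a k (fun z => extMatrix α z i j) y := by
  have hx : fderiv ℝ (fderiv ℝ α) y (1, 0) = 0 :=
    fderiv_fderiv_eq_zero_of_eqOn hU hα hl hy
  have hs : IsSymmSndFDerivAt ℝ α y :=
    (hα.contDiffAt (hU.mem_nhds hy)).isSymmSndFDerivAt (by simp; norm_cast)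
  let A : (Fin m → ℂ) → (Fin m → ℂ) → (Fin m → ℂ) → ℝ := fun u v w =>
    fderiv ℝ (fderiv ℝ α) y (0, u) (0, v) (0, w) - fderiv ℝ (fderiv ℝ α) y (0, u) (0, w) (0, v)
  have hA : ∀ (u v w : Fin m → ℂ), fderiv ℝ (fun z => skew (fderiv ℝ α z) (0, v) (0, w)) y
      (horLift (a y) u) = A u v w := fun u v w => by
    rw [horLift_eq, map_add, map_smul, fderiv_skew hU hα hy, fderiv_skew hU hα hy, hx]
    simp [A]
  have hd : ∀ v w : CF m, HasFDerivAt (fun z => ((skew (fderiv ℝ α z) v w : ℝ) : ℂ))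
      (Complex.ofRealCLM.comp (fderiv ℝ (fun z => skew (fderiv ℝ α z) v w) y)) y := fun v w =>
    Complex.ofRealCLM.hasFDerivAt.comp y (((contDiffOn_skew hU hα v w).contDiffAt
      (hU.mem_nhds hy)).differentiableAt (by simp)).hasFDerivAt
  have hE : ∀ (u : Fin m → ℂ) (k j : Fin m), fderiv ℝ (fun z => extMatrix α z k j) y
      (horLift (a y) u) = (1 / 2 : ℂ) * ((A u (Pi.single k 1) (Pi.single j Complex.I) : ℂ)
        - Complex.I * (A u (Pi.single k 1) (Pi.single j 1) : ℂ)) := fun u k j => by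
    have h1 := ((hd (0, Pi.single k 1) (0, Pi.single j Complex.I)).sub
      ((hd (0, Pi.single k 1) (0, Pi.single j 1)).const_mul Complex.I)).const_mul (1 / 2 : ℂ)
    have h2 : fderiv ℝ (fun z => extMatrix α z k j) y = _ := HasFDerivAt.fderiv h1
    rw [h2, ← hA, ← hA]
    rfl
  have halt : ∀ u v w, A u v w = -A u w v := fun u v w => by simp only [A]; ring
  have hn : ∀ w : Fin m → ℂ, ((0, -w) : CF m) = -(0, w) := fun w => by simp
  have hneg : ∀ u v w, A u v (-w) = -A u v w := fun u v w => by
    simp only [A, hn, map_neg, _root_.neg_apply]; ring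
  have hcyc : ∀ u v w, A u v w + A v w u + A w u v = 0 := fun u v w => by
    simp only [A]
    rw [hs (0, u) (0, v), hs (0, v) (0, w), hs (0, w) (0, u)]
    ring
  have hI : ∀ u v w, A u (Complex.I • v) (Complex.I • w) = A u v w := fun u v w => by
    have h1 : (fun z => skew (fderiv ℝ α z) (0, Complex.I • v) (0, Complex.I • w))
        =ᶠ[𝓝 y] fun z => skew (fderiv ℝ α z) (0, v) (0, w) := by
      filter_upwards [hU.mem_nhds hy] with z hz using hinv z hz (0, v) (0, w)
    rw [← hA, ← hA, h1.fderiv_eq]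
  -- The two instances, with eⱼ and with √-1 eⱼ, give the imaginary and the real part of the
  -- identity.
  have e1 := closed_one_one_aux A halt hneg hcyc hI (Pi.single i 1) (Pi.single k 1) (Pi.single j 1)
  have e2 := closed_one_one_aux A halt hneg hcyc hI (Pi.single i 1) (Pi.single k 1)
    (Complex.I • Pi.single j 1)
  rw [smul_smul, Complex.I_mul_I, neg_one_smul, hneg, hneg] at e2
  rw [dz, dz, hE, hE, hE, hE, single_I i, single_I k, single_I j]
  apply Complex.ext
  · simp
    linarith
  · simp
    linarith

end Local

end Sasaki

end

/-! ### Compactly supported divergences and the local vanishing theorem -/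

noncomputable section

namespace Sasaki

section Local

variable {m : ℕ} {U K : Set (CF m)} {a α τ : CF m → CF m →L[ℝ] ℝ}

/-- The horizontal `√-1`-invariant part of the exterior derivative of a 1-form on `ℝ × ℂᵐ`. -/
def horTensor (a : CF m → CF m →L[ℝ] ℝ) (τ : CF m → CF m →L[ℝ] ℝ) (y : CF m)
    (v w : Fin m → ℂ) : ℝ :=
  (1 / 2) * (skew (fderiv ℝ τ y) (horLift (a y) v) (horLift (a y) w)
    + skew (fderiv ℝ τ y) (horLift (a y) (Complex.I • v)) (horLift (a y) (Complex.I • w)))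

/-- The coefficients of the (0,1)-part of a 1-form, multiplied by `-√-1`. -/
def dzbarCoeff (τ : CF m → CF m →L[ℝ] ℝ) (y : CF m) (j : Fin m) : ℂ :=
  (1 / 2 : ℂ) * ((τ y (0, Pi.single j Complex.I) : ℂ) - Complex.I * (τ y (0, Pi.single j 1) : ℂ))

theorem fderiv_dzbarCoeff {y : CF m} (hτ : DifferentiableAt ℝ τ y) (j : Fin m) (u : CF m) :
    fderiv ℝ (fun z => dzbarCoeff τ z j) y u
      = (1 / 2 : ℂ) * ((fderiv ℝ τ y u (0, Pi.single j Complex.I) : ℂ)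
        - Complex.I * (fderiv ℝ τ y u (0, Pi.single j 1) : ℂ)) := by
  have h : ∀ v : CF m, HasFDerivAt (fun z => ((τ z v : ℝ) : ℂ))
      (Complex.ofRealCLM.comp ((fderiv ℝ τ y).flip v)) y := fun v =>
    Complex.ofRealCLM.hasFDerivAt.comp y (hasFDerivAt_apply_const hτ v)
  have h1 := ((h (0, Pi.single j Complex.I)).sub
    ((h (0, Pi.single j 1)).const_mul Complex.I)).const_mul (1 / 2 : ℂ)
  have h2 : fderiv ℝ (fun z => dzbarCoeff τ z j) y = _ := HasFDerivAt.fderiv h1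
  rw [h2]
  rfl

/-- The transverse (1,1)-part of the exterior derivative of a horizontal 1-form. -/
theorem formMatrix_horTensor (hU : IsOpen U) (hτ : ContDiffOn ℝ ∞ τ U)
    (h0 : ∀ y ∈ U, τ y (1, 0) = 0) {y : CF m} (hy : y ∈ U) :
    formMatrix (horTensor a τ y)
      = (Matrix.of fun i j => dz a i (fun z => dzbarCoeff τ z j) y)
        + (Matrix.of fun i j => dz a i (fun z => dzbarCoeff τ z j) y).conjTranspose := by
  have hd : DifferentiableAt ℝ τ y := (hτ.contDiffAt (hU.mem_nhds hy)).differentiableAt (by simp)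
  have hr : ∀ u, fderiv ℝ τ y u (1, 0) = 0 := fun u => by
    have h2 : HasFDerivAt (fun z => τ z (1, 0)) (0 : CF m →L[ℝ] ℝ) y :=
      (hasFDerivAt_const 0 y).congr_of_eventuallyEq
        (by filter_upwards [hU.mem_nhds hy] with z hz using h0 z hz)
    exact congrArg (fun L : CF m →L[ℝ] ℝ => L u) ((hasFDerivAt_apply_const hd (1, 0)).unique h2)
  have hn : ∀ w : Fin m → ℂ, ((0, -w) : CF m) = -(0, w) := fun w => by simp
  have hT : ∀ v w, skew (fderiv ℝ τ y) (horLift (a y) v) (horLift (a y) w)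
      = fderiv ℝ τ y (horLift (a y) v) (0, w) - fderiv ℝ τ y (horLift (a y) w) (0, v) := by
    intro v w
    have h1 : ∀ u v, fderiv ℝ τ y u (horLift (a y) v) = fderiv ℝ τ y u (0, v) := fun u v => by
      rw [horLift_eq, map_add, map_smul, hr, smul_zero, zero_add]
    have h2 : ∀ v w, skew (fderiv ℝ τ y) v w = fderiv ℝ τ y v w - fderiv ℝ τ y w v :=
      fun _ _ => rfl
    rw [h2, h1, h1]
  have hneg : ∀ v, horLift (a y) (-v) = -horLift (a y) v := fun v => by
    rw [horLift, horLift, hn, map_neg]; simp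
  ext i j
  simp only [Matrix.add_apply, Matrix.conjTranspose_apply, Matrix.of_apply, formMatrix, horTensor,
    hT, dz, fderiv_dzbarCoeff hd, single_I, smul_smul, Complex.I_mul_I, neg_one_smul, hneg,
    map_neg]
  apply Complex.ext
  · simp
    ring
  · simp
    ring

/-! #### Functions with compact support in an open set -/

section Support

variable {E F : Type*} [NormedAddCommGroup E] [NormedSpace ℝ E] [NormedAddCommGroup F]
  [NormedSpace ℝ F] {V C : Set E} {f : E → F}

theorem contDiff_of_eq_zero_off (hV : IsOpen V) (hC : IsClosed C) (hCV : C ⊆ V)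
    (hf : ContDiffOn ℝ ∞ f V) (h0 : ∀ y ∉ C, f y = 0) : ContDiff ℝ ∞ f := by
  rw [contDiff_iff_contDiffAt]
  intro y
  by_cases hy : y ∈ C
  · exact hf.contDiffAt (hV.mem_nhds (hCV hy))
  · refine (contDiffAt_const (c := (0 : F))).congr_of_eventuallyEq ?_
    filter_upwards [hC.isOpen_compl.mem_nhds hy] with z hz using h0 z hz

theorem hasCompactSupport_of_eq_zero_off (hC : IsCompact C) (h0 : ∀ y ∉ C, f y = 0) :
    HasCompactSupport f := HasCompactSupport.intro hC h0

variable [MeasurableSpace E] [BorelSpace E] [FiniteDimensional ℝ E] (μ : Measure E)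
  [μ.IsAddHaarMeasure]

theorem integrable_fderiv_of_hasCompactSupport {f : E → ℂ} (hf : ContDiff ℝ ∞ f)
    (hc : HasCompactSupport f) (v : E) : Integrable (fun y => fderiv ℝ f y v) μ :=
  ((hf.continuous_fderiv (by simp)).clm_apply continuous_const).integrable_of_hasCompactSupport
    (hc.fderiv_apply (𝕜 := ℝ) v)

theorem integral_fderiv_eq_zero {f : E → ℂ} (hf : ContDiff ℝ ∞ f)
    (hc : HasCompactSupport f) (v : E) : ∫ y, fderiv ℝ f y v ∂μ = 0 := by
  have h := integral_mul_fderiv_eq_neg_fderiv_mul_of_integrable (μ := μ) (𝕜 := ℂ)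
    (f := fun _ => (1 : ℂ)) (g := f) (v := v) (by simp)
    (by simpa using integrable_fderiv_of_hasCompactSupport μ hf hc v)
    (by simpa using hf.continuous.integrable_of_hasCompactSupport hc)
    (fun x _ => differentiableAt_const _)
    (fun x _ => hf.differentiable (by simp) x)
  simpa using h

end Support

variable (μ : Measure (CF m)) [μ.IsAddHaarMeasure]

/-- Horizontal lifts are divergence free: as a does not depend on the leaf coordinate x, the
derivative ∂_v F - a(v) ∂_x F equals ∂_v F - ∂_x (a(v) F), and both terms are derivatives of
functions with compact support. -/
theorem integral_fderiv_horLift (hU : IsOpen U) (ha : ContDiffOn ℝ ∞ a U)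
    (ha0 : ∀ y ∈ U, fderiv ℝ a y (1, 0) = 0) (hK : IsCompact K) (hKU : K ⊆ U) {F : CF m → ℂ}
    (hF : ContDiffOn ℝ ∞ F U) (hF0 : ∀ y ∉ K, F y = 0) (v : Fin m → ℂ) :
    Integrable (fun y => fderiv ℝ F y (horLift (a y) v)) μ ∧
      ∫ y, fderiv ℝ F y (horLift (a y) v) ∂μ = 0 := by
  have hFs := contDiff_of_eq_zero_off hU hK.isClosed hKU hF hF0
  have hFc := hasCompactSupport_of_eq_zero_off hK hF0
  let G : CF m → ℂ := fun y => ((a y (0, v) : ℝ) : ℂ) * F y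
  have hav : ContDiffOn ℝ ∞ (fun y => ((a y (0, v) : ℝ) : ℂ)) U :=
    Complex.ofRealCLM.contDiff.comp_contDiffOn (ha.clm_apply contDiffOn_const)
  have hG : ContDiffOn ℝ ∞ G U := hav.mul hF
  have hG0 : ∀ y ∉ K, G y = 0 := fun y hy => by simp only [G, hF0 y hy, mul_zero]
  have hGs := contDiff_of_eq_zero_off hU hK.isClosed hKU hG hG0
  have hGc := hasCompactSupport_of_eq_zero_off hK hG0
  -- Nothing is known about a outside U, but there all derivatives of F vanish.
  have hz : ∀ {f : CF m → ℂ}, (∀ y ∉ K, f y = 0) → ∀ y ∉ U, ∀ u, fderiv ℝ f y u = 0 := by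
    intro f h0 y hy u
    have h1 : f =ᶠ[𝓝 y] fun _ => 0 := by
      filter_upwards [hK.isClosed.isOpen_compl.mem_nhds (fun h => hy (hKU h))] with z hz
        using h0 z hz
    rw [h1.fderiv_eq]
    simp
  have heq : (fun y => fderiv ℝ F y (horLift (a y) v))
      = fun y => fderiv ℝ F y (0, v) - fderiv ℝ G y (1, 0) := by
    funext y
    by_cases hy : y ∈ U
    · have hd : DifferentiableAt ℝ a y :=
        (ha.contDiffAt (hU.mem_nhds hy)).differentiableAt (by simp)
      have h1 : HasFDerivAt (fun y => ((a y (0, v) : ℝ) : ℂ))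
          (Complex.ofRealCLM.comp ((fderiv ℝ a y).flip (0, v))) y :=
        Complex.ofRealCLM.hasFDerivAt.comp y (hasFDerivAt_apply_const hd (0, v))
      have h2 := h1.mul (hFs.differentiable (by simp) y).hasFDerivAt
      have h3 : fderiv ℝ G y = _ := HasFDerivAt.fderiv h2
      rw [h3, horLift_eq, map_add, map_smul]
      simp [ha0 y hy]
      ring
    · rw [hz hF0 y hy, hz hF0 y hy, hz hG0 y hy, sub_zero]
  have i1 := integrable_fderiv_of_hasCompactSupport μ hFs hFc (0, v)
  have i2 := integrable_fderiv_of_hasCompactSupport μ hGs hGc (1, 0)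
  rw [heq]
  refine ⟨i1.sub i2, ?_⟩
  rw [integral_sub i1 i2, integral_fderiv_eq_zero μ hFs hFc, integral_fderiv_eq_zero μ hGs hGc,
    sub_zero]

theorem integral_dz (hU : IsOpen U) (ha : ContDiffOn ℝ ∞ a U)
    (ha0 : ∀ y ∈ U, fderiv ℝ a y (1, 0) = 0) (hK : IsCompact K) (hKU : K ⊆ U) {F : CF m → ℂ}
    (hF : ContDiffOn ℝ ∞ F U) (hF0 : ∀ y ∉ K, F y = 0) (i : Fin m) :
    Integrable (dz a i F) μ ∧ ∫ y, dz a i F y ∂μ = 0 := by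
  obtain ⟨i1, e1⟩ := integral_fderiv_horLift μ hU ha ha0 hK hKU hF hF0 (Pi.single i 1)
  obtain ⟨i2, e2⟩ := integral_fderiv_horLift μ hU ha ha0 hK hKU hF hF0 (Pi.single i Complex.I)
  refine ⟨(i1.sub (i2.const_mul Complex.I)).const_mul (1 / 2 : ℂ), ?_⟩
  simp only [dz]
  rw [integral_const_mul, integral_sub i1 (i2.const_mul Complex.I), integral_const_mul, e1, e2]
  simp

theorem extMatrix_isHermitian {y : CF m}
    (hinv : ∀ v w, skew (fderiv ℝ α y) (stdJ m v) (stdJ m w) = skew (fderiv ℝ α y) v w) :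
    (extMatrix α y).IsHermitian := by
  let b : (Fin m → ℂ) →ₗ[ℝ] (Fin m → ℂ) →ₗ[ℝ] ℝ :=
    (ContinuousLinearMap.toLinearMap₁₂ (skew (fderiv ℝ α y))).compl₁₂
      (LinearMap.inr ℝ ℝ (Fin m → ℂ)) (LinearMap.inr ℝ ℝ (Fin m → ℂ))
  refine formMatrix_isHermitian b (fun v w => ?_) (fun v w => hinv (0, v) (0, w))
  change skew (fderiv ℝ α y) (0, v) (0, w) = -skew (fderiv ℝ α y) (0, w) (0, v)
  exact (neg_sub _ _).symm

/-- Integration by parts: `m (dα)ᵐ⁻¹ ∧ dτ ∧ η` has integral zero, for a closed (1,1)-form `dα` and a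
horizontal 1-form `τ` with compact support. -/
theorem integral_trace_eq_zero (hU : IsOpen U) (ha : ContDiffOn ℝ ∞ a U)
    (ha0 : ∀ y ∈ U, fderiv ℝ a y (1, 0) = 0) (hα : ContDiffOn ℝ ∞ α U)
    (hα0 : ∀ y ∈ U, fderiv ℝ α y (1, 0) = 0)
    (hinv : ∀ y ∈ U, ∀ v w, skew (fderiv ℝ α y) (stdJ m v) (stdJ m w) = skew (fderiv ℝ α y) v w)
    (hτ : ContDiffOn ℝ ∞ τ U) (hτ1 : ∀ y ∈ U, τ y (1, 0) = 0)
    (hK : IsCompact K) (hKU : K ⊆ U) (hτ0 : ∀ y ∉ K, τ y = 0) :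
    ∫ y in U, ((extMatrix α y).adjugate * formMatrix (horTensor a τ y)).trace.re ∂μ = 0 := by
  -- The cofactors of dα contracted with the (0,1)-coefficients of τ. Twice the real part of the
  -- horizontal divergence of F is the integrand.
  let F : Fin m → CF m → ℂ := fun i y => ((extMatrix α y).updateRow i (dzbarCoeff τ y)).det
  have hc : ∀ j, ContDiffOn ℝ ∞ (fun z => dzbarCoeff τ z j) U := fun j => by
    have h : ∀ v : CF m, ContDiffOn ℝ ∞ (fun z => ((τ z v : ℝ) : ℂ)) U := fun v =>
      Complex.ofRealCLM.contDiff.comp_contDiffOn (hτ.clm_apply contDiffOn_const)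
    exact contDiffOn_const.mul ((h _).sub (contDiffOn_const.mul (h _)))
  have hF : ∀ i, ContDiffOn ℝ ∞ (F i) U := fun i =>
    contDiffOn_det (M := fun y => (extMatrix α y).updateRow i (dzbarCoeff τ y)) fun r j => by
      by_cases hr : r = i
      · subst hr
        simpa using hc j
      · simpa [Matrix.updateRow_ne hr] using contDiffOn_extMatrix hU hα r j
  have hF0 : ∀ i, ∀ y ∉ K, F i y = 0 := fun i y hy => by
    refine Matrix.det_eq_zero_of_row_eq_zero i fun j => ?_
    simp [dzbarCoeff, hτ0 y hy]
  have key : ∀ y ∈ U, ((extMatrix α y).adjugate * formMatrix (horTensor a τ y)).trace.re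
      = (2 * ∑ i, dz a i (F i) y).re := by
    intro y hy
    have hd : ∀ i j, DifferentiableAt ℝ (fun z => extMatrix α z i j) y := fun i j =>
      ((contDiffOn_extMatrix hU hα i j).contDiffAt (hU.mem_nhds hy)).differentiableAt (by simp)
    have hd' : ∀ j, DifferentiableAt ℝ (fun z => dzbarCoeff τ z j) y := fun j =>
      ((hc j).contDiffAt (hU.mem_nhds hy)).differentiableAt (by simp)
    rw [formMatrix_horTensor hU hτ hτ1 hy,
      trace_adjugate_mul_add_conjTranspose (extMatrix_isHermitian (hinv y hy)), trace_adjugate_mul]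
    have h1 := sum_det_updateRow_dz a (H := extMatrix α) (b := dzbarCoeff τ) hd hd'
      (fun i k j => dz_extMatrix_symm hU hα hα0 hinv hy i k j)
    rw [← h1, Complex.mul_re]
    simp
    rfl
  rw [setIntegral_congr_fun hU.measurableSet key]
  have hI : ∀ i, Integrable (dz a i (F i)) μ := fun i =>
    (integral_dz μ hU ha ha0 hK hKU (hF i) (hF0 i) i).1
  have hI2 : Integrable (fun y => 2 * ∑ i, dz a i (F i) y) μ :=
    (integrable_finsetSum _ fun i _ => hI i).const_mul 2
  have hzero : ∀ y ∉ U, (2 * ∑ i, dz a i (F i) y).re = 0 := by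
    intro y hy
    have h1 : ∀ i u, fderiv ℝ (F i) y u = 0 := fun i u => by
      have h1 : F i =ᶠ[𝓝 y] fun _ => 0 := by
        filter_upwards [hK.isClosed.isOpen_compl.mem_nhds (fun h => hy (hKU h))] with z hz
          using hF0 i z hz
      rw [h1.fderiv_eq]
      simp
    simp [dz, h1]
  rw [setIntegral_eq_integral_of_forall_compl_eq_zero hzero]
  have h2 : ∫ y, (2 * ∑ i, dz a i (F i) y).re ∂μ = (∫ y, 2 * ∑ i, dz a i (F i) y ∂μ).re :=
    Complex.reCLM.integral_comp_comm hI2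
  rw [h2, integral_const_mul, integral_finsetSum _ fun i _ => hI i]
  simp [fun i => (integral_dz μ hU ha ha0 hK hKU (hF i) (hF0 i) i).2]

end Local

end Sasaki

end

noncomputable section

namespace Sasaki

/-! ### The volume ratio and its polarization -/

/-- An alternating map vanishes on dependent frames, whereas `frameConst` is positive. -/
theorem linearIndependent_stdFrame (m : ℕ) : LinearIndependent ℝ (stdFrame m) := by
  by_contra h
  have h1 := (powWedgeAlternating m (hermBilin (1 : Matrix (Fin m) (Fin m) ℂ))
    (LinearMap.fst ℝ ℝ (Fin m → ℂ))).map_linearDependent (stdFrame m) h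
  rw [powWedgeAlternating_apply] at h1
  exact (frameConst_pos m).ne' h1

/-- The frame `∂/∂x¹, ∂/∂y¹, …, ∂/∂xᵐ, ∂/∂yᵐ, ∂/∂x` as a basis. -/
def stdFrameBasis (m : ℕ) : Module.Basis (Fin (2 * m + 1)) ℝ (CF m) :=
  basisOfLinearIndependentOfCardEqFinrank (linearIndependent_stdFrame m)
    (by rw [finrank_CF, Fintype.card_fin])

theorem stdFrameBasis_apply (m : ℕ) (i : Fin (2 * m + 1)) : stdFrameBasis m i = stdFrame m i := by
  simp [stdFrameBasis]

section Volume

variable {m : ℕ} {S : Type*} [TopologicalSpace S] [ChartedSpace (Model m) S]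
  [IsManifold (𝓡 (2 * m + 1)) ∞ S] (𝒮 : SasakianStructure m S)

/-- The horizontal `Φ`-invariant part of a 2-tensor. -/
def horPart (p : S) (κ : Tan m p →L[ℝ] Tan m p →L[ℝ] ℝ) : Tan m p →L[ℝ] Tan m p →L[ℝ] ℝ :=
  (1 / 2 : ℝ) • (ContinuousLinearMap.bilinearComp (E := Model m) (F := Model m) (E' := Model m)
      (F' := Model m) κ ((transverseJ 𝒮 p).comp (transverseJ 𝒮 p))
      ((transverseJ 𝒮 p).comp (transverseJ 𝒮 p))
    + ContinuousLinearMap.bilinearComp (E := Model m) (F := Model m) (E' := Model m)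
      (F' := Model m) κ (transverseJ 𝒮 p) (transverseJ 𝒮 p))

variable {𝒮} {p : S} {κ A : Tan m p →L[ℝ] Tan m p →L[ℝ] ℝ}

theorem horPart_apply (v w : Tan m p) : horPart 𝒮 p κ v w
    = (1 / 2) * (κ (transverseJ 𝒮 p (transverseJ 𝒮 p v)) (transverseJ 𝒮 p (transverseJ 𝒮 p w))
      + κ (transverseJ 𝒮 p v) (transverseJ 𝒮 p w)) := rfl

theorem transverseJ_cube (v : Tan m p) :
    transverseJ 𝒮 p (transverseJ 𝒮 p (transverseJ 𝒮 p v)) = -transverseJ 𝒮 p v := by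
  rw [transverseJ_transverseJ, contact_transverseJ, zero_smul, add_zero]

/-- Because Φ³ = -Φ, applying Φ to both arguments exchanges the two summands. -/
theorem horPart_isInvariantAt : IsInvariantAt 𝒮 p (horPart 𝒮 p κ) := by
  intro v w
  rw [horPart_apply, horPart_apply, transverseJ_cube, transverseJ_cube]
  simp only [map_neg, _root_.neg_apply, neg_neg]
  ring

theorem IsInvariantAt.horPart_eq (h : IsInvariantAt 𝒮 p κ) : horPart 𝒮 p κ = κ := by
  refine ContinuousLinearMap.ext fun v => ContinuousLinearMap.ext fun w => ?_
  rw [horPart_apply, h, h]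
  ring

theorem IsInvariantAt.reeb_left (h : IsInvariantAt 𝒮 p κ) (w : Tan m p) :
    κ (reeb 𝒮 p) w = 0 := by
  rw [← h, transverseJ_reeb, map_zero, _root_.zero_apply]

theorem IsInvariantAt.reeb_right (h : IsInvariantAt 𝒮 p κ) (w : Tan m p) :
    κ w (reeb 𝒮 p) = 0 := by
  rw [← h, transverseJ_reeb, map_zero]

/-- A 2-tensor is alternating. -/
def IsAlternatingAt {p : S} (κ : Tan m p →L[ℝ] Tan m p →L[ℝ] ℝ) : Prop := ∀ v w, κ v w = -κ w v

theorem IsAlternatingAt.horPart (h : IsAlternatingAt κ) : IsAlternatingAt (horPart 𝒮 p κ) := by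
  intro v w
  rw [horPart_apply, horPart_apply, h, h (transverseJ 𝒮 p v)]
  ring

theorem IsAlternatingAt.add_smul (hA : IsAlternatingAt A) (h : IsAlternatingAt κ) (s : ℝ) :
    IsAlternatingAt (A + s • κ) := by
  intro v w
  simp only [_root_.add_apply, _root_.smul_apply, smul_eq_mul]
  rw [hA v w, h v w]
  ring

theorem horPart_add_smul (s : ℝ) :
    horPart 𝒮 p (A + s • κ) = horPart 𝒮 p A + s • horPart 𝒮 p κ := by
  refine ContinuousLinearMap.ext fun v => ContinuousLinearMap.ext fun w => ?_
  simp only [horPart_apply, _root_.add_apply, _root_.smul_apply, smul_eq_mul]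
  ring

namespace FoliationChart

variable (χ : FoliationChart 𝒮)

/-- The coefficient matrix of a 2-tensor at a point. -/
def matrixAt (p : S) (κ : Tan m p →L[ℝ] Tan m p →L[ℝ] ℝ) : Matrix (Fin m) (Fin m) ℂ :=
  formMatrix fun v w => κ (χ.inv p (0, v)) (χ.inv p (0, w))

theorem matrixAt_add_smul (s : ℝ) :
    χ.matrixAt p (A + s • κ) = χ.matrixAt p A + (s : ℂ) • χ.matrixAt p κ := by
  ext i j
  simp only [matrixAt, formMatrix, Matrix.of_apply, Matrix.add_apply, Matrix.smul_apply,
    _root_.add_apply, _root_.smul_apply, smul_eq_mul]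
  push_cast
  ring

/-- A 2-tensor at a point, read in a foliation chart. -/
def bilinAt (p : S) (κ : Tan m p →L[ℝ] Tan m p →L[ℝ] ℝ) : CF m →ₗ[ℝ] CF m →ₗ[ℝ] ℝ :=
  LinearMap.mk₂ ℝ (fun v w => κ (χ.inv p v) (χ.inv p w))
    (fun _ _ _ => by rw [map_add, map_add, _root_.add_apply])
    (fun _ _ _ => by rw [map_smul, map_smul, _root_.smul_apply])
    (fun _ _ _ => by rw [map_add, map_add]) (fun _ _ _ => by rw [map_smul, map_smul])

/-- The endomorphism of `ℝ × ℂᵐ` which maps the standard frame to a given frame. -/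
def frameMap (p : S) (v : Fin (2 * m + 1) → Tan m p) : CF m →ₗ[ℝ] CF m :=
  (stdFrameBasis m).constr ℝ fun i => χ.der p (v i)

theorem frameMap_stdFrame (v : Fin (2 * m + 1) → Tan m p) (i : Fin (2 * m + 1)) :
    χ.frameMap p v (stdFrame m i) = χ.der p (v i) := by
  rw [← stdFrameBasis_apply, frameMap, Module.Basis.constr_basis]

variable {χ}

theorem bilinAt_stdJ (hp : p ∈ χ.chart.source) (h : IsInvariantAt 𝒮 p κ) (v w : Fin m → ℂ) :
    χ.bilinAt p κ (0, Complex.I • v) (0, Complex.I • w) = χ.bilinAt p κ (0, v) (0, w) := by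
  obtain ⟨y, hy, rfl⟩ := χ.exists_symm_eq hp
  have h1 := h (χ.inv _ (0, v)) (χ.inv _ (0, w))
  rw [χ.transverseJ_inv hy, χ.transverseJ_inv hy] at h1
  have h2 : ∀ (c : ℝ) (v : Fin m → ℂ), χ.inv (χ.chart.symm y) (c, v)
      = c • reeb 𝒮 (χ.chart.symm y) + χ.inv (χ.chart.symm y) (0, v) := fun c v => by
    rw [← χ.inv_one_zero hp, ← map_smul, ← map_add]
    congr 1
    refine Prod.ext ?_ ?_ <;> simp
  rw [h2, h2 _ (Complex.I • ((0, w) : CF m).2)] at h1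
  simp only [map_add, map_smul, _root_.add_apply, _root_.smul_apply, h.reeb_left, h.reeb_right,
    smul_zero, zero_add] at h1
  exact h1

/-- The frame enters only through a determinant which does not depend on κ and θ, so it cancels in
quotients. The form θ enters only through θ(ξ) = 1, so η_φ and η give the same top form. -/
theorem powWedge_chart (hp : p ∈ χ.chart.source) (hκ : IsAlternatingAt κ) (h : IsInvariantAt 𝒮 p κ)
    (θ : Tan m p →L[ℝ] ℝ) (hθ : θ (reeb 𝒮 p) = 1) (v : Fin (2 * m + 1) → Tan m p) :
    powWedge m (fun x y => κ x y) θ v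
      = LinearMap.det (χ.frameMap p v) * ((χ.matrixAt p κ).det.re * frameConst m) := by
  let θ' : CF m →ₗ[ℝ] ℝ := (θ.comp (χ.inv p) : CF m →L[ℝ] ℝ)
  have h1 : powWedge m (fun x y => κ x y) θ v
      = powWedge m (fun x y => χ.bilinAt p κ x y) θ' (fun i => χ.frameMap p v (stdFrame m i)) := by
    have h2 : ∀ i, χ.inv p (χ.frameMap p v (stdFrame m i)) = v i := fun i => by
      rw [frameMap_stdFrame, χ.inv_der hp]
    have h3 : ∀ i j, χ.bilinAt p κ (χ.frameMap p v (stdFrame m i))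
        (χ.frameMap p v (stdFrame m j)) = κ (v i) (v j) := fun i j => by
      have h4 : χ.bilinAt p κ (χ.frameMap p v (stdFrame m i)) (χ.frameMap p v (stdFrame m j))
        = κ (χ.inv p (χ.frameMap p v (stdFrame m i))) (χ.inv p (χ.frameMap p v (stdFrame m j))) :=
        rfl
      rw [h4, h2, h2]
    have h4 : ∀ i, θ' (χ.frameMap p v (stdFrame m i)) = θ (v i) := fun i =>
      congrArg θ (h2 i)
    simp only [powWedge, h3, h4]
  rw [h1, powWedge_comp m (finrank_CF m), powWedge_eq_det _ _ (fun x y => hκ _ _) _ _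
    (bilinAt_stdJ hp h)]
  · rfl
  · intro x
    change κ (χ.inv p (1, 0)) _ = 0
    rw [χ.inv_one_zero hp, h.reeb_left]
  · change θ (χ.inv p (1, 0)) = 1
    rw [χ.inv_one_zero hp, hθ]

theorem det_frameMap_ne_zero (hp : p ∈ χ.chart.source) {v : Fin (2 * m + 1) → Tan m p} (hv : LinearIndependent ℝ v) :
    LinearMap.det (χ.frameMap p v) ≠ 0 := by
  have h1 : LinearIndependent ℝ fun i => χ.der p (v i) := by
    refine hv.map' (χ.der p : Tan m p →ₗ[ℝ] CF m) (LinearMap.ker_eq_bot.2 fun x y hxy => ?_)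
    rw [← χ.inv_der hp x, ← χ.inv_der hp y]
    exact congrArg (χ.inv p) hxy
  let b := basisOfLinearIndependentOfCardEqFinrank h1 (by rw [finrank_CF, Fintype.card_fin])
  have h2 : χ.frameMap p v
      = ((stdFrameBasis m).equiv b (Equiv.refl _) : CF m →ₗ[ℝ] CF m) := by
    refine (stdFrameBasis m).ext fun i => ?_
    rw [stdFrameBasis_apply, frameMap_stdFrame, ← stdFrameBasis_apply]
    simp [b]
  rw [h2]
  exact (LinearEquiv.isUnit_det' _).ne_zero

open scoped ComplexOrder in
/-- Positive forms have positive definite coefficient matrices. -/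
theorem posDef_matrixAt (hp : p ∈ χ.chart.source) (hA : IsAlternatingAt A) (h : IsInvariantAt 𝒮 p A)
    (hpos : ∀ X, contact 𝒮 p X = 0 → X ≠ 0 → 0 < A X (transverseJ 𝒮 p X)) :
    (χ.matrixAt p A).PosDef := by
  obtain ⟨y, hy, rfl⟩ := χ.exists_symm_eq hp
  let b : (Fin m → ℂ) →ₗ[ℝ] (Fin m → ℂ) →ₗ[ℝ] ℝ :=
    (χ.bilinAt _ A).compl₁₂ (LinearMap.inr ℝ ℝ (Fin m → ℂ)) (LinearMap.inr ℝ ℝ (Fin m → ℂ))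
  have hb : ∀ v w, b (Complex.I • v) (Complex.I • w) = b v w := bilinAt_stdJ hp h
  have hherm : (χ.matrixAt _ A).IsHermitian :=
    formMatrix_isHermitian b (fun v w => hA _ _) hb
  refine Matrix.PosDef.of_dotProduct_mulVec_pos hherm fun x hx => ?_
  -- The conjugate appears because the form is vᵀ H w̄ while positive definiteness tests x̄ᵀ H x.
  set v : Fin m → ℂ := star x with hv
  have hv0 : v ≠ 0 := fun h0 => hx (star_eq_zero.1 h0)
  have h1 := hermForm_formMatrix b hb v (Complex.I • v)
  rw [hermForm_eq] at h1
  have h2 : b v (Complex.I • v) = A (χ.inv _ (0, v)) (χ.inv _ (0, Complex.I • v)) := rfl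
  -- The lift of v need not be horizontal. Its image under Φ lies in D, positivity is applied there,
  -- and invariance of A returns to the lift.
  have hX0 : transverseJ 𝒮 _ (χ.inv (χ.chart.symm y) (0, v)) ≠ 0 := by
    intro h0
    rw [χ.transverseJ_inv hy] at h0
    have h3 := congrArg (χ.der _) h0
    rw [χ.der_inv hp, map_zero] at h3
    have h4 : Complex.I • v = 0 := congrArg Prod.snd h3
    exact hv0 ((smul_eq_zero.1 h4).resolve_left Complex.I_ne_zero)
  have h3 := hpos _ (contact_transverseJ 𝒮 _ _) hX0
  rw [h] at h3
  have h5 : A (χ.inv _ (0, v)) (transverseJ 𝒮 _ (χ.inv _ (0, v)))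
      = A (χ.inv _ (0, v)) (χ.inv _ (0, Complex.I • v)) := by
    rw [χ.transverseJ_inv hy]
    have h6 : ∀ (c : ℝ) (v : Fin m → ℂ), χ.inv (χ.chart.symm y) (c, v)
        = c • reeb 𝒮 (χ.chart.symm y) + χ.inv (χ.chart.symm y) (0, v) := fun c v => by
      rw [← χ.inv_one_zero hp, ← map_smul, ← map_add]
      congr 1
      refine Prod.ext ?_ ?_ <;> simp
    rw [h6 (-_), map_add, map_smul, h.reeb_right, smul_zero, zero_add]
  rw [h5, ← h2, ← h1] at h3
  have h7 : (χ.matrixAt _ A).mulVec (star (Complex.I • v))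
      = -Complex.I • (χ.matrixAt _ A).mulVec x := by
    rw [star_smul, hv, star_star, Matrix.mulVec_smul]
    simp
  have h8 : (formMatrix fun x y => b x y) = χ.matrixAt _ A := rfl
  rw [h8, h7, dotProduct_smul] at h3
  have h9 : 0 < (v ⬝ᵥ (χ.matrixAt _ A).mulVec x).re := by
    simp only [smul_eq_mul, Complex.mul_im, Complex.neg_re, Complex.neg_im, Complex.I_re,
      Complex.I_im] at h3
    linarith
  rw [Complex.pos_iff]
  refine ⟨h9, ?_⟩
  have h10 := hherm.im_star_dotProduct_mulVec_self x
  exact h10.symm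

end FoliationChart

variable (𝒮)

/-- The standard frame of the model space. -/
def stdB (p : S) (i : Fin (2 * m + 1)) : Tan m p := (EuclideanSpace.single i 1 : Model m)

theorem linearIndependent_stdB (p : S) : LinearIndependent ℝ (stdB (m := m) p) := by
  have h := (EuclideanSpace.basisFun (Fin (2 * m + 1)) ℝ).toBasis.linearIndependent
  have h1 : ⇑(EuclideanSpace.basisFun (Fin (2 * m + 1)) ℝ).toBasis
      = fun i => (EuclideanSpace.single i 1 : Model m) := by
    funext i
    simp
  rw [h1] at h
  exact h

/-- The quotient of the volume forms `κᵐ ∧ η` and `(dη)ᵐ ∧ η`. -/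
def volRatio (p : S) (κ : Tan m p →L[ℝ] Tan m p →L[ℝ] ℝ) : ℝ :=
  powWedge m (fun v w => horPart 𝒮 p κ v w) (contact 𝒮 p) (stdB p) /
    powWedge m (fun v w => kahlerForm 𝒮 p v w) (contact 𝒮 p) (stdB p)

/-- The quotient of `m Aᵐ⁻¹ ∧ κ ∧ η` and `(dη)ᵐ ∧ η`. -/
def mixedRatio (p : S) (A κ : Tan m p →L[ℝ] Tan m p →L[ℝ] ℝ) : ℝ :=
  deriv (fun s : ℝ => volRatio 𝒮 p (A + s • κ)) 0

theorem isAlternatingAt_kahlerForm (p : S) : IsAlternatingAt (kahlerForm 𝒮 p) :=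
  dOne_alternating p

variable {𝒮} {χ : FoliationChart 𝒮}

open scoped ComplexOrder in
theorem det_matrixAt_kahlerForm_pos (hp : p ∈ χ.chart.source) :
    0 < (χ.matrixAt p (kahlerForm 𝒮 p)).det.re :=
  (Complex.pos_iff.1 (FoliationChart.posDef_matrixAt hp (isAlternatingAt_kahlerForm 𝒮 p)
    (kahlerForm_transverseJ 𝒮 p) fun _ h h0 => kahlerForm_pos 𝒮 p h h0).det_pos).1

theorem volRatio_eq (hp : p ∈ χ.chart.source) (hκ : IsAlternatingAt κ) :
    volRatio 𝒮 p κ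
      = (χ.matrixAt p (horPart 𝒮 p κ)).det.re / (χ.matrixAt p (kahlerForm 𝒮 p)).det.re := by
  rw [volRatio, FoliationChart.powWedge_chart hp hκ.horPart horPart_isInvariantAt _
    (contact_reeb 𝒮 p), FoliationChart.powWedge_chart hp (isAlternatingAt_kahlerForm 𝒮 p)
      (kahlerForm_transverseJ 𝒮 p) _ (contact_reeb 𝒮 p)]
  rw [mul_div_mul_left _ _ (FoliationChart.det_frameMap_ne_zero hp (linearIndependent_stdB p)),
    mul_div_mul_right _ _ (frameConst_pos m).ne']

/-- The volume ratio turns into the quotient of the top forms on all frames. -/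
theorem powWedge_eq_volRatio_mul (hκ : IsAlternatingAt κ) (h : IsInvariantAt 𝒮 p κ)
    (θ : Tan m p →L[ℝ] ℝ) (hθ : θ (reeb 𝒮 p) = 1) (v : Fin (2 * m + 1) → Tan m p) :
    powWedge m (fun x y => κ x y) θ v
      = volRatio 𝒮 p κ * powWedge m (fun x y => kahlerForm 𝒮 p x y) (contact 𝒮 p) v := by
  obtain ⟨χ, hp⟩ := exists_foliationChart 𝒮 p
  have h0 := (det_matrixAt_kahlerForm_pos hp).ne'
  rw [volRatio_eq hp hκ, h.horPart_eq, FoliationChart.powWedge_chart hp hκ h θ hθ,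
    FoliationChart.powWedge_chart hp (isAlternatingAt_kahlerForm 𝒮 p)
      (kahlerForm_transverseJ 𝒮 p) _ (contact_reeb 𝒮 p)]
  field_simp

theorem volRatio_kahlerForm (p : S) : volRatio 𝒮 p (kahlerForm 𝒮 p) = 1 := by
  obtain ⟨χ, hp⟩ := exists_foliationChart 𝒮 p
  have h : IsInvariantAt 𝒮 p (kahlerForm 𝒮 p) := kahlerForm_transverseJ 𝒮 p
  rw [volRatio_eq hp (isAlternatingAt_kahlerForm 𝒮 p), h.horPart_eq,
    div_self (det_matrixAt_kahlerForm_pos hp).ne']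

end Volume

end Sasaki

end

noncomputable section

namespace Sasaki

/-! ### Algebra of the mixed volume ratio -/

theorem hasDerivAt_det_curve {m : ℕ} {M : ℝ → Matrix (Fin m) (Fin m) ℂ} {N : Matrix (Fin m) (Fin m) ℂ}
    {t : ℝ} (h : ∀ i j, HasDerivAt (fun s => M s i j) (N i j) t) :
    HasDerivAt (fun s => (M s).det) ((M t).adjugate * N).trace t := by
  obtain ⟨L, h1, h2⟩ := hasFDerivAt_det fun i j => (h i j).differentiableAt
  have h3 := h1.hasDerivAt
  rw [h2] at h3
  rw [trace_adjugate_mul]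
  convert h3 using 4 with i
  funext j
  exact (h i j).deriv.symm

/-- The degree bound m is what makes quadrature with the m + 1 nodes 0, …, m exact. -/
theorem exists_polynomial_det_re {m : ℕ} (M N : Matrix (Fin m) (Fin m) ℂ) :
    ∃ q : Polynomial ℝ, q.natDegree ≤ m ∧ ∀ s : ℝ, (M + (s : ℂ) • N).det.re = q.eval s := by
  set P := Matrix.det ((Polynomial.X : Polynomial ℂ) • N.map Polynomial.C + M.map Polynomial.C)
    with hP
  have hd : P.natDegree ≤ m := by
    simpa using Polynomial.natDegree_det_X_add_C_le N M
  refine ⟨∑ i ∈ Finset.range (m + 1), Polynomial.C (P.coeff i).re * Polynomial.X ^ i, ?_, fun s => ?_⟩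
  · refine Polynomial.natDegree_sum_le_of_forall_le _ _ fun i hi => ?_
    exact (Polynomial.natDegree_C_mul_X_pow_le _ _).trans (Nat.lt_succ_iff.1 (Finset.mem_range.1 hi))
  · have h1 : (M + (s : ℂ) • N).det = P.eval (s : ℂ) := by
      rw [hP, ← Polynomial.coe_evalRingHom, RingHom.map_det]
      congr 1
      ext i j
      simp [add_comm]
      exact mul_comm _ _
    rw [h1, Polynomial.eval_eq_sum_range' (Nat.lt_succ_of_le hd), Polynomial.eval_finsetSum,
      Complex.re_sum]
    refine Finset.sum_congr rfl fun i _ => ?_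
    rw [← Complex.ofReal_pow, Complex.re_mul_ofReal]
    simp

section Mixed

variable {m : ℕ} {S : Type*} [TopologicalSpace S] [ChartedSpace (Model m) S]
  [IsManifold (𝓡 (2 * m + 1)) ∞ S] {𝒮 : SasakianStructure m S} {χ : FoliationChart 𝒮} {p : S}
  {A κ κ' : Tan m p →L[ℝ] Tan m p →L[ℝ] ℝ}

theorem add_zero_smul_tensor : A + (0 : ℝ) • κ = A := by
  refine ContinuousLinearMap.ext fun v => ContinuousLinearMap.ext fun w => ?_
  simp only [_root_.add_apply, _root_.smul_apply, smul_eq_mul, zero_mul, add_zero]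

theorem add_smul_add_smul (r s : ℝ) : A + s • κ + r • κ = A + (s + r) • κ := by
  refine ContinuousLinearMap.ext fun v => ContinuousLinearMap.ext fun w => ?_
  simp only [_root_.add_apply, _root_.smul_apply, smul_eq_mul]
  ring

theorem hasDerivAt_volRatio_aux (hp : p ∈ χ.chart.source)
    {B : ℝ → Tan m p →L[ℝ] Tan m p →L[ℝ] ℝ} {t : ℝ} (hB : ∀ s, IsAlternatingAt (B s))
    (h : ∀ v w, HasDerivAt (fun s => B s v w) (κ v w) t) :
    HasDerivAt (fun s => volRatio 𝒮 p (B s))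
      (((χ.matrixAt p (horPart 𝒮 p (B t))).adjugate * χ.matrixAt p (horPart 𝒮 p κ)).trace.re /
        (χ.matrixAt p (kahlerForm 𝒮 p)).det.re) t := by
  have h1 : ∀ v w, HasDerivAt (fun s => horPart 𝒮 p (B s) v w) (horPart 𝒮 p κ v w) t := fun v w => by
    simp only [horPart_apply]
    exact ((h _ _).add (h _ _)).const_mul _
  have h2 : ∀ i j, HasDerivAt (fun s => χ.matrixAt p (horPart 𝒮 p (B s)) i j)
      (χ.matrixAt p (horPart 𝒮 p κ) i j) t := fun i j => by
    simp only [FoliationChart.matrixAt, formMatrix, Matrix.of_apply]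
    exact ((h1 _ _).ofReal_comp.sub ((h1 _ _).ofReal_comp.const_mul _)).const_mul _
  have h3 := (Complex.reCLM.hasFDerivAt.comp_hasDerivAt t (hasDerivAt_det_curve h2)).div_const
    (χ.matrixAt p (kahlerForm 𝒮 p)).det.re
  refine h3.congr_of_eventuallyEq (Eventually.of_forall fun s => ?_)
  exact volRatio_eq hp (hB s)

theorem mixedRatio_eq (hp : p ∈ χ.chart.source) (hA : IsAlternatingAt A) (hκ : IsAlternatingAt κ) :
    mixedRatio 𝒮 p A κ
      = ((χ.matrixAt p (horPart 𝒮 p A)).adjugate * χ.matrixAt p (horPart 𝒮 p κ)).trace.re /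
        (χ.matrixAt p (kahlerForm 𝒮 p)).det.re := by
  have h := hasDerivAt_volRatio_aux (κ := κ) (t := 0) hp (hA.add_smul hκ) fun v w => by
    simp only [_root_.add_apply, _root_.smul_apply, smul_eq_mul]
    simpa using ((hasDerivAt_id (0 : ℝ)).mul_const (κ v w)).const_add (A v w)
  rw [add_zero_smul_tensor] at h
  exact h.deriv

theorem hasDerivAt_volRatio {B : ℝ → Tan m p →L[ℝ] Tan m p →L[ℝ] ℝ} {t : ℝ}
    (hB : ∀ s, IsAlternatingAt (B s)) (hκ : IsAlternatingAt κ)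
    (h : ∀ v w, HasDerivAt (fun s => B s v w) (κ v w) t) :
    HasDerivAt (fun s => volRatio 𝒮 p (B s)) (mixedRatio 𝒮 p (B t) κ) t := by
  obtain ⟨χ, hp⟩ := exists_foliationChart 𝒮 p
  rw [mixedRatio_eq hp (hB t) hκ]
  exact hasDerivAt_volRatio_aux hp hB h

/-- The volume ratio is a polynomial on affine lines. -/
theorem exists_polynomial_volRatio (hA : IsAlternatingAt A) (hκ : IsAlternatingAt κ) :
    ∃ q : Polynomial ℝ, q.natDegree ≤ m ∧ (∀ s : ℝ, volRatio 𝒮 p (A + s • κ) = q.eval s) ∧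
      ∀ s : ℝ, mixedRatio 𝒮 p (A + s • κ) κ = q.derivative.eval s := by
  obtain ⟨χ, hp⟩ := exists_foliationChart 𝒮 p
  obtain ⟨q, hq, h⟩ := exists_polynomial_det_re (χ.matrixAt p (horPart 𝒮 p A))
    (χ.matrixAt p (horPart 𝒮 p κ))
  set c := (χ.matrixAt p (kahlerForm 𝒮 p)).det.re
  have h1 : ∀ s : ℝ, volRatio 𝒮 p (A + s • κ) = (q * Polynomial.C c⁻¹).eval s := fun s => by
    rw [volRatio_eq hp (hA.add_smul hκ s), horPart_add_smul, χ.matrixAt_add_smul, h,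
      Polynomial.eval_mul, Polynomial.eval_C, div_eq_mul_inv]
  refine ⟨q * Polynomial.C c⁻¹, (Polynomial.natDegree_mul_C_le _ _).trans hq, h1, fun s => ?_⟩
  rw [mixedRatio]
  simp only [add_smul_add_smul, h1]
  have h3 := ((q * Polynomial.C c⁻¹).hasDerivAt (s + 0)).comp_const_add s 0
  rw [add_zero] at h3
  exact h3.deriv

/-- This allows the parts of an exact form which are not horizontal of type (1,1) to be discarded
under the integral. -/
theorem mixedRatio_congr (h : horPart 𝒮 p κ = horPart 𝒮 p κ') :
    mixedRatio 𝒮 p A κ = mixedRatio 𝒮 p A κ' := by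
  simp only [mixedRatio, volRatio, horPart_add_smul, h]

theorem mixedRatio_add_smul (hA : IsAlternatingAt A) (hκ : IsAlternatingAt κ)
    (hκ' : IsAlternatingAt κ') (c : ℝ) :
    mixedRatio 𝒮 p A (κ + c • κ') = mixedRatio 𝒮 p A κ + c * mixedRatio 𝒮 p A κ' := by
  obtain ⟨χ, hp⟩ := exists_foliationChart 𝒮 p
  rw [mixedRatio_eq hp hA (hκ.add_smul hκ' c), mixedRatio_eq hp hA hκ, mixedRatio_eq hp hA hκ',
    horPart_add_smul, χ.matrixAt_add_smul, Matrix.mul_add, Matrix.trace_add, Matrix.mul_smul,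
    Matrix.trace_smul, Complex.add_re, smul_eq_mul, Complex.re_ofReal_mul]
  ring

/-- Euler's identity for a homogeneous polynomial of degree m; it produces the average m (2m+2) of
the scalar curvature. -/
theorem mixedRatio_self (hA : IsAlternatingAt A) : mixedRatio 𝒮 p A A = m * volRatio 𝒮 p A := by
  obtain ⟨χ, hp⟩ := exists_foliationChart 𝒮 p
  rw [mixedRatio_eq hp hA hA, volRatio_eq hp hA, Matrix.adjugate_mul, Matrix.trace_smul,
    Matrix.trace_one, Fintype.card_fin, smul_eq_mul, mul_comm, ← Complex.ofReal_natCast,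
    Complex.re_ofReal_mul, mul_div_assoc]

/-- The transverse scalar curvature in terms of mixed volumes. -/
theorem FoliationChart.scal_mul_volRatio {α : ∀ p : S, Tan m p →L[ℝ] Tan m p →L[ℝ] ℝ}
    (hp : p ∈ χ.chart.source) (hα : IsAlternatingAt (α p)) (hα' : IsInvariantAt 𝒮 p (α p))
    (hρ : IsAlternatingAt (χ.ricci α p)) (hρ' : IsInvariantAt 𝒮 p (χ.ricci α p))
    (hdet : (χ.matrixAt p (α p)).det ≠ 0) (him : (χ.matrixAt p (α p)).det.im = 0) :
    χ.scal α p * volRatio 𝒮 p (α p) = mixedRatio 𝒮 p (α p) (χ.ricci α p) := by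
  rw [mixedRatio_eq hp hα hρ, volRatio_eq hp hα, hα'.horPart_eq, hρ'.horPart_eq, ← mul_div_assoc]
  congr 1
  have h1 : χ.scal α p = ((χ.matrixAt p (α p))⁻¹ * χ.matrixAt p (χ.ricci α p)).trace.re := rfl
  set M := χ.matrixAt p (α p)
  have h2 : M.det = (M.det.re : ℂ) := Complex.ext rfl (by simpa using him)
  have h3 : M.det.re ≠ 0 := fun h0 => hdet (by rw [h2, h0, Complex.ofReal_zero])
  rw [h1, Matrix.inv_def, Ring.inverse_eq_inv', h2, ← Complex.ofReal_inv, Matrix.smul_mul,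
    Matrix.trace_smul, smul_eq_mul, Complex.re_ofReal_mul, Complex.ofReal_re]
  field_simp

end Mixed

end Sasaki

end

noncomputable section

namespace Sasaki

/-! ### Transverse Ricci forms -/

section Ricci

variable {m : ℕ} {S : Type*} [TopologicalSpace S] [ChartedSpace (Model m) S]
  [IsManifold (𝓡 (2 * m + 1)) ∞ S] {𝒮 : SasakianStructure m S}

theorem isBasicFunction_of_isBasicOn {u : S → ℝ} (h : ∀ χ : FoliationChart 𝒮, χ.IsBasicOn u) :
    IsBasicFunction 𝒮 u := by
  refine ⟨fun p => ?_, fun p => ?_⟩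
  · obtain ⟨χ, hp⟩ := exists_foliationChart 𝒮 p
    have h1 : ContMDiffOn (𝓡 (2 * m + 1)) 𝓘(ℝ, ℝ) ∞ (χ.pull0 u ∘ χ.chart) χ.chart.source :=
      (contMDiffOn_iff_contDiffOn.2 (h χ).smooth).comp χ.smooth fun q hq => χ.chart.map_source hq
    refine (h1.contMDiffAt (χ.chart.open_source.mem_nhds hp)).congr_of_eventuallyEq ?_
    filter_upwards [χ.chart.open_source.mem_nhds hp] with q hq
    exact congrArg u (χ.chart.left_inv hq).symm
  · obtain ⟨χ, hp⟩ := exists_foliationChart 𝒮 p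
    rw [← χ.inv_one_zero hp]
    obtain ⟨y, hy, rfl⟩ := χ.exists_symm_eq hp
    rw [χ.diff_inv hy (((h χ).smooth.contDiffAt (χ.chart.open_target.mem_nhds hy)).differentiableAt
      (by simp)), (h χ).basic y hy]

namespace FoliationChart

variable {χ : FoliationChart 𝒮} {y : CF m}

theorem matrixAt_dOne {α : ∀ p : S, Tan m p →L[ℝ] ℝ} (hy : y ∈ χ.chart.target)
    (hα : DifferentiableAt ℝ (χ.pull1 α) y) :
    χ.matrixAt (χ.chart.symm y) (dOne (𝓡 (2 * m + 1)) α (χ.chart.symm y))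
      = extMatrix (χ.pull1 α) y := by
  simp only [matrixAt, extMatrix, χ.dOne_inv hy hα]

theorem transverseJ_inv_eq_horLift (hy : y ∈ χ.chart.target) (v : CF m) :
    transverseJ 𝒮 (χ.chart.symm y) (χ.inv (χ.chart.symm y) v)
      = χ.inv (χ.chart.symm y) (horLift (χ.pull1 (contact 𝒮) y) (Complex.I • v.2)) :=
  χ.transverseJ_inv hy v

theorem matrixAt_horPart_dOne {τ : ∀ p : S, Tan m p →L[ℝ] ℝ} (hy : y ∈ χ.chart.target)
    (hτ : DifferentiableAt ℝ (χ.pull1 τ) y) :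
    χ.matrixAt (χ.chart.symm y) (horPart 𝒮 _ (dOne (𝓡 (2 * m + 1)) τ (χ.chart.symm y)))
      = formMatrix (horTensor (χ.pull1 (contact 𝒮)) (χ.pull1 τ) y) := by
  have h1 : ∀ v : Fin m → ℂ, horLift (χ.pull1 (contact 𝒮) y) (-v)
      = -horLift (χ.pull1 (contact 𝒮) y) v := fun v => by
    have h2 : ((0, -v) : CF m) = -(0, v) := by simp
    refine Prod.ext ?_ ?_
    · simp only [horLift, h2, map_neg, Prod.fst_neg]
    · simp only [horLift, Prod.snd_neg]
  have h2 : ∀ v w : Fin m → ℂ,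
      horPart 𝒮 _ (dOne (𝓡 (2 * m + 1)) τ (χ.chart.symm y)) (χ.inv _ (0, v)) (χ.inv _ (0, w))
        = horTensor (χ.pull1 (contact 𝒮)) (χ.pull1 τ) y v w := fun v w => by
    have h3 : ∀ v : Fin m → ℂ, Complex.I • (horLift (χ.pull1 (contact 𝒮) y)
        (Complex.I • v)).2 = -v := fun v => by
      simp [horLift, smul_smul]
    rw [horPart_apply, transverseJ_inv_eq_horLift hy, transverseJ_inv_eq_horLift hy,
      transverseJ_inv_eq_horLift hy, transverseJ_inv_eq_horLift hy, χ.dOne_inv hy hτ,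
      χ.dOne_inv hy hτ, h3, h3, h1, h1, horTensor]
    simp only [map_neg, _root_.neg_apply, neg_neg]
  simp only [matrixAt, h2]

theorem IsTypeOneOneOn.fderiv_det {α : ∀ p : S, Tan m p →L[ℝ] ℝ} (h : χ.IsTypeOneOneOn α)
    (hy : y ∈ χ.chart.target) :
    fderiv ℝ (fun z => (extMatrix (χ.pull1 α) z).det) y (1, 0) = 0 := by
  have hd : ∀ i j, DifferentiableAt ℝ (fun z => extMatrix (χ.pull1 α) z i j) y := fun i j =>
    ((contDiffOn_extMatrix χ.chart.open_target h.smooth i j).contDiffAt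
      (χ.chart.open_target.mem_nhds hy)).differentiableAt (by simp)
  have h0 := fderiv_fderiv_eq_zero_of_eqOn χ.chart.open_target h.smooth h.fderiv_left hy
  have h1 : ∀ v w : CF m, HasFDerivAt
      (fun z => ((skew (fderiv ℝ (χ.pull1 α) z) v w : ℝ) : ℂ))
      (Complex.ofRealCLM.comp (fderiv ℝ (fun z => skew (fderiv ℝ (χ.pull1 α) z) v w) y)) y :=
    fun v w => Complex.ofRealCLM.hasFDerivAt.comp y
      (((contDiffOn_skew χ.chart.open_target h.smooth v w).contDiffAt
        (χ.chart.open_target.mem_nhds hy)).differentiableAt (by simp)).hasFDerivAt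
  have h2 : ∀ v w : CF m, fderiv ℝ (fun z => skew (fderiv ℝ (χ.pull1 α) z) v w) y (1, 0) = 0 :=
    fun v w => by
      rw [fderiv_skew χ.chart.open_target h.smooth hy, h0]
      simp
  have h3 : ∀ i j, fderiv ℝ (fun z => extMatrix (χ.pull1 α) z i j) y (1, 0) = 0 := fun i j => by
    have h4 : fderiv ℝ (fun z => extMatrix (χ.pull1 α) z i j) y = _ :=
      HasFDerivAt.fderiv (((h1 (0, Pi.single i 1) (0, Pi.single j Complex.I)).sub
        ((h1 (0, Pi.single i 1) (0, Pi.single j 1)).const_mul Complex.I)).const_mul (1 / 2 : ℂ))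
    rw [h4]
    simp [h2]
  rw [Sasaki.fderiv_det hd]
  refine Finset.sum_eq_zero fun i _ => ?_
  simp only [h3]
  exact Matrix.det_eq_zero_of_row_eq_zero i fun j => by simp

theorem IsTypeOneOneOn.isBasicOn_logDet {α : ∀ p : S, Tan m p →L[ℝ] ℝ} (h : χ.IsTypeOneOneOn α)
    (hpos : ∀ p ∈ χ.chart.source, 0 < (χ.matrixAt p (dOne (𝓡 (2 * m + 1)) α p)).det.re) :
    χ.IsBasicOn (χ.logDet (dOne (𝓡 (2 * m + 1)) α)) := by
  have h1 : ∀ z ∈ χ.chart.target, χ.pull0 (χ.logDet (dOne (𝓡 (2 * m + 1)) α)) z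
      = Real.log (extMatrix (χ.pull1 α) z).det.re := fun z hz => by
    rw [← matrixAt_dOne hz (h.differentiableAt hz)]
    rfl
  have h2 : ∀ z ∈ χ.chart.target, 0 < (extMatrix (χ.pull1 α) z).det.re := fun z hz => by
    rw [← matrixAt_dOne hz (h.differentiableAt hz)]
    exact hpos _ (χ.chart.map_target hz)
  have h3 : ContDiffOn ℝ ∞ (fun z => (extMatrix (χ.pull1 α) z).det) χ.chart.target :=
    contDiffOn_det (contDiffOn_extMatrix χ.chart.open_target h.smooth)
  have h4 : ContDiffOn ℝ ∞ (fun z => (extMatrix (χ.pull1 α) z).det.re) χ.chart.target :=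
    Complex.reCLM.contDiff.comp_contDiffOn h3
  refine ⟨(h4.log fun z hz => (h2 z hz).ne').congr h1, fun y hy => ?_⟩
  have hn := χ.chart.open_target.mem_nhds hy
  have h5 : χ.pull0 (χ.logDet (dOne (𝓡 (2 * m + 1)) α))
      =ᶠ[𝓝 y] fun z => Real.log (extMatrix (χ.pull1 α) z).det.re := by
    filter_upwards [hn] with z hz using h1 z hz
  have h6 : HasFDerivAt (fun z => (extMatrix (χ.pull1 α) z).det.re)
      (Complex.reCLM.comp (fderiv ℝ (fun z => (extMatrix (χ.pull1 α) z).det) y)) y :=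
    Complex.reCLM.hasFDerivAt.comp y ((h3.contDiffAt hn).differentiableAt (by simp)).hasFDerivAt
  rw [h5.fderiv_eq, (h6.log (h2 y hy).ne').fderiv, _root_.smul_apply,
    ContinuousLinearMap.comp_apply, h.fderiv_det hy, map_zero, smul_zero]

theorem IsBasicOn.ddcB_inv {u : S → ℝ} (hu : χ.IsBasicOn u) (hy : y ∈ χ.chart.target) (v w : CF m) :
    ddcB 𝒮 u (χ.chart.symm y) (χ.inv _ v) (χ.inv _ w)
      = -(1 / 2) * (fderiv ℝ (fderiv ℝ (χ.pull0 u)) y v (stdJ m w)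
        - fderiv ℝ (fderiv ℝ (χ.pull0 u)) y w (stdJ m v)) := by
  rw [ddcB, χ.dOne_inv hy (hu.isTypeOneOneOn.differentiableAt hy), skew_apply,
    hu.fderiv_pull1_dcB hy, hu.fderiv_pull1_dcB hy]
  ring

/-- The relation between the functions is assumed only on the chart domain, because it is applied to
log det (g_{i j̄}), which has a meaning only there. -/
theorem IsBasicOn.fderiv_fderiv_add_smul {u v w : S → ℝ} (hu : χ.IsBasicOn u) (hv : χ.IsBasicOn v)
    {c : ℝ} (h : ∀ p ∈ χ.chart.source, w p = u p + c * v p) (hy : y ∈ χ.chart.target) :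
    fderiv ℝ (fderiv ℝ (χ.pull0 w)) y = fderiv ℝ (fderiv ℝ (χ.pull0 u)) y
      + c • fderiv ℝ (fderiv ℝ (χ.pull0 v)) y := by
  have hd : ∀ {u : S → ℝ}, χ.IsBasicOn u → ∀ z ∈ χ.chart.target,
      DifferentiableAt ℝ (χ.pull0 u) z ∧ DifferentiableAt ℝ (fderiv ℝ (χ.pull0 u)) z :=
    fun hu z hz => ⟨(hu.smooth.contDiffAt (χ.chart.open_target.mem_nhds hz)).differentiableAt
      (by simp), ((hu.smooth.contDiffAt (χ.chart.open_target.mem_nhds hz)).fderiv_right (m := 1)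
        (by norm_cast)).differentiableAt (by simp)⟩
  have h1 : ∀ z ∈ χ.chart.target, fderiv ℝ (χ.pull0 w) z
      = fderiv ℝ (χ.pull0 u) z + c • fderiv ℝ (χ.pull0 v) z := fun z hz => by
    have h2 : χ.pull0 w =ᶠ[𝓝 z] χ.pull0 u + c • χ.pull0 v := by
      filter_upwards [χ.chart.open_target.mem_nhds hz] with x hx
      exact h _ (χ.chart.map_target hx)
    rw [h2.fderiv_eq, fderiv_add (hd hu z hz).1 ((hd hv z hz).1.const_smul c),
      fderiv_const_smul (hd hv z hz).1]
  have h2 : fderiv ℝ (χ.pull0 w) =ᶠ[𝓝 y] fderiv ℝ (χ.pull0 u) + c • fderiv ℝ (χ.pull0 v) := by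
    filter_upwards [χ.chart.open_target.mem_nhds hy] with z hz using h1 z hz
  rw [h2.fderiv_eq, fderiv_add (hd hu y hy).2 ((hd hv y hy).2.const_smul c),
    fderiv_const_smul (hd hv y hy).2]

theorem IsBasicOn.add_smul {u v w : S → ℝ} (hu : χ.IsBasicOn u) (hv : χ.IsBasicOn v)
    {c : ℝ} (h : ∀ p ∈ χ.chart.source, w p = u p + c * v p) : χ.IsBasicOn w := by
  have h0 : ∀ z ∈ χ.chart.target, χ.pull0 w z = (χ.pull0 u + c • χ.pull0 v) z := fun z hz =>
    h _ (χ.chart.map_target hz)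
  refine ⟨(hu.smooth.add (hv.smooth.const_smul c)).congr h0, fun y hy => ?_⟩
  have hn := χ.chart.open_target.mem_nhds hy
  have h1 : χ.pull0 w =ᶠ[𝓝 y] χ.pull0 u + c • χ.pull0 v := by
    filter_upwards [hn] with z hz using h0 z hz
  have hv' := (hv.smooth.contDiffAt hn).differentiableAt (by simp)
  rw [h1.fderiv_eq, fderiv_add ((hu.smooth.contDiffAt hn).differentiableAt (by simp))
    (hv'.const_smul c), fderiv_const_smul hv', _root_.add_apply, _root_.smul_apply, hu.basic y hy,
    hv.basic y hy, smul_zero, add_zero]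

theorem IsBasicOn.ddcB_add_smul {u v w : S → ℝ} (hu : χ.IsBasicOn u) (hv : χ.IsBasicOn v)
    {c : ℝ} (h : ∀ p ∈ χ.chart.source, w p = u p + c * v p) {p : S} (hp : p ∈ χ.chart.source) :
    ddcB 𝒮 w p = ddcB 𝒮 u p + c • ddcB 𝒮 v p := by
  obtain ⟨y, hy, rfl⟩ := χ.exists_symm_eq hp
  have h1 : ∀ a b : CF m, ddcB 𝒮 w (χ.chart.symm y) (χ.inv _ a) (χ.inv _ b)
      = ddcB 𝒮 u (χ.chart.symm y) (χ.inv _ a) (χ.inv _ b)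
        + c * ddcB 𝒮 v (χ.chart.symm y) (χ.inv _ a) (χ.inv _ b) := fun a b => by
    rw [hu.ddcB_inv hy, hv.ddcB_inv hy, (hu.add_smul hv h).ddcB_inv hy,
      hu.fderiv_fderiv_add_smul hv h hy]
    simp only [_root_.add_apply, _root_.smul_apply, smul_eq_mul]
    ring
  refine ContinuousLinearMap.ext fun a => ContinuousLinearMap.ext fun b => ?_
  have h2 := h1 (χ.der _ a) (χ.der _ b)
  rw [χ.inv_der hp, χ.inv_der hp] at h2
  simpa only [_root_.add_apply, _root_.smul_apply, smul_eq_mul] using h2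

end FoliationChart

theorem IsBasicFunction.add_smul {u v : S → ℝ} (hu : IsBasicFunction 𝒮 u)
    (hv : IsBasicFunction 𝒮 v) (c : ℝ) : IsBasicFunction 𝒮 fun p => u p + c * v p :=
  isBasicFunction_of_isBasicOn fun χ => (χ.isBasicOn_of_isBasicFunction hu).add_smul
    (χ.isBasicOn_of_isBasicFunction hv) fun _ _ => rfl

theorem IsBasicFunction.ddcB_add_smul {u v : S → ℝ} (hu : IsBasicFunction 𝒮 u)
    (hv : IsBasicFunction 𝒮 v) (c : ℝ) (p : S) :
    ddcB 𝒮 (fun p => u p + c * v p) p = ddcB 𝒮 u p + c • ddcB 𝒮 v p := by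
  obtain ⟨χ, hp⟩ := exists_foliationChart 𝒮 p
  exact (χ.isBasicOn_of_isBasicFunction hu).ddcB_add_smul (χ.isBasicOn_of_isBasicFunction hv)
    (fun _ _ => rfl) hp

theorem isBasicFunction_const (c : ℝ) : IsBasicFunction 𝒮 fun _ => c :=
  isBasicFunction_of_isBasicOn fun χ => by
    have h : χ.pull0 (fun _ => c) = fun _ => c := rfl
    exact ⟨by rw [h]; exact contDiffOn_const, fun y _ => by rw [h]; simp⟩

theorem ddcB_const (c : ℝ) (p : S) : ddcB 𝒮 (fun _ => c) p = 0 := by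
  obtain ⟨χ, hp⟩ := exists_foliationChart 𝒮 p
  obtain ⟨y, hy, rfl⟩ := χ.exists_symm_eq hp
  have h0 : fderiv ℝ (χ.pull0 fun _ => c) = 0 := by
    have h : χ.pull0 (fun _ => c) = fun _ => c := rfl
    rw [h]
    exact fderiv_const c
  have h1 : ∀ a b : CF m, ddcB 𝒮 (fun _ => c) (χ.chart.symm y) (χ.inv _ a) (χ.inv _ b) = 0 :=
    fun a b => by
      rw [(χ.isBasicOn_of_isBasicFunction (isBasicFunction_const c)).ddcB_inv hy, h0, fderiv_zero]
      simp
  refine ContinuousLinearMap.ext fun a => ContinuousLinearMap.ext fun b => ?_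
  have h2 := h1 (χ.der _ a) (χ.der _ b)
  rwa [χ.inv_der hp, χ.inv_der hp] at h2

/-! ### Potentials -/

variable {φ : S → ℝ}

theorem isTypeOneOne_contactOf (hφ : IsBasicFunction 𝒮 φ) : IsTypeOneOne 𝒮 (contactOf 𝒮 φ) :=
  isTypeOneOne_contact.add hφ.isTypeOneOne

theorem isAlternatingAt_dOne (α : ∀ p : S, Tan m p →L[ℝ] ℝ) (p : S) :
    IsAlternatingAt (dOne (𝓡 (2 * m + 1)) α p) := dOne_alternating p

theorem isInvariantAt_kahlerFormOf (hφ : IsBasicFunction 𝒮 φ) (p : S) :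
    IsInvariantAt 𝒮 p (kahlerFormOf 𝒮 φ p) := (isTypeOneOne_contactOf hφ).isInvariantAt p

open scoped ComplexOrder in
theorem det_matrixAt_kahlerFormOf_pos {χ : FoliationChart 𝒮} {p : S} (hφ : φ ∈ potentials 𝒮)
    (hp : p ∈ χ.chart.source) :
    0 < (χ.matrixAt p (kahlerFormOf 𝒮 φ p)).det.re ∧
      (χ.matrixAt p (kahlerFormOf 𝒮 φ p)).det.im = 0 := by
  have h := (Complex.pos_iff.1 (FoliationChart.posDef_matrixAt hp
    (isAlternatingAt_dOne (contactOf 𝒮 φ) p) (isInvariantAt_kahlerFormOf hφ.1 p)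
      (hφ.2 p)).det_pos)
  exact ⟨h.1, h.2.symm⟩

/-- The quotient of the volume forms `(dη_φ)ᵐ ∧ η_φ` and `(dη)ᵐ ∧ η`. -/
def density (𝒮 : SasakianStructure m S) (φ : S → ℝ) (p : S) : ℝ :=
  volRatio 𝒮 p (kahlerFormOf 𝒮 φ p)

theorem density_eq {χ : FoliationChart 𝒮} {p : S} (hφ : IsBasicFunction 𝒮 φ)
    (hp : p ∈ χ.chart.source) : density 𝒮 φ p
      = (χ.matrixAt p (kahlerFormOf 𝒮 φ p)).det.re / (χ.matrixAt p (kahlerForm 𝒮 p)).det.re := by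
  have h : IsAlternatingAt (kahlerFormOf 𝒮 φ p) := isAlternatingAt_dOne _ p
  rw [density, volRatio_eq hp h,
    (isInvariantAt_kahlerFormOf hφ p).horPart_eq]

theorem density_pos (hφ : φ ∈ potentials 𝒮) (p : S) : 0 < density 𝒮 φ p := by
  obtain ⟨χ, hp⟩ := exists_foliationChart 𝒮 p
  rw [density_eq hφ.1 hp]
  exact div_pos (det_matrixAt_kahlerFormOf_pos hφ hp).1 (det_matrixAt_kahlerForm_pos hp)

/-- The local functions log det change by the global function log density. Hence the Ricci forms of
dη_φ and dη differ by dd^c of a global basic function. -/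
theorem log_density_eq {χ : FoliationChart 𝒮} {p : S} (hφ : φ ∈ potentials 𝒮)
    (hp : p ∈ χ.chart.source) : χ.logDet (kahlerFormOf 𝒮 φ) p
      = χ.logDet (kahlerForm 𝒮) p + 1 * Real.log (density 𝒮 φ p) := by
  rw [density_eq hφ.1 hp, Real.log_div (det_matrixAt_kahlerFormOf_pos hφ hp).1.ne'
    (det_matrixAt_kahlerForm_pos hp).ne']
  have h1 : χ.logDet (kahlerForm 𝒮) p = Real.log (χ.matrixAt p (kahlerForm 𝒮 p)).det.re := rfl
  have h2 : χ.logDet (kahlerFormOf 𝒮 φ) p = Real.log (χ.matrixAt p (kahlerFormOf 𝒮 φ p)).det.re :=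
    rfl
  rw [h1, h2]
  ring

theorem isBasicOn_logDet_kahlerForm (χ : FoliationChart 𝒮) : χ.IsBasicOn (χ.logDet (kahlerForm 𝒮)) :=
  FoliationChart.isTypeOneOneOn_contact.isBasicOn_logDet fun _ hp => det_matrixAt_kahlerForm_pos hp

theorem isBasicOn_logDet_kahlerFormOf (hφ : φ ∈ potentials 𝒮) (χ : FoliationChart 𝒮) :
    χ.IsBasicOn (χ.logDet (kahlerFormOf 𝒮 φ)) :=
  (isTypeOneOne_contactOf hφ.1 χ).isBasicOn_logDet fun _ hp =>
    (det_matrixAt_kahlerFormOf_pos hφ hp).1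

theorem isBasicFunction_log_density (hφ : φ ∈ potentials 𝒮) :
    IsBasicFunction 𝒮 fun p => Real.log (density 𝒮 φ p) :=
  isBasicFunction_of_isBasicOn fun χ => (isBasicOn_logDet_kahlerFormOf hφ χ).add_smul (c := -1)
    (isBasicOn_logDet_kahlerForm χ) fun p hp => by
      rw [log_density_eq hφ hp]
      ring

theorem FoliationChart.ricci_kahlerFormOf {χ : FoliationChart 𝒮} {p : S} (hφ : φ ∈ potentials 𝒮)
    (hp : p ∈ χ.chart.source) : χ.ricci (kahlerFormOf 𝒮 φ) p
      = χ.ricci (kahlerForm 𝒮) p + (-1 : ℝ) • ddcB 𝒮 (fun q => Real.log (density 𝒮 φ q)) p := by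
  have h := (isBasicOn_logDet_kahlerForm χ).ddcB_add_smul
    (χ.isBasicOn_of_isBasicFunction (isBasicFunction_log_density hφ))
    (fun q hq => log_density_eq hφ hq) hp
  refine ContinuousLinearMap.ext fun a => ContinuousLinearMap.ext fun b => ?_
  simp only [ricci, h, _root_.add_apply, _root_.smul_apply, _root_.neg_apply, smul_eq_mul]
  ring

/-- The chart chosen in the definitions depends on p alone, so a single chart serves all forms at p
and independence of the chart is not needed. -/
theorem exists_transverseRicci_eq (p : S) : ∃ χ : FoliationChart 𝒮, p ∈ χ.chart.source ∧
    ∀ α : ∀ p : S, Tan m p →L[ℝ] Tan m p →L[ℝ] ℝ,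
      transverseRicci 𝒮 α p = χ.ricci α p ∧ transverseScal 𝒮 α p = χ.scal α p := by
  have h := exists_foliationChart 𝒮 p
  exact ⟨h.choose, h.choose_spec, fun α => ⟨dif_pos h, dif_pos h⟩⟩

theorem FoliationChart.isInvariantAt_ricci {χ : FoliationChart 𝒮} {p : S}
    {α : ∀ p : S, Tan m p →L[ℝ] Tan m p →L[ℝ] ℝ}
    (hα : χ.IsBasicOn (χ.logDet α)) (hp : p ∈ χ.chart.source) :
    IsInvariantAt 𝒮 p (χ.ricci α p) := fun v w =>
  congrArg Neg.neg (hα.isTypeOneOneOn.isInvariantAt hp v w)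

theorem FoliationChart.isAlternatingAt_ricci {χ : FoliationChart 𝒮} {p : S}
    {α : ∀ p : S, Tan m p →L[ℝ] Tan m p →L[ℝ] ℝ} : IsAlternatingAt (χ.ricci α p) := fun v w =>
  congrArg Neg.neg (isAlternatingAt_dOne (dcB 𝒮 (χ.logDet α)) p v w)

theorem isInvariantAt_transverseRicci (p : S) :
    IsInvariantAt 𝒮 p (transverseRicci 𝒮 (kahlerForm 𝒮) p) := by
  obtain ⟨χ, hp, h⟩ := exists_transverseRicci_eq (𝒮 := 𝒮) p
  rw [(h _).1]
  exact FoliationChart.isInvariantAt_ricci (isBasicOn_logDet_kahlerForm χ) hp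

theorem transverseRicci_kahlerFormOf (hφ : φ ∈ potentials 𝒮) (p : S) :
    transverseRicci 𝒮 (kahlerFormOf 𝒮 φ) p = transverseRicci 𝒮 (kahlerForm 𝒮) p
      + (-1 : ℝ) • ddcB 𝒮 (fun q => Real.log (density 𝒮 φ q)) p := by
  obtain ⟨χ, hp, h⟩ := exists_transverseRicci_eq (𝒮 := 𝒮) p
  rw [(h _).1, (h _).1]
  exact FoliationChart.ricci_kahlerFormOf hφ hp

theorem transverseScal_mul_density (hφ : φ ∈ potentials 𝒮) (p : S) :
    transverseScal 𝒮 (kahlerFormOf 𝒮 φ) p * density 𝒮 φ p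
      = mixedRatio 𝒮 p (kahlerFormOf 𝒮 φ p) (transverseRicci 𝒮 (kahlerFormOf 𝒮 φ) p) := by
  obtain ⟨χ, hp, h⟩ := exists_transverseRicci_eq (𝒮 := 𝒮) p
  rw [(h _).1, (h _).2]
  have h1 := det_matrixAt_kahlerFormOf_pos hφ hp
  exact FoliationChart.scal_mul_volRatio hp (isAlternatingAt_dOne _ p)
    (isInvariantAt_kahlerFormOf hφ.1 p) FoliationChart.isAlternatingAt_ricci
    (FoliationChart.isInvariantAt_ricci (isBasicOn_logDet_kahlerFormOf hφ χ) hp)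
    (fun h0 => h1.1.ne' (by rw [h0, Complex.zero_re])) h1.2

end Ricci

end Sasaki

end

noncomputable section

namespace Sasaki

/-! ### The volume measure -/

theorem integrableOn_of_eq_zero_off {E : Type*} [TopologicalSpace E] [T2Space E] [MeasurableSpace E]
    [OpensMeasurableSpace E] {μ : Measure E} [IsFiniteMeasureOnCompacts μ] {f : E → ℝ} {U K : Set E}
    (hU : IsOpen U) (hf : ContinuousOn f U) (hK : IsCompact K) (hKU : K ⊆ U)
    (h0 : ∀ y ∈ U, y ∉ K → f y = 0) : IntegrableOn f U μ :=
  ((hf.mono hKU).integrableOn_compact' hK hK.measurableSet).of_forall_sdiff_eq_zero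
    hU.measurableSet fun y hy => h0 y hy.1 hy.2

/-- An identification of `ℝ × ℂᵐ` with the model space. -/
def modelEquiv (m : ℕ) : CF m ≃L[ℝ] Model m :=
  ContinuousLinearEquiv.ofFinrankEq ((finrank_CF m).trans (finrank_euclideanSpace_fin).symm)

/-- The Lebesgue measure on `ℝ × ℂᵐ`, up to a constant. -/
def modelMeasure (m : ℕ) : Measure (CF m) := Measure.map (modelEquiv m).symm volume

instance (m : ℕ) : (modelMeasure m).IsAddHaarMeasure :=
  ContinuousLinearEquiv.isAddHaarMeasure_map (modelEquiv m).symm volume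

theorem setIntegral_modelMeasure {m : ℕ} (s : Set (CF m)) (g : CF m → ℝ) :
    ∫ z in s, g z ∂modelMeasure m = ∫ y in modelEquiv m '' s, g ((modelEquiv m).symm y) := by
  have h := setIntegral_map_equiv (μ := (volume : Measure (Model m)))
    (modelEquiv m).symm.toHomeomorph.toMeasurableEquiv g s
  refine h.trans ?_
  congr 2
  exact ((modelEquiv m).toEquiv.image_eq_preimage_symm s).symm

section Density

variable {m : ℕ} {S : Type*} [TopologicalSpace S] [ChartedSpace (Model m) S]
  [IsManifold (𝓡 (2 * m + 1)) ∞ S] (𝒮 : SasakianStructure m S)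

/-- The volume form `(dη)ᵐ ∧ η`. -/
def volForm (p : S) (v : Fin (2 * m + 1) → Tan m p) : ℝ :=
  powWedge m (fun v w => kahlerForm 𝒮 p v w) (contact 𝒮 p) v

/-- The determinant which relates the standard frame of `ℝ × ℂᵐ` and that of the model space. -/
def modelDet (m : ℕ) : ℝ :=
  LinearMap.det ((stdFrameBasis m).constr ℝ fun i =>
    (modelEquiv m).symm (EuclideanSpace.single i 1) : CF m →ₗ[ℝ] CF m)

variable {𝒮} (χ : FoliationChart 𝒮)

namespace FoliationChart

/-- The density of the volume form in a foliation chart. -/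
def volDensity (z : CF m) : ℝ :=
  (χ.matrixAt (χ.chart.symm z) (kahlerForm 𝒮 (χ.chart.symm z))).det.re

theorem volDensity_pos {z : CF m} (hz : z ∈ χ.chart.target) : 0 < χ.volDensity z :=
  det_matrixAt_kahlerForm_pos (χ.chart.map_target hz)

theorem volDensity_eq {z : CF m} (hz : z ∈ χ.chart.target) :
    χ.volDensity z = (extMatrix (χ.pull1 (contact 𝒮)) z).det.re :=
  congrArg (fun M : Matrix (Fin m) (Fin m) ℂ => M.det.re)
    (matrixAt_dOne hz (isTypeOneOneOn_contact.differentiableAt hz))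

theorem contDiffOn_volDensity : ContDiffOn ℝ ∞ χ.volDensity χ.chart.target :=
  (Complex.reCLM.contDiff.comp_contDiffOn (contDiffOn_det (contDiffOn_extMatrix χ.chart.open_target
    χ.contDiffOn_pull1_contact))).congr fun _ hz => χ.volDensity_eq hz

theorem volForm_modelFrame {p : S} (hp : p ∈ χ.chart.source) :
    volForm 𝒮 p (fun i => χ.inv p ((modelEquiv m).symm (EuclideanSpace.single i 1)))
      = modelDet m * ((χ.matrixAt p (kahlerForm 𝒮 p)).det.re * frameConst m) := by
  rw [volForm, powWedge_chart hp (isAlternatingAt_kahlerForm 𝒮 p) (kahlerForm_transverseJ 𝒮 p) _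
    (contact_reeb 𝒮 p)]
  simp only [frameMap, χ.der_inv hp, modelDet]

theorem modelDet_ne_zero (χ : FoliationChart 𝒮) {p : S} (hp : p ∈ χ.chart.source) :
    modelDet m ≠ 0 := by
  have h1 : LinearIndependent ℝ fun i : Fin (2 * m + 1) =>
      χ.inv p ((modelEquiv m).symm (EuclideanSpace.single i 1)) := by
    refine LinearIndependent.of_comp ((χ.der p : Tan m p →ₗ[ℝ] CF m)) ?_
    refine LinearIndependent.of_comp ((modelEquiv m).toLinearEquiv : CF m →ₗ[ℝ] Model m) ?_
    have h : ∀ i : Fin (2 * m + 1), modelEquiv m (χ.der p (χ.inv p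
        ((modelEquiv m).symm (EuclideanSpace.single i 1)))) = stdB p i := fun i => by
      rw [χ.der_inv hp, ContinuousLinearEquiv.apply_symm_apply]
      rfl
    have h' : (⇑((modelEquiv m).toLinearEquiv : CF m →ₗ[ℝ] Model m) ∘
        ⇑(χ.der p : Tan m p →ₗ[ℝ] CF m) ∘ fun i => χ.inv p
          ((modelEquiv m).symm (EuclideanSpace.single i 1))) = stdB p := funext h
    rw [h']
    exact linearIndependent_stdB p
  have h2 := det_frameMap_ne_zero hp h1
  simp only [frameMap, χ.der_inv hp] at h2
  exact h2

/-- The density in a preferred chart is the Jacobian of the transition map times the density in the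
foliation chart. The arbitrary identification `modelEquiv` costs only the constant `modelDet`. -/
theorem chartDensity_eq (x : S) {y : Model m}
    (hy : y ∈ (chartAt (Model m) x).target ∩ (chartAt (Model m) x).symm ⁻¹' χ.chart.source) :
    chartDensity (volForm 𝒮) x y
      = LinearMap.det (((modelEquiv m : CF m →L[ℝ] Model m).comp
          (fderiv ℝ (χ.transition x) y) : Model m →L[ℝ] Model m) : Model m →ₗ[ℝ] Model m) *
        (modelDet m * (χ.volDensity (χ.transition x y) * frameConst m)) := by
  set q := (extChartAt (𝓡 (2 * m + 1)) x).symm y with hq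
  have hqs : q ∈ χ.chart.source := hy.2
  have h1 : χ.chart.symm (χ.transition x y) = q := χ.chart.left_inv hqs
  have h2 : χ.volDensity (χ.transition x y) = (χ.matrixAt q (kahlerForm 𝒮 q)).det.re :=
    congrArg (fun r => (χ.matrixAt r (kahlerForm 𝒮 r)).det.re) h1
  rw [h2, ← χ.volForm_modelFrame hqs]
  let B : Model m →ₗ[ℝ] Model m →ₗ[ℝ] ℝ := (χ.bilinAt q (kahlerForm 𝒮 q)).compl₁₂
    ((modelEquiv m).symm.toLinearEquiv : Model m →ₗ[ℝ] CF m)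
    ((modelEquiv m).symm.toLinearEquiv : Model m →ₗ[ℝ] CF m)
  let θ : Model m →ₗ[ℝ] ℝ := (((contact 𝒮 q).comp (χ.inv q) : CF m →L[ℝ] ℝ) : CF m →ₗ[ℝ] ℝ).comp
    ((modelEquiv m).symm.toLinearEquiv : Model m →ₗ[ℝ] CF m)
  have h3 := powWedge_comp m finrank_euclideanSpace_fin B θ
    (((modelEquiv m : CF m →L[ℝ] Model m).comp
      (fderiv ℝ (χ.transition x) y) : Model m →L[ℝ] Model m) : Model m →ₗ[ℝ] Model m)
    (fun i => EuclideanSpace.single i 1)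
  refine Eq.trans ?_ h3
  have h4 : ∀ v : Model m, chartSymmDeriv (𝓡 (2 * m + 1)) x y v
      = χ.inv q ((modelEquiv m).symm (modelEquiv m (fderiv ℝ (χ.transition x) y v))) := fun v => by
    rw [χ.chartSymmDeriv_eq x hy, ContinuousLinearEquiv.symm_apply_apply]
    rfl
  simp only [chartDensity, h4]
  rfl

theorem continuousOn_chartDensity (x : S) :
    ContinuousOn (chartDensity (volForm 𝒮) x) (chartAt (Model m) x).target := by
  intro y hy
  obtain ⟨χ, hp⟩ := exists_foliationChart 𝒮 ((chartAt (Model m) x).symm y)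
  have hN := χ.isOpen_transition_domain x
  have hyN : y ∈ (chartAt (Model m) x).target ∩ (chartAt (Model m) x).symm ⁻¹' χ.chart.source :=
    ⟨hy, hp⟩
  have hT := χ.contDiffOn_transition x
  have h1 : ContinuousOn (fun y => LinearMap.det (((modelEquiv m : CF m →L[ℝ] Model m).comp
      (fderiv ℝ (χ.transition x) y) : Model m →L[ℝ] Model m) : Model m →ₗ[ℝ] Model m) *
        (modelDet m * (χ.volDensity (χ.transition x y) * frameConst m)))
      ((chartAt (Model m) x).target ∩ (chartAt (Model m) x).symm ⁻¹' χ.chart.source) := by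
    refine ContinuousOn.mul ?_ (continuousOn_const.mul (ContinuousOn.mul ?_ continuousOn_const))
    · exact (ContinuousLinearMap.continuous_det (𝕜 := ℝ) (E := Model m)).comp_continuousOn
        (continuousOn_const.clm_comp (hT.continuousOn_fderiv_of_isOpen hN (by simp)))
    · exact χ.contDiffOn_volDensity.continuousOn.comp hT.continuousOn
        fun z hz => χ.chart.map_source hz.2
  exact ((h1.congr fun z hz => χ.chartDensity_eq x hz).continuousAt
    (hN.mem_nhds hyN)).continuousWithinAt

/-- The change of variables from a chart to a foliation chart. -/
theorem setIntegral_chart_eq (x : S) {G : S → ℝ}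
    (hG : ∀ p, G p ≠ 0 → p ∈ χ.chart.source ∧ p ∈ (chartAt (Model m) x).source) :
    ∫ y in (chartAt (Model m) x).target, G ((chartAt (Model m) x).symm y) *
        |chartDensity (volForm 𝒮) x y|
      = (|modelDet m| * frameConst m) *
        ∫ z in χ.chart.target, G (χ.chart.symm z) * χ.volDensity z ∂modelMeasure m := by
  set e := chartAt (Model m) x with he
  set D := e.target ∩ e.symm ⁻¹' χ.chart.source with hD
  have hDo : IsOpen D := χ.isOpen_transition_domain x
  have hT := χ.contDiffOn_transition x
  set f : Model m → Model m := fun y => modelEquiv m (χ.transition x y) with hf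
  set f' : Model m → Model m →L[ℝ] Model m := fun y =>
    (modelEquiv m : CF m →L[ℝ] Model m).comp (fderiv ℝ (χ.transition x) y) with hf'
  have hff' : ∀ y ∈ D, HasFDerivWithinAt f (f' y) D y := fun y hy =>
    ((modelEquiv m).hasFDerivAt.comp y (((hT.contDiffAt (hDo.mem_nhds hy)).differentiableAt
      (by simp)).hasFDerivAt)).hasFDerivWithinAt
  have hinj : InjOn f D := fun y hy z hz hyz => by
    have h1 : χ.chart (e.symm y) = χ.chart (e.symm z) := (modelEquiv m).injective hyz
    have h2 := χ.chart.injOn hy.2 hz.2 h1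
    exact e.symm.injOn hy.1 hz.1 h2
  set g : Model m → ℝ := fun y => G (χ.chart.symm ((modelEquiv m).symm y)) *
    χ.volDensity ((modelEquiv m).symm y) with hg
  have h1 := integral_image_eq_integral_abs_det_fderiv_smul volume hDo.measurableSet hff' hinj g
  -- The support condition on G allows both integrals to be restricted to the overlap of the two
  -- charts, where the change of variables is injective.
  have h2 : ∫ y in e.target, G (e.symm y) * |chartDensity (volForm 𝒮) x y|
      = ∫ y in D, G (e.symm y) * |chartDensity (volForm 𝒮) x y| := by
    refine setIntegral_eq_of_subset_of_forall_sdiff_eq_zero e.open_target.measurableSet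
      inter_subset_left fun y hy => ?_
    have h3 : G (e.symm y) = 0 := by
      by_contra h0
      exact hy.2 ⟨hy.1, (hG _ h0).1⟩
    rw [h3, zero_mul]
  have h3 : ∀ y ∈ D, G (e.symm y) * |chartDensity (volForm 𝒮) x y|
      = (|modelDet m| * frameConst m) * (|(f' y).det| • g (f y)) := fun y hy => by
    have h4 : (modelEquiv m).symm (f y) = χ.transition x y :=
      (modelEquiv m).symm_apply_apply _
    have h5 : χ.chart.symm (χ.transition x y) = e.symm y := χ.chart.left_inv hy.2
    have h6 : χ.transition x y ∈ χ.chart.target := χ.chart.map_source hy.2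
    rw [χ.chartDensity_eq x hy, hg]
    simp only [h4, h5, abs_mul, abs_of_pos (χ.volDensity_pos h6), abs_of_pos (frameConst_pos m),
      smul_eq_mul]
    change _ * (|(f' y).det| * _) = _
    ring
  have h7 : f '' D ⊆ modelEquiv m '' χ.chart.target := by
    rintro _ ⟨y, hy, rfl⟩
    exact ⟨_, χ.chart.map_source hy.2, rfl⟩
  have h8 : MeasurableSet (modelEquiv m '' χ.chart.target) :=
    ((modelEquiv m).toHomeomorph.isOpenMap _ χ.chart.open_target).measurableSet
  rw [h2, setIntegral_congr_fun hDo.measurableSet h3, integral_const_mul, ← h1,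
    setIntegral_modelMeasure]
  congr 1
  refine (setIntegral_eq_of_subset_of_forall_sdiff_eq_zero h8 h7 fun y hy => ?_).symm
  obtain ⟨⟨z, hz, rfl⟩, hy⟩ := hy
  have h9 : G (χ.chart.symm z) = 0 := by
    by_contra h0
    have h10 : e.symm (e (χ.chart.symm z)) = χ.chart.symm z := e.left_inv (hG _ h0).2
    refine hy ⟨e (χ.chart.symm z), ⟨e.map_source (hG _ h0).2, ?_⟩, ?_⟩
    · rw [mem_preimage, h10]
      exact (hG _ h0).1
    · have h11 : χ.transition x (e (χ.chart.symm z)) = z :=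
        (congrArg χ.chart h10).trans (χ.chart.right_inv hz)
      exact congrArg (modelEquiv m) h11
  rw [hg]
  simp only [ContinuousLinearEquiv.symm_apply_apply, h9, zero_mul]

end FoliationChart

end Density

end Sasaki

end

/-! ### Integrals of top forms as integrals against a finite Borel measure -/

noncomputable section

namespace Sasaki

section Measure

variable {m : ℕ} {S : Type*} [TopologicalSpace S] [ChartedSpace (Model m) S]
  [IsManifold (𝓡 (2 * m + 1)) ∞ S] [CompactSpace S] [T2Space S]

theorem tsupport_chartPartition (x : S) :
    tsupport (chartPartition m S x) ⊆ (chartAt (Model m) x).source :=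
  (SmoothPartitionOfUnity.exists_isSubordinate_chartAt_source (𝓡 (2 * m + 1)) S).choose_spec x

theorem finite_chartPartition : {x : S | (Function.support (chartPartition m S x)).Nonempty}.Finite :=
  (chartPartition m S).locallyFinite.finite_nonempty_of_compact

variable (m S) in
/-- The indices of the nonzero functions of the partition of unity. -/
def partitionIndex : Finset S := (finite_chartPartition (m := m) (S := S)).toFinset

theorem chartPartition_eq_zero {x : S} (hx : x ∉ partitionIndex m S) (p : S) :
    chartPartition m S x p = 0 := by
  by_contra h
  exact hx ((finite_chartPartition (m := m) (S := S)).mem_toFinset.2 ⟨p, h⟩)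

theorem sum_chartPartition (p : S) : ∑ x ∈ partitionIndex m S, chartPartition m S x p = 1 := by
  rw [← (chartPartition m S).sum_eq_one (mem_univ p)]
  refine (finsum_eq_sum_of_support_subset _ fun x hx => ?_).symm
  by_contra h
  exact hx (chartPartition_eq_zero h p)

variable (𝒮 : SasakianStructure m S)

/-- The weight of the chart at `x` in the integral over `S`. -/
def chartWeight (x : S) (y : Model m) : ℝ :=
  chartPartition m S x ((chartAt (Model m) x).symm y) * |chartDensity (volForm 𝒮) x y|

theorem chartWeight_nonneg (x : S) (y : Model m) : 0 ≤ chartWeight 𝒮 x y :=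
  mul_nonneg ((chartPartition m S).nonneg x _) (abs_nonneg _)

theorem continuousOn_chartWeight (x : S) :
    ContinuousOn (chartWeight 𝒮 x) (chartAt (Model m) x).target :=
  ((chartPartition m S x).contMDiff.continuous.comp_continuousOn
    (chartAt (Model m) x).continuousOn_symm).mul (FoliationChart.continuousOn_chartDensity x).abs

theorem integrableOn_chartWeight (x : S) :
    IntegrableOn (chartWeight 𝒮 x) (chartAt (Model m) x).target := by
  have hK : IsCompact (chartAt (Model m) x '' tsupport (chartPartition m S x)) :=
    (isClosed_tsupport _).isCompact.image_of_continuousOn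
      ((chartAt (Model m) x).continuousOn.mono (tsupport_chartPartition x))
  refine integrableOn_of_eq_zero_off (chartAt (Model m) x).open_target
    (continuousOn_chartWeight 𝒮 x) hK ?_ fun y hy hyK => ?_
  · rintro _ ⟨p, hp, rfl⟩
    exact (chartAt (Model m) x).map_source (tsupport_chartPartition x hp)
  · have h : chartPartition m S x ((chartAt (Model m) x).symm y) = 0 := by
      by_contra h0
      exact hyK ⟨_, subset_tsupport _ h0, (chartAt (Model m) x).right_inv hy⟩
    rw [chartWeight, h, zero_mul]

/-- The orientation is that of the volume form itself, so sign times density is the absolute value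
of the density and all weights are nonnegative. -/
theorem integralTop_volForm (F : S → ℝ) :
    integralTop (volForm 𝒮) (fun p v => F p * volForm 𝒮 p v)
      = ∑ x ∈ partitionIndex m S, ∫ y in (chartAt (Model m) x).target,
          chartWeight 𝒮 x y * F ((chartAt (Model m) x).symm y) := by
  have h1 : ∀ x : S, (extChartAt (𝓡 (2 * m + 1)) x).target = (chartAt (Model m) x).target :=
    fun x => by simp [mfld_simps]
  have h2 : ∀ (x : S) (y : Model m),
      chartPartition m S x ((extChartAt (𝓡 (2 * m + 1)) x).symm y) *
        SignType.sign (chartDensity (volForm 𝒮) x y) *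
          chartDensity (fun p v => F p * volForm 𝒮 p v) x y
      = chartWeight 𝒮 x y * F ((chartAt (Model m) x).symm y) := fun x y => by
    have h3 : chartDensity (fun p v => F p * volForm 𝒮 p v) x y
      = F ((chartAt (Model m) x).symm y) * chartDensity (volForm 𝒮) x y := rfl
    have h4 : chartPartition m S x ((extChartAt (𝓡 (2 * m + 1)) x).symm y)
      = chartPartition m S x ((chartAt (Model m) x).symm y) := rfl
    rw [h3, h4, chartWeight, ← sign_mul_self (chartDensity (volForm 𝒮) x y)]
    ring
  unfold integralTop
  simp only [h1, h2]
  refine finsum_eq_sum_of_support_subset _ fun x hx => ?_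
  by_contra h
  refine hx ?_
  simp [chartWeight, chartPartition_eq_zero h]

variable [MeasurableSpace S] [BorelSpace S]

/-- The part of the volume measure which is carried by the chart at `x`. -/
def chartMeasure (x : S) : Measure S :=
  Measure.map (chartAt (Model m) x).symm
    ((volume.restrict (chartAt (Model m) x).target).withDensity fun y =>
      ENNReal.ofReal (chartWeight 𝒮 x y))

/-- The measure of the volume form `(dη)ᵐ ∧ η`. -/
def volMeasure : Measure S := ∑ x ∈ partitionIndex m S, chartMeasure 𝒮 x

theorem aemeasurable_chart_symm (x : S) : AEMeasurable (chartAt (Model m) x).symm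
    ((volume.restrict (chartAt (Model m) x).target).withDensity fun y =>
      ENNReal.ofReal (chartWeight 𝒮 x y)) :=
  ((chartAt (Model m) x).continuousOn_symm.aemeasurable
    (chartAt (Model m) x).open_target.measurableSet).mono_ac (withDensity_absolutelyContinuous _ _)

instance (x : S) : IsFiniteMeasure (chartMeasure 𝒮 x) := by
  have := isFiniteMeasure_withDensity_ofReal (integrableOn_chartWeight 𝒮 x).2
  exact Measure.isFiniteMeasure_map _ _

instance : IsFiniteMeasure (volMeasure 𝒮) := by
  unfold volMeasure
  infer_instance

theorem integral_chartMeasure (x : S) {F : S → ℝ} (hF : Continuous F) :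
    ∫ p, F p ∂chartMeasure 𝒮 x = ∫ y in (chartAt (Model m) x).target,
      chartWeight 𝒮 x y * F ((chartAt (Model m) x).symm y) := by
  rw [chartMeasure, integral_map (aemeasurable_chart_symm 𝒮 x) hF.aestronglyMeasurable,
    integral_withDensity_eq_integral_toReal_smul₀
      ((continuousOn_chartWeight 𝒮 x).aemeasurable
        (chartAt (Model m) x).open_target.measurableSet).ennreal_ofReal
      (ae_of_all _ fun _ => ENNReal.ofReal_lt_top)]
  simp only [ENNReal.toReal_ofReal (chartWeight_nonneg 𝒮 x _), smul_eq_mul]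

theorem integrable_of_continuous {F : S → ℝ} (hF : Continuous F) (μ : Measure S)
    [IsFiniteMeasure μ] : Integrable F μ :=
  (BoundedContinuousFunction.mkOfCompact ⟨F, hF⟩).integrable μ

theorem integral_volMeasure {F : S → ℝ} (hF : Continuous F) :
    ∫ p, F p ∂volMeasure 𝒮 = ∑ x ∈ partitionIndex m S, ∫ y in (chartAt (Model m) x).target,
      chartWeight 𝒮 x y * F ((chartAt (Model m) x).symm y) := by
  rw [volMeasure, integral_finsetSum_measure fun x _ => integrable_of_continuous hF _]
  exact Finset.sum_congr rfl fun x _ => integral_chartMeasure 𝒮 x hF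

theorem integralTop_eq_integral {F : S → ℝ} (hF : Continuous F) :
    integralTop (volForm 𝒮) (fun p v => F p * volForm 𝒮 p v) = ∫ p, F p ∂volMeasure 𝒮 := by
  rw [integralTop_volForm, integral_volMeasure 𝒮 hF]

variable {𝒮}

/-- The integral of a function which is supported in a foliation chart. -/
theorem FoliationChart.integral_eq (χ : FoliationChart 𝒮) {F : S → ℝ} (hF : Continuous F)
    (h : tsupport F ⊆ χ.chart.source) :
    ∫ p, F p ∂volMeasure 𝒮 = (|modelDet m| * frameConst m) *
      ∫ z in χ.chart.target, F (χ.chart.symm z) * χ.volDensity z ∂modelMeasure m := by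
  -- Each member of the partition of unity contributes an integral over the same foliation chart;
  -- the partition functions then add up to 1.
  have h1 : ∀ x : S, ∫ y in (chartAt (Model m) x).target,
      chartWeight 𝒮 x y * F ((chartAt (Model m) x).symm y)
      = (|modelDet m| * frameConst m) * ∫ z in χ.chart.target,
        (chartPartition m S x (χ.chart.symm z) * F (χ.chart.symm z)) * χ.volDensity z
          ∂modelMeasure m := fun x => by
    rw [← χ.setIntegral_chart_eq x (G := fun p => chartPartition m S x p * F p) fun p hp =>
      ⟨h (subset_tsupport _ (right_ne_zero_of_mul hp)),
        tsupport_chartPartition x (subset_tsupport _ (left_ne_zero_of_mul hp))⟩]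
    congr 1
    funext y
    rw [chartWeight]
    ring
  have hK : IsCompact (χ.chart '' tsupport F) :=
    (isClosed_tsupport _).isCompact.image_of_continuousOn (χ.chart.continuousOn.mono h)
  have h2 : ∀ x : S, IntegrableOn (fun z => (chartPartition m S x (χ.chart.symm z) *
      F (χ.chart.symm z)) * χ.volDensity z) χ.chart.target (modelMeasure m) := fun x => by
    refine integrableOn_of_eq_zero_off χ.chart.open_target ?_ hK ?_ fun z hz hzK => ?_
    · exact (((chartPartition m S x).contMDiff.continuous.mul hF).comp_continuousOn
        χ.chart.continuousOn_symm).mul χ.contDiffOn_volDensity.continuousOn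
    · rintro _ ⟨p, hp, rfl⟩
      exact χ.chart.map_source (h hp)
    · have h0 : F (χ.chart.symm z) = 0 := by
        by_contra h0
        exact hzK ⟨_, subset_tsupport _ h0, χ.chart.right_inv hz⟩
      rw [h0, mul_zero, zero_mul]
  rw [integral_volMeasure 𝒮 hF, Finset.sum_congr rfl fun x _ => h1 x, ← Finset.mul_sum,
    ← integral_finsetSum _ fun x _ => h2 x]
  congr 2
  funext z
  rw [← Finset.sum_mul, ← Finset.sum_mul, sum_chartPartition, one_mul]

/-- A bump function supported in a foliation chart has positive integral, because the density is
positive there. This allows division by V. -/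
theorem volMeasure_univ_pos [Nonempty S] : 0 < (volMeasure 𝒮).real univ := by
  rcases (measureReal_nonneg (μ := volMeasure 𝒮) (s := univ)).lt_or_eq with h | h
  · exact h
  exfalso
  have hμ : volMeasure 𝒮 = 0 := by
    rw [eq_comm, measureReal_eq_zero_iff] at h
    exact Measure.measure_univ_eq_zero.1 h
  obtain ⟨p⟩ := ‹Nonempty S›
  obtain ⟨χ, hp⟩ := exists_foliationChart 𝒮 p
  obtain ⟨f, hf, hf1, hf2⟩ := exists_tsupport_one_of_isOpen_isClosed χ.chart.open_source
    isClosed_closure.isCompact isClosed_singleton (singleton_subset_iff.2 hp)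
  have h1 := χ.integral_eq f.continuous hf
  rw [hμ, integral_zero_measure] at h1
  have h2 : 0 < |modelDet m| * frameConst m :=
    mul_pos (abs_pos.2 (FoliationChart.modelDet_ne_zero χ hp)) (frameConst_pos m)
  have h3 := (mul_eq_zero.1 h1.symm).resolve_left h2.ne'
  have hc : ContinuousOn (fun z => f (χ.chart.symm z)) χ.chart.target :=
    f.continuous.comp_continuousOn χ.chart.continuousOn_symm
  have hi : IntegrableOn (fun z => f (χ.chart.symm z) * χ.volDensity z) χ.chart.target
      (modelMeasure m) := by
    refine integrableOn_of_eq_zero_off χ.chart.open_target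
      (hc.mul χ.contDiffOn_volDensity.continuousOn)
      ((isClosed_tsupport f).isCompact.image_of_continuousOn (χ.chart.continuousOn.mono hf)) ?_
      fun z hz hzK => ?_
    · rintro _ ⟨p, hp, rfl⟩
      exact χ.chart.map_source (hf hp)
    · have h0 : f (χ.chart.symm z) = 0 := by
        by_contra h0
        exact hzK ⟨_, subset_tsupport _ h0, χ.chart.right_inv hz⟩
      rw [h0, zero_mul]
  have h4 : 0 ≤ᵐ[(modelMeasure m).restrict χ.chart.target]
      fun z => f (χ.chart.symm z) * χ.volDensity z := by
    filter_upwards [ae_restrict_mem χ.chart.open_target.measurableSet] with z hz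
    exact mul_nonneg (hf2 _).1 (χ.volDensity_pos hz).le
  have h5 := (setIntegral_pos_iff_support_of_nonneg_ae h4 hi).2
  refine (h5 ?_).ne' h3
  have h6 : IsOpen (χ.chart.target ∩ (fun z => f (χ.chart.symm z)) ⁻¹' Ioi 0) :=
    hc.isOpen_inter_preimage χ.chart.open_target isOpen_Ioi
  refine (h6.measure_pos (modelMeasure m) ⟨χ.chart p, χ.chart.map_source hp, ?_⟩).trans_le
    (measure_mono fun z hz => ⟨?_, hz.1⟩)
  · change 0 < f (χ.chart.symm (χ.chart p))
    rw [χ.chart.left_inv hp, hf1 rfl]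
    exact zero_lt_one
  · exact (mul_pos hz.2 (χ.volDensity_pos hz.1)).ne'

end Measure

end Sasaki

end

noncomputable section

namespace Sasaki

/-! ### Integration by parts on a compact Sasakian manifold -/

section Parts

variable {m : ℕ} {S : Type*} [TopologicalSpace S] [ChartedSpace (Model m) S]
  [IsManifold (𝓡 (2 * m + 1)) ∞ S] {𝒮 : SasakianStructure m S}

theorem continuous_of_continuousOn_pull0 (𝒮 : SasakianStructure m S) {F : S → ℝ}
    (h : ∀ χ : FoliationChart 𝒮, ContinuousOn (χ.pull0 F) χ.chart.target) : Continuous F := by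
  refine continuous_iff_continuousAt.2 fun p => ?_
  obtain ⟨χ, hp⟩ := exists_foliationChart 𝒮 p
  have h1 : ContinuousOn (χ.pull0 F ∘ χ.chart) χ.chart.source :=
    (h χ).comp χ.chart.continuousOn fun q hq => χ.chart.map_source hq
  refine (h1.continuousAt (χ.chart.open_source.mem_nhds hp)).congr ?_
  filter_upwards [χ.chart.open_source.mem_nhds hp] with q hq
  exact congrArg F (χ.chart.left_inv hq)

variable (𝒮) in
/-- Smooth 1-forms which annihilate the Reeb field. -/
structure IsHorizontal (τ : ∀ p : S, Tan m p →L[ℝ] ℝ) : Prop where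
  smooth : ∀ χ : FoliationChart 𝒮, ContDiffOn ℝ ∞ (χ.pull1 τ) χ.chart.target
  reeb : ∀ p, τ p (reeb 𝒮 p) = 0

variable {α τ σ : ∀ p : S, Tan m p →L[ℝ] ℝ} {u v : S → ℝ}

theorem IsHorizontal.add (hτ : IsHorizontal 𝒮 τ) (hσ : IsHorizontal 𝒮 σ) :
    IsHorizontal 𝒮 fun p => τ p + σ p :=
  ⟨fun χ => (hτ.smooth χ).add (hσ.smooth χ), fun p => by
    rw [_root_.add_apply, hτ.reeb, hσ.reeb, add_zero]⟩

theorem IsHorizontal.smul (hτ : IsHorizontal 𝒮 τ) (hu : ContMDiff (𝓡 (2 * m + 1)) 𝓘(ℝ, ℝ) ∞ u) :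
    IsHorizontal 𝒮 fun p => u p • τ p :=
  ⟨fun χ => (χ.contDiffOn_pull0 hu).smul (hτ.smooth χ), fun p => by
    rw [_root_.smul_apply, hτ.reeb, smul_zero]⟩

theorem IsHorizontal.differentiableAt (hτ : IsHorizontal 𝒮 τ) {χ : FoliationChart 𝒮} {y : CF m}
    (hy : y ∈ χ.chart.target) : DifferentiableAt ℝ (χ.pull1 τ) y :=
  (((hτ.smooth χ).contDiffAt (χ.chart.open_target.mem_nhds hy)).differentiableAt (by simp))

theorem IsHorizontal.dOne_add (hτ : IsHorizontal 𝒮 τ) (hσ : IsHorizontal 𝒮 σ) (p : S) :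
    dOne (𝓡 (2 * m + 1)) (fun p => τ p + σ p) p
      = dOne (𝓡 (2 * m + 1)) τ p + dOne (𝓡 (2 * m + 1)) σ p := by
  obtain ⟨χ, hp⟩ := exists_foliationChart 𝒮 p
  exact Sasaki.dOne_add hp (hτ.differentiableAt (χ.chart.map_source hp))
    (hσ.differentiableAt (χ.chart.map_source hp))

theorem IsBasicFunction.isHorizontal_dcB (hu : IsBasicFunction 𝒮 u) : IsHorizontal 𝒮 (dcB 𝒮 u) :=
  ⟨fun χ => (χ.isBasicOn_of_isBasicFunction hu).contDiffOn_pull1_dcB, fun p => by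
    rw [dcB, _root_.smul_apply, ContinuousLinearMap.comp_apply, transverseJ_reeb, map_zero,
      smul_zero]⟩

theorem continuousOn_formMatrix_horTensor {a τ : CF m → CF m →L[ℝ] ℝ} {U : Set (CF m)}
    (hU : IsOpen U) (ha : ContDiffOn ℝ ∞ a U) (hτ : ContDiffOn ℝ ∞ τ U) (i j : Fin m) :
    ContinuousOn (fun y => formMatrix (horTensor a τ y) i j) U := by
  have h1 : ∀ v : Fin m → ℂ, ContinuousOn (fun y => horLift (a y) v) U := fun v =>
    (ha.continuousOn.clm_apply continuousOn_const).neg.prodMk continuousOn_const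
  have h2 := hτ.continuousOn_fderiv_of_isOpen hU (by simp)
  have h3 : ∀ v w : Fin m → ℂ, ContinuousOn (fun y => skew (fderiv ℝ τ y) (horLift (a y) v)
      (horLift (a y) w)) U := fun v w =>
    ((h2.clm_apply (h1 v)).clm_apply (h1 w)).sub ((h2.clm_apply (h1 w)).clm_apply (h1 v))
  have h4 : ∀ v w : Fin m → ℂ, ContinuousOn (fun y => horTensor a τ y v w) U := fun v w =>
    continuousOn_const.mul ((h3 _ _).add (h3 _ _))
  have h5 : ∀ v w : Fin m → ℂ, ContinuousOn (fun y => ((horTensor a τ y v w : ℝ) : ℂ)) U :=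
    fun v w => Complex.continuous_ofReal.comp_continuousOn (h4 v w)
  exact continuousOn_const.mul ((h5 _ _).sub (continuousOn_const.mul (h5 _ _)))

theorem FoliationChart.mixedRatio_dOne {χ : FoliationChart 𝒮} (hα : IsTypeOneOne 𝒮 α)
    (hτ : IsHorizontal 𝒮 τ) {y : CF m} (hy : y ∈ χ.chart.target) :
    mixedRatio 𝒮 (χ.chart.symm y) (dOne (𝓡 (2 * m + 1)) α _) (dOne (𝓡 (2 * m + 1)) τ _)
      = ((extMatrix (χ.pull1 α) y).adjugate *
        formMatrix (horTensor (χ.pull1 (contact 𝒮)) (χ.pull1 τ) y)).trace.re / χ.volDensity y := by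
  rw [mixedRatio_eq (χ.chart.map_target hy) (isAlternatingAt_dOne α _) (isAlternatingAt_dOne τ _),
    (hα.isInvariantAt _).horPart_eq, matrixAt_dOne hy ((hα χ).differentiableAt hy),
    matrixAt_horPart_dOne hy (hτ.differentiableAt hy)]
  rfl

theorem continuousOn_trace_adjugate_mul {X : Type*} [TopologicalSpace X] {U : Set X}
    {H N : X → Matrix (Fin m) (Fin m) ℂ} (hH : ContinuousOn H U) (hN : ContinuousOn N U) :
    ContinuousOn (fun y => ((H y).adjugate * N y).trace.re) U := by
  have h1 : ContinuousOn (fun y => (H y).adjugate) U :=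
    (Continuous.matrix_adjugate continuous_id).comp_continuousOn hH
  have h2 : ∀ {Z : X → Matrix (Fin m) (Fin m) ℂ}, ContinuousOn Z U → ∀ i j,
      ContinuousOn (fun y => Z y i j) U := fun hZ i j =>
    (continuous_id.matrix_elem i j).comp_continuousOn hZ
  refine Complex.continuous_re.comp_continuousOn ?_
  simp only [Matrix.trace, Matrix.diag, Matrix.mul_apply]
  exact continuousOn_finsetSum _ fun i _ => continuousOn_finsetSum _ fun j _ =>
    (h2 h1 i j).mul (h2 hN j i)

theorem continuous_mixedRatio (hα : IsTypeOneOne 𝒮 α) (hτ : IsHorizontal 𝒮 τ) :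
    Continuous fun p => mixedRatio 𝒮 p (dOne (𝓡 (2 * m + 1)) α p) (dOne (𝓡 (2 * m + 1)) τ p) := by
  refine continuous_of_continuousOn_pull0 𝒮 fun χ => ?_
  have h1 : ContinuousOn (fun y => extMatrix (χ.pull1 α) y) χ.chart.target :=
    continuousOn_pi.2 fun i => continuousOn_pi.2 fun j =>
      (contDiffOn_extMatrix χ.chart.open_target (hα χ).smooth i j).continuousOn
  have h2 : ContinuousOn (fun y => formMatrix (horTensor (χ.pull1 (contact 𝒮)) (χ.pull1 τ) y))
      χ.chart.target := continuousOn_pi.2 fun i => continuousOn_pi.2 fun j =>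
    continuousOn_formMatrix_horTensor χ.chart.open_target χ.contDiffOn_pull1_contact
      (hτ.smooth χ) i j
  have h3 := continuousOn_trace_adjugate_mul h1 h2
  exact (h3.div χ.contDiffOn_volDensity.continuousOn fun y hy => (χ.volDensity_pos hy).ne').congr
    fun y hy => FoliationChart.mixedRatio_dOne hα hτ hy

theorem mixedRatio_zero {p : S} {A : Tan m p →L[ℝ] Tan m p →L[ℝ] ℝ} :
    mixedRatio 𝒮 p A 0 = 0 := by
  have h : ∀ s : ℝ, A + s • (0 : Tan m p →L[ℝ] Tan m p →L[ℝ] ℝ) = A := fun s => by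
    refine ContinuousLinearMap.ext fun v => ContinuousLinearMap.ext fun w => ?_
    simp only [_root_.add_apply, _root_.smul_apply, _root_.zero_apply, smul_eq_mul, mul_zero,
      add_zero]
  simp only [mixedRatio, h, deriv_const]

theorem dOne_eq_zero {K : Set S} (hK : IsClosed K) (h0 : ∀ p ∉ K, τ p = 0) {p : S} (hp : p ∉ K)
    (hτ : IsHorizontal 𝒮 τ) : dOne (𝓡 (2 * m + 1)) τ p = 0 := by
  obtain ⟨χ, hps⟩ := exists_foliationChart 𝒮 p
  obtain ⟨y, hy, rfl⟩ := χ.exists_symm_eq hps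
  have h1 : χ.pull1 τ =ᶠ[𝓝 y] fun _ => 0 := by
    have h2 := (χ.chart.continuousAt_symm hy).preimage_mem_nhds (hK.isOpen_compl.mem_nhds hp)
    filter_upwards [h2] with z hz
    refine ContinuousLinearMap.ext fun w => ?_
    rw [χ.pull1_apply, h0 _ hz]
    rfl
  have h2 : ∀ v w : CF m, dOne (𝓡 (2 * m + 1)) τ (χ.chart.symm y) (χ.inv _ v) (χ.inv _ w) = 0 :=
    fun v w => by
      rw [χ.dOne_inv hy (hτ.differentiableAt hy), h1.fderiv_eq, fderiv_fun_const, FoliationChart.skew_apply]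
      simp
  refine ContinuousLinearMap.ext fun a => ContinuousLinearMap.ext fun b => ?_
  have h3 := h2 (χ.der _ a) (χ.der _ b)
  rwa [χ.inv_der hps, χ.inv_der hps] at h3

theorem dOne_smul (hu : ContMDiff (𝓡 (2 * m + 1)) 𝓘(ℝ, ℝ) ∞ u) (hτ : IsHorizontal 𝒮 τ) (p : S)
    (a b : Tan m p) : dOne (𝓡 (2 * m + 1)) (fun p => u p • τ p) p a b
      = u p * dOne (𝓡 (2 * m + 1)) τ p a b + (diff u p a * τ p b - diff u p b * τ p a) := by
  obtain ⟨χ, hp⟩ := exists_foliationChart 𝒮 p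
  obtain ⟨y, hy, rfl⟩ := χ.exists_symm_eq hp
  have hu' : DifferentiableAt ℝ (χ.pull0 u) y := ((χ.contDiffOn_pull0 hu).contDiffAt
    (χ.chart.open_target.mem_nhds hy)).differentiableAt (by simp)
  have h1 : fderiv ℝ (χ.pull1 fun p => u p • τ p) y = _ :=
    HasFDerivAt.fderiv (hu'.hasFDerivAt.smul (hτ.differentiableAt hy).hasFDerivAt)
  have h2 : ∀ v w : CF m, dOne (𝓡 (2 * m + 1)) (fun p => u p • τ p) (χ.chart.symm y) (χ.inv _ v)
      (χ.inv _ w) = u (χ.chart.symm y) * dOne (𝓡 (2 * m + 1)) τ (χ.chart.symm y) (χ.inv _ v)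
        (χ.inv _ w) + (diff u _ (χ.inv _ v) * τ _ (χ.inv _ w)
          - diff u _ (χ.inv _ w) * τ _ (χ.inv _ v)) := fun v w => by
    rw [χ.dOne_inv hy ((hτ.smul hu).differentiableAt hy), χ.dOne_inv hy (hτ.differentiableAt hy),
      χ.diff_inv hy hu', χ.diff_inv hy hu', h1, FoliationChart.skew_apply,
      FoliationChart.skew_apply]
    simp only [_root_.add_apply, _root_.smul_apply, ContinuousLinearMap.smulRight_apply,
      smul_eq_mul, FoliationChart.pull1_apply, FoliationChart.pull0]
    ring
  have h3 := h2 (χ.der _ a) (χ.der _ b)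
  rwa [χ.inv_der hp, χ.inv_der hp] at h3

/-- The remaining terms are du ∧ d^c v - dv ∧ d^c u. The forms du ∧ d^c v and dv ∧ d^c u have the
same horizontal Φ-invariant part, so this difference drops out. -/
theorem horPart_dOne_commutator (hu : IsBasicFunction 𝒮 u) (hv : IsBasicFunction 𝒮 v) (p : S) :
    horPart 𝒮 p (dOne (𝓡 (2 * m + 1)) (fun p => u p • dcB 𝒮 v p + (-v p) • dcB 𝒮 u p) p)
      = horPart 𝒮 p (u p • ddcB 𝒮 v p + (-v p) • ddcB 𝒮 u p) := by
  have hv' : ContMDiff (𝓡 (2 * m + 1)) 𝓘(ℝ, ℝ) ∞ fun p => -v p := hv.1.neg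
  have hdv : ∀ a, diff (fun p => -v p) p a = -diff v p a := fun a => by
    have h : diff (m := m) (fun p => -v p) p = -diff v p := mfderiv_neg
    rw [h]
    rfl
  have h1 : ∀ a b, dOne (𝓡 (2 * m + 1)) (fun p => u p • dcB 𝒮 v p + (-v p) • dcB 𝒮 u p) p a b
      = u p * ddcB 𝒮 v p a b + (-v p) * ddcB 𝒮 u p a b
        + (diff u p a * dcB 𝒮 v p b - diff u p b * dcB 𝒮 v p a
          - (diff v p a * dcB 𝒮 u p b - diff v p b * dcB 𝒮 u p a)) := fun a b => by
    rw [(hv.isHorizontal_dcB.smul hu.1).dOne_add (hu.isHorizontal_dcB.smul hv'),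
      _root_.add_apply, _root_.add_apply, dOne_smul hu.1 hv.isHorizontal_dcB,
      dOne_smul hv' hu.isHorizontal_dcB, hdv, hdv]
    simp only [ddcB]
    ring
  have hd : ∀ (w : S → ℝ) (a : Tan m p), dcB 𝒮 w p a = -(1 / 2) * diff w p (transverseJ 𝒮 p a) :=
    fun w a => rfl
  refine ContinuousLinearMap.ext fun a => ContinuousLinearMap.ext fun b => ?_
  rw [horPart_apply, horPart_apply, h1, h1]
  simp only [hd, transverseJ_cube, map_neg, _root_.add_apply, _root_.smul_apply, smul_eq_mul]
  ring

variable [CompactSpace S] [T2Space S] [MeasurableSpace S] [BorelSpace S]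

theorem FoliationChart.integral_mixedRatio_eq_zero (χ : FoliationChart 𝒮) (hα : IsTypeOneOne 𝒮 α)
    (hτ : IsHorizontal 𝒮 τ) {K : Set S} (hK : IsClosed K) (hKχ : K ⊆ χ.chart.source)
    (h0 : ∀ p ∉ K, τ p = 0) :
    ∫ p, mixedRatio 𝒮 p (dOne (𝓡 (2 * m + 1)) α p) (dOne (𝓡 (2 * m + 1)) τ p) ∂volMeasure 𝒮
      = 0 := by
  have h1 : tsupport (fun p => mixedRatio 𝒮 p (dOne (𝓡 (2 * m + 1)) α p)
      (dOne (𝓡 (2 * m + 1)) τ p)) ⊆ K := by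
    refine closure_minimal (fun p hp => ?_) hK
    by_contra hpK
    refine hp ?_
    simp only [dOne_eq_zero hK h0 hpK hτ, mixedRatio_zero]
  rw [χ.integral_eq (continuous_mixedRatio hα hτ) (h1.trans hKχ)]
  have h2 : ∀ y ∈ χ.chart.target, mixedRatio 𝒮 (χ.chart.symm y) (dOne (𝓡 (2 * m + 1)) α _)
      (dOne (𝓡 (2 * m + 1)) τ _) * χ.volDensity y
      = ((extMatrix (χ.pull1 α) y).adjugate *
        formMatrix (horTensor (χ.pull1 (contact 𝒮)) (χ.pull1 τ) y)).trace.re := fun y hy => by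
    rw [FoliationChart.mixedRatio_dOne hα hτ hy, div_mul_cancel₀ _ (χ.volDensity_pos hy).ne']
  rw [setIntegral_congr_fun χ.chart.open_target.measurableSet h2]
  have hKc : IsCompact (χ.chart '' K) :=
    hK.isCompact.image_of_continuousOn (χ.chart.continuousOn.mono hKχ)
  classical
  -- The local theorem wants a form vanishing off a compact set everywhere, and outside the chart
  -- target the pullback has no meaning; it is extended by zero.
  set τ' : CF m → CF m →L[ℝ] ℝ := χ.chart.target.indicator (χ.pull1 τ) with hτ'
  have h3 : ∀ y ∈ χ.chart.target, τ' =ᶠ[𝓝 y] χ.pull1 τ := fun y hy => by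
    filter_upwards [χ.chart.open_target.mem_nhds hy] with z hz using indicator_of_mem hz _
  have h4 : ∀ y ∈ χ.chart.target, ((extMatrix (χ.pull1 α) y).adjugate *
        formMatrix (horTensor (χ.pull1 (contact 𝒮)) (χ.pull1 τ) y)).trace.re
      = ((extMatrix (χ.pull1 α) y).adjugate *
        formMatrix (horTensor (χ.pull1 (contact 𝒮)) τ' y)).trace.re := fun y hy => by
    have h5 : horTensor (χ.pull1 (contact 𝒮)) (χ.pull1 τ) y
        = horTensor (χ.pull1 (contact 𝒮)) τ' y := by
      funext v w
      rw [horTensor, horTensor, (h3 y hy).fderiv_eq]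
    rw [h5]
  have h5 : ∀ y ∈ χ.chart.target, τ' y (1, 0) = 0 := fun y hy => by
    rw [(h3 y hy).eq_of_nhds, χ.pull1_apply, χ.inv_one_zero (χ.chart.map_target hy), hτ.reeb]
  have h6 : χ.chart '' K ⊆ χ.chart.target := by
    rintro _ ⟨p, hp, rfl⟩
    exact χ.chart.map_source (hKχ hp)
  have h7 : ∀ y ∉ χ.chart '' K, τ' y = 0 := fun y hy => by
    by_cases hyt : y ∈ χ.chart.target
    · rw [hτ', indicator_of_mem hyt]
      refine ContinuousLinearMap.ext fun w => ?_
      rw [χ.pull1_apply, h0 _ fun hyK => hy ⟨_, hyK, χ.chart.right_inv hyt⟩]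
      rfl
    · exact indicator_of_notMem hyt _
  rw [setIntegral_congr_fun χ.chart.open_target.measurableSet h4,
    integral_trace_eq_zero (modelMeasure m) χ.chart.open_target χ.contDiffOn_pull1_contact
      isTypeOneOneOn_contact.fderiv_left (hα χ).smooth (hα χ).fderiv_left (hα χ).skew_stdJ
      ((hτ.smooth χ).congr fun y hy => (h3 y hy).eq_of_nhds) h5 hKc h6 h7, mul_zero]

/-- A partition of unity localizes τ in foliation charts. Its members are not basic in general,
which is why τ is required to be horizontal but not basic. -/
theorem integral_mixedRatio_eq_zero (hα : IsTypeOneOne 𝒮 α) (hτ : IsHorizontal 𝒮 τ) :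
    ∫ p, mixedRatio 𝒮 p (dOne (𝓡 (2 * m + 1)) α p) (dOne (𝓡 (2 * m + 1)) τ p) ∂volMeasure 𝒮
      = 0 := by
  classical
  choose χ hχ using exists_foliationChart 𝒮
  obtain ⟨f, hf⟩ := SmoothPartitionOfUnity.exists_isSubordinate (𝓡 (2 * m + 1))
    (isClosed_univ (X := S)) (fun p => (χ p).chart.source) (fun p => (χ p).chart.open_source)
    fun p _ => mem_iUnion.2 ⟨p, hχ p⟩
  have hfin : {x : S | (Function.support (f x)).Nonempty}.Finite :=
    f.locallyFinite.finite_nonempty_of_compact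
  have hsum : ∀ p, ∑ x ∈ hfin.toFinset, f x p = 1 := fun p => by
    rw [← f.sum_eq_one (mem_univ p)]
    refine (finsum_eq_sum_of_support_subset _ fun x hx => ?_).symm
    exact hfin.mem_toFinset.2 ⟨p, hx⟩
  -- Horizontality of the partial sums is carried along in the induction, since splitting d of a sum
  -- needs differentiability of both summands.
  have key : ∀ s : Finset S, IsHorizontal 𝒮 (fun p => (∑ x ∈ s, f x p) • τ p) ∧
      ∫ p, mixedRatio 𝒮 p (dOne (𝓡 (2 * m + 1)) α p)
        (dOne (𝓡 (2 * m + 1)) (fun p => (∑ x ∈ s, f x p) • τ p) p) ∂volMeasure 𝒮 = 0 := by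
    intro s
    induction s using Finset.induction_on with
    | empty =>
      have h : (fun p => (∑ x ∈ (∅ : Finset S), f x p) • τ p) = fun p => (0 : ℝ) • τ p := by simp
      rw [h]
      have h1 : IsHorizontal 𝒮 (fun p => (0 : ℝ) • τ p) := hτ.smul contMDiff_const
      refine ⟨h1, ?_⟩
      have h2 : ∀ p, dOne (𝓡 (2 * m + 1)) (fun p => (0 : ℝ) • τ p) p = 0 := fun p =>
        dOne_eq_zero (𝒮 := 𝒮) isClosed_empty (fun p _ => zero_smul _ _) (notMem_empty p) h1
      simp only [h2, mixedRatio_zero, integral_zero]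
    | insert i s hi ih =>
      have h1 : IsHorizontal 𝒮 (fun p => f i p • τ p) := hτ.smul (f i).contMDiff
      have h2 : (fun p => (∑ x ∈ insert i s, f x p) • τ p)
          = fun p => (∑ x ∈ s, f x p) • τ p + f i p • τ p := by
        funext p
        rw [Finset.sum_insert hi, add_smul]
        exact add_comm _ _
      rw [h2]
      refine ⟨ih.1.add h1, ?_⟩
      have h3 : ∀ p, mixedRatio 𝒮 p (dOne (𝓡 (2 * m + 1)) α p) (dOne (𝓡 (2 * m + 1))
          (fun p => (∑ x ∈ s, f x p) • τ p + f i p • τ p) p)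
          = mixedRatio 𝒮 p (dOne (𝓡 (2 * m + 1)) α p) (dOne (𝓡 (2 * m + 1))
            (fun p => (∑ x ∈ s, f x p) • τ p) p) + mixedRatio 𝒮 p (dOne (𝓡 (2 * m + 1)) α p)
              (dOne (𝓡 (2 * m + 1)) (fun p => f i p • τ p) p) := fun p => by
        have h4 := mixedRatio_add_smul (𝒮 := 𝒮) (isAlternatingAt_dOne α p)
          (isAlternatingAt_dOne (fun p => (∑ x ∈ s, f x p) • τ p) p)
          (isAlternatingAt_dOne (fun p => f i p • τ p) p) 1
        rw [one_mul] at h4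
        rw [ih.1.dOne_add h1, ← h4]
        congr 1
        refine ContinuousLinearMap.ext fun a => ContinuousLinearMap.ext fun b => ?_
        simp only [_root_.add_apply, one_smul]
      simp only [h3]
      rw [integral_add (integrable_of_continuous (continuous_mixedRatio hα ih.1) _)
        (integrable_of_continuous (continuous_mixedRatio hα h1) _), ih.2, zero_add]
      refine (χ i).integral_mixedRatio_eq_zero hα h1 (isClosed_tsupport (f i)) (hf i) fun p hp => ?_
      have h5 : f i p = 0 := by
        by_contra h0
        exact hp (subset_tsupport _ h0)
      rw [h5, zero_smul]
  have h := (key hfin.toFinset).2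
  have h1 : (fun p => (∑ x ∈ hfin.toFinset, f x p) • τ p) = τ := by
    funext p
    rw [hsum, one_smul]
  rwa [h1] at h

/-- The operator `v ↦ m (dα)ᵐ⁻¹ ∧ d d^c v ∧ η` is symmetric. -/
theorem integral_mul_mixedRatio_comm (hα : IsTypeOneOne 𝒮 α) (hu : IsBasicFunction 𝒮 u)
    (hv : IsBasicFunction 𝒮 v) :
    ∫ p, u p * mixedRatio 𝒮 p (dOne (𝓡 (2 * m + 1)) α p) (ddcB 𝒮 v p) ∂volMeasure 𝒮
      = ∫ p, v p * mixedRatio 𝒮 p (dOne (𝓡 (2 * m + 1)) α p) (ddcB 𝒮 u p) ∂volMeasure 𝒮 := by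
  have hv' : ContMDiff (𝓡 (2 * m + 1)) 𝓘(ℝ, ℝ) ∞ fun p => -v p := hv.1.neg
  have h1 := integral_mixedRatio_eq_zero hα
    ((hv.isHorizontal_dcB.smul hu.1).add (hu.isHorizontal_dcB.smul hv'))
  have hz : ∀ p : S, IsAlternatingAt (0 : Tan m p →L[ℝ] Tan m p →L[ℝ] ℝ) := fun p v w => by
    simp only [_root_.zero_apply, neg_zero]
  have h2 : ∀ p, mixedRatio 𝒮 p (dOne (𝓡 (2 * m + 1)) α p) (dOne (𝓡 (2 * m + 1))
      (fun p => u p • dcB 𝒮 v p + (-v p) • dcB 𝒮 u p) p)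
      = u p * mixedRatio 𝒮 p (dOne (𝓡 (2 * m + 1)) α p) (ddcB 𝒮 v p)
        - v p * mixedRatio 𝒮 p (dOne (𝓡 (2 * m + 1)) α p) (ddcB 𝒮 u p) := fun p => by
    have hA := isAlternatingAt_dOne α p
    have hU : IsAlternatingAt (ddcB 𝒮 u p) := isAlternatingAt_dOne _ p
    have hV : IsAlternatingAt (ddcB 𝒮 v p) := isAlternatingAt_dOne _ p
    have h3 : u p • ddcB 𝒮 v p + (-v p) • ddcB 𝒮 u p
        = (0 + u p • ddcB 𝒮 v p) + (-v p) • ddcB 𝒮 u p := by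
      refine ContinuousLinearMap.ext fun a => ContinuousLinearMap.ext fun b => ?_
      simp only [_root_.add_apply, _root_.zero_apply, _root_.smul_apply, smul_eq_mul]
      ring
    rw [mixedRatio_congr (horPart_dOne_commutator hu hv p), h3,
      mixedRatio_add_smul hA ((hz p).add_smul hV _) hU, mixedRatio_add_smul hA (hz p) hV,
      mixedRatio_zero]
    ring
  have hc : ∀ {w : S → ℝ}, IsBasicFunction 𝒮 w → Continuous fun p =>
      mixedRatio 𝒮 p (dOne (𝓡 (2 * m + 1)) α p) (ddcB 𝒮 w p) := fun hw =>
    continuous_mixedRatio hα hw.isHorizontal_dcB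
  simp only [h2] at h1
  have i1 : Integrable (fun p => u p * mixedRatio 𝒮 p (dOne (𝓡 (2 * m + 1)) α p) (ddcB 𝒮 v p))
      (volMeasure 𝒮) := integrable_of_continuous (hu.1.continuous.mul (hc hv)) _
  have i2 : Integrable (fun p => v p * mixedRatio 𝒮 p (dOne (𝓡 (2 * m + 1)) α p) (ddcB 𝒮 u p))
      (volMeasure 𝒮) := integrable_of_continuous (hv.1.continuous.mul (hc hu)) _
  rw [integral_sub i1 i2] at h1
  exact sub_eq_zero.1 h1

end Parts

end Sasaki

end

noncomputable section

namespace Sasaki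

/-! ### Smooth families of basic functions -/

theorem hasDerivAt_apply {E F : Type*} [NormedAddCommGroup E] [NormedSpace ℝ E]
    [NormedAddCommGroup F] [NormedSpace ℝ F] {D : ℝ → E →L[ℝ] F} {D' : E →L[ℝ] F} {t : ℝ}
    (h : HasDerivAt D D' t) (v : E) : HasDerivAt (fun s => D s v) (D' v) t :=
  (ContinuousLinearMap.apply ℝ F v).hasFDerivAt.comp_hasDerivAt t h

section Families

variable {m : ℕ} {S : Type*} [TopologicalSpace S] [ChartedSpace (Model m) S]
  [IsManifold (𝓡 (2 * m + 1)) ∞ S] {𝒮 : SasakianStructure m S}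

theorem continuousOn_uncurry_of_charts (𝒮 : SasakianStructure m S) {J : Set ℝ} {F : ℝ → S → ℝ}
    (h : ∀ χ : FoliationChart 𝒮, ContinuousOn (fun z : ℝ × CF m => F z.1 (χ.chart.symm z.2))
      (J ×ˢ χ.chart.target)) : ContinuousOn (Function.uncurry F) (J ×ˢ univ) := by
  rintro ⟨t, p⟩ ⟨ht, -⟩
  obtain ⟨χ, hp⟩ := exists_foliationChart 𝒮 p
  have h1 : ContinuousOn (fun z : ℝ × S => F z.1 (χ.chart.symm (χ.chart z.2)))
      (J ×ˢ χ.chart.source) := by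
    have h2 : ContinuousOn (fun z : ℝ × S => ((z.1, χ.chart z.2) : ℝ × CF m))
        (J ×ˢ χ.chart.source) := continuousOn_fst.prodMk
      (χ.chart.continuousOn.comp continuousOn_snd fun z hz => hz.2)
    exact (h χ).comp h2 fun z hz => ⟨hz.1, χ.chart.map_source hz.2⟩
  have h3 : ContinuousWithinAt (Function.uncurry F) (J ×ˢ χ.chart.source) (t, p) :=
    (h1 (t, p) ⟨ht, hp⟩).congr (fun z hz => congrArg (F z.1) (χ.chart.left_inv hz.2).symm)
      (congrArg (F t) (χ.chart.left_inv hp).symm)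
  have h4 : J ×ˢ χ.chart.source = (J ×ˢ univ) ∩ (Prod.snd ⁻¹' χ.chart.source : Set (ℝ × S)) := by
    ext z
    simp
  rw [h4] at h3
  exact (continuousWithinAt_inter ((χ.chart.open_source.preimage continuous_snd).mem_nhds hp)).1 h3

variable (𝒮) in
/-- Smooth families of basic functions. -/
structure IsSmoothFamily (J : Set ℝ) (G : ℝ → S → ℝ) : Prop where
  smooth : ∀ χ : FoliationChart 𝒮, ContDiffOn ℝ ∞ (fun z : ℝ × CF m => G z.1 (χ.chart.symm z.2))
    (J ×ˢ χ.chart.target)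
  basic : ∀ t ∈ J, IsBasicFunction 𝒮 (G t)

variable {c d : ℝ} {G H : ℝ → S → ℝ} {α : ∀ p : S, Tan m p →L[ℝ] ℝ} {t : ℝ}

theorem IsSmoothFamily.continuousOn {J : Set ℝ} (hG : IsSmoothFamily 𝒮 J G) :
    ContinuousOn (Function.uncurry G) (J ×ˢ univ) :=
  continuousOn_uncurry_of_charts 𝒮 fun χ => (hG.smooth χ).continuousOn

/-- The derivative of a family of functions on `[c, d]`. -/
def velocityOn (c d : ℝ) (G : ℝ → S → ℝ) (t : ℝ) (p : S) : ℝ :=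
  derivWithin (fun s => G s p) (Icc c d) t

theorem velocityOn_eq_deriv (ht : t ∈ Ioo c d) (p : S) :
    velocityOn c d G t p = deriv (fun s => G s p) t :=
  derivWithin_of_mem_nhds (Icc_mem_nhds ht.1 ht.2)

theorem contDiffAt_of_Icc {E F : Type*} [NormedAddCommGroup E] [NormedSpace ℝ E]
    [NormedAddCommGroup F] [NormedSpace ℝ F] {f : ℝ × E → F} {U : Set E} (hU : IsOpen U)
    (hf : ContDiffOn ℝ ∞ f (Icc c d ×ˢ U)) (ht : t ∈ Ioo c d) {y : E} (hy : y ∈ U) :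
    ContDiffAt ℝ ∞ f (t, y) :=
  hf.contDiffAt (prod_mem_nhds (Icc_mem_nhds ht.1 ht.2) (hU.mem_nhds hy))

theorem IsSmoothFamily.hasDerivAt (hG : IsSmoothFamily 𝒮 (Icc c d) G) (ht : t ∈ Ioo c d) (p : S) :
    HasDerivAt (fun s => G s p) (velocityOn c d G t p) t := by
  rw [velocityOn_eq_deriv ht]
  obtain ⟨χ, hp⟩ := exists_foliationChart 𝒮 p
  obtain ⟨y, hy, rfl⟩ := χ.exists_symm_eq hp
  have h := (contDiffAt_of_Icc χ.chart.open_target (hG.smooth χ) ht hy).differentiableAt (by simp)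
  exact (hasDerivAt_slice h.hasFDerivAt).differentiableAt.hasDerivAt

theorem IsSmoothFamily.pull0_velocityOn {χ : FoliationChart 𝒮} (ht : t ∈ Ioo c d) :
    χ.pull0 (velocityOn c d G t) = fun y => deriv (fun s => G s (χ.chart.symm y)) t :=
  funext fun _ => velocityOn_eq_deriv ht _

/-- In the interior the velocity is basic because the derivative along the leaf commutes with the
derivative in t; at the end points this follows by continuity. -/
theorem IsSmoothFamily.velocityOn (hcd : c < d) (hG : IsSmoothFamily 𝒮 (Icc c d) G) :
    IsSmoothFamily 𝒮 (Icc c d) (velocityOn c d G) := by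
  have hJ : UniqueDiffOn ℝ (Icc c d) := uniqueDiffOn_Icc hcd
  have h0 : ∀ χ : FoliationChart 𝒮, ContDiffOn ℝ ∞
      (fun z : ℝ × CF m => Sasaki.velocityOn c d G z.1 (χ.chart.symm z.2))
        (Icc c d ×ˢ χ.chart.target) := fun χ =>
    contDiffOn_derivWithin_slice hJ χ.chart.open_target (hG.smooth χ)
  refine ⟨h0, fun t ht => isBasicFunction_of_isBasicOn fun χ => ⟨?_, fun y hy => ?_⟩⟩
  · have h1 : ContDiffOn ℝ ∞ (fun y : CF m => (t, y)) χ.chart.target :=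
      contDiffOn_const.prodMk contDiffOn_id
    exact (h0 χ).comp h1 fun y hy => ⟨ht, hy⟩
  · have h1 : ContinuousOn (fun s => fderiv ℝ (χ.pull0 (Sasaki.velocityOn c d G s)) y (1, 0))
        (Icc c d) := by
      have h2 := (contDiffOn_fderiv_slice hJ χ.chart.open_target (h0 χ)).continuousOn
      have h3 : ContinuousOn (fun s : ℝ => (s, y)) (Icc c d) := by fun_prop
      exact ((h2.comp h3 fun s hs => ⟨hs, hy⟩)).clm_apply continuousOn_const
    refine EqOn.of_subset_closure (s := Ioo c d) (g := fun _ => (0 : ℝ)) (fun s hs => ?_) h1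
      continuousOn_const Ioo_subset_Icc_self (closure_Ioo hcd.ne).ge ht
    have h4 := hasDerivAt_fderiv_slice (f := fun z : ℝ × CF m => G z.1 (χ.chart.symm z.2))
      ((contDiffAt_of_Icc χ.chart.open_target (hG.smooth χ) hs hy).of_le (by norm_cast))
    have h5 := (ContinuousLinearMap.apply ℝ ℝ ((1, 0) : CF m)).hasFDerivAt.comp_hasDerivAt s h4
    have h6 : (fun r => (ContinuousLinearMap.apply ℝ ℝ ((1, 0) : CF m))
        (fderiv ℝ (fun y' => G r (χ.chart.symm y')) y)) =ᶠ[𝓝 s] fun _ => 0 := by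
      filter_upwards [Icc_mem_nhds hs.1 hs.2] with r hr
      exact (χ.isBasicOn_of_isBasicFunction (hG.basic r hr)).basic y hy
    have h7 := h5.unique ((hasDerivAt_const s (0 : ℝ)).congr_of_eventuallyEq h6)
    rw [IsSmoothFamily.pull0_velocityOn hs]
    exact h7

namespace FoliationChart

variable {χ : FoliationChart 𝒮} {y : CF m}

theorem hasDerivAt_fderiv_fderiv (hG : IsSmoothFamily 𝒮 (Icc c d) G) (hcd : c < d)
    (ht : t ∈ Ioo c d) (hy : y ∈ χ.chart.target) :
    HasDerivAt (fun s => fderiv ℝ (fderiv ℝ (χ.pull0 (G s))) y)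
      (fderiv ℝ (fderiv ℝ (χ.pull0 (velocityOn c d G t))) y) t := by
  have hJ : UniqueDiffOn ℝ (Icc c d) := uniqueDiffOn_Icc hcd
  have h1 := contDiffOn_fderiv_slice hJ χ.chart.open_target (hG.smooth χ)
  have h2 := hasDerivAt_fderiv_slice
    (f := fun z : ℝ × CF m => fderiv ℝ (fun y' => G z.1 (χ.chart.symm y')) z.2)
    ((contDiffAt_of_Icc χ.chart.open_target h1 ht hy).of_le (by norm_cast))
  have h3 : (fun y' => deriv (fun s => fderiv ℝ (fun y' => G s (χ.chart.symm y')) y') t)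
      =ᶠ[𝓝 y] fderiv ℝ (χ.pull0 (velocityOn c d G t)) := by
    filter_upwards [χ.chart.open_target.mem_nhds hy] with y' hy'
    rw [IsSmoothFamily.pull0_velocityOn ht]
    exact (hasDerivAt_fderiv_slice (f := fun z : ℝ × CF m => G z.1 (χ.chart.symm z.2))
      ((contDiffAt_of_Icc χ.chart.open_target (hG.smooth χ) ht hy').of_le (by norm_cast))).deriv
  rw [h3.fderiv_eq] at h2
  exact h2

/-- The Hessian of a function in a foliation chart, as a transverse 2-form. -/
def hessForm (χ : FoliationChart 𝒮) (u : S → ℝ) (y v w : CF m) : ℝ :=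
  -(1 / 2) * (fderiv ℝ (fderiv ℝ (χ.pull0 u)) y v (stdJ m w)
    - fderiv ℝ (fderiv ℝ (χ.pull0 u)) y w (stdJ m v))

theorem hasDerivAt_hessForm (hG : IsSmoothFamily 𝒮 (Icc c d) G) (hcd : c < d)
    (ht : t ∈ Ioo c d) (hy : y ∈ χ.chart.target) (v w : CF m) :
    HasDerivAt (fun s => χ.hessForm (G s) y v w) (χ.hessForm (velocityOn c d G t) y v w) t := by
  have h := hasDerivAt_fderiv_fderiv hG hcd ht hy
  have h1 : ∀ v w : CF m, HasDerivAt (fun s => fderiv ℝ (fderiv ℝ (χ.pull0 (G s))) y v w)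
      (fderiv ℝ (fderiv ℝ (χ.pull0 (velocityOn c d G t))) y v w) t := fun v w =>
    hasDerivAt_apply (hasDerivAt_apply h v) w
  exact ((h1 _ _).sub (h1 _ _)).const_mul _

theorem continuousOn_hessForm (hG : IsSmoothFamily 𝒮 (Icc c d) G) (hcd : c < d) (v w : CF m) :
    ContinuousOn (fun z : ℝ × CF m => χ.hessForm (G z.1) z.2 v w)
      (Icc c d ×ˢ χ.chart.target) := by
  have hJ : UniqueDiffOn ℝ (Icc c d) := uniqueDiffOn_Icc hcd
  have h1 : ContinuousOn (fun z : ℝ × CF m => fderiv ℝ (fderiv ℝ (χ.pull0 (G z.1))) z.2)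
      (Icc c d ×ˢ χ.chart.target) :=
    (contDiffOn_fderiv_slice hJ χ.chart.open_target
      (contDiffOn_fderiv_slice hJ χ.chart.open_target (hG.smooth χ))).continuousOn
  have h2 : ∀ v w : CF m, ContinuousOn
      (fun z : ℝ × CF m => fderiv ℝ (fderiv ℝ (χ.pull0 (G z.1))) z.2 v w)
      (Icc c d ×ˢ χ.chart.target) := fun v w =>
    (h1.clm_apply continuousOn_const).clm_apply continuousOn_const
  exact continuousOn_const.mul ((h2 _ _).sub (h2 _ _))

theorem continuousOn_matrixAt_ddcB (hG : IsSmoothFamily 𝒮 (Icc c d) G) (hcd : c < d) :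
    ContinuousOn (fun z : ℝ × CF m => χ.matrixAt (χ.chart.symm z.2)
      (ddcB 𝒮 (G z.1) (χ.chart.symm z.2))) (Icc c d ×ˢ χ.chart.target) := by
  have h1 : ∀ v w : CF m, ContinuousOn (fun z : ℝ × CF m =>
      ((ddcB 𝒮 (G z.1) (χ.chart.symm z.2) (χ.inv _ v) (χ.inv _ w) : ℝ) : ℂ))
        (Icc c d ×ˢ χ.chart.target) := fun v w =>
    Complex.continuous_ofReal.comp_continuousOn ((continuousOn_hessForm hG hcd v w).congr
      fun z hz => (χ.isBasicOn_of_isBasicFunction (hG.basic z.1 hz.1)).ddcB_inv hz.2 v w)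
  exact continuousOn_pi.2 fun i => continuousOn_pi.2 fun j =>
    continuousOn_const.mul ((h1 _ _).sub (continuousOn_const.mul (h1 _ _)))

end FoliationChart

theorem hasDerivAt_ddcB (hG : IsSmoothFamily 𝒮 (Icc c d) G) (hcd : c < d)
    (ht : t ∈ Ioo c d) (p : S) (v w : Tan m p) :
    HasDerivAt (fun s => ddcB 𝒮 (G s) p v w) (ddcB 𝒮 (velocityOn c d G t) p v w) t := by
  obtain ⟨χ, hp⟩ := exists_foliationChart 𝒮 p
  obtain ⟨y, hy, rfl⟩ := χ.exists_symm_eq hp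
  have h1 : ∀ v w : CF m, HasDerivAt (fun s => ddcB 𝒮 (G s) (χ.chart.symm y) (χ.inv _ v)
      (χ.inv _ w)) (ddcB 𝒮 (velocityOn c d G t) (χ.chart.symm y) (χ.inv _ v) (χ.inv _ w)) t :=
    fun v w => by
      rw [(χ.isBasicOn_of_isBasicFunction ((hG.velocityOn hcd).basic t
        (Ioo_subset_Icc_self ht))).ddcB_inv hy]
      refine (FoliationChart.hasDerivAt_hessForm hG hcd ht hy v w).congr_of_eventuallyEq ?_
      filter_upwards [Icc_mem_nhds ht.1 ht.2] with s hs
      exact (χ.isBasicOn_of_isBasicFunction (hG.basic s hs)).ddcB_inv hy v w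
  have h2 := h1 (χ.der _ v) (χ.der _ w)
  rwa [χ.inv_der hp, χ.inv_der hp] at h2

theorem isAlternatingAt_ddcB (u : S → ℝ) (p : S) : IsAlternatingAt (ddcB 𝒮 u p) :=
  isAlternatingAt_dOne (dcB 𝒮 u) p

theorem mixedRatio_smul {p : S} {A κ : Tan m p →L[ℝ] Tan m p →L[ℝ] ℝ} (hA : IsAlternatingAt A)
    (hκ : IsAlternatingAt κ) (c : ℝ) : mixedRatio 𝒮 p A (c • κ) = c * mixedRatio 𝒮 p A κ := by
  have hz : IsAlternatingAt (0 : Tan m p →L[ℝ] Tan m p →L[ℝ] ℝ) := fun v w => by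
    simp only [_root_.zero_apply, neg_zero]
  have h : c • κ = 0 + c • κ := by
    refine ContinuousLinearMap.ext fun a => ContinuousLinearMap.ext fun b => ?_
    simp only [_root_.add_apply, _root_.zero_apply, _root_.smul_apply, smul_eq_mul]
    ring
  rw [h, mixedRatio_add_smul hA hz hκ, mixedRatio_zero, zero_add]

theorem IsAlternatingAt.smul {p : S} {κ : Tan m p →L[ℝ] Tan m p →L[ℝ] ℝ}
    (hκ : IsAlternatingAt κ) (c : ℝ) : IsAlternatingAt (c • κ) := fun v w => by
  simp only [_root_.smul_apply, smul_eq_mul]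
  rw [hκ v w]
  ring

theorem IsInvariantAt.add_smul {p : S} {A κ : Tan m p →L[ℝ] Tan m p →L[ℝ] ℝ}
    (hA : IsInvariantAt 𝒮 p A) (hκ : IsInvariantAt 𝒮 p κ) (s : ℝ) :
    IsInvariantAt 𝒮 p (A + s • κ) := fun v w => by
  simp only [_root_.add_apply, _root_.smul_apply, smul_eq_mul]
  rw [hA v w, hκ v w]

/-- The form `dα + j d d^c G_t` of a family of basic functions. -/
def familyForm (𝒮 : SasakianStructure m S) (α : ∀ p : S, Tan m p →L[ℝ] ℝ) (j : ℝ) (u : S → ℝ)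
    (p : S) : Tan m p →L[ℝ] Tan m p →L[ℝ] ℝ := dOne (𝓡 (2 * m + 1)) α p + j • ddcB 𝒮 u p

theorem isAlternatingAt_familyForm (j : ℝ) (u : S → ℝ) (p : S) :
    IsAlternatingAt (familyForm 𝒮 α j u p) :=
  (isAlternatingAt_dOne α p).add_smul (isAlternatingAt_ddcB u p) j

theorem isInvariantAt_familyForm (hα : IsTypeOneOne 𝒮 α) {u : S → ℝ} (hu : IsBasicFunction 𝒮 u)
    (j : ℝ) (p : S) : IsInvariantAt 𝒮 p (familyForm 𝒮 α j u p) :=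
  (hα.isInvariantAt p).add_smul (hu.isTypeOneOne.isInvariantAt p) j

theorem hasDerivAt_volRatio_familyForm (hG : IsSmoothFamily 𝒮 (Icc c d) G) (hcd : c < d)
    (ht : t ∈ Ioo c d) (j : ℝ) (p : S) :
    HasDerivAt (fun s => volRatio 𝒮 p (familyForm 𝒮 α j (G s) p))
      (j * mixedRatio 𝒮 p (familyForm 𝒮 α j (G t) p) (ddcB 𝒮 (velocityOn c d G t) p)) t := by
  rw [← mixedRatio_smul (isAlternatingAt_familyForm j (G t) p) (isAlternatingAt_ddcB _ p)]
  refine hasDerivAt_volRatio (fun s => isAlternatingAt_familyForm j (G s) p)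
    ((isAlternatingAt_ddcB _ p).smul j) fun v w => ?_
  simp only [familyForm, _root_.add_apply, _root_.smul_apply, smul_eq_mul]
  exact ((hasDerivAt_ddcB hG hcd ht p v w).const_mul j).const_add _

theorem continuousOn_matrixAt_familyForm {χ : FoliationChart 𝒮} (hα : IsTypeOneOne 𝒮 α)
    (hG : IsSmoothFamily 𝒮 (Icc c d) G) (hcd : c < d) (j : ℝ) :
    ContinuousOn (fun z : ℝ × CF m => χ.matrixAt (χ.chart.symm z.2)
      (horPart 𝒮 _ (familyForm 𝒮 α j (G z.1) (χ.chart.symm z.2)))) (Icc c d ×ˢ χ.chart.target) := by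
  have h1 : ContinuousOn (fun z : ℝ × CF m => extMatrix (χ.pull1 α) z.2)
      (Icc c d ×ˢ χ.chart.target) := continuousOn_pi.2 fun i => continuousOn_pi.2 fun k =>
    (contDiffOn_extMatrix χ.chart.open_target (hα χ).smooth i k).continuousOn.comp continuousOn_snd
      fun z hz => hz.2
  have h2 := FoliationChart.continuousOn_matrixAt_ddcB (χ := χ) hG hcd
  refine (h1.add (h2.const_smul (j : ℂ))).congr fun z hz => ?_
  rw [(isInvariantAt_familyForm hα (hG.basic z.1 hz.1) j _).horPart_eq, familyForm,
    χ.matrixAt_add_smul, FoliationChart.matrixAt_dOne hz.2 ((hα χ).differentiableAt hz.2)]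
  rfl

theorem continuousOn_volRatio_familyForm (hα : IsTypeOneOne 𝒮 α)
    (hG : IsSmoothFamily 𝒮 (Icc c d) G) (hcd : c < d) (j : ℝ) :
    ContinuousOn (Function.uncurry fun t p => volRatio 𝒮 p (familyForm 𝒮 α j (G t) p))
      (Icc c d ×ˢ univ) := by
  refine continuousOn_uncurry_of_charts 𝒮 fun χ => ?_
  have h1 : ContinuousOn (fun z : ℝ × CF m => (χ.matrixAt (χ.chart.symm z.2)
      (horPart 𝒮 _ (familyForm 𝒮 α j (G z.1) (χ.chart.symm z.2)))).det.re)
        (Icc c d ×ˢ χ.chart.target) := by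
    have h2 : Continuous fun M : Matrix (Fin m) (Fin m) ℂ => M.det := continuous_id.matrix_det
    exact Complex.continuous_re.comp_continuousOn
      (h2.comp_continuousOn (continuousOn_matrixAt_familyForm hα hG hcd j))
  refine (h1.div (χ.contDiffOn_volDensity.continuousOn.comp continuousOn_snd fun z hz => hz.2)
    fun z hz => (χ.volDensity_pos hz.2).ne').congr fun z hz => ?_
  exact volRatio_eq (χ.chart.map_target hz.2) (isAlternatingAt_familyForm j _ _)

theorem continuousOn_mixedRatio_familyForm (hα : IsTypeOneOne 𝒮 α)
    (hG : IsSmoothFamily 𝒮 (Icc c d) G) (hH : IsSmoothFamily 𝒮 (Icc c d) H) (hcd : c < d) (j : ℝ) :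
    ContinuousOn (Function.uncurry fun t p =>
      mixedRatio 𝒮 p (familyForm 𝒮 α j (G t) p) (ddcB 𝒮 (H t) p)) (Icc c d ×ˢ univ) := by
  refine continuousOn_uncurry_of_charts 𝒮 fun χ => ?_
  have h1 := continuousOn_trace_adjugate_mul
    (continuousOn_matrixAt_familyForm (χ := χ) hα hG hcd j)
    (FoliationChart.continuousOn_matrixAt_ddcB (χ := χ) hH hcd)
  refine (h1.div (χ.contDiffOn_volDensity.continuousOn.comp continuousOn_snd fun z hz => hz.2)
    fun z hz => (χ.volDensity_pos hz.2).ne').congr fun z hz => ?_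
  have h2 := mixedRatio_eq (χ.chart.map_target hz.2)
    (isAlternatingAt_familyForm (𝒮 := 𝒮) (α := α) j (G z.1) _)
    (isAlternatingAt_ddcB (𝒮 := 𝒮) (H z.1) (χ.chart.symm z.2))
  have h3 : horPart 𝒮 _ (ddcB 𝒮 (H z.1) (χ.chart.symm z.2)) = ddcB 𝒮 (H z.1) (χ.chart.symm z.2) :=
    IsInvariantAt.horPart_eq ((hH.basic z.1 hz.1).isTypeOneOne.isInvariantAt _)
  rw [h3] at h2
  exact h2

/-! ### Integrals which depend on a parameter -/

variable [CompactSpace S] [MeasurableSpace S] [BorelSpace S]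

theorem continuousOn_integral_family {μ : Measure S} [IsFiniteMeasure μ] {J : Set ℝ}
    {F : ℝ → S → ℝ} (hF : ContinuousOn (Function.uncurry F) (J ×ˢ univ)) :
    ContinuousOn (fun t => ∫ p, F t p ∂μ) J :=
  continuousOn_integral_of_compact_support isCompact_univ hF fun _ p _ hp => (hp (mem_univ p)).elim

theorem continuous_of_continuousOn_uncurry {J : Set ℝ} {F : ℝ → S → ℝ}
    (hF : ContinuousOn (Function.uncurry F) (J ×ˢ univ)) (ht : t ∈ J) : Continuous (F t) := by
  have h : Continuous fun p : S => (t, p) := by fun_prop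
  exact hF.comp_continuous h fun p => ⟨ht, mem_univ p⟩

/-- Compactness of [c, d] × S bounds the derivative uniformly, which gives the dominating constant.
-/
theorem hasDerivAt_integral_family {μ : Measure S} [IsFiniteMeasure μ]
    {F F' : ℝ → S → ℝ} (hF : ContinuousOn (Function.uncurry F) (Icc c d ×ˢ univ))
    (hF' : ContinuousOn (Function.uncurry F') (Icc c d ×ˢ univ))
    (h : ∀ t ∈ Ioo c d, ∀ p, HasDerivAt (fun s => F s p) (F' t p) t) (ht : t ∈ Ioo c d) :
    HasDerivAt (fun s => ∫ p, F s p ∂μ) (∫ p, F' t p ∂μ) t := by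
  obtain ⟨C, hC⟩ := (isCompact_Icc.prod isCompact_univ).exists_bound_of_continuousOn hF'
  have hI : ∀ {F : ℝ → S → ℝ}, ContinuousOn (Function.uncurry F) (Icc c d ×ˢ univ) →
      ∀ s ∈ Icc c d, Integrable (F s) μ := fun hF s hs =>
    (BoundedContinuousFunction.mkOfCompact ⟨_, continuous_of_continuousOn_uncurry hF hs⟩).integrable
      μ
  refine (hasDerivAt_integral_of_dominated_loc_of_deriv_le (bound := fun _ => C)
    (Ioo_mem_nhds ht.1 ht.2) ?_ (hI hF t (Ioo_subset_Icc_self ht))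
    (hI hF' t (Ioo_subset_Icc_self ht)).aestronglyMeasurable
    (ae_of_all _ fun p s hs => hC (s, p) ⟨Ioo_subset_Icc_self hs, mem_univ p⟩)
    (integrable_const C) (ae_of_all _ fun p s hs => h s hs p)).2
  filter_upwards [Icc_mem_nhds ht.1 ht.2] with s hs
  exact (hI hF s hs).aestronglyMeasurable

end Families

end Sasaki

end

noncomputable section

namespace Sasaki

/-! ### Quadrature -/

/-- Lagrange interpolation at 0, …, m reproduces polynomials of degree at most m. Integrals and
derivatives in the auxiliary parameter s thus become finite sums, which commute with integration
over S. -/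
theorem exists_quadrature (m : ℕ) (Λ : Polynomial ℝ →ₗ[ℝ] ℝ) :
    ∃ w : ℕ → ℝ, ∀ q : Polynomial ℝ, q.natDegree ≤ m →
      ∑ j ∈ Finset.range (m + 1), w j * q.eval (j : ℝ) = Λ q := by
  refine ⟨fun j => Λ (Lagrange.basis (Finset.range (m + 1)) (fun i : ℕ => (i : ℝ)) j),
    fun q hq => ?_⟩
  have hinj : Set.InjOn (fun i : ℕ => (i : ℝ)) (Finset.range (m + 1)) :=
    fun i _ j _ h => Nat.cast_injective h
  have hdeg : q.degree < (Finset.range (m + 1)).card := by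
    rw [Finset.card_range]
    exact Polynomial.degree_le_natDegree.trans_lt (by exact_mod_cast Nat.lt_succ_of_le hq)
  have h := Lagrange.eq_interpolate hinj hdeg
  rw [Lagrange.interpolate_apply] at h
  conv_rhs => rw [h, map_sum]
  refine Finset.sum_congr rfl fun j _ => ?_
  rw [← Polynomial.smul_eq_C_mul, map_smul, smul_eq_mul, mul_comm]

/-- Integration of polynomials over `[0, 1]`. -/
def unitIntegral : Polynomial ℝ →ₗ[ℝ] ℝ where
  toFun q := ∫ x in (0 : ℝ)..1, q.eval x
  map_add' p q := by
    simp only [Polynomial.eval_add]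
    exact intervalIntegral.integral_add (p.continuous.intervalIntegrable _ _)
      (q.continuous.intervalIntegrable _ _)
  map_smul' c q := by
    simp only [Polynomial.eval_smul, smul_eq_mul, RingHom.id_apply]
    exact intervalIntegral.integral_const_mul _ _

theorem unitIntegral_derivative (q : Polynomial ℝ) :
    unitIntegral q.derivative = q.eval 1 - q.eval 0 :=
  intervalIntegral.integral_eq_sub_of_hasDerivAt (fun x _ => q.hasDerivAt x)
    (q.derivative.continuous.intervalIntegrable _ _)

/-- Weights which compute the integral over `[0, 1]` of the polynomials of degree at most `m`. -/
def weight (m : ℕ) : ℕ → ℝ := (exists_quadrature m unitIntegral).choose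

/-- Degree m + 1 is admissible because the quadrature is applied to the derivative. -/
theorem sum_weight_derivative {m : ℕ} {q : Polynomial ℝ} (hq : q.natDegree ≤ m + 1) :
    ∑ j ∈ Finset.range (m + 1), weight m j * q.derivative.eval (j : ℝ) = q.eval 1 - q.eval 0 := by
  rw [← unitIntegral_derivative]
  exact (exists_quadrature m unitIntegral).choose_spec _
    (q.natDegree_derivative_le.trans (by omega))

theorem sum_weight (m : ℕ) : ∑ j ∈ Finset.range (m + 1), weight m j = 1 := by
  have h := sum_weight_derivative (m := m) (q := Polynomial.X) (by simp)
  simpa using h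

/-- The integrand q + X q' is the derivative of X q, which vanishes at 0. -/
theorem sum_weight_mul {m : ℕ} {q : Polynomial ℝ} (hq : q.natDegree ≤ m) :
    ∑ j ∈ Finset.range (m + 1), weight m j * (q.eval (j : ℝ) + j * q.derivative.eval (j : ℝ))
      = q.eval 1 := by
  have h := sum_weight_derivative (m := m) (q := Polynomial.X * q)
    (Polynomial.natDegree_mul_le.trans (by simp; omega))
  simpa using h

/-- The derivative of a polynomial at `0`. -/
def slopeAtZero : Polynomial ℝ →ₗ[ℝ] ℝ := (Polynomial.leval 0).comp Polynomial.derivative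

/-- Weights which compute the derivative at `0` of the polynomials of degree at most `m`. -/
def slopeWeight (m : ℕ) : ℕ → ℝ := (exists_quadrature m slopeAtZero).choose

theorem sum_slopeWeight_mul {m : ℕ} {q : Polynomial ℝ} (hq : q.natDegree ≤ m) :
    ∑ j ∈ Finset.range (m + 1), slopeWeight m j * q.eval (j : ℝ) = q.derivative.eval 0 :=
  (exists_quadrature m slopeAtZero).choose_spec q hq

theorem sum_slopeWeight (m : ℕ) : ∑ j ∈ Finset.range (m + 1), slopeWeight m j = 0 := by
  have h := sum_slopeWeight_mul (m := m) (q := 1) (by simp)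
  simpa using h

/-! ### Primitives -/

/-- `P` is a continuous primitive of the continuous function `I` on `[c, d]`. -/
structure IsPrimitiveOn (P I : ℝ → ℝ) (c d : ℝ) : Prop where
  continuousOn : ContinuousOn P (Icc c d)
  continuousOn_deriv : ContinuousOn I (Icc c d)
  hasDerivAt : ∀ t ∈ Ioo c d, HasDerivAt P (I t) t

section Primitives

variable {P Q I K : ℝ → ℝ} {c d : ℝ}

theorem IsPrimitiveOn.add (hP : IsPrimitiveOn P I c d) (hQ : IsPrimitiveOn Q K c d) :
    IsPrimitiveOn (fun t => P t + Q t) (fun t => I t + K t) c d :=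
  ⟨hP.1.add hQ.1, hP.2.add hQ.2, fun t ht => (hP.3 t ht).add (hQ.3 t ht)⟩

theorem IsPrimitiveOn.const_mul (hP : IsPrimitiveOn P I c d) (a : ℝ) :
    IsPrimitiveOn (fun t => a * P t) (fun t => a * I t) c d :=
  ⟨continuousOn_const.mul hP.1, continuousOn_const.mul hP.2, fun t ht => (hP.3 t ht).const_mul a⟩

theorem IsPrimitiveOn.sum {ι : Type*} {s : Finset ι} {P I : ι → ℝ → ℝ}
    (h : ∀ i ∈ s, IsPrimitiveOn (P i) (I i) c d) :
    IsPrimitiveOn (fun t => ∑ i ∈ s, P i t) (fun t => ∑ i ∈ s, I i t) c d :=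
  ⟨continuousOn_finsetSum s fun i hi => (h i hi).1, continuousOn_finsetSum s fun i hi => (h i hi).2,
    fun t ht => HasDerivAt.fun_sum fun i hi => (h i hi).3 t ht⟩

theorem IsPrimitiveOn.congr (hP : IsPrimitiveOn P I c d) (h : ∀ t ∈ Icc c d, K t = I t) :
    IsPrimitiveOn P K c d :=
  ⟨hP.1, hP.2.congr h, fun t ht => (h t (Ioo_subset_Icc_self ht)).symm ▸ hP.3 t ht⟩

/-- Agreement of K and I is asked only on the open interval: at a break point of a path the
two-sided velocity may not exist, and the end points are a null set. -/
theorem IsPrimitiveOn.intervalIntegrable (hcd : c < d) (hP : IsPrimitiveOn P I c d)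
    (h : ∀ t ∈ Ioo c d, K t = I t) :
    IntervalIntegrable K volume c d ∧ ∫ t in c..d, K t = P d - P c := by
  have hI : IntervalIntegrable I volume c d :=
    (hP.2.mono (uIcc_of_le hcd.le).le).intervalIntegrable
  have hae : ∀ᵐ t ∂(volume : Measure ℝ), t ∈ uIoc c d → I t = K t := by
    have h1 : ∀ᵐ t ∂(volume : Measure ℝ), t ≠ d := by simp [ae_iff, measure_singleton]
    filter_upwards [h1] with t ht htc
    rw [uIoc_of_le hcd.le] at htc
    exact (h t ⟨htc.1, lt_of_le_of_ne htc.2 ht⟩).symm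
  refine ⟨hI.congr_ae ((ae_restrict_iff' measurableSet_uIoc).2 hae), ?_⟩
  rw [← intervalIntegral.integral_congr_ae hae]
  exact intervalIntegral.integral_eq_sub_of_hasDerivAt_of_le hcd.le hP.1 hP.3 hI

end Primitives

/-! ### The energy functionals -/

section Energy

variable {m : ℕ} {S : Type*} [TopologicalSpace S] [ChartedSpace (Model m) S]
  [IsManifold (𝓡 (2 * m + 1)) ∞ S] {𝒮 : SasakianStructure m S}
  {α τ : ∀ p : S, Tan m p →L[ℝ] ℝ} {u φ : S → ℝ}

theorem isTypeOneOne_add_smul_dcB (hα : IsTypeOneOne 𝒮 α) (hu : IsBasicFunction 𝒮 u) (j : ℝ) :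
    IsTypeOneOne 𝒮 fun p => α p + j • dcB 𝒮 u p := hα.add (hu.isTypeOneOne.const_smul j)

theorem IsTypeOneOne.dOne_add_smul (hα : IsTypeOneOne 𝒮 α) (hτ : IsTypeOneOne 𝒮 τ) (j : ℝ) (p : S) :
    dOne (𝓡 (2 * m + 1)) (fun p => α p + j • τ p) p
      = dOne (𝓡 (2 * m + 1)) α p + j • dOne (𝓡 (2 * m + 1)) τ p := by
  rw [hα.dOne_add (hτ.const_smul j), hτ.dOne_const_smul]

theorem dOne_add_smul_dcB (hα : IsTypeOneOne 𝒮 α) (hu : IsBasicFunction 𝒮 u) (j : ℝ) (p : S) :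
    dOne (𝓡 (2 * m + 1)) (fun p => α p + j • dcB 𝒮 u p) p = familyForm 𝒮 α j u p :=
  hα.dOne_add_smul hu.isTypeOneOne j p

theorem continuous_volRatio (hα : IsTypeOneOne 𝒮 α) :
    Continuous fun p => volRatio 𝒮 p (dOne (𝓡 (2 * m + 1)) α p) := by
  refine continuous_of_continuousOn_pull0 𝒮 fun χ => ?_
  have h1 : ContinuousOn (fun y => (extMatrix (χ.pull1 α) y).det.re) χ.chart.target :=
    Complex.continuous_re.comp_continuousOn (contDiffOn_det
      (contDiffOn_extMatrix χ.chart.open_target (hα χ).smooth)).continuousOn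
  refine (h1.div χ.contDiffOn_volDensity.continuousOn fun y hy => (χ.volDensity_pos hy).ne').congr
    fun y hy => ?_
  have h2 := volRatio_eq (χ.chart.map_target hy) (isAlternatingAt_dOne α (χ.chart.symm y))
  rw [(hα.isInvariantAt _).horPart_eq,
    FoliationChart.matrixAt_dOne hy ((hα χ).differentiableAt hy)] at h2
  exact h2

theorem sum_weight_volRatio {p : S} {A κ : Tan m p →L[ℝ] Tan m p →L[ℝ] ℝ} (hA : IsAlternatingAt A)
    (hκ : IsAlternatingAt κ) :
    ∑ j ∈ Finset.range (m + 1), weight m j * (volRatio 𝒮 p (A + (j : ℝ) • κ)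
      + j * mixedRatio 𝒮 p (A + (j : ℝ) • κ) κ) = volRatio 𝒮 p (A + (1 : ℝ) • κ) := by
  obtain ⟨q, hq, h1, h2⟩ := exists_polynomial_volRatio (𝒮 := 𝒮) hA hκ
  simp only [h1, h2]
  exact sum_weight_mul hq

/-- The fundamental theorem of calculus for s ↦ `volRatio` (A + s κ) on [0, 1], in quadrature form.
-/
theorem volRatio_sub_eq_sum {p : S} {A κ : Tan m p →L[ℝ] Tan m p →L[ℝ] ℝ} (hA : IsAlternatingAt A)
    (hκ : IsAlternatingAt κ) :
    volRatio 𝒮 p (A + (1 : ℝ) • κ) = volRatio 𝒮 p A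
      + ∑ j ∈ Finset.range (m + 1), weight m j * mixedRatio 𝒮 p (A + (j : ℝ) • κ) κ := by
  obtain ⟨q, hq, h1, h2⟩ := exists_polynomial_volRatio (𝒮 := 𝒮) hA hκ
  have h3 := h1 0
  rw [add_zero_smul_tensor] at h3
  simp only [h1, h2, h3]
  rw [sum_weight_derivative (hq.trans (Nat.le_succ m))]
  ring

theorem sum_slopeWeight_volRatio {p : S} {A κ : Tan m p →L[ℝ] Tan m p →L[ℝ] ℝ}
    (hA : IsAlternatingAt A) (hκ : IsAlternatingAt κ) :
    ∑ j ∈ Finset.range (m + 1), slopeWeight m j * volRatio 𝒮 p (A + (j : ℝ) • κ)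
      = mixedRatio 𝒮 p A κ := by
  obtain ⟨q, hq, h1, h2⟩ := exists_polynomial_volRatio (𝒮 := 𝒮) hA hκ
  have h3 := h2 0
  rw [add_zero_smul_tensor] at h3
  simp only [h1, h3]
  exact sum_slopeWeight_mul hq

theorem kahlerFormOf_eq_familyForm (hφ : IsBasicFunction 𝒮 φ) (p : S) :
    kahlerFormOf 𝒮 φ p = familyForm 𝒮 (contact 𝒮) 1 φ p := by
  rw [kahlerFormOf_eq hφ]
  refine ContinuousLinearMap.ext fun a => ContinuousLinearMap.ext fun b => ?_
  simp only [familyForm, _root_.add_apply, _root_.smul_apply, smul_eq_mul, one_mul]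
  rfl

theorem ddcB_add_const (hφ : IsBasicFunction 𝒮 φ) (C : ℝ) (p : S) :
    ddcB 𝒮 (fun p => φ p + C) p = ddcB 𝒮 φ p := by
  have h := hφ.ddcB_add_smul (isBasicFunction_const C) 1 p
  simp only [one_mul] at h
  rw [h, ddcB_const]
  refine ContinuousLinearMap.ext fun a => ContinuousLinearMap.ext fun b => ?_
  simp only [_root_.add_apply, _root_.smul_apply, _root_.zero_apply, smul_eq_mul]
  ring

theorem IsBasicFunction.add_const (hφ : IsBasicFunction 𝒮 φ) (C : ℝ) :
    IsBasicFunction 𝒮 fun p => φ p + C := by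
  simpa only [one_mul] using hφ.add_smul (isBasicFunction_const C) 1

variable [CompactSpace S] [T2Space S] [MeasurableSpace S] [BorelSpace S]

/-- The total volume does not change under the exact form dτ: the difference is a combination of
mixed integrals against dτ, each of which vanishes. -/
theorem integral_volRatio_add (hα : IsTypeOneOne 𝒮 α) (hτ : IsTypeOneOne 𝒮 τ)
    (hτ' : IsHorizontal 𝒮 τ) :
    ∫ p, volRatio 𝒮 p (dOne (𝓡 (2 * m + 1)) α p + (1 : ℝ) • dOne (𝓡 (2 * m + 1)) τ p) ∂volMeasure 𝒮
      = ∫ p, volRatio 𝒮 p (dOne (𝓡 (2 * m + 1)) α p) ∂volMeasure 𝒮 := by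
  have h1 : ∀ p, volRatio 𝒮 p (dOne (𝓡 (2 * m + 1)) α p + (1 : ℝ) • dOne (𝓡 (2 * m + 1)) τ p) = _ :=
    fun p => volRatio_sub_eq_sum (isAlternatingAt_dOne α p) (isAlternatingAt_dOne τ p)
  have h2 : ∀ (j : ℝ) (p : S), mixedRatio 𝒮 p
      (dOne (𝓡 (2 * m + 1)) α p + j • dOne (𝓡 (2 * m + 1)) τ p) (dOne (𝓡 (2 * m + 1)) τ p)
      = mixedRatio 𝒮 p (dOne (𝓡 (2 * m + 1)) (fun p => α p + j • τ p) p)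
        (dOne (𝓡 (2 * m + 1)) τ p) := fun j p => by rw [hα.dOne_add_smul hτ]
  have hc : ∀ j : ℝ, Continuous fun p => mixedRatio 𝒮 p (dOne (𝓡 (2 * m + 1))
      (fun p => α p + j • τ p) p) (dOne (𝓡 (2 * m + 1)) τ p) := fun j =>
    continuous_mixedRatio (hα.add (hτ.const_smul j)) hτ'
  have i1 : Integrable (fun p => volRatio 𝒮 p (dOne (𝓡 (2 * m + 1)) α p)) (volMeasure 𝒮) :=
    integrable_of_continuous (continuous_volRatio hα) _
  have i2 : ∀ j : ℕ, Integrable (fun p => weight m j * mixedRatio 𝒮 p (dOne (𝓡 (2 * m + 1))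
      (fun p => α p + (j : ℝ) • τ p) p) (dOne (𝓡 (2 * m + 1)) τ p)) (volMeasure 𝒮) := fun j =>
    (integrable_of_continuous (hc j) _).const_mul _
  simp only [h1, h2]
  rw [integral_add i1 (integrable_finsetSum _ fun j _ => i2 j), integral_finsetSum _ fun j _ => i2 j]
  simp only [integral_const_mul, integral_mixedRatio_eq_zero (hα.add (hτ.const_smul _)) hτ',
    mul_zero, Finset.sum_const_zero, add_zero]

/-- The functional whose derivative along a family `φ_t` is `∫ dφ_t/dt (dα + d d^c φ_t)ᵐ ∧ η`. -/
def energy (𝒮 : SasakianStructure m S) (α : ∀ p : S, Tan m p →L[ℝ] ℝ) (φ : S → ℝ) : ℝ :=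
  ∑ j ∈ Finset.range (m + 1), weight m j *
    ∫ p, φ p * volRatio 𝒮 p (familyForm 𝒮 α j φ p) ∂volMeasure 𝒮

theorem continuous_volRatio_familyForm (hα : IsTypeOneOne 𝒮 α) (hu : IsBasicFunction 𝒮 u) (j : ℝ) :
    Continuous fun p => volRatio 𝒮 p (familyForm 𝒮 α j u p) := by
  simpa only [dOne_add_smul_dcB hα hu] using continuous_volRatio (isTypeOneOne_add_smul_dcB hα hu j)

theorem continuous_mixedRatio_familyForm (hα : IsTypeOneOne 𝒮 α) (hu : IsBasicFunction 𝒮 u)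
    (hτ : IsHorizontal 𝒮 τ) (j : ℝ) :
    Continuous fun p => mixedRatio 𝒮 p (familyForm 𝒮 α j u p) (dOne (𝓡 (2 * m + 1)) τ p) := by
  simpa only [dOne_add_smul_dcB hα hu] using
    continuous_mixedRatio (isTypeOneOne_add_smul_dcB hα hu j) hτ

theorem integral_mul_mixedRatio_familyForm_comm {v w : S → ℝ} (hα : IsTypeOneOne 𝒮 α)
    (hu : IsBasicFunction 𝒮 u) (j : ℝ) (hv : IsBasicFunction 𝒮 v) (hw : IsBasicFunction 𝒮 w) :
    ∫ p, v p * mixedRatio 𝒮 p (familyForm 𝒮 α j u p) (ddcB 𝒮 w p) ∂volMeasure 𝒮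
      = ∫ p, w p * mixedRatio 𝒮 p (familyForm 𝒮 α j u p) (ddcB 𝒮 v p) ∂volMeasure 𝒮 := by
  simpa only [dOne_add_smul_dcB hα hu] using
    integral_mul_mixedRatio_comm (isTypeOneOne_add_smul_dcB hα hu j) hv hw

theorem integral_volRatio_familyForm (hα : IsTypeOneOne 𝒮 α) (hu : IsBasicFunction 𝒮 u) (j : ℝ) :
    ∫ p, volRatio 𝒮 p (familyForm 𝒮 α j u p) ∂volMeasure 𝒮
      = ∫ p, volRatio 𝒮 p (dOne (𝓡 (2 * m + 1)) α p) ∂volMeasure 𝒮 := by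
  have h0 : IsHorizontal 𝒮 fun p => j • dcB 𝒮 u p := hu.isHorizontal_dcB.smul contMDiff_const
  rw [← integral_volRatio_add hα (hu.isTypeOneOne.const_smul j) h0]
  congr 1
  funext p
  rw [hu.isTypeOneOne.dOne_const_smul]
  congr 1
  refine ContinuousLinearMap.ext fun a => ContinuousLinearMap.ext fun b => ?_
  simp only [familyForm, _root_.add_apply, _root_.smul_apply, smul_eq_mul, one_mul]
  rfl

/-- Constants do not change dd^c φ, all forms dα + j dd^c φ have the same total volume, and the
weights add up to 1. -/
theorem energy_add_const (hα : IsTypeOneOne 𝒮 α) (hφ : IsBasicFunction 𝒮 φ) (C : ℝ) :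
    energy 𝒮 α (fun p => φ p + C) = energy 𝒮 α φ
      + C * ∫ p, volRatio 𝒮 p (dOne (𝓡 (2 * m + 1)) α p) ∂volMeasure 𝒮 := by
  have h1 : ∀ (j : ℕ) (p : S), familyForm 𝒮 α j (fun p => φ p + C) p = familyForm 𝒮 α j φ p :=
    fun j p => by rw [familyForm, familyForm, ddcB_add_const hφ]
  have h2 : ∀ j : ℕ, ∫ p, (φ p + C) * volRatio 𝒮 p (familyForm 𝒮 α j φ p) ∂volMeasure 𝒮
      = ∫ p, φ p * volRatio 𝒮 p (familyForm 𝒮 α j φ p) ∂volMeasure 𝒮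
        + C * ∫ p, volRatio 𝒮 p (dOne (𝓡 (2 * m + 1)) α p) ∂volMeasure 𝒮 := fun j => by
    have hc := continuous_volRatio_familyForm hα hφ j
    have i1 : Integrable (fun p => φ p * volRatio 𝒮 p (familyForm 𝒮 α j φ p)) (volMeasure 𝒮) :=
      integrable_of_continuous (hφ.1.continuous.mul hc) _
    have i2 : Integrable (fun p => C * volRatio 𝒮 p (familyForm 𝒮 α j φ p)) (volMeasure 𝒮) :=
      integrable_of_continuous (continuous_const.mul hc) _
    simp only [add_mul]
    rw [integral_add i1 i2, integral_const_mul, integral_volRatio_familyForm hα hφ]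
  simp only [energy, h1, h2, mul_add, Finset.sum_add_distrib]
  rw [← Finset.sum_mul, sum_weight, one_mul]

variable {c d : ℝ} {G : ℝ → S → ℝ}

/-- At node j the derivative is the velocity times the volume ratio, plus j times G times the mixed
ratio against dd^c of the velocity. Symmetry exchanges G and the velocity, and pointwise the
weighted sum over j of P(j) + j P'(j) is P(1). -/
theorem energy_isPrimitiveOn (hα : IsTypeOneOne 𝒮 α) (hcd : c < d)
    (hG : IsSmoothFamily 𝒮 (Icc c d) G) :
    IsPrimitiveOn (fun t => energy 𝒮 α (G t)) (fun t => ∫ p, velocityOn c d G t p *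
      volRatio 𝒮 p (familyForm 𝒮 α 1 (G t) p) ∂volMeasure 𝒮) c d := by
  have hv := hG.velocityOn hcd
  set F' : ℕ → ℝ → S → ℝ := fun j t p =>
    velocityOn c d G t p * volRatio 𝒮 p (familyForm 𝒮 α j (G t) p)
      + G t p * (j * mixedRatio 𝒮 p (familyForm 𝒮 α j (G t) p) (ddcB 𝒮 (velocityOn c d G t) p))
    with hF'
  have hF1 : ∀ j : ℕ, ContinuousOn (Function.uncurry fun t p =>
      G t p * volRatio 𝒮 p (familyForm 𝒮 α j (G t) p)) (Icc c d ×ˢ univ) := fun j =>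
    hG.continuousOn.mul (continuousOn_volRatio_familyForm hα hG hcd j)
  have hF2 : ∀ j : ℕ, ContinuousOn (Function.uncurry (F' j)) (Icc c d ×ˢ univ) := fun j =>
    (hv.continuousOn.mul (continuousOn_volRatio_familyForm hα hG hcd j)).add
      (hG.continuousOn.mul (continuousOn_const.mul
        (continuousOn_mixedRatio_familyForm hα hG hv hcd j)))
  have h1 : ∀ j : ℕ, IsPrimitiveOn
      (fun t => ∫ p, G t p * volRatio 𝒮 p (familyForm 𝒮 α j (G t) p) ∂volMeasure 𝒮)
      (fun t => ∫ p, F' j t p ∂volMeasure 𝒮) c d := fun j =>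
    ⟨continuousOn_integral_family (hF1 j), continuousOn_integral_family (hF2 j), fun t ht =>
      hasDerivAt_integral_family (hF1 j) (hF2 j) (fun s hs p =>
        (hG.hasDerivAt hs p).mul (hasDerivAt_volRatio_familyForm hG hcd hs j p)) ht⟩
  refine (IsPrimitiveOn.sum fun j (_ : j ∈ Finset.range (m + 1)) =>
    (h1 j).const_mul (weight m j)).congr fun t ht => ?_
  have hGt := hG.basic t ht
  have hvt := hv.basic t ht
  have hcv := hvt.1.continuous
  have h2 : ∀ j : ℕ, ∫ p, F' j t p ∂volMeasure 𝒮
      = ∫ p, velocityOn c d G t p * (volRatio 𝒮 p (familyForm 𝒮 α j (G t) p)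
        + j * mixedRatio 𝒮 p (familyForm 𝒮 α j (G t) p) (ddcB 𝒮 (G t) p)) ∂volMeasure 𝒮 :=
    fun j => by
      have c1 := continuous_volRatio_familyForm hα hGt j
      have c2 : ∀ {w : S → ℝ}, IsBasicFunction 𝒮 w → Continuous fun p =>
          mixedRatio 𝒮 p (familyForm 𝒮 α j (G t) p) (ddcB 𝒮 w p) := fun hw =>
        continuous_mixedRatio_familyForm hα hGt hw.isHorizontal_dcB j
      have i1 : Integrable (fun p => velocityOn c d G t p *
          volRatio 𝒮 p (familyForm 𝒮 α j (G t) p)) (volMeasure 𝒮) :=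
        integrable_of_continuous (hcv.mul c1) _
      have i2 : Integrable (fun p => (j : ℝ) * (G t p * mixedRatio 𝒮 p (familyForm 𝒮 α j (G t) p)
          (ddcB 𝒮 (velocityOn c d G t) p))) (volMeasure 𝒮) :=
        integrable_of_continuous (continuous_const.mul (hGt.1.continuous.mul (c2 hvt))) _
      have i3 : Integrable (fun p => (j : ℝ) * (velocityOn c d G t p *
          mixedRatio 𝒮 p (familyForm 𝒮 α j (G t) p) (ddcB 𝒮 (G t) p))) (volMeasure 𝒮) :=
        integrable_of_continuous (continuous_const.mul (hcv.mul (c2 hGt))) _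
      have e1 : ∀ p, F' j t p = velocityOn c d G t p * volRatio 𝒮 p (familyForm 𝒮 α j (G t) p)
          + j * (G t p * mixedRatio 𝒮 p (familyForm 𝒮 α j (G t) p)
            (ddcB 𝒮 (velocityOn c d G t) p)) := fun p => by
        simp only [hF']
        ring
      have e2 : ∀ p, velocityOn c d G t p * (volRatio 𝒮 p (familyForm 𝒮 α j (G t) p)
          + j * mixedRatio 𝒮 p (familyForm 𝒮 α j (G t) p) (ddcB 𝒮 (G t) p))
          = velocityOn c d G t p * volRatio 𝒮 p (familyForm 𝒮 α j (G t) p)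
            + j * (velocityOn c d G t p *
              mixedRatio 𝒮 p (familyForm 𝒮 α j (G t) p) (ddcB 𝒮 (G t) p)) := fun p => by ring
      simp only [e1, e2]
      rw [integral_add i1 i2, integral_add i1 i3, integral_const_mul, integral_const_mul,
        integral_mul_mixedRatio_familyForm_comm hα hGt j hGt hvt]
  have i4 : ∀ j : ℕ, Integrable (fun p => weight m j * (velocityOn c d G t p *
      (volRatio 𝒮 p (familyForm 𝒮 α j (G t) p)
        + j * mixedRatio 𝒮 p (familyForm 𝒮 α j (G t) p) (ddcB 𝒮 (G t) p)))) (volMeasure 𝒮) :=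
    fun j => integrable_of_continuous (continuous_const.mul (hcv.mul
      ((continuous_volRatio_familyForm hα hGt j).add (continuous_const.mul
        (continuous_mixedRatio_familyForm hα hGt hGt.isHorizontal_dcB j))))) _
  simp only [h2, ← integral_const_mul]
  rw [← integral_finsetSum _ fun j _ => i4 j]
  congr 1
  funext p
  have h3 := sum_weight_volRatio (𝒮 := 𝒮) (isAlternatingAt_dOne α p)
    (isAlternatingAt_ddcB (𝒮 := 𝒮) (G t) p)
  rw [familyForm, ← h3, Finset.mul_sum]
  refine Finset.sum_congr rfl fun j _ => ?_
  rw [familyForm]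
  ring

end Energy

end Sasaki

end

noncomputable section

namespace Sasaki

/-! ### The entropy and the K-energy -/

section Entropy

variable {m : ℕ} {S : Type*} [TopologicalSpace S] [ChartedSpace (Model m) S]
  [IsManifold (𝓡 (2 * m + 1)) ∞ S] {𝒮 : SasakianStructure m S}
  {β : ∀ p : S, Tan m p →L[ℝ] ℝ} {φ v : S → ℝ}

theorem density_eq_volRatio_familyForm (hφ : IsBasicFunction 𝒮 φ) (p : S) :
    density 𝒮 φ p = volRatio 𝒮 p (familyForm 𝒮 (contact 𝒮) 1 φ p) := by
  rw [density, kahlerFormOf_eq_familyForm hφ]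

theorem continuous_density (hφ : IsBasicFunction 𝒮 φ) : Continuous (density 𝒮 φ) :=
  continuous_volRatio (isTypeOneOne_contactOf hφ)

theorem density_add_const (hφ : IsBasicFunction 𝒮 φ) (C : ℝ) (p : S) :
    density 𝒮 (fun p => φ p + C) p = density 𝒮 φ p := by
  rw [density_eq_volRatio_familyForm (hφ.add_const C), density_eq_volRatio_familyForm hφ,
    familyForm, familyForm, ddcB_add_const hφ]

theorem contactOf_reeb (φ : S → ℝ) (p : S) : contactOf 𝒮 φ p (reeb 𝒮 p) = 1 := by
  rw [contactOf, _root_.add_apply, contact_reeb, dcB, _root_.smul_apply,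
    ContinuousLinearMap.comp_apply, transverseJ_reeb, map_zero, smul_zero, add_zero]

theorem IsBasicOneForm.isHorizontal (hβ : IsBasicOneForm 𝒮 β) : IsHorizontal 𝒮 β :=
  ⟨fun χ => χ.contDiffOn_pull1 hβ.1, hβ.2.1⟩

theorem isInvariantAt_kahlerForm (p : S) : IsInvariantAt 𝒮 p (kahlerForm 𝒮 p) :=
  isTypeOneOne_contact.isInvariantAt p

/-- A primitive of the difference of the transverse Ricci form and a multiple of the Kähler form. -/
theorem IsBasicOneForm.isTypeOneOne (hβ : IsBasicOneForm 𝒮 β) {c : ℝ}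
    (h : ∀ p, transverseRicci 𝒮 (kahlerForm 𝒮) p - c • kahlerForm 𝒮 p
      = dOne (𝓡 (2 * m + 1)) β p) : IsTypeOneOne 𝒮 β := fun χ => by
  refine FoliationChart.isTypeOneOneOn_of_dOne (χ.contDiffOn_pull1 hβ.1) 0 hβ.2.1 fun p v w => ?_
  rw [← h]
  simp only [_root_.sub_apply, _root_.smul_apply]
  rw [isInvariantAt_transverseRicci p v w, isInvariantAt_kahlerForm p v w]

/-- The function `log ((dη_φ)ᵐ ∧ η / (dη)ᵐ ∧ η) + c φ`. -/
def logPotential (𝒮 : SasakianStructure m S) (c : ℝ) (φ : S → ℝ) (p : S) : ℝ :=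
  Real.log (density 𝒮 φ p) + c * φ p

theorem isBasicFunction_logPotential (hφ : φ ∈ potentials 𝒮) (c : ℝ) :
    IsBasicFunction 𝒮 (logPotential 𝒮 c φ) := (isBasicFunction_log_density hφ).add_smul hφ.1 c

/-- The Ricci form of dη_φ is c dη_φ + dβ - dd^c f with f the log potential. Pairing it with
(dη_φ)ᵐ⁻¹, the term c dη_φ yields m c times the density, which is what is subtracted. -/
theorem transverseScal_sub_mul_density {c : ℝ} (hφ : φ ∈ potentials 𝒮)
    (h : ∀ p, transverseRicci 𝒮 (kahlerForm 𝒮) p - c • kahlerForm 𝒮 p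
      = dOne (𝓡 (2 * m + 1)) β p) (p : S) :
    (transverseScal 𝒮 (kahlerFormOf 𝒮 φ) p - m * c) * density 𝒮 φ p
      = mixedRatio 𝒮 p (familyForm 𝒮 (contact 𝒮) 1 φ p) (dOne (𝓡 (2 * m + 1)) β p)
        - mixedRatio 𝒮 p (familyForm 𝒮 (contact 𝒮) 1 φ p) (ddcB 𝒮 (logPotential 𝒮 c φ) p) := by
  have hA : IsAlternatingAt (familyForm 𝒮 (contact 𝒮) 1 φ p) := isAlternatingAt_familyForm 1 φ p
  have hβ : IsAlternatingAt (dOne (𝓡 (2 * m + 1)) β p) := isAlternatingAt_dOne β p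
  have hf : IsAlternatingAt (ddcB 𝒮 (logPotential 𝒮 c φ) p) := isAlternatingAt_ddcB _ p
  have e1 : ddcB 𝒮 (logPotential 𝒮 c φ) p
      = ddcB 𝒮 (fun q => Real.log (density 𝒮 φ q)) p + c • ddcB 𝒮 φ p :=
    (isBasicFunction_log_density hφ).ddcB_add_smul hφ.1 c p
  have e2 : transverseRicci 𝒮 (kahlerFormOf 𝒮 φ) p = (dOne (𝓡 (2 * m + 1)) β p
      + (-1 : ℝ) • ddcB 𝒮 (logPotential 𝒮 c φ) p) + c • familyForm 𝒮 (contact 𝒮) 1 φ p := by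
    rw [transverseRicci_kahlerFormOf hφ, ← h, e1]
    refine ContinuousLinearMap.ext fun a => ContinuousLinearMap.ext fun b => ?_
    have e3 : dOne (𝓡 (2 * m + 1)) (contact 𝒮) p a b = kahlerForm 𝒮 p a b := rfl
    simp only [familyForm, _root_.add_apply, _root_.sub_apply, _root_.smul_apply, smul_eq_mul, e3]
    ring
  have e4 := transverseScal_mul_density hφ p
  have e5 := density_eq_volRatio_familyForm hφ.1 p
  rw [kahlerFormOf_eq_familyForm hφ.1, e2, mixedRatio_add_smul hA (hβ.add_smul hf _) hA,
    mixedRatio_add_smul hA hβ hf, mixedRatio_self hA, ← e5] at e4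
  rw [sub_mul, e4]
  ring

variable [CompactSpace S] [T2Space S] [MeasurableSpace S] [BorelSpace S]

/-- The integral of `(log ((dη_φ)ᵐ ∧ η / (dη)ᵐ ∧ η) + c φ) (dη_φ)ᵐ ∧ η`. -/
def entropy (𝒮 : SasakianStructure m S) (c : ℝ) (φ : S → ℝ) : ℝ :=
  ∫ p, logPotential 𝒮 c φ p * density 𝒮 φ p ∂volMeasure 𝒮

theorem integral_density (hφ : IsBasicFunction 𝒮 φ) :
    ∫ p, density 𝒮 φ p ∂volMeasure 𝒮 = (volMeasure 𝒮).real univ := by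
  have h := integral_volRatio_familyForm isTypeOneOne_contact hφ 1
  have h1 : ∀ p, volRatio 𝒮 p (dOne (𝓡 (2 * m + 1)) (contact 𝒮) p) = 1 := volRatio_kahlerForm
  simp only [h1, ← density_eq_volRatio_familyForm hφ] at h
  rw [h, integral_const, smul_eq_mul, mul_one]

/-- The density is unchanged, so only the summand c φ moves, and it is integrated against a density
of total mass V. -/
theorem entropy_add_const (hφ : φ ∈ potentials 𝒮) (c C : ℝ) :
    entropy 𝒮 c (fun p => φ p + C) = entropy 𝒮 c φ + c * C * (volMeasure 𝒮).real univ := by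
  have h1 : ∀ p, logPotential 𝒮 c (fun p => φ p + C) p * density 𝒮 (fun p => φ p + C) p
      = logPotential 𝒮 c φ p * density 𝒮 φ p + c * C * density 𝒮 φ p := fun p => by
    rw [logPotential, logPotential, density_add_const hφ.1]
    ring
  have hc := continuous_density hφ.1
  have i1 : Integrable (fun p => logPotential 𝒮 c φ p * density 𝒮 φ p) (volMeasure 𝒮) :=
    integrable_of_continuous ((isBasicFunction_logPotential hφ c).1.continuous.mul hc) _
  have i2 : Integrable (fun p => c * C * density 𝒮 φ p) (volMeasure 𝒮) :=
    integrable_of_continuous (continuous_const.mul hc) _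
  simp only [entropy, h1]
  rw [integral_add i1 i2, integral_const_mul, integral_density hφ.1]

variable {c d : ℝ} {G : ℝ → S → ℝ}

/-- Let D be the density, N its derivative and f the log potential. Then (f D)' = N + b (velocity) D
+ f N. The integral of N vanishes, being mixed against an exact form, and in f N the operator dd^c
is moved from the velocity to f. -/
theorem entropy_isPrimitiveOn (hcd : c < d) (hG : IsSmoothFamily 𝒮 (Icc c d) G)
    (hpos : ∀ t ∈ Icc c d, G t ∈ potentials 𝒮) (b : ℝ) :
    IsPrimitiveOn (fun t => entropy 𝒮 b (G t)) (fun t => ∫ p, velocityOn c d G t p *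
      (mixedRatio 𝒮 p (familyForm 𝒮 (contact 𝒮) 1 (G t) p) (ddcB 𝒮 (logPotential 𝒮 b (G t)) p)
        + b * volRatio 𝒮 p (familyForm 𝒮 (contact 𝒮) 1 (G t) p)) ∂volMeasure 𝒮) c d := by
  have hv := hG.velocityOn hcd
  set D : ℝ → S → ℝ := fun t p => volRatio 𝒮 p (familyForm 𝒮 (contact 𝒮) 1 (G t) p) with hD
  set N : ℝ → S → ℝ := fun t p => mixedRatio 𝒮 p (familyForm 𝒮 (contact 𝒮) 1 (G t) p)
    (ddcB 𝒮 (velocityOn c d G t) p) with hN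
  have hDd : ∀ t ∈ Icc c d, ∀ p, density 𝒮 (G t) p = D t p := fun t ht p =>
    density_eq_volRatio_familyForm (hG.basic t ht) p
  have hDpos : ∀ t ∈ Icc c d, ∀ p, 0 < D t p := fun t ht p =>
    hDd t ht p ▸ density_pos (hpos t ht) p
  have cD : ContinuousOn (Function.uncurry D) (Icc c d ×ˢ univ) :=
    continuousOn_volRatio_familyForm isTypeOneOne_contact hG hcd 1
  have cN : ContinuousOn (Function.uncurry N) (Icc c d ×ˢ univ) :=
    continuousOn_mixedRatio_familyForm isTypeOneOne_contact hG hv hcd 1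
  have cW : ContinuousOn (Function.uncurry fun t p => Real.log (D t p) + b * G t p)
      (Icc c d ×ˢ univ) :=
    (cD.log fun z hz => (hDpos z.1 hz.1 z.2).ne').add (continuousOn_const.mul hG.continuousOn)
  have hF1 : ContinuousOn (Function.uncurry fun t p => (Real.log (D t p) + b * G t p) * D t p)
      (Icc c d ×ˢ univ) := cW.mul cD
  set F' : ℝ → S → ℝ := fun t p => N t p + b * velocityOn c d G t p * D t p
    + (Real.log (D t p) + b * G t p) * N t p with hF'
  have hF2 : ContinuousOn (Function.uncurry F') (Icc c d ×ˢ univ) :=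
    (cN.add ((continuousOn_const.mul hv.continuousOn).mul cD)).add (cW.mul cN)
  have h0 : ∀ t ∈ Icc c d, ∫ p, (Real.log (D t p) + b * G t p) * D t p ∂volMeasure 𝒮
      = entropy 𝒮 b (G t) := fun t ht => by
    simp only [entropy, logPotential, hDd t ht]
  have h1 : IsPrimitiveOn (fun t => entropy 𝒮 b (G t)) (fun t => ∫ p, F' t p ∂volMeasure 𝒮) c d := by
    refine ⟨(continuousOn_integral_family hF1).congr fun t ht => (h0 t ht).symm,
      continuousOn_integral_family hF2, fun t ht => ?_⟩
    refine (hasDerivAt_integral_family hF1 hF2 (fun s hs p => ?_) ht).congr_of_eventuallyEq ?_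
    · have hp := (hDpos s (Ioo_subset_Icc_self hs) p).ne'
      have d1 : HasDerivAt (fun s => D s p) (N s p) s := by
        simpa only [Nat.cast_one, one_mul] using
          hasDerivAt_volRatio_familyForm (α := contact 𝒮) hG hcd hs 1 p
      refine (((d1.log hp).add ((hG.hasDerivAt hs p).const_mul b)).mul d1).congr_deriv ?_
      simp only [hF']
      field_simp
      rfl
    · filter_upwards [Icc_mem_nhds ht.1 ht.2] with s hs
      exact (h0 s hs).symm
  refine h1.congr fun t ht => ?_
  have hGt := hG.basic t ht
  have hvt := hv.basic t ht
  have hwt := isBasicFunction_logPotential (hpos t ht) b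
  have hcv := hvt.1.continuous
  have c1 : Continuous (D t) := continuous_volRatio_familyForm isTypeOneOne_contact hGt 1
  have c2 : ∀ {w : S → ℝ}, IsBasicFunction 𝒮 w → Continuous fun p =>
      mixedRatio 𝒮 p (familyForm 𝒮 (contact 𝒮) 1 (G t) p) (ddcB 𝒮 w p) := fun hw =>
    continuous_mixedRatio_familyForm isTypeOneOne_contact hGt hw.isHorizontal_dcB 1
  have i1 : Integrable (N t) (volMeasure 𝒮) := integrable_of_continuous (c2 hvt) _
  have i2 : Integrable (fun p => b * (velocityOn c d G t p * D t p)) (volMeasure 𝒮) :=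
    integrable_of_continuous (continuous_const.mul (hcv.mul c1)) _
  have i3 : Integrable (fun p => logPotential 𝒮 b (G t) p * N t p) (volMeasure 𝒮) :=
    integrable_of_continuous (hwt.1.continuous.mul (c2 hvt)) _
  have i4 : Integrable (fun p => velocityOn c d G t p * mixedRatio 𝒮 p
      (familyForm 𝒮 (contact 𝒮) 1 (G t) p) (ddcB 𝒮 (logPotential 𝒮 b (G t)) p)) (volMeasure 𝒮) :=
    integrable_of_continuous (hcv.mul (c2 hwt)) _
  have z1 : ∫ p, N t p ∂volMeasure 𝒮 = 0 := by
    have h := integral_mixedRatio_eq_zero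
      (isTypeOneOne_add_smul_dcB (isTypeOneOne_contact (𝒮 := 𝒮)) hGt 1) hvt.isHorizontal_dcB
    simp only [dOne_add_smul_dcB isTypeOneOne_contact hGt] at h
    exact h
  have z2 := integral_mul_mixedRatio_familyForm_comm isTypeOneOne_contact hGt 1 hvt hwt
  have e1 : ∀ p, F' t p = (N t p + b * (velocityOn c d G t p * D t p))
      + logPotential 𝒮 b (G t) p * N t p := fun p => by
    simp only [hF', logPotential, hDd t ht]
    ring
  have e2 : ∀ p, velocityOn c d G t p * (mixedRatio 𝒮 p (familyForm 𝒮 (contact 𝒮) 1 (G t) p)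
      (ddcB 𝒮 (logPotential 𝒮 b (G t)) p) + b * D t p)
      = velocityOn c d G t p * mixedRatio 𝒮 p
      (familyForm 𝒮 (contact 𝒮) 1 (G t) p) (ddcB 𝒮 (logPotential 𝒮 b (G t)) p)
        + b * (velocityOn c d G t p * D t p) := fun p => by ring
  have i12 : Integrable (fun p => N t p + b * (velocityOn c d G t p * D t p)) (volMeasure 𝒮) :=
    i1.add i2
  simp only [e1]
  rw [integral_add i12 i3, integral_add i1 i2, z1]
  refine (integral_congr_ae (ae_of_all _ e2)).trans ?_
  rw [integral_add i4 i2, z2]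
  ring

/-- The negative of the K-energy, up to the volume: the derivative of this functional along a family
`φ_t` is `∫ dφ_t/dt (s^T - m c) (dη_{φ_t})ᵐ ∧ η` if `Ric^T (dη) = c dη + dβ`. -/
def kEnergy (𝒮 : SasakianStructure m S) (c : ℝ) (β : ∀ p : S, Tan m p →L[ℝ] ℝ) (φ : S → ℝ) : ℝ :=
  (∑ j ∈ Finset.range (m + 1), slopeWeight m j * energy 𝒮 (fun p => contact 𝒮 p + (j : ℝ) • β p) φ)
    + ((-1) * entropy 𝒮 c φ + c * energy 𝒮 (contact 𝒮) φ)

/-- The energy based at η + j β has derivative ∫ (velocity)(dη_φ + j dβ)ᵐ ∧ η, and the slope weights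
extract from these its derivative at j = 0, the mixed ratio against dβ. Minus the entropy
contributes the dd^c term; its surplus -b (velocity) D is cancelled by b times the energy. -/
theorem kEnergy_isPrimitiveOn (hβ : IsTypeOneOne 𝒮 β) (hβ' : IsHorizontal 𝒮 β) (hcd : c < d)
    (hG : IsSmoothFamily 𝒮 (Icc c d) G) (hpos : ∀ t ∈ Icc c d, G t ∈ potentials 𝒮) (b : ℝ) :
    IsPrimitiveOn (fun t => kEnergy 𝒮 b β (G t)) (fun t => ∫ p, velocityOn c d G t p *
      (mixedRatio 𝒮 p (familyForm 𝒮 (contact 𝒮) 1 (G t) p) (dOne (𝓡 (2 * m + 1)) β p)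
        - mixedRatio 𝒮 p (familyForm 𝒮 (contact 𝒮) 1 (G t) p)
          (ddcB 𝒮 (logPotential 𝒮 b (G t)) p)) ∂volMeasure 𝒮) c d := by
  have hη : ∀ j : ℕ, IsTypeOneOne 𝒮 fun p => contact 𝒮 p + (j : ℝ) • β p := fun j =>
    isTypeOneOne_contact.add (hβ.const_smul j)
  refine ((IsPrimitiveOn.sum fun j (_ : j ∈ Finset.range (m + 1)) =>
    (energy_isPrimitiveOn (hη j) hcd hG).const_mul (slopeWeight m j)).add
    (((entropy_isPrimitiveOn hcd hG hpos b).const_mul (-1)).add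
      ((energy_isPrimitiveOn isTypeOneOne_contact hcd hG).const_mul b))).congr fun t ht => ?_
  have hGt := hG.basic t ht
  have hvt := (hG.velocityOn hcd).basic t ht
  have hwt := isBasicFunction_logPotential (hpos t ht) b
  have hcv := hvt.1.continuous
  have e1 : ∀ (j : ℕ) (p : S), familyForm 𝒮 (fun p => contact 𝒮 p + (j : ℝ) • β p) 1 (G t) p
      = familyForm 𝒮 (contact 𝒮) 1 (G t) p + (j : ℝ) • dOne (𝓡 (2 * m + 1)) β p := fun j p => by
    rw [familyForm, familyForm, isTypeOneOne_contact.dOne_add_smul hβ]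
    refine ContinuousLinearMap.ext fun x => ContinuousLinearMap.ext fun y => ?_
    simp only [_root_.add_apply, _root_.smul_apply, smul_eq_mul]
    ring
  have e2 : ∀ p, velocityOn c d G t p *
      mixedRatio 𝒮 p (familyForm 𝒮 (contact 𝒮) 1 (G t) p) (dOne (𝓡 (2 * m + 1)) β p)
      = ∑ j ∈ Finset.range (m + 1), slopeWeight m j * (velocityOn c d G t p * volRatio 𝒮 p
        (familyForm 𝒮 (fun p => contact 𝒮 p + (j : ℝ) • β p) 1 (G t) p)) := fun p => by
    rw [← sum_slopeWeight_volRatio (𝒮 := 𝒮) (isAlternatingAt_familyForm 1 (G t) p)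
      (isAlternatingAt_dOne β p), Finset.mul_sum]
    refine Finset.sum_congr rfl fun j _ => ?_
    rw [e1]
    ring
  have i0 : ∀ j : ℕ, Integrable (fun p => slopeWeight m j * (velocityOn c d G t p * volRatio 𝒮 p
      (familyForm 𝒮 (fun p => contact 𝒮 p + (j : ℝ) • β p) 1 (G t) p))) (volMeasure 𝒮) := fun j =>
    integrable_of_continuous (continuous_const.mul (hcv.mul
      (continuous_volRatio_familyForm (hη j) hGt 1))) _
  have e3 : ∫ p, velocityOn c d G t p *
      mixedRatio 𝒮 p (familyForm 𝒮 (contact 𝒮) 1 (G t) p) (dOne (𝓡 (2 * m + 1)) β p) ∂volMeasure 𝒮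
      = ∑ j ∈ Finset.range (m + 1), slopeWeight m j * ∫ p, velocityOn c d G t p * volRatio 𝒮 p
        (familyForm 𝒮 (fun p => contact 𝒮 p + (j : ℝ) • β p) 1 (G t) p) ∂volMeasure 𝒮 := by
    refine (integral_congr_ae (ae_of_all _ e2)).trans ?_
    rw [integral_finsetSum _ fun j _ => i0 j]
    simp only [integral_const_mul]
  rw [← e3]
  have i1 : Integrable (fun p => velocityOn c d G t p * mixedRatio 𝒮 p
      (familyForm 𝒮 (contact 𝒮) 1 (G t) p) (dOne (𝓡 (2 * m + 1)) β p)) (volMeasure 𝒮) :=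
    integrable_of_continuous (hcv.mul
      (continuous_mixedRatio_familyForm isTypeOneOne_contact hGt hβ' 1)) _
  have i2 : Integrable (fun p => velocityOn c d G t p * mixedRatio 𝒮 p
      (familyForm 𝒮 (contact 𝒮) 1 (G t) p) (ddcB 𝒮 (logPotential 𝒮 b (G t)) p)) (volMeasure 𝒮) :=
    integrable_of_continuous (hcv.mul (continuous_mixedRatio_familyForm isTypeOneOne_contact hGt
      hwt.isHorizontal_dcB 1)) _
  have i3 : Integrable (fun p => b * (velocityOn c d G t p *
      volRatio 𝒮 p (familyForm 𝒮 (contact 𝒮) 1 (G t) p))) (volMeasure 𝒮) :=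
    integrable_of_continuous (continuous_const.mul (hcv.mul
      (continuous_volRatio_familyForm isTypeOneOne_contact hGt 1))) _
  have e4 : ∀ p, velocityOn c d G t p * (mixedRatio 𝒮 p
      (familyForm 𝒮 (contact 𝒮) 1 (G t) p) (ddcB 𝒮 (logPotential 𝒮 b (G t)) p)
        + b * volRatio 𝒮 p (familyForm 𝒮 (contact 𝒮) 1 (G t) p))
      = velocityOn c d G t p * mixedRatio 𝒮 p
      (familyForm 𝒮 (contact 𝒮) 1 (G t) p) (ddcB 𝒮 (logPotential 𝒮 b (G t)) p)
        + b * (velocityOn c d G t p * volRatio 𝒮 p (familyForm 𝒮 (contact 𝒮) 1 (G t) p)) :=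
    fun p => by ring
  simp only [e4, mul_sub]
  rw [integral_add i2 i3, integral_sub i1 i2, integral_const_mul]
  ring

theorem energy_contact_add_const (hφ : IsBasicFunction 𝒮 φ) (C : ℝ) :
    energy 𝒮 (contact 𝒮) (fun p => φ p + C)
      = energy 𝒮 (contact 𝒮) φ + C * (volMeasure 𝒮).real univ := by
  have h1 : ∀ p, volRatio 𝒮 p (dOne (𝓡 (2 * m + 1)) (contact 𝒮) p) = 1 := volRatio_kahlerForm
  rw [energy_add_const isTypeOneOne_contact hφ]
  simp only [h1, integral_const, smul_eq_mul, mul_one]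

/-- Every energy in the β-part shifts by C times the same volume, and the slope weights add up to 0.
The shifts b C V of the entropy and of b times the energy have opposite signs. -/
theorem kEnergy_add_const (hβ : IsTypeOneOne 𝒮 β) (hβ' : IsHorizontal 𝒮 β)
    (hφ : φ ∈ potentials 𝒮) (b C : ℝ) :
    kEnergy 𝒮 b β (fun p => φ p + C) = kEnergy 𝒮 b β φ := by
  have hV : ∀ j : ℕ, ∫ p, volRatio 𝒮 p (dOne (𝓡 (2 * m + 1))
      (fun p => contact 𝒮 p + (j : ℝ) • β p) p) ∂volMeasure 𝒮
      = ∫ p, volRatio 𝒮 p (dOne (𝓡 (2 * m + 1)) (contact 𝒮) p) ∂volMeasure 𝒮 := fun j => by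
    rw [← integral_volRatio_add isTypeOneOne_contact (hβ.const_smul j)
      (hβ'.smul contMDiff_const)]
    congr 1
    funext p
    rw [isTypeOneOne_contact.dOne_add_smul hβ, hβ.dOne_const_smul]
    congr 1
    refine ContinuousLinearMap.ext fun x => ContinuousLinearMap.ext fun y => ?_
    simp only [_root_.add_apply, _root_.smul_apply, smul_eq_mul, one_mul]
  have h1 : ∀ j : ℕ, energy 𝒮 (fun p => contact 𝒮 p + (j : ℝ) • β p) (fun p => φ p + C) = _ :=
    fun j => energy_add_const (isTypeOneOne_contact.add (hβ.const_smul j)) hφ.1 C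
  simp only [kEnergy, h1, hV, mul_add, Finset.sum_add_distrib]
  rw [← Finset.sum_mul, sum_slopeWeight, entropy_add_const hφ, energy_contact_add_const hφ.1]
  ring

end Entropy

end Sasaki

end

noncomputable section

namespace Sasaki

/-! ### Paths of potentials -/

section Paths

variable {m : ℕ} {S : Type*} [TopologicalSpace S] [ChartedSpace (Model m) S]
  [IsManifold (𝓡 (2 * m + 1)) ∞ S] {𝒮 : SasakianStructure m S} {φ φ' f : S → ℝ}

theorem add_const_mem_potentials (hφ : φ ∈ potentials 𝒮) (C : ℝ) :
    (fun p => φ p + C) ∈ potentials 𝒮 := by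
  refine ⟨hφ.1.add_const C, fun p X hX hX0 => ?_⟩
  rw [kahlerFormOf_eq (hφ.1.add_const C), ddcB_add_const hφ.1, ← kahlerFormOf_eq hφ.1]
  exact hφ.2 p X hX hX0

/-- Ω is convex because dη_φ is affine in φ; segments therefore serve as paths. -/
theorem segment_mem_potentials (hφ : φ ∈ potentials 𝒮) (hφ' : φ' ∈ potentials 𝒮) {t : ℝ}
    (ht : t ∈ Icc (0 : ℝ) 1) : (fun p => φ p + t * (φ' p + (-1) * φ p)) ∈ potentials 𝒮 := by
  have h1 : IsBasicFunction 𝒮 fun p => φ' p + (-1) * φ p := hφ'.1.add_smul hφ.1 (-1)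
  refine ⟨hφ.1.add_smul h1 t, fun p X hX hX0 => ?_⟩
  have h2 := hφ.2 p X hX hX0
  have h3 := hφ'.2 p X hX hX0
  rw [kahlerFormOf_eq hφ.1] at h2
  rw [kahlerFormOf_eq hφ'.1] at h3
  rw [kahlerFormOf_eq (hφ.1.add_smul h1 t), hφ.1.ddcB_add_smul h1, hφ'.1.ddcB_add_smul hφ.1]
  simp only [_root_.add_apply, _root_.smul_apply, smul_eq_mul] at h2 h3 ⊢
  rcases ht.1.eq_or_lt with rfl | h
  · linarith
  · have h4 := mul_pos h h3
    have h5 := mul_nonneg (sub_nonneg.2 ht.2) h2.le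
    linarith

theorem isSmoothFamily_of_contMDiffOn {J : Set ℝ} {G : ℝ → S → ℝ}
    (h : ContMDiffOn (𝓘(ℝ, ℝ).prod (𝓡 (2 * m + 1))) 𝓘(ℝ, ℝ) ∞ (fun c : ℝ × S => G c.1 c.2)
      (J ×ˢ univ)) (hb : ∀ t ∈ J, IsBasicFunction 𝒮 (G t)) : IsSmoothFamily 𝒮 J G := by
  refine ⟨fun χ => ?_, hb⟩
  rw [← contMDiffOn_iff_contDiffOn]
  have h1 : ContMDiffOn 𝓘(ℝ, ℝ × CF m) 𝓘(ℝ, ℝ) ∞ (fun z : ℝ × CF m => z.1) (J ×ˢ χ.chart.target) :=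
    contDiff_fst.contMDiff.contMDiffOn
  have h2 : ContMDiffOn 𝓘(ℝ, ℝ × CF m) (𝓡 (2 * m + 1)) ∞
      (fun z : ℝ × CF m => χ.chart.symm z.2) (J ×ˢ χ.chart.target) :=
    χ.smooth_symm.comp (t := χ.chart.target) (f := fun z : ℝ × CF m => z.2)
      contDiff_snd.contMDiff.contMDiffOn fun z hz => hz.2
  exact h.comp (h1.prodMk h2) fun z hz => ⟨hz.1, mem_univ _⟩

theorem nonempty_potentialPath (hφ : φ ∈ potentials 𝒮) (hφ' : φ' ∈ potentials 𝒮) :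
    Nonempty (PotentialPath 𝒮 φ φ') := by
  refine ⟨⟨0, 1, fun t p => φ p + t * (φ' p + (-1) * φ p), fun t ht =>
    segment_mem_potentials hφ hφ' ht, funext fun p => by ring, funext fun p => by ring,
    1, fun i => i, Nat.cast_zero, Nat.cast_one, fun i _ =>
      Nat.cast_lt.2 i.lt_succ_self, fun i _ => ?_⟩⟩
  have h1 : ContMDiff (𝓘(ℝ, ℝ).prod (𝓡 (2 * m + 1))) 𝓘(ℝ, ℝ) ∞ fun c : ℝ × S => φ c.2 :=
    hφ.1.1.comp contMDiff_snd
  have h2 : ContMDiff (𝓘(ℝ, ℝ).prod (𝓡 (2 * m + 1))) 𝓘(ℝ, ℝ) ∞ fun c : ℝ × S =>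
      φ' c.2 + (-1) * φ c.2 := (hφ'.1.add_smul hφ.1 (-1)).1.comp contMDiff_snd
  have h3 : ContMDiff (𝓘(ℝ, ℝ).prod (𝓡 (2 * m + 1))) 𝓘(ℝ, ℝ) ∞ fun c : ℝ × S => c.1 :=
    contMDiff_fst
  exact (h1.add (h3.smul h2)).contMDiffOn

/-- The fundamental theorem of calculus along a path of potentials. -/
theorem PotentialPath.integral_eq (γ : PotentialPath 𝒮 φ φ') {K : ℝ → ℝ} {E : (S → ℝ) → ℝ}
    (h : ∀ c d, c < d → IsSmoothFamily 𝒮 (Icc c d) γ.path →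
      (∀ t ∈ Icc c d, γ.path t ∈ potentials 𝒮) →
      ∃ I : ℝ → ℝ, IsPrimitiveOn (fun t => E (γ.path t)) I c d ∧ ∀ t ∈ Ioo c d, K t = I t) :
    IntervalIntegrable K volume γ.a γ.b ∧ ∫ t in γ.a..γ.b, K t = E φ' - E φ := by
  obtain ⟨n, τ, h0, hn, hlt, hsm⟩ := γ.piecewise_smooth
  have hmono : ∀ k i, i + k ≤ n → τ i ≤ τ (i + k) := by
    intro k
    induction k with
    | zero => exact fun i _ => le_rfl
    | succ k ih => exact fun i hi => (ih i (by omega)).trans (hlt (i + k) (by omega)).le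
  have hp : ∀ i < n, IntervalIntegrable K volume (τ i) (τ (i + 1)) ∧
      ∫ t in τ i..τ (i + 1), K t = E (γ.path (τ (i + 1))) - E (γ.path (τ i)) := fun i hi => by
    have ha : γ.a ≤ τ i := by
      have h1 := hmono i 0 (by omega)
      rwa [zero_add, h0] at h1
    have hb : τ (i + 1) ≤ γ.b := by
      have h1 := hmono (n - (i + 1)) (i + 1) (by omega)
      rwa [Nat.add_sub_cancel' hi, hn] at h1
    have hmem : ∀ t ∈ Icc (τ i) (τ (i + 1)), γ.path t ∈ potentials 𝒮 := fun t ht =>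
      γ.mem t ⟨ha.trans ht.1, ht.2.trans hb⟩
    obtain ⟨I, hI, hK⟩ := h _ _ (hlt i hi)
      (isSmoothFamily_of_contMDiffOn (hsm i hi) fun t ht => (hmem t ht).1) hmem
    exact hI.intervalIntegrable (hlt i hi) hK
  rw [← h0, ← hn]
  refine ⟨IntervalIntegrable.trans_iterate fun i hi => (hp i hi).1, ?_⟩
  -- The values of E at the break points telescope, since the path itself is unambiguous there.
  rw [← intervalIntegral.sum_integral_adjacent_intervals fun i hi => (hp i hi).1,
    Finset.sum_congr rfl fun i hi => (hp i (Finset.mem_range.1 hi)).2,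
    Finset.sum_range_sub fun i => E (γ.path (τ i)), h0, hn, γ.left, γ.right]

variable [CompactSpace S] [T2Space S] [MeasurableSpace S] [BorelSpace S]

/-- Both η_φ and η take the value 1 on ξ, and dη_φ is annihilated by ξ; so (dη_φ)ᵐ ∧ η_φ is the
density times (dη)ᵐ ∧ η. -/
theorem integralOf_eq (hφ : IsBasicFunction 𝒮 φ) (hf : Continuous fun p => f p * density 𝒮 φ p) :
    integralOf 𝒮 φ f = ∫ p, f p * density 𝒮 φ p ∂volMeasure 𝒮 := by
  rw [← integralTop_eq_integral 𝒮 hf, integralOf]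
  congr 1
  funext p v
  have h : IsAlternatingAt (kahlerFormOf 𝒮 φ p) := isAlternatingAt_dOne _ p
  rw [powWedge_eq_volRatio_mul h (isInvariantAt_kahlerFormOf hφ p) _ (contactOf_reeb φ p),
    ← mul_assoc]
  rfl

theorem contactVolume_eq : contactVolume 𝒮 = (volMeasure 𝒮).real univ := by
  have h := integralTop_eq_integral 𝒮 (F := fun _ => 1) continuous_const
  simp only [one_mul, integral_const, smul_eq_mul, mul_one] at h
  exact h

variable {β : ∀ p : S, Tan m p →L[ℝ] ℝ} (γ : PotentialPath 𝒮 φ φ')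

theorem PotentialPath.integral_integrandL :
    IntervalIntegrable γ.integrandL volume γ.a γ.b ∧ ∫ t in γ.a..γ.b, γ.integrandL t
      = energy 𝒮 (contact 𝒮) φ' - energy 𝒮 (contact 𝒮) φ := by
  refine γ.integral_eq fun c d hcd hG _ =>
    ⟨_, energy_isPrimitiveOn isTypeOneOne_contact hcd hG, fun t ht => ?_⟩
  have hGt := hG.basic t (Ioo_subset_Icc_self ht)
  have hvt := (hG.velocityOn hcd).basic t (Ioo_subset_Icc_self ht)
  have e1 : γ.velocity t = velocityOn c d γ.path t := funext fun p => (velocityOn_eq_deriv ht p).symm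
  rw [PotentialPath.integrandL, e1, integralOf_eq hGt
    (hvt.1.continuous.mul (continuous_density hGt))]
  simp only [density_eq_volRatio_familyForm hGt]

theorem PotentialPath.integral_integrandM (hβ : IsTypeOneOne 𝒮 β) (hβ' : IsHorizontal 𝒮 β)
    (h : ∀ p, transverseRicci 𝒮 (kahlerForm 𝒮) p - (2 * m + 2 : ℝ) • kahlerForm 𝒮 p
      = dOne (𝓡 (2 * m + 1)) β p) :
    IntervalIntegrable γ.integrandM volume γ.a γ.b ∧ ∫ t in γ.a..γ.b, γ.integrandM t
      = kEnergy 𝒮 (2 * m + 2) β φ' - kEnergy 𝒮 (2 * m + 2) β φ := by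
  refine γ.integral_eq fun c d hcd hG hpos =>
    ⟨_, kEnergy_isPrimitiveOn hβ hβ' hcd hG hpos (2 * m + 2), fun t ht => ?_⟩
  have hφt := hpos t (Ioo_subset_Icc_self ht)
  have hGt := hφt.1
  have hvt := (hG.velocityOn hcd).basic t (Ioo_subset_Icc_self ht)
  have hwt := isBasicFunction_logPotential hφt (2 * m + 2)
  have e1 : γ.velocity t = velocityOn c d γ.path t := funext fun p => (velocityOn_eq_deriv ht p).symm
  have e2 : ∀ p, γ.velocity t p * (transverseScal 𝒮 (kahlerFormOf 𝒮 (γ.path t)) p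
      - m * (2 * m + 2)) * density 𝒮 (γ.path t) p = velocityOn c d γ.path t p *
        (mixedRatio 𝒮 p (familyForm 𝒮 (contact 𝒮) 1 (γ.path t) p) (dOne (𝓡 (2 * m + 1)) β p)
          - mixedRatio 𝒮 p (familyForm 𝒮 (contact 𝒮) 1 (γ.path t) p)
            (ddcB 𝒮 (logPotential 𝒮 (2 * m + 2) (γ.path t)) p)) := fun p => by
    rw [mul_assoc, transverseScal_sub_mul_density hφt h, e1]
  rw [PotentialPath.integrandM, integralOf_eq hGt]
  · simp only [e2]
  · simp only [e2]
    exact hvt.1.continuous.mul ((continuous_mixedRatio_familyForm isTypeOneOne_contact hGt hβ' 1).sub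
      (continuous_mixedRatio_familyForm isTypeOneOne_contact hGt hwt.isHorizontal_dcB 1))

end Paths

end Sasaki

end

/-! ### The two cocycles -/

theorem mainTheorem9 (m : ℕ) {S : Type*} [TopologicalSpace S] [ChartedSpace (Sasaki.Model m) S]
    [IsManifold (𝓡 (2 * m + 1)) ∞ S] [CompactSpace S] [T2Space S] [Nonempty S]
    (𝒮 : Sasaki.SasakianStructure m S)
    (hRic : Sasaki.BasicCohomologous 𝒮 (Sasaki.transverseRicci 𝒮 (Sasaki.kahlerForm 𝒮))
      (fun p => (2 * m + 2 : ℝ) • Sasaki.kahlerForm 𝒮 p)) :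
    -- any two potentials are joined by a path, and `Ω` is stable under adding constants
    (∀ φ ∈ Sasaki.potentials 𝒮, ∀ φ' ∈ Sasaki.potentials 𝒮,
      Nonempty (Sasaki.PotentialPath 𝒮 φ φ')) ∧
    (∀ φ ∈ Sasaki.potentials 𝒮, ∀ C : ℝ, (fun p => φ p + C) ∈ Sasaki.potentials 𝒮) ∧
    ∃ L M : (S → ℝ) → (S → ℝ) → ℝ,
      -- the path integrals make sense, and do not depend on the path
      (∀ (φ φ' : S → ℝ) (γ : Sasaki.PotentialPath 𝒮 φ φ'),
        IntervalIntegrable γ.integrandL volume γ.a γ.b ∧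
        IntervalIntegrable γ.integrandM volume γ.a γ.b ∧
        γ.valueL = L φ φ' ∧ γ.valueM = M φ φ') ∧
      -- the 1-cocycle condition
      (∀ φ ∈ Sasaki.potentials 𝒮, ∀ φ' ∈ Sasaki.potentials 𝒮,
        L φ φ' + L φ' φ = 0 ∧ M φ φ' + M φ' φ = 0) ∧
      (∀ φ ∈ Sasaki.potentials 𝒮, ∀ φ' ∈ Sasaki.potentials 𝒮, ∀ φ'' ∈ Sasaki.potentials 𝒮,
        L φ φ' + L φ' φ'' + L φ'' φ = 0 ∧ M φ φ' + M φ' φ'' + M φ'' φ = 0) ∧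
      -- adding constants
      (∀ φ ∈ Sasaki.potentials 𝒮, ∀ φ' ∈ Sasaki.potentials 𝒮, ∀ C₁ C₂ : ℝ,
        L φ (fun p => φ' p + C₂) = L φ φ' + C₂ ∧
        M (fun p => φ p + C₁) (fun p => φ' p + C₂) = M φ φ') := by
  let _ : MeasurableSpace S := borel S
  have _ : BorelSpace S := ⟨rfl⟩
  obtain ⟨β, hβ, hRic⟩ := hRic
  -- The form dβ is a difference of two Φ-invariant forms, so β itself can be used to deform η in
  -- the energy.
  have h1 : Sasaki.IsTypeOneOne 𝒮 β := hβ.isTypeOneOne hRic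
  have h2 := hβ.isHorizontal
  have hV : Sasaki.contactVolume 𝒮 ≠ 0 := by
    rw [Sasaki.contactVolume_eq]
    exact Sasaki.volMeasure_univ_pos.ne'
  refine ⟨fun φ hφ φ' hφ' => Sasaki.nonempty_potentialPath hφ hφ',
    fun φ hφ C => Sasaki.add_const_mem_potentials hφ C,
    -- Both functionals are differences of a function of one argument, which makes the cocycle
    -- identities purely algebraic.
    fun φ φ' => 1 / Sasaki.contactVolume 𝒮 * (Sasaki.energy 𝒮 (Sasaki.contact 𝒮) φ'
      - Sasaki.energy 𝒮 (Sasaki.contact 𝒮) φ),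
    fun φ φ' => -(1 / Sasaki.contactVolume 𝒮) * (Sasaki.kEnergy 𝒮 (2 * m + 2) β φ'
      - Sasaki.kEnergy 𝒮 (2 * m + 2) β φ), fun φ φ' γ => ?_, fun φ _ φ' _ => ?_,
    fun φ _ φ' _ φ'' _ => ?_, fun φ hφ φ' hφ' C₁ C₂ => ?_⟩
  · have hL := γ.integral_integrandL
    have hM := γ.integral_integrandM h1 h2 hRic
    exact ⟨hL.1, hM.1, by rw [Sasaki.PotentialPath.valueL, hL.2],
      by rw [Sasaki.PotentialPath.valueM, hM.2]⟩
  · constructor <;> ring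
  · constructor <;> ring
  · dsimp only
    rw [Sasaki.energy_contact_add_const hφ'.1, Sasaki.kEnergy_add_const h1 h2 hφ,
      Sasaki.kEnergy_add_const h1 h2 hφ', ← Sasaki.contactVolume_eq]
    refine ⟨?_, rfl⟩
    field_simp
    ring
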